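/- Let $k$ be a commutative ring. DG categories are over $k$ and small unless said otherwise, and $\mathrm{Ho}(\mathcal A)$ is the category with the objects of $\mathcal A$ and the morphisms $H^0\mathrm{Hom}_{\mathcal A}(X,Y)$. Let $\mathcal A^{\mathrm{pre\text{-}tr}}$ be the DG category of one-sided twisted complexes over $\mathcal A$, that is, of formal expressions $(\bigoplus_{i=1}^n C_i[r_i],q)$ with $C_i\in\mathcal A$, $r_i\in\mathbb Z$, $q=(q_{ij})$ homogeneous of degree $1$, $q_{ij}=0$ for $i\ge j$, and $dq+q^2=0$; put $\mathcal A^{\mathrm{tr}}=\mathrm{Ho}(\mathcal A^{\mathrm{pre\text{-}tr}})$, a triangulated category. Let $\mathcal B\subset\mathcal A$ be a full DG subcategory. A *DG quotient of $\mathcal A$ modulo $\mathcal B$* is a diagram of DG functors $\mathcal A\xleftarrow{\ \pi\ }\mathcal A'\xrightarrow{\ \xi\ }\mathcal C$ such that $\pi$ is a quasi-equivalence (a quasi-isomorphism on all complexes of morphisms, with $\mathrm{Ho}(\pi)$ essentially surjective), $\mathrm{Ho}(\xi):\mathrm{Ho}(\mathcal A')\to\mathrm{Ho}(\mathcal C)$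 is essentially surjective, and $\xi^{\mathrm{tr}}:\mathcal A'^{\,\mathrm{tr}}\to\mathcal C^{\mathrm{tr}}$ induces, via the equivalence $\pi^{\mathrm{tr}}:\mathcal A'^{\,\mathrm{tr}}\to\mathcal A^{\mathrm{tr}}$, an equivalence $\mathcal A^{\mathrm{tr}}/\mathcal B^{\mathrm{tr}}\to\mathcal C^{\mathrm{tr}}$ from the Verdier quotient. (For $\mathcal A'=\mathcal A$ and $\pi=\mathrm{id}$ this says that the DG functor $\xi:\mathcal A\to\mathcal C$ is a DG quotient modulo $\mathcal B$.) The same definition is used for DG categories with a large class of objects. A right DG $\mathcal A$-module is *semi-free* if it is the union of an increasing sequence $0=\Phi_0\subset\Phi_1\subset\cdots$ of DG submodules such that every $\Phi_{i+1}/\Phi_i$ is isomorphic to a direct sum of shifts of representable modules $\mathrm{Hom}_{\mathcal A}(-,X)$. Let $\mathcal A_{\to}$ be the DG category of semi-free right DG $\mathcal A$-modules. A DG functor $F:\mathcal A\to\mathcal A_1$ induces, by induction $M\mapsto M\otimes_{\mathcal A}\mathrm{Hom}_{\mathcal A_1}(-,F(-))$, a DG functor $F_{\to}:\mathcal A_{\to}\to(\mathcal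 A_1)_{\to}$; for the inclusion of $\mathcal B$ in $\mathcal A$ it is fully faithful, and $\mathcal B_{\to}$ is identified in this way with a full DG subcategory of $\mathcal A_{\to}$. Put $\mathcal A_{\leftarrow}=((\mathcal A^{\circ})_{\to})^{\circ}$, $F_{\leftarrow}=((F^{\circ})_{\to})^{\circ}$, where $^\circ$ denotes the dual DG category, and let $\mathcal B_{\leftarrow}\subset\mathcal A_{\leftarrow}$ be the full DG subcategory given by $(\mathcal B^{\circ})_{\to}\subset(\mathcal A^{\circ})_{\to}$. Let $D(\mathcal A)$ be the derived category of right DG $\mathcal A$-modules, that is, the Verdier quotient of their homotopy category by the acyclic modules. A DG functor $F:\mathcal A\to\mathcal A_1$ induces a restriction functor $F^*:D(\mathcal A_1)\to D(\mathcal A)$. **Proposition.** Let $\mathcal A\xleftarrow{\ \pi\ }\mathcal A'\xrightarrow{\ \xi\ }\mathcal C$ be a DG quotient of the DG category $\mathcal A$ modulo the full DG subcategory $\mathcal B\subset\mathcal A$. Then: (i) $\mathcal A_{\to}\xleftarrow{\pi_{\to}}\mathcal A'_{\to}\xrightarrow{\xi_{\to}}\mathcal C_{\to}$ is a DG quotient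 of $\mathcal A_{\to}$ modulo $\mathcal B_{\to}$; (i') $\mathcal A_{\leftarrow}\xleftarrow{\pi_{\leftarrow}}\mathcal A'_{\leftarrow}\xrightarrow{\xi_{\leftarrow}}\mathcal C_{\leftarrow}$ is a DG quotient of $\mathcal A_{\leftarrow}$ modulo $\mathcal B_{\leftarrow}$; (ii) $\pi^*:D(\mathcal A)\to D(\mathcal A')$ is an equivalence, the restriction functor $(\pi^*)^{-1}\xi^*:D(\mathcal C)\to D(\mathcal A)$ is fully faithful, and its essential image consists precisely of the objects of $D(\mathcal A)$ annihilated by the restriction functor $\rho:D(\mathcal A)\to D(\mathcal B)$; the functor $D(\mathcal A)/D(\mathcal C)\to D(\mathcal B)$ induced by $\rho$, from the Verdier quotient of $D(\mathcal A)$ by this essential image, is an equivalence. -/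

import Mathlib

open CategoryTheory

universe w v v₁ v₂ v₃ u u₁ u₂ u₃

noncomputable section

namespace DG

/-- The sign `(-1) ^ n`, as an integer. -/
def sgn (n : ℤ) : ℤ := (n.negOnePow : ℤˣ)

lemma sgn_add (m n : ℤ) : sgn (m + n) = sgn m * sgn n := by
  simp [sgn, Int.negOnePow_add]

lemma sgn_sub (m n : ℤ) : sgn (m - n) = sgn m * sgn n := by
  simp [sgn, Int.negOnePow_sub]

@[simp] lemma sgn_zero : sgn 0 = 1 := by simp [sgn]

@[simp] lemma sgn_one : sgn 1 = -1 := by simp [sgn]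

@[simp] lemma sgn_mul_self (n : ℤ) : sgn n * sgn n = 1 := by
  rw [← sgn_sub, sub_self, sgn_zero]

/-- A differential graded category over the commutative ring `k`: the morphisms from `X` to `Y`
form a complex of `k`-modules (with differential of degree `+1`), and composition
`g, f ↦ g ∘ f` is `k`-bilinear, of degree zero, and satisfies the graded Leibniz rule.
Degrees are matched by explicit equations. -/
structure DGCategory (k : Type w) [CommRing k] where
  /-- objects -/
  Ob : Type u
  /-- morphisms of a given degree -/
  Hom : Ob → Ob → ℤ → Type v
  [addCommGroup : ∀ X Y n, AddCommGroup (Hom X Y n)]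
  [module : ∀ X Y n, Module k (Hom X Y n)]
  /-- the differential, from degree `p` to degree `q = p + 1` -/
  d : ∀ {X Y : Ob} (p q : ℤ), p + 1 = q → (Hom X Y p →ₗ[k] Hom X Y q)
  /-- identity morphisms -/
  one : ∀ X : Ob, Hom X X 0
  /-- composition `comp h g f = g ∘ f` -/
  comp : ∀ {X Y Z : Ob} {q p r : ℤ}, q + p = r → (Hom Y Z q →ₗ[k] Hom X Y p →ₗ[k] Hom X Z r)
  d_d : ∀ {X Y : Ob} (p q r : ℤ) (h : p + 1 = q) (h' : q + 1 = r) (f : Hom X Y p),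
    d q r h' (d p q h f) = 0
  one_comp : ∀ {X Y : Ob} {p : ℤ} (h : 0 + p = p) (f : Hom X Y p), comp h (one Y) f = f
  comp_one : ∀ {X Y : Ob} {p : ℤ} (h : p + 0 = p) (f : Hom X Y p), comp h f (one X) = f
  assoc : ∀ {X Y Z W : Ob} {a b c ab bc abc : ℤ} (h₁ : a + b = ab) (h₂ : ab + c = abc)
    (h₃ : b + c = bc) (h₄ : a + bc = abc) (f : Hom Z W a) (g : Hom Y Z b) (h : Hom X Y c),
    comp h₂ (comp h₁ f g) h = comp h₄ f (comp h₃ g h)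
  leibniz : ∀ {X Y Z : Ob} {p p' q q' r r' : ℤ} (h : q + p = r) (hr : r + 1 = r')
    (hq : q + 1 = q') (hp : p + 1 = p') (h₁ : q' + p = r') (h₂ : q + p' = r')
    (g : Hom Y Z q) (f : Hom X Y p),
    d r r' hr (comp h g f) = comp h₁ (d q q' hq g) f + sgn q • comp h₂ g (d p p' hp f)

attribute [instance] DGCategory.addCommGroup DGCategory.module

section

variable {k : Type w} [CommRing k]

/-- A DG functor: it acts on morphisms by `k`-linear maps of degree zero which commute with the
differentials and preserve identities and composition. -/
structure DGFunctor (A : DGCategory.{w, v₁, u₁} k) (B : DGCategory.{w, v₂, u₂} k) where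
  obj : A.Ob → B.Ob
  map : ∀ {X Y : A.Ob} (n : ℤ), A.Hom X Y n →ₗ[k] B.Hom (obj X) (obj Y) n
  map_d : ∀ {X Y : A.Ob} (p q : ℤ) (h : p + 1 = q) (f : A.Hom X Y p),
    map q (A.d p q h f) = B.d p q h (map p f)
  map_one : ∀ X : A.Ob, map 0 (A.one X) = B.one (obj X)
  map_comp : ∀ {X Y Z : A.Ob} {p q r : ℤ} (h : q + p = r) (g : A.Hom Y Z q) (f : A.Hom X Y p),
    map r (A.comp h g f) = B.comp h (map q g) (map p f)

variable {A : DGCategory.{w, v₁, u₁} k} {B : DGCategory.{w, v₂, u₂} k}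
  {C : DGCategory.{w, v₃, u₃} k}

lemma DGCategory.d_one (A : DGCategory.{w, v₁, u₁} k) (X : A.Ob) (q : ℤ) (h : 0 + 1 = q) :
    A.d 0 q h (A.one X) = 0 := by
  subst h
  have e := A.leibniz (X := X) (add_zero 0) (zero_add 1) (zero_add 1) (zero_add 1) (add_zero _)
    (zero_add _) (A.one X) (A.one X)
  rw [A.one_comp, sgn_zero, one_smul] at e
  have e₁ := A.comp_one (add_zero (0 + 1 : ℤ)) (A.d 0 (0 + 1) rfl (A.one X))
  have e₂ := A.one_comp (zero_add (0 + 1 : ℤ)) (A.d 0 (0 + 1) rfl (A.one X))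
  erw [e₁, e₂] at e
  simpa using e

/-- Composition of DG functors: first `F`, then `G`. -/
def DGFunctor.comp (F : DGFunctor A B) (G : DGFunctor B C) : DGFunctor A C where
  obj X := G.obj (F.obj X)
  map n := (G.map n).comp (F.map n)
  map_d p q h f := by simp [F.map_d, G.map_d]
  map_one X := by simp [F.map_one, G.map_one]
  map_comp h g f := by simp [F.map_comp, G.map_comp]

/-- The full DG subcategory on the objects satisfying `P`. -/
abbrev fullSub (A : DGCategory.{w, v, u} k) (P : A.Ob → Prop) : DGCategory.{w, v, u} k where
  Ob := {X : A.Ob // P X}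
  Hom X Y n := A.Hom X.1 Y.1 n
  d p q h := A.d p q h
  one X := A.one X.1
  comp h := A.comp h
  d_d p q r h h' f := A.d_d p q r h h' f
  one_comp h f := A.one_comp h f
  comp_one h f := A.comp_one h f
  assoc h₁ h₂ h₃ h₄ f g h := A.assoc h₁ h₂ h₃ h₄ f g h
  leibniz h hr hq hp h₁ h₂ g f := A.leibniz h hr hq hp h₁ h₂ g f

/-- The inclusion of a full DG subcategory. -/
def inclusion (A : DGCategory.{w, v, u} k) (P : A.Ob → Prop) : DGFunctor (fullSub A P) A where
  obj X := X.1
  map _ := LinearMap.id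
  map_d _ _ _ _ := rfl
  map_one _ := rfl
  map_comp _ _ _ := rfl

/-- The DG functor between full DG subcategories induced by a DG functor. -/
def fullSubMap (F : DGFunctor A B) (P : A.Ob → Prop) (Q : B.Ob → Prop)
    (hF : ∀ X, P X → Q (F.obj X)) : DGFunctor (fullSub A P) (fullSub B Q) where
  obj X := ⟨F.obj X.1, hF _ X.2⟩
  map n := F.map n
  map_d p q h f := F.map_d p q h f
  map_one X := F.map_one X.1
  map_comp h g f := F.map_comp h g f

/-- The dual DG category: `g ∘ᵒ f = (-1) ^ (deg f * deg g) f ∘ g`, with the same differential. -/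
abbrev DGCategory.op (A : DGCategory.{w, v, u} k) : DGCategory.{w, v, u} k where
  Ob := A.Ob
  Hom X Y n := A.Hom Y X n
  d p q h := A.d p q h
  one X := A.one X
  comp {_ _ _ q p _} h := sgn (q * p) • (A.comp ((add_comm p q).trans h)).flip
  d_d p q r h h' f := A.d_d p q r h h' f
  one_comp h f := by
    simp only [zero_mul, sgn_zero, one_smul, LinearMap.flip_apply]
    exact A.comp_one _ f
  comp_one h f := by
    simp only [mul_zero, sgn_zero, one_smul, LinearMap.flip_apply]
    exact A.one_comp _ f
  assoc {_ _ _ _ a b c ab bc abc} h₁ h₂ h₃ h₄ f g h := by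
    simp only [LinearMap.smul_apply, LinearMap.flip_apply, map_zsmul, smul_smul]
    rw [A.assoc (by omega) _ ((add_comm b a).trans h₁) (by omega)]
    congr 1
    subst h₁ h₃
    simp only [mul_add, add_mul, sgn_add]
    ring
  leibniz {_ _ _ p p' q q' r r'} h hr hq hp h₁ h₂ g f := by
    simp only [LinearMap.smul_apply, LinearMap.flip_apply, map_zsmul, smul_smul]
    rw [A.leibniz (by omega) hr hp hq (by omega) (by omega)]
    subst hq hp
    simp only [mul_add, add_mul, sgn_add, smul_add, smul_smul, mul_one, one_mul]
    have e := sgn_mul_self p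
    have e' := sgn_mul_self q
    rw [add_comm]
    congr 2
    linear_combination (-sgn (q * p)) * e'

/-- The DG functor between dual DG categories given by a DG functor. -/
def DGFunctor.op (F : DGFunctor A B) : DGFunctor A.op B.op where
  obj := F.obj
  map n := F.map n
  map_d p q h f := F.map_d p q h f
  map_one X := F.map_one X
  map_comp h g f := by
    simp only [LinearMap.smul_apply, LinearMap.flip_apply, map_zsmul, F.map_comp]

/-- The identity of `X`, in a degree which is only propositionally zero. -/
def DGCategory.oneOf (A : DGCategory.{w, v, u} k) (X : A.Ob) {n : ℤ} (hn : n = 0) : A.Hom X X n :=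
  hn ▸ A.one X

lemma DGCategory.oneOf_comp (A : DGCategory.{w, v, u} k) {X Y : A.Ob} {n p : ℤ} (hn : n = 0)
    (h : n + p = p) (f : A.Hom X Y p) : A.comp h (A.oneOf Y hn) f = f := by
  subst hn
  exact A.one_comp h f

lemma DGCategory.comp_oneOf (A : DGCategory.{w, v, u} k) {X Y : A.Ob} {n p : ℤ} (hn : n = 0)
    (h : p + n = p) (f : A.Hom X Y p) : A.comp h f (A.oneOf X hn) = f := by
  subst hn
  exact A.comp_one h f

lemma DGFunctor.map_oneOf (F : DGFunctor A B) (X : A.Ob) {n : ℤ} (hn : n = 0) :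
    F.map n (A.oneOf X hn) = B.oneOf (F.obj X) hn := by
  subst hn
  exact F.map_one X

/-- The identity of `X`, as a morphism to a propositionally equal object. -/
def DGCategory.oneEq (A : DGCategory.{w, v, u} k) {X Y : A.Ob} (e : X = Y) : A.Hom X Y 0 :=
  e ▸ A.one X

/-- The formal shifts `X[r]` of the objects of `A`, with
`Hom (X[r]) (Y[s]) = Hom (X, Y)[s - r]`. The differential carries the sign `(-1) ^ s`, so that
the composition of `A`, used without any sign, satisfies the Leibniz rule. -/
abbrev shiftHull (A : DGCategory.{w, v, u} k) : DGCategory.{w, v, u} k where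
  Ob := A.Ob × ℤ
  Hom X Y n := A.Hom X.1 Y.1 (n + Y.2 - X.2)
  d {X Y} p q h := sgn Y.2 • A.d (p + Y.2 - X.2) (q + Y.2 - X.2) (by omega)
  one X := A.oneOf X.1 (by omega)
  comp h := A.comp (by omega)
  d_d p q r h h' f := by simp [A.d_d]
  one_comp h f := A.oneOf_comp _ _ f
  comp_one h f := A.comp_oneOf _ _ f
  assoc h₁ h₂ h₃ h₄ f g h := A.assoc _ _ _ _ f g h
  leibniz {X Y Z p p' q q' r r'} h hr hq hp h₁ h₂ g f := by
    simp only [LinearMap.smul_apply, map_zsmul]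
    rw [A.leibniz (q' := q' + Z.2 - Y.2) (p' := p' + Y.2 - X.2) _ _ (by omega) (by omega)
      (by omega) (by omega), smul_add, smul_smul, smul_smul]
    congr 2
    rw [sgn_sub, sgn_add]
    linear_combination sgn q * sgn Y.2 * sgn_mul_self Z.2

/-- The action of a DG functor on formal shifts. -/
def shiftHullMap (F : DGFunctor A B) : DGFunctor (shiftHull A) (shiftHull B) where
  obj X := (F.obj X.1, X.2)
  map {X Y} n := F.map (n + Y.2 - X.2)
  map_d {X Y} p q h f := by
    simp only [LinearMap.smul_apply, map_zsmul, F.map_d]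
  map_one X := F.map_oneOf X.1 (by omega)
  map_comp h g f := F.map_comp _ g f

/-- The formal finite direct sums of objects of `A`; morphisms are matrices, composed by matrix
multiplication, and the differential is applied to each entry. -/
abbrev addHull (A : DGCategory.{w, v, u} k) : DGCategory.{w, v, u} k where
  Ob := Σ n : ℕ, (Fin n → A.Ob)
  Hom X Y l := ∀ (i : Fin Y.1) (j : Fin X.1), A.Hom (X.2 j) (Y.2 i) l
  d p q h :=
    { toFun f i j := A.d p q h (f i j)
      map_add' f g := by funext i j; simp
      map_smul' c f := by funext i j; simp }
  one X i j := if e : j = i then A.oneEq (congrArg X.2 e) else 0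
  comp h := LinearMap.mk₂ k (fun g f i j => ∑ s, A.comp h (g i s) (f s j))
    (fun g g' f => by funext i j; simp [Finset.sum_add_distrib])
    (fun c g f => by funext i j; simp [Finset.smul_sum])
    (fun g f f' => by funext i j; simp [Finset.sum_add_distrib])
    (fun c g f => by funext i j; simp [Finset.smul_sum])
  d_d p q r h h' f := by funext i j; exact A.d_d p q r h h' (f i j)
  one_comp {X Y p} h f := by
    funext i j
    change ∑ s, A.comp h (if e : s = i then A.oneEq (congrArg Y.2 e) else 0) (f s j) = f i j
    rw [Finset.sum_eq_single i]
    · rw [dif_pos rfl]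
      exact A.one_comp h (f i j)
    · intro s _ hs
      rw [dif_neg hs, map_zero, LinearMap.zero_apply]
    · simp
  comp_one {X Y p} h f := by
    funext i j
    change ∑ s, A.comp h (f i s) (if e : j = s then A.oneEq (congrArg X.2 e) else 0) = f i j
    rw [Finset.sum_eq_single j]
    · rw [dif_pos rfl]
      exact A.comp_one h (f i j)
    · intro s _ hs
      rw [dif_neg (Ne.symm hs), map_zero]
    · simp
  assoc h₁ h₂ h₃ h₄ f g h := by
    funext i j
    simp only [LinearMap.mk₂_apply, map_sum, LinearMap.sum_apply]
    rw [Finset.sum_comm]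
    exact Finset.sum_congr rfl fun s _ => Finset.sum_congr rfl fun t _ => A.assoc h₁ h₂ h₃ h₄ _ _ _
  leibniz {X Y Z p p' q q' r r'} h hr hq hp h₁ h₂ g f := by
    funext i j
    change A.d r r' hr (∑ s, A.comp h (g i s) (f s j)) =
      ∑ s, A.comp h₁ (A.d q q' hq (g i s)) (f s j) +
        sgn q • ∑ s, A.comp h₂ (g i s) (A.d p p' hp (f s j))
    rw [map_sum, Finset.smul_sum, ← Finset.sum_add_distrib]
    exact Finset.sum_congr rfl fun s _ => A.leibniz h hr hq hp h₁ h₂ _ _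

/-- The action of a DG functor on formal finite direct sums. -/
def addHullMap (F : DGFunctor A B) : DGFunctor (addHull A) (addHull B) where
  obj X := ⟨X.1, fun i => F.obj (X.2 i)⟩
  map n :=
    { toFun f i j := F.map n (f i j)
      map_add' f g := by funext i j; exact map_add _ _ _
      map_smul' c f := by funext i j; exact map_smul _ _ _ }
  map_d p q h f := by funext i j; exact F.map_d p q h (f i j)
  map_one X := by
    funext i j
    change F.map 0 (if e : j = i then A.oneEq (congrArg X.2 e) else 0) =
      (if e : j = i then B.oneEq (congrArg (fun i => F.obj (X.2 i)) e) else 0)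
    split_ifs with e
    · subst e
      exact F.map_one _
    · exact map_zero _
  map_comp h g f := by
    funext i j
    change F.map _ (∑ s, A.comp h (g i s) (f s j)) = ∑ s, B.comp h (F.map _ (g i s)) (F.map _ (f s j))
    rw [map_sum]
    exact Finset.sum_congr rfl fun s _ => F.map_comp h _ _

/-- An object `X` together with an endomorphism `q` of degree one such that `dq + q ^ 2 = 0`. -/
structure Twisted (A : DGCategory.{w, v, u} k) where
  obj : A.Ob
  q : A.Hom obj obj 1
  eq : A.d 1 2 rfl q + A.comp (r := 2) rfl q q = 0

/-- Twisted objects of `A`: morphisms and their composition are as in `A`, and the differential of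
`f` of degree `l` is `df + q' f - (-1) ^ l f q`. -/
abbrev twist (A : DGCategory.{w, v, u} k) : DGCategory.{w, v, max u v} k where
  Ob := Twisted A
  Hom X Y n := A.Hom X.obj Y.obj n
  d {X Y} p p' h := A.d p p' h + A.comp ((add_comm 1 p).trans h) Y.q
    - sgn p • (A.comp h).flip X.q
  one X := A.one X.obj
  comp h := A.comp h
  d_d {X Y} p p' p'' h h' f := by
    simp only [LinearMap.sub_apply, LinearMap.add_apply, LinearMap.smul_apply,
      LinearMap.flip_apply, map_sub, map_add, map_zsmul, A.d_d]
    rw [A.leibniz (q' := 2) (p' := p') _ _ rfl h (by omega) (by omega),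
      A.leibniz (q' := p') (p' := 2) _ _ h rfl (by omega) (by omega),
      eq_neg_of_add_eq_zero_left X.eq, eq_neg_of_add_eq_zero_left Y.eq]
    simp only [map_neg, LinearMap.neg_apply]
    rw [A.assoc (ab := 2) (bc := p') rfl (by omega) (by omega) (by omega) Y.q Y.q f,
      A.assoc (ab := p') (bc := 2) (by omega) (by omega) rfl (by omega) f X.q X.q,
      A.assoc (ab := p') (bc := p') (by omega) (by omega) (by omega) (by omega) Y.q f X.q]
    simp only [smul_sub, smul_add, smul_smul, smul_neg]
    subst h
    rw [sgn_add, sgn_one]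
    module
  one_comp h f := A.one_comp h f
  comp_one h f := A.comp_one h f
  assoc h₁ h₂ h₃ h₄ f g h := A.assoc h₁ h₂ h₃ h₄ f g h
  leibniz {X Y Z p p' q q' r r'} h hr hq hp h₁ h₂ g f := by
    simp only [LinearMap.sub_apply, LinearMap.add_apply, LinearMap.smul_apply,
      LinearMap.flip_apply, map_sub, map_add, map_zsmul]
    rw [A.leibniz h hr hq hp h₁ h₂, A.assoc (ab := q') (bc := p') hq (by omega) (by omega) h₂ g Y.q f,
      A.assoc (ab := q') (by omega) (by omega) h (by omega) Z.q g f,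
      A.assoc (bc := p') h hr hp h₂ g f X.q]
    simp only [smul_sub, smul_add, smul_smul]
    subst h
    rw [sgn_add]
    module

/-- The action of a DG functor on twisted objects. -/
def twistMap (F : DGFunctor A B) : DGFunctor (twist A) (twist B) where
  obj X :=
    { obj := F.obj X.obj
      q := F.map 1 X.q
      eq := by rw [← F.map_d, ← F.map_comp, ← map_add, X.eq, map_zero] }
  map n := F.map n
  map_d {X Y} p p' h f := by
    change F.map _ (A.d p p' h f + A.comp _ Y.q f - sgn p • A.comp _ f X.q) =
      B.d p p' h (F.map _ f) + B.comp _ (F.map _ Y.q) (F.map _ f)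
        - sgn p • B.comp _ (F.map _ f) (F.map _ X.q)
    rw [map_sub, map_add, map_zsmul, F.map_d, F.map_comp, F.map_comp]
  map_one X := F.map_one X.obj
  map_comp h g f := F.map_comp h g f

/-- The twisted object `(⨁ᵢ Cᵢ[rᵢ], q)` is one-sided if `q i j = 0` for `i ≥ j`. -/
def OneSided {A : DGCategory.{w, v, u} k} (X : Twisted (addHull (shiftHull A))) : Prop :=
  ∀ i j : Fin X.obj.1, j ≤ i → X.q i j = 0

/-- The DG category of one-sided twisted complexes `(⨁ᵢ Cᵢ[rᵢ], q)` over `A`. -/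
abbrev pretr (A : DGCategory.{w, v, u} k) : DGCategory.{w, v, max u v} k :=
  fullSub (twist (addHull (shiftHull A))) OneSided

/-- The DG functor induced by `F` on one-sided twisted complexes. -/
def pretrMap (F : DGFunctor A B) : DGFunctor (pretr A) (pretr B) :=
  fullSubMap (twistMap (addHullMap (shiftHullMap F))) OneSided OneSided
    fun X hX i j hij => by
      change F.map _ (X.q i j) = 0
      rw [hX i j hij]
      exact map_zero _

/-- The one-sided twisted complexes all of whose terms `Cᵢ` satisfy `P`. -/
def pretrSub {A : DGCategory.{w, v, u} k} (P : A.Ob → Prop) (X : (pretr A).Ob) : Prop :=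
  ∀ i : Fin X.1.obj.1, P (X.1.obj.2 i).1

/-- The complex of `k`-modules with given terms and differentials, as an object of Mathlib's
category of cochain complexes. -/
def mkComplex (X : ℤ → Type v) [∀ n, AddCommGroup (X n)] [∀ n, Module k (X n)]
    (d : ∀ p q : ℤ, p + 1 = q → (X p →ₗ[k] X q))
    (dd : ∀ (p q r : ℤ) (h : p + 1 = q) (h' : q + 1 = r) (x : X p), d q r h' (d p q h x) = 0) :
    CochainComplex (ModuleCat.{v} k) ℤ where
  X n := ModuleCat.of k (X n)
  d p q := if h : p + 1 = q then ModuleCat.ofHom (d p q h) else 0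
  shape p q h := dif_neg h
  d_comp_d' p q r h h' := by
    change p + 1 = q at h
    change q + 1 = r at h'
    rw [dif_pos h, dif_pos h']
    ext x
    exact dd p q r h h' x

/-- The chain map given by linear maps which commute with the differentials. -/
def mkComplexMap {X Y : ℤ → Type v} [∀ n, AddCommGroup (X n)] [∀ n, Module k (X n)]
    [∀ n, AddCommGroup (Y n)] [∀ n, Module k (Y n)]
    {d : ∀ p q : ℤ, p + 1 = q → (X p →ₗ[k] X q)} {dd} {d' : ∀ p q : ℤ, p + 1 = q → (Y p →ₗ[k] Y q)}
    {dd'} (f : ∀ n, X n →ₗ[k] Y n) (hf : ∀ p q h x, f q (d p q h x) = d' p q h (f p x)) :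
    mkComplex X d dd ⟶ mkComplex Y d' dd' where
  f n := ModuleCat.ofHom (f n)
  comm' p q h := by
    change p + 1 = q at h
    dsimp only [mkComplex]
    rw [dif_pos h, dif_pos h]
    ext x
    exact (hf p q h x).symm

/-- The complex of morphisms from `X` to `Y`. -/
def DGCategory.homComplex (A : DGCategory.{w, v, u} k) (X Y : A.Ob) :
    CochainComplex (ModuleCat.{v} k) ℤ :=
  mkComplex (A.Hom X Y) A.d A.d_d

/-- The category with the objects of `A` and the closed morphisms of degree zero. -/
structure Z0 (A : DGCategory.{w, v, u} k) where
  ob : A.Ob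

instance (A : DGCategory.{w, v, u} k) : Category.{v} (Z0 A) where
  Hom X Y := {f : A.Hom X.ob Y.ob 0 // A.d 0 1 (zero_add 1) f = 0}
  id X := ⟨A.one X.ob, A.d_one _ _ _⟩
  comp f g := ⟨A.comp (zero_add 0) g.1 f.1, by
    rw [A.leibniz _ _ (zero_add 1) (zero_add 1) (add_zero 1) (zero_add 1), f.2, g.2]
    simp⟩
  id_comp f := Subtype.ext (A.comp_one _ f.1)
  comp_id f := Subtype.ext (A.one_comp _ f.1)
  assoc f g h := Subtype.ext (A.assoc _ _ _ _ h.1 g.1 f.1).symm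

/-- Two closed morphisms of degree zero are homotopic if their difference is a coboundary. -/
def homotopic (A : DGCategory.{w, v, u} k) : HomRel (Z0 A) := fun X Y f g =>
  ∃ h : A.Hom X.ob Y.ob (-1), A.d (-1) 0 (neg_add_cancel 1) h = f.1 - g.1

/-- The homotopy category of a DG category: its morphisms are the elements of the cohomology in
degree zero of the complexes of morphisms. -/
abbrev Ho (A : DGCategory.{w, v, u} k) := CategoryTheory.Quotient (homotopic A)

instance (A : DGCategory.{w, v, u} k) : Congruence (homotopic A) where
  equivalence := ⟨fun f => ⟨0, by simp⟩, fun ⟨h, e⟩ => ⟨-h, by rw [map_neg, e, neg_sub]⟩,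
    fun ⟨h, e⟩ ⟨h', e'⟩ => ⟨h + h', by rw [map_add, e, e', sub_add_sub_cancel]⟩⟩
  comp_left f g g' := fun ⟨h, e⟩ => ⟨A.comp (add_zero _) h f.1, by
    rw [A.leibniz _ _ (neg_add_cancel 1) (zero_add 1) (zero_add 0) (neg_add_cancel 1), f.2, e]
    simp only [map_zero, smul_zero, add_zero, map_sub, LinearMap.sub_apply]
    rfl⟩
  comp_right {_ _ _ f f'} g := fun ⟨h, e⟩ => ⟨A.comp (zero_add _) g.1 h, by
    rw [A.leibniz _ _ (zero_add 1) (neg_add_cancel 1) (add_neg_cancel 1) (zero_add 0), g.2, e]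
    simp only [map_zero, LinearMap.zero_apply, zero_add, map_sub, sgn_zero, one_smul]
    rfl⟩

/-- The object of the homotopy category given by `X`. -/
abbrev Ho.of {A : DGCategory.{w, v, u} k} (X : A.Ob) : Ho A := ⟨⟨X⟩⟩

/-- A DG functor on closed morphisms of degree zero. -/
def Z0.map (F : DGFunctor A B) : Z0 A ⥤ Z0 B where
  obj X := ⟨F.obj X.ob⟩
  map f := ⟨F.map 0 f.1, by rw [← F.map_d, f.2, map_zero]⟩
  map_id X := Subtype.ext (F.map_one X.ob)
  map_comp f g := Subtype.ext (F.map_comp _ g.1 f.1)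

/-- The functor between homotopy categories induced by a DG functor. -/
def Ho.map (F : DGFunctor A B) : Ho A ⥤ Ho B :=
  CategoryTheory.Quotient.lift _ (Z0.map F ⋙ Quotient.functor _) fun _ _ f g ⟨h, e⟩ =>
    CategoryTheory.Quotient.sound _ ⟨F.map (-1) h, by
      refine (F.map_d _ _ _ h).symm.trans ?_
      rw [e]
      exact map_sub _ _ _⟩

/-- A DG functor is a quasi-equivalence if it is a quasi-isomorphism on complexes of morphisms
(that is, it is fully faithful on graded homotopy categories), and is essentially surjective on
homotopy categories. -/
structure DGFunctor.IsQuasiEquivalence {A : DGCategory.{w, v, u₁} k} {B : DGCategory.{w, v, u₂} k}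
    (F : DGFunctor A B) : Prop where
  quasiIso : ∀ X Y : A.Ob, QuasiIso
    (mkComplexMap F.map F.map_d : A.homComplex X Y ⟶ B.homComplex (F.obj X) (F.obj Y))
  essSurj : (Ho.map F).EssSurj

/-- The structure of a cone of the morphism `f` of degree zero (assumed closed when used) on the
object `C`: morphisms of degrees `-1`, `0`, `1`, `0` which decompose `C` as `Y ⊕ X[1]`, up to the
differential, which is zero on `Y` and is `f` on `X`. -/
structure ConeData {A : DGCategory.{w, v, u} k} {X Y : A.Ob} (f : A.Hom X Y 0) (C : A.Ob) where
  inl : A.Hom X C (-1)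
  inr : A.Hom Y C 0
  fst : A.Hom C X 1
  snd : A.Hom C Y 0
  fst_inl : A.comp (add_neg_cancel 1) fst inl = A.one X
  snd_inr : A.comp (add_zero 0) snd inr = A.one Y
  fst_inr : A.comp (add_zero 1) fst inr = 0
  snd_inl : A.comp (zero_add (-1)) snd inl = 0
  total : A.comp (neg_add_cancel 1) inl fst + A.comp (add_zero 0) inr snd = A.one C
  d_inr : A.d 0 1 (zero_add 1) inr = 0
  d_inl : A.d (-1) 0 (neg_add_cancel 1) inl = A.comp (add_zero 0) inr f

/-- A DG functor sends cones to cones. -/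
def ConeData.map {X Y : A.Ob} {f : A.Hom X Y 0} {C : A.Ob} (c : ConeData f C)
    (F : DGFunctor A B) : ConeData (F.map 0 f) (F.obj C) where
  inl := F.map _ c.inl
  inr := F.map _ c.inr
  fst := F.map _ c.fst
  snd := F.map _ c.snd
  fst_inl := by rw [← F.map_comp, c.fst_inl, F.map_one]
  snd_inr := by rw [← F.map_comp, c.snd_inr, F.map_one]
  fst_inr := by rw [← F.map_comp, c.fst_inr, map_zero]
  snd_inl := by rw [← F.map_comp, c.snd_inl, map_zero]
  total := by rw [← F.map_comp, ← F.map_comp, ← map_add, c.total, F.map_one]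
  d_inr := by rw [← F.map_d, c.d_inr, map_zero]
  d_inl := by rw [← F.map_d, c.d_inl, F.map_comp]

/-- The morphisms in the homotopy category of `A` which have a cone isomorphic there to an
object satisfying `P`. -/
def coneIn (A : DGCategory.{w, v, u} k) (P : A.Ob → Prop) : MorphismProperty (Ho A) :=
  fun X Y φ => ∃ (f : X.as ⟶ Y.as) (C Z : A.Ob), (Quotient.functor (homotopic A)).map f = φ ∧
    Nonempty (ConeData f.1 C) ∧ P Z ∧ Nonempty (Ho.of C ≅ Ho.of Z)

/-- The triangulated category associated with `A`: the homotopy category of the one-sided twisted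
complexes. -/
abbrev Tr (A : DGCategory.{w, v, u} k) := Ho (pretr A)

/-- The functor induced by a DG functor on the associated triangulated categories. -/
abbrev Tr.map (F : DGFunctor A B) : Tr A ⥤ Tr B := Ho.map (pretrMap F)

/-- For a full DG subcategory of `A` with the objects satisfying `P`, the class of morphisms whose
inversion turns the triangulated category of `A` into its Verdier quotient by the triangulated
category of that subcategory. -/
def verdierClass (A : DGCategory.{w, v, u} k) (P : A.Ob → Prop) : MorphismProperty (Tr A) :=
  coneIn (pretr A) (pretrSub P)

/-- The diagram `A ⟵ A' ⟶ C` formed by `π` and `ξ` is a DG quotient of `A` modulo the full DG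
subcategory on the objects satisfying `P`: `π` is a quasi-equivalence, `ξ` is essentially surjective
on homotopy categories, and `ξ` induces an equivalence from the Verdier quotient of the triangulated
category of `A` (which is identified by `π` with that of `A'`) to the triangulated category of `C`.
The case where `π` is an identity functor is that of a DG functor which is a DG quotient. -/
structure IsDGQuotient {A' : DGCategory.{w, v, u₁} k} {A : DGCategory.{w, v, u₂} k}
    {C : DGCategory.{w, v, u₃} k} (π : DGFunctor A' A) (ξ : DGFunctor A' C) (P : A.Ob → Prop) :
    Prop where
  quasiEquivalence : π.IsQuasiEquivalence
  essSurj : (Ho.map ξ).EssSurj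
  isLocalization : (Tr.map ξ).IsLocalization ((verdierClass A P).inverseImage (Tr.map π))

end

section

variable {k : Type u} [CommRing k]

/-- A right DG module over `A`: complexes of `k`-modules `X Y`, for the objects `Y` of `A`, with a
`k`-bilinear, associative and unital right action of the morphisms of `A` which satisfies the
graded Leibniz rule. This is the same thing as a DG functor from `A.op` to complexes of
`k`-modules (a morphism `f` acting by `m ↦ (-1) ^ (deg f * deg m) m f`). -/
structure RightModule (A : DGCategory.{u, u, u} k) where
  X : A.Ob → ℤ → Type u
  [addCommGroup : ∀ Y n, AddCommGroup (X Y n)]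
  [module : ∀ Y n, Module k (X Y n)]
  d : ∀ {Y : A.Ob} (p q : ℤ), p + 1 = q → (X Y p →ₗ[k] X Y q)
  act : ∀ {Y Z : A.Ob} {q p r : ℤ}, q + p = r → (X Y q →ₗ[k] A.Hom Z Y p →ₗ[k] X Z r)
  d_d : ∀ {Y : A.Ob} (p q r : ℤ) (h : p + 1 = q) (h' : q + 1 = r) (m : X Y p),
    d q r h' (d p q h m) = 0
  act_one : ∀ {Y : A.Ob} {p : ℤ} (h : p + 0 = p) (m : X Y p), act h m (A.one Y) = m
  act_comp : ∀ {Y Z W : A.Ob} {a b c ab bc abc : ℤ} (h₁ : a + b = ab) (h₂ : ab + c = abc)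
    (h₃ : b + c = bc) (h₄ : a + bc = abc) (m : X Y a) (f : A.Hom Z Y b) (g : A.Hom W Z c),
    act h₂ (act h₁ m f) g = act h₄ m (A.comp h₃ f g)
  leibniz : ∀ {Y Z : A.Ob} {p p' q q' r r' : ℤ} (h : q + p = r) (hr : r + 1 = r')
    (hq : q + 1 = q') (hp : p + 1 = p') (h₁ : q' + p = r') (h₂ : q + p' = r')
    (m : X Y q) (f : A.Hom Z Y p),
    d r r' hr (act h m f) = act h₁ (d q q' hq m) f + sgn q • act h₂ m (A.d p p' hp f)

attribute [instance] RightModule.addCommGroup RightModule.module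

/-- Families of `k`-linear maps of degree `n`. (They are indexed by the pairs `(p, q)` of degrees
with `p + n = q`.) -/
abbrev Family {A : DGCategory.{u, u, u} k} (M N : RightModule A) (n : ℤ) :=
  ∀ (Y : A.Ob) (t : {t : ℤ × ℤ // t.1 + n = t.2}), M.X Y t.1.1 →ₗ[k] N.X Y t.1.2

/-- The component of a family of linear maps from degree `p` to degree `q`. -/
abbrev app {A : DGCategory.{u, u, u} k} {M N : RightModule A} {n : ℤ} (f : Family M N n)
    (Y : A.Ob) (p q : ℤ) (h : p + n = q) : M.X Y p →ₗ[k] N.X Y q := f Y ⟨(p, q), h⟩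

/-- Compatibility of a family of linear maps with the right action. -/
structure Family.IsEquivariant {A : DGCategory.{u, u, u} k} {M N : RightModule A} {n : ℤ}
    (f : Family M N n) : Prop where
  app_act : ∀ {Y Z : A.Ob} {p p' a q q' : ℤ} (hp : p + n = p') (hq : q + n = q')
    (h : p + a = q) (h' : p' + a = q') (m : M.X Y p) (x : A.Hom Z Y a),
    app f Z q q' hq (M.act h m x) = N.act h' (app f Y p p' hp m) x

/-- The morphisms of degree `n` of right DG modules: families of `k`-linear maps of degree `n`
which commute with the action. -/
def moduleHom {A : DGCategory.{u, u, u} k} (M N : RightModule A) (n : ℤ) :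
    Submodule k (Family M N n) where
  carrier := {f | Family.IsEquivariant f}
  add_mem' {f g} hf hg := ⟨fun hp hq h h' m x => by
    have e := hf.app_act hp hq h h' m x
    have e' := hg.app_act hp hq h h' m x
    simp only [app, Pi.add_apply, LinearMap.add_apply, map_add] at e e' ⊢
    rw [e, e']⟩
  zero_mem' := ⟨fun hp hq h h' m x => by simp [app]⟩
  smul_mem' c f hf := ⟨fun hp hq h h' m x => by
    have e := hf.app_act hp hq h h' m x
    simp only [app, Pi.smul_apply, LinearMap.smul_apply, map_smul] at e ⊢
    rw [e]⟩

/-- The differential `d ∘ f - (-1) ^ n f ∘ d` on families of linear maps of degree `n`. -/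
def familyD {A : DGCategory.{u, u, u} k} {M N : RightModule A} (n n' : ℤ) (h : n + 1 = n') :
    Family M N n →ₗ[k] Family M N n' where
  toFun f Y t := N.d (t.1.1 + n) t.1.2 (by have := t.2; omega) ∘ₗ app f Y t.1.1 (t.1.1 + n) rfl
    - sgn n • app f Y (t.1.1 + 1) t.1.2 (by have := t.2; omega) ∘ₗ M.d t.1.1 (t.1.1 + 1) rfl
  map_add' f g := by
    funext Y t
    ext m
    simp only [app, Pi.add_apply, LinearMap.sub_apply, LinearMap.add_apply, LinearMap.smul_apply,
      LinearMap.comp_apply, map_add, smul_add]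
    abel
  map_smul' c f := by
    funext Y t
    ext m
    simp only [app, Pi.smul_apply, LinearMap.sub_apply, LinearMap.smul_apply, LinearMap.comp_apply,
      map_smul, RingHom.id_apply, smul_sub]
    rw [smul_comm]

lemma familyD_apply {A : DGCategory.{u, u, u} k} {M N : RightModule A} {n n' : ℤ} (h : n + 1 = n')
    (f : Family M N n) (Y : A.Ob) {p p₁ q₁ q : ℤ}
    (hq : p + n' = q) (h₁ : p + n = q₁) (h₂ : q₁ + 1 = q) (h₃ : p + 1 = p₁) (h₄ : p₁ + n = q)
    (m : M.X Y p) :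
    app (familyD n n' h f) Y p q hq m =
      N.d q₁ q h₂ (app f Y p q₁ h₁ m) - sgn n • app f Y p₁ q h₄ (M.d p p₁ h₃ m) := by
  subst h₁ h₃
  rfl

/-- Composition of families of linear maps. -/
def familyComp {A : DGCategory.{u, u, u} k} {M N L : RightModule A} {b a c : ℤ} (h : b + a = c)
    (g : Family N L b) (f : Family M N a) : Family M L c := fun Y t =>
  app g Y (t.1.1 + a) t.1.2 (by have := t.2; omega) ∘ₗ app f Y t.1.1 (t.1.1 + a) rfl

lemma familyComp_apply {A : DGCategory.{u, u, u} k} {M N L : RightModule A} {b a c : ℤ}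
    (h : b + a = c) (g : Family N L b) (f : Family M N a)
    (Y : A.Ob) {p s q : ℤ} (hq : p + c = q) (hs : p + a = s) (hs' : s + b = q) (m : M.X Y p) :
    app (familyComp h g f) Y p q hq m = app g Y s q hs' (app f Y p s hs m) := by
  subst hs
  rfl

/-- The identity family. -/
def familyOne {A : DGCategory.{u, u, u} k} (M : RightModule A) : Family M M 0 := fun Y t =>
  (add_zero t.1.1).symm.trans t.2 ▸ LinearMap.id

lemma familyOne_apply {A : DGCategory.{u, u, u} k} (M : RightModule A) (Y : A.Ob) (p : ℤ)
    (h : p + 0 = p) (m : M.X Y p) : app (familyOne M) Y p p h m = m := rfl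

lemma family_ext {A : DGCategory.{u, u, u} k} {M N : RightModule A} {n : ℤ} {f g : moduleHom M N n}
    (h : ∀ (Y : A.Ob) (p q : ℤ) (hq : p + n = q) (m : M.X Y p),
      app f.1 Y p q hq m = app g.1 Y p q hq m) : f = g :=
  Subtype.ext (funext fun _ => funext fun t => LinearMap.ext fun m => h _ t.1.1 t.1.2 t.2 m)

/-- The DG category of right DG modules over `A`. -/
abbrev rightMod (A : DGCategory.{u, u, u} k) : DGCategory.{u, u, u + 1} k where
  Ob := RightModule A
  Hom M N n := moduleHom M N n
  d {M N} n n' h := (familyD n n' h).restrict fun f hf => ⟨fun {Y Z p p' a q q'} hp hq h' h'' m x => by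
    rw [familyD_apply h f Z (q₁ := q + n) (p₁ := q + 1) hq rfl (by omega) rfl (by omega),
      familyD_apply h f Y (q₁ := p + n) (p₁ := p + 1) hp rfl (by omega) rfl (by omega),
      hf.app_act rfl rfl h' (by omega),
      N.leibniz (q' := p') (p' := a + 1) _ _ (by omega) rfl (by omega) (by omega),
      M.leibniz (q' := p + 1) (p' := a + 1) _ _ rfl rfl (by omega) (by omega),
      map_add, hf.app_act (p' := p') (by omega) _ _ h'', map_zsmul,
      hf.app_act (p' := p + n) rfl _ _ (by omega)]
    simp only [map_sub, LinearMap.sub_apply, map_zsmul, LinearMap.smul_apply, smul_add, smul_smul]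
    rw [sgn_add]
    module⟩
  one M := ⟨familyOne M, ⟨fun {Y Z p p' a q q'} hp hq h h' m x => by
    obtain rfl : p = p' := by omega
    obtain rfl : q = q' := by omega
    rfl⟩⟩
  comp {M N L b a c} h := LinearMap.mk₂ k
    (fun g f => ⟨familyComp h g.1 f.1, ⟨fun {Y Z p p' a' q q'} hp hq h' h'' m x => by
      rw [familyComp_apply (s := p + a) h _ _ _ hp rfl (by omega),
        familyComp_apply (s := q + a) h _ _ _ hq rfl (by omega),
        f.2.app_act rfl rfl h' (by omega), g.2.app_act (by omega) (by omega) (by omega) h'']⟩⟩)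
    (fun g g' f => rfl)
    (fun c g f => rfl)
    (fun g f f' => by
      refine family_ext fun Y p q hq m => ?_
      exact map_add (app g.1 Y (p + a) q _) _ _)
    (fun c g f => by
      refine family_ext fun Y p q hq m => ?_
      exact map_smul (app g.1 Y (p + a) q _) _ _)
  d_d {M N} n n' n'' h h' f := by
    refine family_ext fun Y p q hq m => ?_
    change app (familyD n' n'' h' (familyD n n' h f.1)) Y p q hq m = 0
    rw [familyD_apply (q₁ := p + n') (p₁ := p + 1) h' _ _ hq rfl (by omega) rfl (by omega),
      familyD_apply (q₁ := p + n) (p₁ := p + 1) h _ _ rfl rfl (by omega) rfl (by omega),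
      familyD_apply (q₁ := p + n') (p₁ := p + 1 + 1) h _ _ (by omega) (by omega) (by omega) rfl
        (by omega), M.d_d, map_sub, N.d_d, map_zsmul, map_zero]
    subst h
    rw [sgn_add, sgn_one]
    module
  one_comp {M N p} h f := by
    refine family_ext fun Y q r hr m => ?_
    obtain rfl : q + p = r := hr
    exact familyComp_apply h (familyOne N) f.1 Y rfl rfl (by omega) m
  comp_one {M N p} h f := by
    refine family_ext fun Y q r hr m => ?_
    obtain rfl : q + p = r := hr
    exact familyComp_apply h f.1 (familyOne M) Y rfl (add_zero q) rfl m
  assoc {M N L K a b c ab bc abc} h₁ h₂ h₃ h₄ f g h := by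
    refine family_ext fun Y p q hq m => ?_
    change app (familyComp h₂ (familyComp h₁ f.1 g.1) h.1) Y p q hq m =
      app (familyComp h₄ f.1 (familyComp h₃ g.1 h.1)) Y p q hq m
    rw [familyComp_apply (s := p + c) _ _ _ _ _ rfl (by omega),
      familyComp_apply (s := p + bc) _ _ _ _ _ (by omega) (by omega),
      familyComp_apply (s := p + bc) _ _ _ _ _ (by omega) (by omega),
      familyComp_apply (s := p + c) _ _ _ _ _ (by omega) (by omega)]
  leibniz {M N L p p' q q' r r'} h hr hq hp h₁ h₂ g f := by
    refine family_ext fun Y s t ht m => ?_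
    change app (familyD r r' hr (familyComp h g.1 f.1)) Y s t ht m =
      app (familyComp h₁ (familyD q q' hq g.1) f.1) Y s t ht m +
        sgn q • app (familyComp h₂ g.1 (familyD p p' hp f.1)) Y s t ht m
    rw [familyD_apply (q₁ := s + r) (p₁ := s + 1) _ _ _ _ rfl (by omega) rfl (by omega),
      familyComp_apply (s := s + p) _ _ _ _ _ rfl (by omega),
      familyComp_apply (s := s + p') _ _ _ _ _ (by omega) (by omega),
      familyComp_apply (s := s + p) _ _ _ _ _ rfl (by omega),
      familyComp_apply (s := s + p') _ _ _ _ _ rfl (by omega),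
      familyD_apply (q₁ := s + r) (p₁ := s + p') _ _ _ _ (by omega) (by omega) (by omega) (by omega),
      familyD_apply (q₁ := s + p) (p₁ := s + 1) _ _ _ _ rfl (by omega) rfl (by omega),
      map_sub, map_zsmul]
    subst h
    rw [sgn_add]
    module

/-- Restriction of right DG modules along a DG functor. -/
def res {A B : DGCategory.{u, u, u} k} (F : DGFunctor A B) :
    DGFunctor (rightMod B) (rightMod A) where
  obj M :=
    { X Y n := M.X (F.obj Y) n
      d p q h := M.d p q h
      act {Y Z q p r} h := (LinearMap.lcomp k _ (F.map p)).comp (M.act h)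
      d_d p q r h h' m := M.d_d p q r h h' m
      act_one h m := by
        change M.act h m (F.map 0 (A.one _)) = m
        rw [F.map_one, M.act_one]
      act_comp h₁ h₂ h₃ h₄ m f g := by
        change M.act _ (M.act _ m (F.map _ f)) (F.map _ g) = M.act _ m (F.map _ (A.comp h₃ f g))
        rw [M.act_comp h₁ h₂ h₃ h₄, F.map_comp]
      leibniz {Y Z p p' q q' r r'} h hr hq hp h₁ h₂ m f := by
        change M.d _ _ _ (M.act _ m (F.map _ f)) = M.act _ (M.d _ _ _ m) (F.map _ f) +
          sgn q • M.act _ m (F.map _ (A.d p p' hp f))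
        rw [M.leibniz h hr hq hp h₁ h₂, F.map_d] }
  map {M N} n :=
    { toFun f := ⟨fun Y t => f.1 (F.obj Y) t, ⟨fun hp hq h h' m x => f.2.app_act hp hq h h' m _⟩⟩
      map_add' f g := rfl
      map_smul' c f := rfl }
  map_d p q h f := rfl
  map_one M := rfl
  map_comp h g f := rfl

/-- A right DG module is acyclic if all its complexes are. -/
def IsAcyclic {A : DGCategory.{u, u, u} k} (M : RightModule A) : Prop :=
  ∀ Y : A.Ob, (mkComplex (M.X Y) M.d M.d_d).Acyclic

/-- The derived category of right DG modules over `A`: the Verdier quotient of their homotopy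
category by the acyclic modules. -/
abbrev D (A : DGCategory.{u, u, u} k) := (coneIn (rightMod A) IsAcyclic).Localization

/-- The localization functor to the derived category. -/
abbrev D.Q (A : DGCategory.{u, u, u} k) : Ho (rightMod A) ⥤ D A :=
  (coneIn (rightMod A) IsAcyclic).Q

/-- The restriction functor between derived categories. -/
def resD {A B : DGCategory.{u, u, u} k} (F : DGFunctor A B) : D B ⥤ D A :=
  Localization.Construction.lift (Ho.map (res F) ⋙ D.Q A) fun _ _ φ hφ => by
    obtain ⟨f, C, Z, rfl, ⟨c⟩, hZ, ⟨e⟩⟩ := hφ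
    exact MorphismProperty.Q_inverts _ _ ⟨(Z0.map (res F)).map f, (res F).obj C,
      (res F).obj Z, rfl, ⟨c.map (res F)⟩, fun Y => hZ (F.obj Y),
      ⟨(Ho.map (res F)).mapIso e⟩⟩

/-- The morphisms of the derived category which have a cone satisfying `P`; here the distinguished
triangles are those isomorphic to images of the triangles of cones of DG modules. -/
def D.coneIn (A : DGCategory.{u, u, u} k) (P : ObjectProperty (D A)) : MorphismProperty (D A) :=
  fun _ _ φ => ∃ (M' N' : Z0 (rightMod A)) (f : M' ⟶ N') (C : RightModule A),
    Nonempty (Arrow.mk φ ≅ Arrow.mk ((D.Q A).map ((Quotient.functor _).map f))) ∧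
      Nonempty (ConeData f.1 C) ∧ P ((D.Q A).obj (Ho.of C))

/-- A DG submodule: submodules of all the terms which are stable under the differential and under
the action. -/
structure DGSubmodule {A : DGCategory.{u, u, u} k} (M : RightModule A) where
  X : ∀ (Y : A.Ob) (n : ℤ), Submodule k (M.X Y n)
  d_mem : ∀ {Y : A.Ob} (p q : ℤ) (h : p + 1 = q) (m : M.X Y p), m ∈ X Y p → M.d p q h m ∈ X Y q
  act_mem : ∀ {Y Z : A.Ob} {q p r : ℤ} (h : q + p = r) (m : M.X Y q) (f : A.Hom Z Y p),
    m ∈ X Y q → M.act h m f ∈ X Z r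

/-- The linear combinations `∑ e s ∘ a s` of homogeneous elements `e s ∈ M.X (x s) (n s)`, with
coefficients `a s` in the representable modules `Hom (-, x s)`. -/
def combination {A : DGCategory.{u, u, u} k} (M : RightModule A) {S : Type u} {x : S → A.Ob}
    {n : S → ℤ} (e : ∀ s, M.X (x s) (n s)) (Z : A.Ob) (p : ℤ) :
    (DirectSum S fun s => A.Hom Z (x s) (p - n s)) →ₗ[k] M.X Z p :=
  letI := Classical.decEq S
  DirectSum.toModule k S _ fun s => M.act (add_sub_cancel (n s) p) (e s)

/-- The quotient of the DG submodule `N'` by the DG submodule `N` is free, that is, isomorphic to a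
direct sum of shifts of representable modules: there are homogeneous elements `e s` of `N'`, with
differentials in `N`, such that every element of `N'` is congruent modulo `N` to exactly one
combination of the `e s`. -/
def IsFreeQuotient {A : DGCategory.{u, u, u} k} {M : RightModule A} (N' N : DGSubmodule M) : Prop :=
  ∃ (S : Type u) (x : S → A.Ob) (n : S → ℤ) (e : ∀ s, M.X (x s) (n s)),
    (∀ s, e s ∈ N'.X (x s) (n s)) ∧
    (∀ s, M.d (n s) (n s + 1) rfl (e s) ∈ N.X (x s) (n s + 1)) ∧
    ∀ (Z : A.Ob) (p : ℤ), ∀ m ∈ N'.X Z p, ∃! a, m - combination M e Z p a ∈ N.X Z p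

/-- A right DG module is semi-free if it is the union of an increasing sequence of DG submodules,
starting with zero, whose successive quotients are free. -/
def IsSemiFree {A : DGCategory.{u, u, u} k} (M : RightModule A) : Prop :=
  ∃ Φ : ℕ → DGSubmodule M,
    (∀ Y n, (Φ 0).X Y n = ⊥) ∧
    (∀ i Y n, (Φ i).X Y n ≤ (Φ (i + 1)).X Y n) ∧
    (∀ Y n (m : M.X Y n), ∃ i, m ∈ (Φ i).X Y n) ∧
    ∀ i, IsFreeQuotient (Φ (i + 1)) (Φ i)

/-- The direct sum, over the objects `X` of `A` and the degrees `p + q = n`, of the tensor products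
`M.X X p ⊗ Hom (Y, F X) q`. -/
abbrev PreInd {A B : DGCategory.{u, u, u} k} (F : DGFunctor A B) (M : RightModule A) (Y : B.Ob)
    (n : ℤ) : Type u :=
  DirectSum {i : A.Ob × ℤ × ℤ // i.2.1 + i.2.2 = n} fun i =>
    TensorProduct k (M.X i.1.1 i.1.2.1) (B.Hom Y (F.obj i.1.1) i.1.2.2)

/-- The elementary tensor `m ⊗ v`, in the direct sum. -/
def preTmul {A B : DGCategory.{u, u, u} k} (F : DGFunctor A B) (M : RightModule A) {Y : B.Ob}
    {n : ℤ} {X : A.Ob} {p q : ℤ} (h : p + q = n) :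
    M.X X p →ₗ[k] B.Hom Y (F.obj X) q →ₗ[k] PreInd F M Y n :=
  letI := Classical.decEq {i : A.Ob × ℤ × ℤ // i.2.1 + i.2.2 = n}
  (TensorProduct.mk k (M.X X p) (B.Hom Y (F.obj X) q)).compr₂
    (DirectSum.lof k {i : A.Ob × ℤ × ℤ // i.2.1 + i.2.2 = n}
      (fun i => TensorProduct k (M.X i.1.1 i.1.2.1) (B.Hom Y (F.obj i.1.1) i.1.2.2)) ⟨(X, p, q), h⟩)

/-- The span of the differences `m f ⊗ v - m ⊗ F(f) v`. -/
def indRelations {A B : DGCategory.{u, u, u} k} (F : DGFunctor A B) (M : RightModule A) (Y : B.Ob)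
    (n : ℤ) : Submodule k (PreInd F M Y n) :=
  Submodule.span k {t | ∃ (X X' : A.Ob) (p a p' q q' : ℤ) (h : p + a = p') (h' : a + q = q')
    (hn : p' + q = n) (hn' : p + q' = n) (m : M.X X p) (f : A.Hom X' X a)
    (v : B.Hom Y (F.obj X') q),
    t = preTmul F M hn (M.act h m f) v - preTmul F M hn' m (B.comp h' (F.map a f) v)}

/-- The term in degree `n` of the tensor product of `M`, over `A`, with the left DG module
`X ↦ Hom (Y, F X)`. -/
abbrev IndX {A B : DGCategory.{u, u, u} k} (F : DGFunctor A B) (M : RightModule A) (Y : B.Ob)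
    (n : ℤ) : Type u := PreInd F M Y n ⧸ indRelations F M Y n

section ind

variable {A B : DGCategory.{u, u, u} k} (F : DGFunctor A B) (M : RightModule A)

/-- The elementary tensor `m ⊗ v`. -/
def tmul {Y : B.Ob} {n : ℤ} {X : A.Ob} {p q : ℤ} (h : p + q = n) :
    M.X X p →ₗ[k] B.Hom Y (F.obj X) q →ₗ[k] IndX F M Y n :=
  (preTmul F M h).compr₂ (indRelations F M Y n).mkQ

lemma tmul_act {Y : B.Ob} {n : ℤ} {X X' : A.Ob} {p a p' q q' : ℤ} (h : p + a = p')
    (h' : a + q = q') (hn : p' + q = n) (hn' : p + q' = n) (m : M.X X p) (f : A.Hom X' X a)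
    (v : B.Hom Y (F.obj X') q) :
    tmul F M hn (M.act h m f) v = tmul F M hn' m (B.comp h' (F.map a f) v) :=
  (Submodule.Quotient.eq _).2
    (Submodule.subset_span ⟨X, X', p, a, p', q, q', h, h', hn, hn', m, f, v, rfl⟩)

lemma ind_ext {Y : B.Ob} {n : ℤ} {V : Type*} [AddCommGroup V] [Module k V]
    {f g : IndX F M Y n →ₗ[k] V}
    (h : ∀ (X : A.Ob) (p q : ℤ) (h : p + q = n) (m : M.X X p) (v : B.Hom Y (F.obj X) q),
      f (tmul F M h m v) = g (tmul F M h m v)) : f = g := by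
  classical
  refine Submodule.linearMap_qext _ (DirectSum.linearMap_ext k fun ⟨⟨X, p, q⟩, hn⟩ =>
    TensorProduct.ext' fun m v => ?_)
  convert h X p q hn m v <;>
  · simp only [tmul, preTmul, LinearMap.comp_apply, LinearMap.compr₂_apply, TensorProduct.mk_apply]
    congr!

/-- Linear maps out of the direct sum of tensor products. -/
def preLift {Y : B.Ob} {n : ℤ} {V : Type*} [AddCommGroup V] [Module k V]
    (φ : ∀ (X : A.Ob) (p q : ℤ), p + q = n → (M.X X p →ₗ[k] B.Hom Y (F.obj X) q →ₗ[k] V)) :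
    PreInd F M Y n →ₗ[k] V :=
  letI := Classical.decEq {i : A.Ob × ℤ × ℤ // i.2.1 + i.2.2 = n}
  DirectSum.toModule k _ V fun i => TensorProduct.lift (φ i.1.1 i.1.2.1 i.1.2.2 i.2)

lemma preLift_preTmul {Y : B.Ob} {n : ℤ} {V : Type*} [AddCommGroup V] [Module k V]
    (φ : ∀ (X : A.Ob) (p q : ℤ), p + q = n → (M.X X p →ₗ[k] B.Hom Y (F.obj X) q →ₗ[k] V))
    {X : A.Ob} {p q : ℤ} (h : p + q = n) (m : M.X X p) (v : B.Hom Y (F.obj X) q) :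
    preLift F M φ (preTmul F M h m v) = φ X p q h m v := by
  simp only [preLift, preTmul, LinearMap.compr₂_apply, DirectSum.toModule_lof,
    TensorProduct.mk_apply, TensorProduct.lift.tmul]

/-- Linear maps out of the tensor product: families of bilinear maps `φ` such that
`φ (m f) v = φ m (F(f) v)`. -/
def indLift {Y : B.Ob} {n : ℤ} {V : Type*} [AddCommGroup V] [Module k V]
    (φ : ∀ (X : A.Ob) (p q : ℤ), p + q = n → (M.X X p →ₗ[k] B.Hom Y (F.obj X) q →ₗ[k] V))
    (hφ : ∀ {X X' : A.Ob} {p a p' q q' : ℤ} (h : p + a = p') (h' : a + q = q') (hn : p' + q = n)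
      (hn' : p + q' = n) (m : M.X X p) (f : A.Hom X' X a) (v : B.Hom Y (F.obj X') q),
      φ X' p' q hn (M.act h m f) v = φ X p q' hn' m (B.comp h' (F.map a f) v)) :
    IndX F M Y n →ₗ[k] V :=
  (indRelations F M Y n).liftQ (preLift F M φ) (by
    refine Submodule.span_le.2 ?_
    rintro _ ⟨X, X', p, a, p', q, q', h, h', hn, hn', m, f, v, rfl⟩
    rw [SetLike.mem_coe, LinearMap.mem_ker, map_sub, preLift_preTmul, preLift_preTmul,
      hφ h h' hn hn', sub_self])

lemma indLift_tmul {Y : B.Ob} {n : ℤ} {V : Type*} [AddCommGroup V] [Module k V]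
    (φ : ∀ (X : A.Ob) (p q : ℤ), p + q = n → (M.X X p →ₗ[k] B.Hom Y (F.obj X) q →ₗ[k] V)) (hφ)
    {X : A.Ob} {p q : ℤ} (h : p + q = n) (m : M.X X p) (v : B.Hom Y (F.obj X) q) :
    indLift F M φ hφ (tmul F M h m v) = φ X p q h m v :=
  preLift_preTmul F M φ h m v

/-- The differential `m ⊗ v ↦ dm ⊗ v + (-1) ^ (deg m) m ⊗ dv` of the tensor product. -/
def indD {Y : B.Ob} (n n' : ℤ) (h : n + 1 = n') : IndX F M Y n →ₗ[k] IndX F M Y n' :=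
  indLift F M
    (fun X p q hn => (tmul F M (by omega)).comp (M.d p (p + 1) rfl) +
      sgn p • (tmul F M (by omega)).compl₂ (B.d q (q + 1) rfl))
    (fun {X X' p a p' q q'} h₁ h₂ hn hn' m f v => by
      simp only [LinearMap.add_apply, LinearMap.smul_apply, LinearMap.comp_apply,
        LinearMap.compl₂_apply]
      rw [M.leibniz (q' := p + 1) (p' := a + 1) h₁ rfl rfl rfl (by omega) (by omega),
        B.leibniz (q' := a + 1) (p' := q + 1) h₂ rfl rfl rfl (by omega) (by omega), map_add,
        LinearMap.add_apply, map_zsmul, LinearMap.smul_apply, map_add, map_zsmul, ← F.map_d,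
        tmul_act (q' := q') F M _ h₂ _ (by omega),
        tmul_act (q' := q' + 1) F M _ (by omega) _ (by omega),
        tmul_act (q' := q' + 1) F M _ (by omega) _ (by omega)]
      subst h₁
      rw [sgn_add]
      module)

lemma indD_tmul {Y : B.Ob} {n n' : ℤ} (hn : n + 1 = n') {X : A.Ob} {p q p' q' : ℤ} (h : p + q = n)
    (hp : p + 1 = p') (hq : q + 1 = q') (h₁ : p' + q = n') (h₂ : p + q' = n') (m : M.X X p)
    (v : B.Hom Y (F.obj X) q) :
    indD F M n n' hn (tmul F M h m v) =
      tmul F M h₁ (M.d p p' hp m) v + sgn p • tmul F M h₂ m (B.d q q' hq v) := by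
  subst hp hq
  exact indLift_tmul F M _ _ h m v

/-- The right action `(m ⊗ v) f = m ⊗ v f` on the tensor product. -/
def indAct {Y Z : B.Ob} {q p r : ℤ} (h : q + p = r) :
    IndX F M Y q →ₗ[k] B.Hom Z Y p →ₗ[k] IndX F M Z r :=
  indLift F M
    (fun X a b hn => LinearMap.mk₂ k
      (fun m v => (tmul F M (by omega) m).comp (B.comp (r := b + p) rfl v))
      (fun m m' v => by ext; simp) (fun c m v => by ext; simp)
      (fun m v v' => by ext; simp) (fun c m v => by ext; simp))
    (fun {X X' a c a' b b'} h₁ h₂ hn hn' m f v => by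
      ext g
      simp only [LinearMap.mk₂_apply, LinearMap.comp_apply]
      rw [tmul_act (q' := b' + p) F M _ (by omega) _ (by omega), B.assoc h₂ rfl rfl (by omega)])

lemma indAct_tmul {Y Z : B.Ob} {q p r : ℤ} (h : q + p = r) {X : A.Ob} {a b b' : ℤ} (hn : a + b = q)
    (hb : b + p = b') (hn' : a + b' = r) (m : M.X X a) (v : B.Hom Y (F.obj X) b)
    (f : B.Hom Z Y p) :
    indAct F M h (tmul F M hn m v) f = tmul F M hn' m (B.comp hb v f) := by
  subst hb
  rw [indAct, indLift_tmul]
  rfl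

/-- The induced right DG module: `Ind M (Y) = M ⊗_A Hom (Y, F -)`. -/
abbrev indModule : RightModule B where
  X Y n := IndX F M Y n
  d p q h := indD F M p q h
  act h := indAct F M h
  d_d {Y} n n' n'' h h' m := by
    refine LinearMap.congr_fun (f := (indD F M n' n'' h').comp (indD F M n n' h)) (g := 0)
      (ind_ext F M fun X p q hn m v => ?_) m
    rw [LinearMap.comp_apply, indD_tmul F M h hn rfl rfl (by omega) (by omega), map_add, map_zsmul,
      indD_tmul F M h' _ rfl rfl (by omega) (by omega),
      indD_tmul F M h' _ rfl rfl (by omega) (by omega), M.d_d, B.d_d]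
    simp only [map_zero, LinearMap.zero_apply, smul_zero]
    rw [sgn_add, sgn_one]
    module
  act_one {Y n} h m := by
    refine LinearMap.congr_fun (f := (indAct F M h).flip (B.one Y)) (g := LinearMap.id)
      (ind_ext F M fun X p q hn m v => ?_) m
    rw [LinearMap.flip_apply, indAct_tmul F M h hn (add_zero q) hn, B.comp_one]
    rfl
  act_comp {Y Z W a b c ab bc abc} h₁ h₂ h₃ h₄ m f g := by
    refine LinearMap.congr_fun (f := ((indAct F M h₂).flip g).comp ((indAct F M h₁).flip f))
      (g := (indAct F M h₄).flip (B.comp h₃ f g)) (ind_ext F M fun X p q hn m v => ?_) m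
    simp only [LinearMap.comp_apply, LinearMap.flip_apply]
    rw [indAct_tmul F M h₁ hn rfl (by omega), indAct_tmul F M h₂ _ (b' := q + bc) (by omega) (by omega),
      indAct_tmul F M h₄ hn rfl (by omega), B.assoc rfl _ h₃ _ v f g]
  leibniz {Y Z p p' q q' r r'} h hr hq hp h₁ h₂ m f := by
    refine LinearMap.congr_fun (f := (indD F M r r' hr).comp ((indAct F M h).flip f))
      (g := ((indAct F M h₁).flip f).comp (indD F M q q' hq) +
        sgn q • (indAct F M h₂).flip (B.d p p' hp f)) (ind_ext F M fun X a b hn m v => ?_) m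
    simp only [LinearMap.comp_apply, LinearMap.flip_apply, LinearMap.add_apply,
      LinearMap.smul_apply]
    rw [indAct_tmul F M h hn rfl (by omega), indD_tmul F M hr _ rfl rfl (by omega) (by omega),
      indD_tmul F M hq hn rfl rfl (by omega) (by omega),
      indAct_tmul F M h₂ hn (b' := b + p + 1) (by omega) (by omega),
      map_add, LinearMap.add_apply, map_zsmul, LinearMap.smul_apply,
      indAct_tmul F M h₁ _ rfl (by omega), indAct_tmul F M h₁ _ (b' := b + p + 1) (by omega) (by omega),
      B.leibniz (q' := b + 1) (p' := p') rfl rfl rfl hp (by omega) (by omega), map_add, map_zsmul]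
    subst hn hp
    rw [sgn_add]
    module

end ind

section ind

variable {A B : DGCategory.{u, u, u} k} (F : DGFunctor A B)

/-- The map `m ⊗ v ↦ f m ⊗ v` on induced modules. -/
def indFamily {M N : RightModule A} {n : ℤ} (f : moduleHom M N n) :
    Family (indModule F M) (indModule F N) n := fun Y t =>
  indLift F M
    (fun X a b h => (tmul F N (by have := t.2; omega)).comp (app f.1 X a (a + n) rfl))
    (fun {X X' a c a' b b'} h h' hn hn' m g v => by
      simp only [LinearMap.comp_apply]
      rw [f.2.app_act (p' := a + n) rfl rfl h (by omega),
        tmul_act F N _ h' _ (by have := t.2; omega)])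

lemma indFamily_tmul {M N : RightModule A} {n : ℤ} (f : moduleHom M N n) {Y : B.Ob} {p p' : ℤ}
    (hp : p + n = p') {X : A.Ob} {a b a' : ℤ} (h : a + b = p) (ha : a + n = a') (h' : a' + b = p')
    (m : M.X X a) (v : B.Hom Y (F.obj X) b) :
    app (indFamily F f) Y p p' hp (tmul F M h m v) = tmul F N h' (app f.1 X a a' ha m) v := by
  subst ha
  exact indLift_tmul F M _ _ h m v

lemma indFamily_isEquivariant {M N : RightModule A} {n : ℤ} (f : moduleHom M N n) :
    (indFamily F f).IsEquivariant where
  app_act {Y Z p p' a q q'} hp hq h h' m x := by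
    refine LinearMap.congr_fun
      (f := (app (indFamily F f) Z q q' hq).comp ((indAct F M h).flip x))
      (g := ((indAct F N h').flip x).comp (app (indFamily F f) Y p p' hp))
      (ind_ext F M fun X b c hn m v => ?_) m
    simp only [LinearMap.comp_apply, LinearMap.flip_apply]
    rw [indAct_tmul F M h hn rfl (by omega), indFamily_tmul F f hq _ rfl (by omega),
      indFamily_tmul F f hp hn rfl (by omega), indAct_tmul F N h' _ rfl (by omega)]

lemma indFamily_one (M : RightModule A) (Y : B.Ob) (p : ℤ) (hp : p + 0 = p) (m : IndX F M Y p) :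
    app (indFamily F ((rightMod A).one M)) Y p p hp m = m := by
  refine LinearMap.congr_fun (f := app (indFamily F ((rightMod A).one M)) Y p p hp)
    (g := LinearMap.id) (ind_ext F M fun X a b hn m v => ?_) m
  rw [indFamily_tmul F _ hp hn (add_zero a) hn]
  exact congrArg (fun m' => tmul F M hn m' v) (familyOne_apply M X a _ m)

lemma indFamily_comp {M N L : RightModule A} {b a c : ℤ} (h : b + a = c) (g : moduleHom N L b)
    (f : moduleHom M N a) (Y : B.Ob) (p q : ℤ) (hq : p + c = q) (m : IndX F M Y p) :
    app (indFamily F ((rightMod A).comp h g f)) Y p q hq m =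
      app (familyComp h (indFamily F g) (indFamily F f)) Y p q hq m := by
  refine LinearMap.congr_fun (f := app (indFamily F ((rightMod A).comp h g f)) Y p q hq)
    (g := app (familyComp h (indFamily F g) (indFamily F f)) Y p q hq)
    (ind_ext F M fun X s t hn m v => ?_) m
  rw [familyComp_apply h _ _ Y hq (s := p + a) rfl (by omega),
    indFamily_tmul F f _ hn rfl (by omega), indFamily_tmul F g _ _ (a' := s + c) (by omega) (by omega),
    indFamily_tmul F _ hq hn (a' := s + c) (by omega) (by omega)]
  exact congrArg (fun m' => tmul F L _ m' v)
    (familyComp_apply h g.1 f.1 X (s := s + a) _ rfl (by omega) m)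

/-- Induction on morphisms of right DG modules. -/
def indHom {M N : RightModule A} (n : ℤ) :
    moduleHom M N n →ₗ[k] moduleHom (indModule F M) (indModule F N) n where
  toFun f := ⟨indFamily F f, indFamily_isEquivariant F f⟩
  map_add' f g := family_ext fun Y p q hq m => by
    refine LinearMap.congr_fun (f := app (indFamily F (f + g)) Y p q hq)
      (g := app (indFamily F f) Y p q hq + app (indFamily F g) Y p q hq)
      (ind_ext F M fun X a b h m v => ?_) m
    rw [LinearMap.add_apply, indFamily_tmul F (f + g) hq h rfl (by omega),
      indFamily_tmul F f hq h rfl (by omega), indFamily_tmul F g hq h rfl (by omega),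
      ← LinearMap.add_apply, ← map_add]
    rfl
  map_smul' c f := family_ext fun Y p q hq m => by
    refine LinearMap.congr_fun (f := app (indFamily F (c • f)) Y p q hq)
      (g := c • app (indFamily F f) Y p q hq) (ind_ext F M fun X a b h m v => ?_) m
    rw [LinearMap.smul_apply, indFamily_tmul F (c • f) hq h rfl (by omega),
      indFamily_tmul F f hq h rfl (by omega), ← LinearMap.smul_apply, ← map_smul]
    rfl

lemma indFamily_d {M N : RightModule A} {n n' : ℤ} (h : n + 1 = n') (f : moduleHom M N n)
    (Y : B.Ob) (p q : ℤ) (hq : p + n' = q) (m : IndX F M Y p) :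
    app (indFamily F ((rightMod A).d n n' h f)) Y p q hq m =
      app (familyD n n' h (indFamily F f)) Y p q hq m := by
  refine LinearMap.congr_fun (f := app (indFamily F ((rightMod A).d n n' h f)) Y p q hq)
    (g := app (familyD n n' h (indFamily F f)) Y p q hq) (ind_ext F M fun X a b hn m v => ?_) m
  rw [familyD_apply h _ Y hq (q₁ := p + n) (p₁ := p + 1) rfl (by omega) rfl (by omega),
    indFamily_tmul F f _ hn rfl (by omega), indFamily_tmul F _ hq hn rfl (by omega)]
  change tmul F N _ (app (familyD n n' h f.1) X a (a + n') _ m) v =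
    indD F N (p + n) q (by omega) (tmul F N _ (app f.1 X a (a + n) _ m) v) -
      sgn n • app (indFamily F f) Y (p + 1) q _ (indD F M p (p + 1) rfl (tmul F M _ m v))
  rw [familyD_apply h _ X rfl (q₁ := a + n) (p₁ := a + 1) rfl (by omega) rfl (by omega),
    indD_tmul F N _ _ (p' := a + n') (by omega) rfl (by omega) (by omega),
    indD_tmul F M _ _ (p' := a + 1) rfl rfl (by omega) (by omega), map_add, map_zsmul,
    indFamily_tmul F f _ _ (a' := a + n') (by omega) (by omega),
    indFamily_tmul F f _ _ (a' := a + n) (by omega) (by omega), map_sub, map_zsmul,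
    LinearMap.sub_apply, LinearMap.smul_apply, sgn_add]
  module

/-- The induction DG functor on right DG modules. -/
def ind : DGFunctor (rightMod A) (rightMod B) where
  obj M := indModule F M
  map n := indHom F n
  map_d _ _ h f := family_ext fun Y p q hq m => indFamily_d F h f Y p q hq m
  map_one M := family_ext fun Y p q hq m => by
    obtain rfl : p = q := by omega
    exact (indFamily_one F M Y p hq m).trans (familyOne_apply (indModule F M) Y p hq m).symm
  map_comp h g f := family_ext fun Y p q hq m => indFamily_comp F h g f Y p q hq m

end ind

section semifree

variable {A B : DGCategory.{u, u, u} k} (M : RightModule A)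

section combination

variable {S : Type u} {x : S → A.Ob} {n : S → ℤ} (e : ∀ s, M.X (x s) (n s))

lemma combination_lof [hS : DecidableEq S] {Z : A.Ob} {p : ℤ} (s : S) (f : A.Hom Z (x s) (p - n s)) :
    combination M e Z p (DirectSum.lof k S (fun s => A.Hom Z (x s) (p - n s)) s f) =
      M.act (add_sub_cancel (n s) p) (e s) f := by
  obtain rfl : hS = Classical.decEq S := Subsingleton.elim _ _
  let := Classical.decEq S
  exact DirectSum.toModule_lof k (φ := fun s => M.act (add_sub_cancel (n s) p) (e s)) s f

lemma combination_mem (N : DGSubmodule M) {Z : A.Ob} {p : ℤ}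
    (a : DirectSum S fun s => A.Hom Z (x s) (p - n s))
    (h : ∀ s, a s ≠ 0 → e s ∈ N.X (x s) (n s)) : combination M e Z p a ∈ N.X Z p := by
  classical
  rw [← DirectSum.sum_support_of a, map_sum]
  refine Submodule.sum_mem _ fun s hs => ?_
  have := combination_lof M e (Z := Z) (p := p) s (a s)
  rw [DirectSum.lof_eq_of] at this
  rw [this]
  exact N.act_mem _ _ _ (h s (by simpa using hs))

lemma combination_act {Z W : A.Ob} {p b q : ℤ} (h : p + b = q) (f : A.Hom W Z b)
    (a : DirectSum S fun s => A.Hom Z (x s) (p - n s)) :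
    M.act h (combination M e Z p a) f = combination M e W q
      (DirectSum.lmap (fun s => (A.comp (by omega : p - n s + b = q - n s)).flip f) a) := by
  classical
  refine LinearMap.congr_fun (f := ((M.act h).flip f).comp (combination M e Z p))
    (g := (combination M e W q).comp (DirectSum.lmap
      (fun s => (A.comp (by omega : p - n s + b = q - n s)).flip f)))
    (DirectSum.linearMap_ext k fun s => LinearMap.ext fun g => ?_) a
  simp only [LinearMap.comp_apply, DirectSum.lmap_lof, combination_lof, LinearMap.flip_apply]
  exact M.act_comp _ _ _ _ _ _ _

end combination

section basis

variable {S : ℕ → Type u} {x : ∀ i, S i → A.Ob} {n : ∀ i, S i → ℤ}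
  (e : ∀ i s, M.X (x i s) (n i s))

/-- All the generators together. -/
abbrev allGen (t : Σ i, S i) : M.X (x t.1 t.2) (n t.1 t.2) := e t.1 t.2

/-- Coefficients with respect to the generators of level `i` as coefficients with respect to all
generators. -/
def pushCoeff (x : ∀ i, S i → A.Ob) (n : ∀ i, S i → ℤ) (Z : A.Ob) (p : ℤ) (i : ℕ) :
    (DirectSum (S i) fun s => A.Hom Z (x i s) (p - n i s)) →ₗ[k]
      DirectSum (Σ i, S i) fun t => A.Hom Z (x t.1 t.2) (p - n t.1 t.2) :=
  letI := Classical.decEq (S i)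
  letI := Classical.decEq (Σ i, S i)
  DirectSum.toModule k (S i) _ fun s =>
    DirectSum.lof k (Σ i, S i) (fun t => A.Hom Z (x t.1 t.2) (p - n t.1 t.2)) ⟨i, s⟩

lemma pushCoeff_lof (Z : A.Ob) (p : ℤ) (i : ℕ) [hS : DecidableEq (S i)]
    [hT : DecidableEq (Σ i, S i)] (s : S i)
    (f : A.Hom Z (x i s) (p - n i s)) :
    pushCoeff x n Z p i (DirectSum.lof k (S i) (fun s => A.Hom Z (x i s) (p - n i s)) s f) =
      DirectSum.lof k (Σ i, S i) (fun t => A.Hom Z (x t.1 t.2) (p - n t.1 t.2)) ⟨i, s⟩ f := by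
  obtain rfl : hS = Classical.decEq (S i) := Subsingleton.elim _ _
  obtain rfl : hT = Classical.decEq (Σ i, S i) := Subsingleton.elim _ _
  let := Classical.decEq (S i)
  let := Classical.decEq (Σ i, S i)
  exact DirectSum.toModule_lof k (φ := fun s =>
    DirectSum.lof k (Σ i, S i) (fun t => A.Hom Z (x t.1 t.2) (p - n t.1 t.2)) ⟨i, s⟩) s f

lemma pushCoeff_apply (Z : A.Ob) (p : ℤ) (i : ℕ)
    (b : DirectSum (S i) fun s => A.Hom Z (x i s) (p - n i s)) (s : S i) :
    pushCoeff x n Z p i b ⟨i, s⟩ = b s := by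
  classical
  refine LinearMap.congr_fun
    (f := (DirectSum.component k (Σ i, S i) (fun t => A.Hom Z (x t.1 t.2) (p - n t.1 t.2))
      ⟨i, s⟩).comp (pushCoeff x n Z p i))
    (g := DirectSum.component k (S i) (fun s => A.Hom Z (x i s) (p - n i s)) s)
    (DirectSum.linearMap_ext k fun s' => LinearMap.ext fun f => ?_) b
  simp only [LinearMap.comp_apply, pushCoeff_lof]
  by_cases h : s' = s
  · subst h
    rw [DirectSum.component.lof_self, DirectSum.component.lof_self]
  · rw [DirectSum.component.of, DirectSum.component.of, dif_neg h, dif_neg (by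
      intro h'; exact h (by simpa using h'))]

lemma pushCoeff_apply_ne (Z : A.Ob) (p : ℤ) (i : ℕ)
    (b : DirectSum (S i) fun s => A.Hom Z (x i s) (p - n i s)) (t : Σ i, S i) (ht : t.1 ≠ i) :
    pushCoeff x n Z p i b t = 0 := by
  classical
  refine LinearMap.congr_fun
    (f := (DirectSum.component k (Σ i, S i) (fun t => A.Hom Z (x t.1 t.2) (p - n t.1 t.2))
      t).comp (pushCoeff x n Z p i)) (g := 0)
    (DirectSum.linearMap_ext k fun s' => LinearMap.ext fun f => ?_) b
  simp only [LinearMap.comp_apply, pushCoeff_lof]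
  rw [DirectSum.component.of, dif_neg (by rintro rfl; exact ht rfl)]
  rfl

lemma combination_pushCoeff (Z : A.Ob) (p : ℤ) (i : ℕ)
    (b : DirectSum (S i) fun s => A.Hom Z (x i s) (p - n i s)) :
    combination M (allGen M e) Z p (pushCoeff x n Z p i b) = combination M (e i) Z p b := by
  classical
  refine LinearMap.congr_fun (f := (combination M (allGen M e) Z p).comp (pushCoeff x n Z p i))
    (g := combination M (e i) Z p) (DirectSum.linearMap_ext k fun s' => LinearMap.ext fun f => ?_) b
  simp only [LinearMap.comp_apply, pushCoeff_lof, combination_lof]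

end basis

/-- A filtration by DG submodules together with bases of the successive quotients. -/
structure SemiBasis where
  Φ : ℕ → DGSubmodule M
  zero : ∀ Y n, (Φ 0).X Y n = ⊥
  le : ∀ i Y n, (Φ i).X Y n ≤ (Φ (i + 1)).X Y n
  exists_mem : ∀ Y n (m : M.X Y n), ∃ i, m ∈ (Φ i).X Y n
  S : ℕ → Type u
  x : ∀ i, S i → A.Ob
  n : ∀ i, S i → ℤ
  e : ∀ i s, M.X (x i s) (n i s)
  e_mem : ∀ i s, e i s ∈ (Φ (i + 1)).X (x i s) (n i s)
  d_mem : ∀ i s, M.d (n i s) (n i s + 1) rfl (e i s) ∈ (Φ i).X (x i s) (n i s + 1)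
  unique : ∀ (i : ℕ) (Z : A.Ob) (p : ℤ), ∀ m ∈ (Φ (i + 1)).X Z p,
    ∃! a, m - combination M (e i) Z p a ∈ (Φ i).X Z p

namespace SemiBasis

variable {M} (b : SemiBasis M)

lemma mono {i j : ℕ} (h : i ≤ j) (Y : A.Ob) (n : ℤ) : (b.Φ i).X Y n ≤ (b.Φ j).X Y n :=
  monotone_nat_of_le_succ (f := fun i => (b.Φ i).X Y n) (fun i => b.le i Y n) h

/-- Coefficients with respect to all generators. -/
abbrev Coeff (Z : A.Ob) (p : ℤ) : Type u :=
  DirectSum (Σ i, b.S i) fun t => A.Hom Z (b.x t.1 t.2) (p - b.n t.1 t.2)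

lemma comb_mem {Z : A.Ob} {p : ℤ} (a : b.Coeff Z p) (i : ℕ) (h : ∀ t, a t ≠ 0 → t.1 < i) :
    combination M (allGen M b.e) Z p a ∈ (b.Φ i).X Z p :=
  combination_mem M (allGen M b.e) (b.Φ i) a fun t ht =>
    b.mono (Nat.succ_le_of_lt (h t ht)) _ _ (b.e_mem t.1 t.2)

lemma surj (i : ℕ) {Z : A.Ob} {p : ℤ} (m : M.X Z p) (hm : m ∈ (b.Φ i).X Z p) :
    ∃ a : b.Coeff Z p, (∀ t, a t ≠ 0 → t.1 < i) ∧ combination M (allGen M b.e) Z p a = m := by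
  induction i generalizing m with
  | zero =>
    rw [b.zero, Submodule.mem_bot] at hm
    exact ⟨0, fun t ht => absurd rfl ht, by rw [map_zero, hm]⟩
  | succ i ih =>
    obtain ⟨a, ha, -⟩ := b.unique i Z p m hm
    obtain ⟨a', ha', h⟩ := ih _ ha
    refine ⟨a' + pushCoeff b.x b.n Z p i a, fun t ht => ?_, ?_⟩
    · by_contra hlt
      have h1 : a' t = 0 := by
        by_contra h'
        exact hlt ((ha' t h').trans (Nat.lt_succ_self i))
      have h2 := pushCoeff_apply_ne Z p i a t (by omega)
      exact ht (by rw [DirectSum.add_apply, h1, h2, add_zero])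
    · rw [map_add, combination_pushCoeff, h, sub_add_cancel]

lemma inj (i : ℕ) {Z : A.Ob} {p : ℤ} (a : b.Coeff Z p) (ha : ∀ t, a t ≠ 0 → t.1 < i)
    (h : combination M (allGen M b.e) Z p a = 0) : a = 0 := by
  induction i generalizing a with
  | zero =>
    refine DFinsupp.ext fun t => ?_
    by_contra ht
    exact absurd (ha t ht) (Nat.not_lt_zero _)
  | succ i ih =>
    let c : DirectSum (b.S i) fun s => A.Hom Z (b.x i s) (p - b.n i s) :=
      DFinsupp.comapDomain (Sigma.mk i) sigma_mk_injective a
    have hc : ∀ s, c s = a ⟨i, s⟩ := fun s => DFinsupp.comapDomain_apply _ _ a s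
    have hlt : ∀ t, (a - pushCoeff b.x b.n Z p i c) t ≠ 0 → t.1 < i := by
      intro t ht
      by_contra hti
      refine ht ?_
      rw [DirectSum.sub_apply]
      rcases eq_or_lt_of_le (not_lt.1 hti) with h' | h'
      · obtain ⟨j, s⟩ := t
        obtain rfl : i = j := h'
        rw [pushCoeff_apply, hc, sub_self]
      · rw [pushCoeff_apply_ne _ _ _ _ _ (by omega), sub_zero]
        by_contra h''
        have := ha t h''
        omega
    have hmem := b.comb_mem _ i hlt
    rw [map_sub, h, combination_pushCoeff] at hmem
    have h0 : c = 0 := (b.unique i Z p 0 (Submodule.zero_mem _)).unique hmem (by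
      rw [map_zero, sub_zero]
      exact Submodule.zero_mem _)
    rw [h0, map_zero, sub_zero] at hlt
    exact ih a hlt h

lemma bijective (Z : A.Ob) (p : ℤ) :
    Function.Bijective (combination M (allGen M b.e) Z p) := by
  classical
  constructor
  · refine (injective_iff_map_eq_zero _).2 fun a h => ?_
    refine b.inj ((DFinsupp.support a).sup Sigma.fst + 1) a (fun t ht => ?_) h
    exact Nat.lt_succ_of_le (Finset.le_sup (f := Sigma.fst) (DFinsupp.mem_support_toFun a t |>.2 ht))
  · intro m
    obtain ⟨i, hi⟩ := b.exists_mem Z p m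
    obtain ⟨a, -, ha⟩ := b.surj i m hi
    exact ⟨a, ha⟩

/-- The coefficients of an element, with respect to all generators. -/
def coeffs (Z : A.Ob) (p : ℤ) : M.X Z p ≃ₗ[k] b.Coeff Z p :=
  (LinearEquiv.ofBijective _ (b.bijective Z p)).symm

lemma coeffs_comb {Z : A.Ob} {p : ℤ} (a : b.Coeff Z p) :
    b.coeffs Z p (combination M (allGen M b.e) Z p a) = a :=
  (LinearEquiv.ofBijective _ (b.bijective Z p)).symm_apply_apply a

/-- The coefficient of one generator. -/
def coeff (t : Σ i, b.S i) (Z : A.Ob) (p : ℤ) :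
    M.X Z p →ₗ[k] A.Hom Z (b.x t.1 t.2) (p - b.n t.1 t.2) :=
  (DirectSum.component k (Σ i, b.S i) (fun t => A.Hom Z (b.x t.1 t.2) (p - b.n t.1 t.2)) t).comp
    (b.coeffs Z p).toLinearMap

lemma coeff_comb (t : Σ i, b.S i) {Z : A.Ob} {p : ℤ} (a : b.Coeff Z p) :
    b.coeff t Z p (combination M (allGen M b.e) Z p a) = a t := by
  change b.coeffs Z p _ t = a t
  rw [coeffs_comb]

lemma coeff_act (t : Σ i, b.S i) {Z W : A.Ob} {p c q : ℤ} (h : p + c = q)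
    (h' : p - b.n t.1 t.2 + c = q - b.n t.1 t.2) (m : M.X Z p) (f : A.Hom W Z c) :
    b.coeff t W q (M.act h m f) = A.comp h' (b.coeff t Z p m) f := by
  obtain ⟨a, rfl⟩ := (b.bijective Z p).2 m
  rw [combination_act, coeff_comb, coeff_comb, DirectSum.lmap_apply]
  rfl

lemma coeff_eq_zero {i : ℕ} (t : Σ i, b.S i) (hi : i ≤ t.1) {Z : A.Ob} {p : ℤ} (m : M.X Z p)
    (hm : m ∈ (b.Φ i).X Z p) : b.coeff t Z p m = 0 := by
  obtain ⟨a, ha, rfl⟩ := b.surj i m hm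
  rw [coeff_comb]
  by_contra h
  have := ha t h
  omega

lemma coeff_e [DecidableEq (Σ i, b.S i)] (t t' : Σ i, b.S i) :
    b.coeff t _ _ (b.e t'.1 t'.2) =
      DirectSum.lof k (Σ i, b.S i) (fun t => A.Hom (b.x t'.1 t'.2) (b.x t.1 t.2) (b.n t'.1 t'.2 - b.n t.1 t.2))
        t' (A.oneOf (b.x t'.1 t'.2) (sub_self (b.n t'.1 t'.2))) t := by
  have h := combination_lof M (allGen M b.e) t'
    (A.oneOf (b.x t'.1 t'.2) (sub_self (b.n t'.1 t'.2)))
  have h' : ∀ (j : ℤ) (hj : j = 0) (hh : b.n t'.1 t'.2 + j = b.n t'.1 t'.2),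
      M.act hh (b.e t'.1 t'.2) (A.oneOf (b.x t'.1 t'.2) hj) = b.e t'.1 t'.2 := by
    rintro j rfl hh
    exact M.act_one hh _
  rw [h' _ (sub_self _)] at h
  rw [← h, coeff_comb]

lemma coeff_e_self (t : Σ i, b.S i) :
    b.coeff t _ _ (b.e t.1 t.2) = A.oneOf (b.x t.1 t.2) (sub_self (b.n t.1 t.2)) := by
  classical
  rw [coeff_e]
  exact DirectSum.component.lof_self k t _

lemma coeff_e_ne (t t' : Σ i, b.S i) (h : t' ≠ t) : b.coeff t _ _ (b.e t'.1 t'.2) = 0 := by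
  classical
  rw [coeff_e]
  exact (DirectSum.component.of k t t' _).trans (dif_neg h)

end SemiBasis

section

variable {M} (F : DGFunctor A B)

lemma span_tmul (Y : B.Ob) (n : ℤ) :
    Submodule.span k {t : IndX F M Y n | ∃ (X : A.Ob) (p q : ℤ) (h : p + q = n) (m : M.X X p)
      (v : B.Hom Y (F.obj X) q), t = tmul F M h m v} = ⊤ := by
  have h : (Submodule.span k {t : IndX F M Y n | ∃ (X : A.Ob) (p q : ℤ) (h : p + q = n)
      (m : M.X X p) (v : B.Hom Y (F.obj X) q), t = tmul F M h m v}).mkQ = 0 :=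
    ind_ext F M fun X p q h m v => (Submodule.Quotient.mk_eq_zero _).2
      (Submodule.subset_span ⟨X, p, q, h, m, v, rfl⟩)
  rw [← Submodule.ker_mkQ (Submodule.span _ _), h, LinearMap.ker_zero]

/-- The image of the tensor product of a DG submodule. -/
def indSubmodule (N : DGSubmodule M) : DGSubmodule (indModule F M) where
  X Y n := Submodule.span k {t | ∃ (X : A.Ob) (p q : ℤ) (h : p + q = n) (m : M.X X p)
    (v : B.Hom Y (F.obj X) q), m ∈ N.X X p ∧ t = tmul F M h m v}
  d_mem {Y} n n' hn m hm := by
    induction hm using Submodule.span_induction with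
    | mem m hm =>
      obtain ⟨X, p, q, h, m, v, hm, rfl⟩ := hm
      change indD F M n n' hn _ ∈ _
      rw [indD_tmul F M hn h rfl rfl (by omega) (by omega)]
      refine Submodule.add_mem _ ?_ (zsmul_mem ?_ _)
      · exact Submodule.subset_span ⟨X, _, _, _, _, _, N.d_mem _ _ _ _ hm, rfl⟩
      · exact Submodule.subset_span ⟨X, _, _, _, _, _, hm, rfl⟩
    | zero => rw [map_zero]; exact Submodule.zero_mem _
    | add m m' _ _ hm hm' => rw [map_add]; exact Submodule.add_mem _ hm hm'
    | smul c m _ hm => rw [map_smul]; exact Submodule.smul_mem _ _ hm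
  act_mem {Y Z q p r} h m f hm := by
    induction hm using Submodule.span_induction with
    | mem m hm =>
      obtain ⟨X, a, b, h', m, v, hm, rfl⟩ := hm
      change indAct F M h _ f ∈ _
      rw [indAct_tmul F M h h' rfl (by omega)]
      exact Submodule.subset_span ⟨X, _, _, _, _, _, hm, rfl⟩
    | zero => rw [map_zero, LinearMap.zero_apply]; exact Submodule.zero_mem _
    | add m m' _ _ hm hm' =>
      rw [map_add, LinearMap.add_apply]; exact Submodule.add_mem _ hm hm'
    | smul c m _ hm => rw [map_smul, LinearMap.smul_apply]; exact Submodule.smul_mem _ _ hm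

lemma tmul_mem (N : DGSubmodule M) {Y : B.Ob} {n : ℤ} {X : A.Ob} {p q : ℤ} (h : p + q = n)
    (m : M.X X p) (v : B.Hom Y (F.obj X) q) (hm : m ∈ N.X X p) :
    tmul F M h m v ∈ (indSubmodule F N).X Y n :=
  Submodule.subset_span ⟨X, p, q, h, m, v, hm, rfl⟩

/-- The generators of the induced module given by homogeneous elements of a module. -/
abbrev indGen {S : Type u} {x : S → A.Ob} {n : S → ℤ} (e : ∀ s, M.X (x s) (n s)) (s : S) :
    (indModule F M).X (F.obj (x s)) (n s) := tmul F M (add_zero (n s)) (e s) (B.one _)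

lemma tmul_combination {S : Type u} {x : S → A.Ob} {n : S → ℤ} (e : ∀ s, M.X (x s) (n s))
    {Y : B.Ob} {j : ℤ} {X : A.Ob} {p q : ℤ} (h : p + q = j)
    (a : DirectSum S fun s => A.Hom X (x s) (p - n s)) (v : B.Hom Y (F.obj X) q) :
    tmul F M h (combination M e X p a) v =
      combination (indModule F M) (indGen F e) Y j
        (DirectSum.lmap (fun s => ((B.comp (by omega : p - n s + q = j - n s)).flip v).comp
          (F.map (p - n s))) a) := by
  classical
  refine LinearMap.congr_fun (f := ((tmul F M h).flip v).comp (combination M e X p))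
    (g := (combination (indModule F M) (indGen F e) Y j).comp
        (DirectSum.lmap (fun s => ((B.comp (by omega : p - n s + q = j - n s)).flip v).comp
          (F.map (p - n s)))))
    (DirectSum.linearMap_ext k fun s => LinearMap.ext fun g => ?_) a
  simp only [LinearMap.comp_apply, DirectSum.lmap_lof, combination_lof, LinearMap.flip_apply]
  refine Eq.trans ?_ (combination_lof (indModule F M) (indGen F e) s _).symm
  change _ = indAct F M (add_sub_cancel (n s) j) _ _
  rw [tmul_act F M _ (by omega : p - n s + q = j - n s) _ (by omega),
    indAct_tmul F M _ _ (zero_add _) (by omega), B.one_comp]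

namespace SemiBasis

variable (b : SemiBasis M)

/-- The coefficient of one generator, on the induced module. -/
def indCoeff (t : Σ i, b.S i) (Y : B.Ob) (n : ℤ) :
    IndX F M Y n →ₗ[k] B.Hom Y (F.obj (b.x t.1 t.2)) (n - b.n t.1 t.2) :=
  indLift F M
    (fun X p q h => (B.comp (by omega : p - b.n t.1 t.2 + q = n - b.n t.1 t.2)).comp
      ((F.map (p - b.n t.1 t.2)).comp (b.coeff t X p)))
    (fun {X X' p a p' q q'} h h' hn hn' m f v => by
      simp only [LinearMap.comp_apply]
      rw [b.coeff_act t h (by omega), F.map_comp,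
        B.assoc _ _ h' (by omega)])

lemma indCoeff_tmul (t : Σ i, b.S i) {Y : B.Ob} {n : ℤ} {X : A.Ob} {p q : ℤ} (h : p + q = n)
    (m : M.X X p) (v : B.Hom Y (F.obj X) q) :
    b.indCoeff F t Y n (tmul F M h m v) =
      B.comp (by omega : p - b.n t.1 t.2 + q = n - b.n t.1 t.2)
        (F.map (p - b.n t.1 t.2) (b.coeff t X p m)) v :=
  indLift_tmul F M _ _ h m v

lemma indCoeff_eq_zero {i : ℕ} (t : Σ i, b.S i) (hi : i ≤ t.1) {Y : B.Ob} {n : ℤ}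
    (m : IndX F M Y n) (hm : m ∈ (indSubmodule F (b.Φ i)).X Y n) : b.indCoeff F t Y n m = 0 := by
  induction hm using Submodule.span_induction with
  | mem m hm =>
    obtain ⟨X, p, q, h, m, v, hm, rfl⟩ := hm
    rw [indCoeff_tmul, b.coeff_eq_zero t hi m hm, map_zero, map_zero, LinearMap.zero_apply]
  | zero => rw [map_zero]
  | add m m' _ _ hm hm' => rw [map_add, hm, hm', add_zero]
  | smul c m _ hm => rw [map_smul, hm, smul_zero]

lemma indCoeff_combination (i : ℕ) (s : b.S i) {Y : B.Ob} {n : ℤ}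
    (a : DirectSum (b.S i) fun s => B.Hom Y (F.obj (b.x i s)) (n - b.n i s)) :
    b.indCoeff F ⟨i, s⟩ Y n (combination (indModule F M) (indGen F (b.e i)) Y n a) = a s := by
  classical
  refine LinearMap.congr_fun
    (f := (b.indCoeff F ⟨i, s⟩ Y n).comp (combination (indModule F M) (indGen F (b.e i)) Y n))
    (g := DirectSum.component k (b.S i) (fun s => B.Hom Y (F.obj (b.x i s)) (n - b.n i s)) s)
    (DirectSum.linearMap_ext k fun s' => LinearMap.ext fun g => ?_) a
  simp only [LinearMap.comp_apply]
  refine (congrArg (b.indCoeff F ⟨i, s⟩ Y n)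
    (combination_lof (indModule F M) (indGen F (b.e i)) s' g)).trans ?_
  change b.indCoeff F ⟨i, s⟩ Y n (indAct F M (add_sub_cancel _ _) _ _) = _
  rw [indAct_tmul F M _ _ (zero_add _) (by omega), B.one_comp, indCoeff_tmul]
  by_cases h : s' = s
  · subst h
    rw [DirectSum.component.lof_self]
    rw [b.coeff_e_self ⟨i, s'⟩, F.map_oneOf]
    exact B.oneOf_comp _ _ _
  · rw [DirectSum.component.of, dif_neg h,
      b.coeff_e_ne ⟨i, s⟩ ⟨i, s'⟩ (by intro h'; exact h (by simpa using h')), map_zero, map_zero,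
      LinearMap.zero_apply]

/-- The induced filtration of the induced module. -/
lemma isSemiFree_ind (b : SemiBasis M) : IsSemiFree (indModule F M) := by
  refine ⟨fun i => indSubmodule F (b.Φ i), fun Y n => ?_, fun i Y n => ?_, fun Y n m => ?_,
    fun i => ⟨b.S i, fun s => F.obj (b.x i s), b.n i, indGen F (b.e i), fun s => ?_, fun s => ?_,
      fun Z p m hm => ?_⟩⟩
  · refine Submodule.span_eq_bot.2 ?_
    rintro _ ⟨X, p, q, h, m, v, hm, rfl⟩
    rw [b.zero, Submodule.mem_bot] at hm
    rw [hm, map_zero, LinearMap.zero_apply]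
  · refine Submodule.span_mono ?_
    rintro _ ⟨X, p, q, h, m, v, hm, rfl⟩
    exact ⟨X, p, q, h, m, v, b.le i _ _ hm, rfl⟩
  · have hmono : ∀ {i j : ℕ}, i ≤ j →
        (indSubmodule F (b.Φ i)).X Y n ≤ (indSubmodule F (b.Φ j)).X Y n := by
      intro i j hij
      refine Submodule.span_mono ?_
      rintro _ ⟨X, p, q, h, m, v, hm, rfl⟩
      exact ⟨X, p, q, h, m, v, b.mono hij _ _ hm, rfl⟩
    have hm : m ∈ (⊤ : Submodule k (IndX F M Y n)) := Submodule.mem_top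
    rw [← span_tmul F Y n] at hm
    induction hm using Submodule.span_induction with
    | mem m hm =>
      obtain ⟨X, p, q, h, m, v, rfl⟩ := hm
      obtain ⟨i, hi⟩ := b.exists_mem X p m
      exact ⟨i, tmul_mem F _ h m v hi⟩
    | zero => exact ⟨0, Submodule.zero_mem _⟩
    | add m m' _ _ hm hm' =>
      obtain ⟨i, hi⟩ := hm
      obtain ⟨j, hj⟩ := hm'
      exact ⟨max i j, Submodule.add_mem _ (hmono (le_max_left i j) hi)
        (hmono (le_max_right i j) hj)⟩
    | smul c m _ hm =>
      obtain ⟨i, hi⟩ := hm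
      exact ⟨i, Submodule.smul_mem _ _ hi⟩
  · exact tmul_mem F _ _ _ _ (b.e_mem i s)
  · change indD F M _ _ rfl _ ∈ _
    rw [indD_tmul F M _ _ rfl (zero_add 1) (by omega) (by omega), B.d_one, map_zero, smul_zero,
      add_zero]
    exact tmul_mem F _ _ _ _ (b.d_mem i s)
  · refine existsUnique_of_exists_of_unique ?_ fun a a' ha ha' => DFinsupp.ext fun s => ?_
    · induction hm using Submodule.span_induction with
      | mem m hm =>
        obtain ⟨X, q, r, h, m, v, hm, rfl⟩ := hm
        obtain ⟨a, ha, -⟩ := b.unique i X q m hm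
        have h0 := tmul_mem F _ h _ v ha
        rw [map_sub, LinearMap.sub_apply, tmul_combination F (b.e i) h a v] at h0
        exact ⟨_, h0⟩
      | zero => exact ⟨0, by rw [map_zero, sub_zero]; exact Submodule.zero_mem _⟩
      | add m m' _ _ hm hm' =>
        obtain ⟨a, ha⟩ := hm
        obtain ⟨a', ha'⟩ := hm'
        refine ⟨a + a', ?_⟩
        rw [map_add, add_sub_add_comm]
        exact Submodule.add_mem _ ha ha'
      | smul c m _ hm =>
        obtain ⟨a, ha⟩ := hm
        refine ⟨c • a, ?_⟩
        rw [map_smul, ← smul_sub]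
        exact Submodule.smul_mem _ _ ha
    · have h := b.indCoeff_eq_zero F ⟨i, s⟩ le_rfl _ ha
      have h' := b.indCoeff_eq_zero F ⟨i, s⟩ le_rfl _ ha'
      rw [map_sub, indCoeff_combination, sub_eq_zero] at h h'
      exact h.symm.trans h'

end SemiBasis

/-- Induction preserves semi-free modules. -/
lemma IsSemiFree.ind (h : IsSemiFree M) : IsSemiFree (indModule F M) := by
  obtain ⟨Φ, h₀, h₁, h₂, h₃⟩ := h
  choose S x n e he hd hu using h₃
  exact SemiBasis.isSemiFree_ind F ⟨Φ, h₀, h₁, h₂, S, x, n, e, he, hd, hu⟩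

end

end semifree

section

variable {A B : DGCategory.{u, u, u} k}

/-- The DG category of semi-free right DG modules over `A`. -/
abbrev indCat (A : DGCategory.{u, u, u} k) : DGCategory.{u, u, u + 1} k :=
  fullSub (rightMod A) IsSemiFree

/-- The DG functor between the DG categories of semi-free modules given by induction. -/
def indMap (F : DGFunctor A B) : DGFunctor (indCat A) (indCat B) :=
  fullSubMap (ind F) IsSemiFree IsSemiFree fun _ h => h.ind F

/-- The full DG subcategory of the semi-free modules over `A` which are induced, up to an
isomorphism of DG modules, from semi-free modules over the full DG subcategory on the objects
satisfying `P`. -/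
def indSub (P : A.Ob → Prop) (M : (indCat A).Ob) : Prop :=
  ∃ N : RightModule (fullSub A P), IsSemiFree N ∧
    Nonempty ((⟨M.1⟩ : Z0 (rightMod A)) ≅ ⟨(ind (inclusion A P)).obj N⟩)

/-- The pro-version of `indCat`: the dual of the category of semi-free modules over the dual. -/
abbrev proCat (A : DGCategory.{u, u, u} k) : DGCategory.{u, u, u + 1} k := (indCat A.op).op

/-- The pro-version of `indMap`. -/
def proMap (F : DGFunctor A B) : DGFunctor (proCat A) (proCat B) := (indMap F.op).op

/-- The pro-version of `indSub`. -/
def proSub (P : A.Ob → Prop) (M : (proCat A).Ob) : Prop := indSub (A := A.op) P M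

end

end

end DG
end

open CategoryTheory

noncomputable section

namespace DG

section

variable {k : Type w} [CommRing k]

/-- A left DG module over `A`, that is, a DG functor from `A` to complexes of `k`-modules. -/
structure LeftModule (A : DGCategory.{w, v, u} k) where
  X : A.Ob → ℤ → Type v₁
  [addCommGroup : ∀ Y n, AddCommGroup (X Y n)]
  [module : ∀ Y n, Module k (X Y n)]
  d : ∀ {Y : A.Ob} (p q : ℤ), p + 1 = q → (X Y p →ₗ[k] X Y q)
  act : ∀ {Y Z : A.Ob} {q p r : ℤ}, q + p = r → (A.Hom Y Z q →ₗ[k] X Y p →ₗ[k] X Z r)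
  d_d : ∀ {Y : A.Ob} (p q r : ℤ) (h : p + 1 = q) (h' : q + 1 = r) (x : X Y p),
    d q r h' (d p q h x) = 0
  one_act : ∀ {Y : A.Ob} {p : ℤ} (h : 0 + p = p) (x : X Y p), act h (A.one Y) x = x
  comp_act : ∀ {Y Z W : A.Ob} {a b c ab bc abc : ℤ} (h₁ : a + b = ab) (h₂ : ab + c = abc)
    (h₃ : b + c = bc) (h₄ : a + bc = abc) (f : A.Hom Z W a) (g : A.Hom Y Z b) (x : X Y c),
    act h₂ (A.comp h₁ f g) x = act h₄ f (act h₃ g x)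
  leibniz : ∀ {Y Z : A.Ob} {p p' q q' r r' : ℤ} (h : q + p = r) (hr : r + 1 = r')
    (hq : q + 1 = q') (hp : p + 1 = p') (h₁ : q' + p = r') (h₂ : q + p' = r')
    (f : A.Hom Y Z q) (x : X Y p),
    d r r' hr (act h f x) = act h₁ (A.d q q' hq f) x + sgn q • act h₂ f (d p p' hp x)

attribute [instance] LeftModule.addCommGroup LeftModule.module

lemma sgn_neg_one : sgn (-1) = -1 := by simp [sgn]

lemma sgn_eq_of_add_eq_zero {a b : ℤ} (h : a + b = 0) : sgn a = sgn b := by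
  obtain rfl : a = -b := by omega
  simp [sgn]

lemma sgn_smul_sgn_smul {M : Type*} [AddCommGroup M] (n : ℤ) (x : M) : sgn n • sgn n • x = x := by
  rw [smul_smul, sgn_mul_self, one_smul]

variable {A : DGCategory.{w, v, u} k}

lemma d_comp_left {X Y Z : A.Ob} {p p' q q' r r' : ℤ} {g : A.Hom Y Z q} (hq : q + 1 = q')
    (hg : A.d q q' hq g = 0) (h : q + p = r) (hr : r + 1 = r') (hp : p + 1 = p') (h₂ : q + p' = r')
    (f : A.Hom X Y p) :
    A.d r r' hr (A.comp h g f) = sgn q • A.comp h₂ g (A.d p p' hp f) := by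
  rw [A.leibniz h hr hq hp (by omega) h₂, hg, map_zero, LinearMap.zero_apply, zero_add]

lemma d_comp_right {X Y Z : A.Ob} {p p' q q' r r' : ℤ} {f : A.Hom X Y p} (hp : p + 1 = p')
    (hf : A.d p p' hp f = 0) (h : q + p = r) (hr : r + 1 = r') (hq : q + 1 = q') (h₂ : q' + p = r')
    (g : A.Hom Y Z q) :
    A.d r r' hr (A.comp h g f) = A.comp h₂ (A.d q q' hq g) f := by
  rw [A.leibniz h hr hq hp h₂ (by omega), hf, map_zero, smul_zero, add_zero]

namespace LeftModule

/-- The left module `Hom (e, -)`. -/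
abbrev hom (A : DGCategory.{w, v, u} k) (e : A.Ob) : LeftModule.{w, v, v, u} A where
  X Y n := A.Hom e Y n
  d p q h := A.d p q h
  act h := A.comp h
  d_d p q r h h' x := A.d_d p q r h h' x
  one_act h x := A.one_comp h x
  comp_act h₁ h₂ h₃ h₄ f g x := A.assoc h₁ h₂ h₃ h₄ f g x
  leibniz h hr hq hp h₁ h₂ f x := A.leibniz h hr hq hp h₁ h₂ f x

variable (L : LeftModule.{w, v, v₁, u} A)

/-- The complex given by an object is acyclic. -/
def IsAcyclic (Y : A.Ob) : Prop :=
  ∀ ⦃p q r : ℤ⦄ (h : p + 1 = q) (h' : q + 1 = r) (x : L.X Y q), L.d q r h' x = 0 →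
    ∃ y, L.d p q h y = x

/-- The morphism `f` of degree zero (assumed closed when used) acts as a quasi-isomorphism: its
cone is acyclic. -/
def IsQis {Y Z : A.Ob} (f : A.Hom Y Z 0) : Prop :=
  ∀ ⦃o p q r : ℤ⦄ (ho : o + 1 = p) (h : p + 1 = q) (h' : q + 1 = r) (x : L.X Y q) (y : L.X Z p),
    L.d q r h' x = 0 → L.act (zero_add q) f x = L.d p q h y →
    ∃ (x' : L.X Y p) (y' : L.X Z o), L.d p q h x' = x ∧ y = L.act (zero_add p) f x' + L.d o p ho y'

variable {L}

lemma d_act_of_closed {Y Z : A.Ob} {a a' p q r s : ℤ} {f : A.Hom Y Z a} (ha : a + 1 = a')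
    (hf : A.d a a' ha f = 0) (h : a + p = q) (hp : p + 1 = r) (hq : q + 1 = s) (h' : a + r = s)
    (x : L.X Y p) : L.d q s hq (L.act h f x) = sgn a • L.act h' f (L.d p r hp x) := by
  rw [L.leibniz h hq ha hp (by omega) h', hf, map_zero, LinearMap.zero_apply, zero_add]

lemma d_act_zero {Y Z : A.Ob} {p q : ℤ} {f : A.Hom Y Z 0} (hf : A.d 0 1 (zero_add 1) f = 0)
    (hp : p + 1 = q) (x : L.X Y p) :
    L.d p q hp (L.act (zero_add p) f x) = L.act (zero_add q) f (L.d p q hp x) := by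
  rw [d_act_of_closed (zero_add 1) hf _ hp hp (zero_add q), sgn_zero, one_smul]

section isQis

variable {Y Z W : A.Ob}

lemma IsQis.one : L.IsQis (A.one Y) := by
  intro o p q r ho h h' x y hx hxy
  refine ⟨y, 0, ?_, ?_⟩
  · rw [← hxy, L.one_act]
  · rw [map_zero, add_zero, L.one_act]

lemma IsQis.comp {f : A.Hom Y Z 0} {g : A.Hom Z W 0} (hf₀ : A.d 0 1 (zero_add 1) f = 0)
    (hg₀ : A.d 0 1 (zero_add 1) g = 0) (hf : L.IsQis f) (hg : L.IsQis g) :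
    L.IsQis (A.comp (add_zero 0) g f) := by
  intro o p q r ho h h' x z hx hxz
  rw [L.comp_act _ _ (zero_add q) (zero_add q)] at hxz
  obtain ⟨y', z', hy', rfl⟩ := hg ho h h' _ z (by rw [d_act_zero hf₀, hx, map_zero]) hxz
  obtain ⟨x', y'', hx', rfl⟩ := hf ho h h' x y' hx hy'.symm
  refine ⟨x', L.act (zero_add o) g y'' + z', hx', ?_⟩
  rw [L.comp_act _ _ (zero_add p) (zero_add p), map_add, map_add, d_act_zero hg₀, add_assoc]

/-- If `g ∘ f` and `f` act as quasi-isomorphisms, then so does `g`. -/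
lemma IsQis.of_comp_right {f : A.Hom Y Z 0} {g : A.Hom Z W 0} (hf₀ : A.d 0 1 (zero_add 1) f = 0)
    (hg₀ : A.d 0 1 (zero_add 1) g = 0) (hf : L.IsQis f) (hgf : L.IsQis (A.comp (add_zero 0) g f)) :
    L.IsQis g := by
  intro o p q r ho h h' y z hy hyz
  obtain ⟨x, y₀, hx, rfl⟩ := hf h h' rfl 0 y (map_zero _) (by rw [map_zero, hy])
  rw [map_add, ← d_act_zero hg₀, ← sub_eq_zero, add_sub_assoc, ← map_sub, ← neg_sub, map_neg,
    ← sub_eq_add_neg, sub_eq_zero, ← L.comp_act (add_zero 0) (zero_add q) _ _] at hyz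
  obtain ⟨x', z', rfl, hz⟩ := hgf ho h h' x _ hx hyz
  refine ⟨L.act (zero_add p) f x' + y₀, z', ?_, ?_⟩
  · rw [map_add, d_act_zero hf₀]
  · rw [map_add, ← L.comp_act (add_zero 0) (zero_add p) _ _, add_right_comm, ← hz, sub_add_cancel]

/-- If `g ∘ f` and `g` act as quasi-isomorphisms, then so does `f`. -/
lemma IsQis.of_comp_left {f : A.Hom Y Z 0} {g : A.Hom Z W 0} (hf₀ : A.d 0 1 (zero_add 1) f = 0)
    (hg₀ : A.d 0 1 (zero_add 1) g = 0) (hg : L.IsQis g) (hgf : L.IsQis (A.comp (add_zero 0) g f)) :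
    L.IsQis f := by
  intro o p q r ho h h' x y hx hxy
  obtain ⟨x', z', hx', hz⟩ := hgf ho h h' x (L.act (zero_add p) g y) hx (by
    rw [d_act_zero hg₀, L.comp_act _ _ (zero_add q) (zero_add q), hxy])
  rw [L.comp_act _ _ (zero_add p) (zero_add p), ← sub_eq_iff_eq_add', ← map_sub] at hz
  obtain ⟨y', -, hy', -⟩ := hg (sub_add_cancel o 1) ho h (y - L.act (zero_add p) f x') z' (by
    rw [map_sub, d_act_zero hf₀, hx', hxy, sub_self]) hz
  exact ⟨x', y', hx', by rw [hy', add_sub_cancel]⟩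

lemma IsQis.of_homotopic {f g : A.Hom Y Z 0} (e : A.Hom Y Z (-1))
    (he : A.d (-1) 0 (neg_add_cancel 1) e = f - g) (hf : L.IsQis f) : L.IsQis g := by
  obtain rfl : f = A.d (-1) 0 (neg_add_cancel 1) e + g := by rw [he, sub_add_cancel]
  intro o p q r ho h h' x y hx hxy
  have key : ∀ {i j l : ℤ} (hj : i + 1 = j) (hl : j + 1 = l) (hi : -1 + j = i) (hj' : -1 + l = j)
      (z : L.X Y j), L.act (zero_add j) (A.d (-1) 0 (neg_add_cancel 1) e) z =
      L.d i j hj (L.act hi e z) + L.act hj' e (L.d j l hl z) := by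
    intro i j l hj hl hi hj' z
    rw [L.leibniz hi hj (neg_add_cancel 1) hl (zero_add j) hj', sgn_neg_one, neg_smul, one_smul,
      neg_add_cancel_right]
  obtain ⟨x', y', rfl, hy⟩ := hf ho h h' x (y + L.act (by omega) e x) hx (by
    rw [map_add, LinearMap.add_apply, key h h' (by omega) (by omega), hxy, hx, map_zero, add_zero,
      map_add, add_comm])
  rw [map_add, LinearMap.add_apply, key ho h (by omega) (by omega)] at hy
  refine ⟨x', L.act (by omega) e x' + y', rfl, ?_⟩
  rw [map_add]
  exact add_right_cancel (hy.trans (by abel))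

/-- A morphism with an inverse up to homotopy acts as a quasi-isomorphism. -/
lemma IsQis.of_homotopyEquiv {f : A.Hom Y Z 0} {g : A.Hom Z Y 0}
    (hf₀ : A.d 0 1 (zero_add 1) f = 0) (hg₀ : A.d 0 1 (zero_add 1) g = 0)
    (e : A.Hom Y Y (-1)) (e' : A.Hom Z Z (-1))
    (he : A.d (-1) 0 (neg_add_cancel 1) e = A.one Y - A.comp (add_zero 0) g f)
    (he' : A.d (-1) 0 (neg_add_cancel 1) e' = A.one Z - A.comp (add_zero 0) f g) :
    L.IsQis f := by
  have h₁ := IsQis.of_homotopic e he (L := L) IsQis.one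
  have h₂ := IsQis.of_homotopic e' he' (L := L) IsQis.one
  intro o p q r ho h h' x y hx hxy
  obtain ⟨x', -, rfl, -⟩ := h₁ ho h h' x (L.act (zero_add p) g y) hx (by
    rw [L.comp_act _ _ (zero_add q) (zero_add q), hxy, d_act_zero hg₀])
  obtain ⟨z, y', hz, hy⟩ := h₂ ho h h' 0 (y - L.act (zero_add p) f x') (map_zero _) (by
    rw [map_zero, map_sub, d_act_zero hf₀, hxy, sub_self])
  refine ⟨x' + L.act (zero_add p) g z, y', ?_, ?_⟩
  · rw [map_add, d_act_zero hg₀, hz, map_zero, add_zero]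
  · rw [map_add, add_assoc, ← L.comp_act (add_zero 0) (zero_add p) _ _, ← hy, add_sub_cancel]

lemma IsAcyclic.of_isQis {f : A.Hom Y Z 0} (hf₀ : A.d 0 1 (zero_add 1) f = 0) (hZ : L.IsAcyclic Z) (hf : L.IsQis f) :
    L.IsAcyclic Y := by
  intro p q r h h' x hx
  obtain ⟨y, hy⟩ := hZ h h' (L.act (zero_add q) f x) (by rw [d_act_zero hf₀, hx, map_zero])
  obtain ⟨x', -, hx', -⟩ := hf (sub_add_cancel p 1) h h' x y hx hy.symm
  exact ⟨x', hx'⟩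

lemma IsAcyclic.of_isQis' {f : A.Hom Y Z 0} (hf₀ : A.d 0 1 (zero_add 1) f = 0)
    (hY : L.IsAcyclic Y) (hf : L.IsQis f) : L.IsAcyclic Z := by
  intro p q r h h' y hy
  obtain ⟨x', y', hx', rfl⟩ := hf h h' rfl 0 y (map_zero _) (by rw [map_zero, hy])
  obtain ⟨x'', rfl⟩ := hY h h' x' hx'
  exact ⟨L.act (zero_add p) f x'' + y', by rw [map_add, d_act_zero hf₀]⟩

end isQis

end LeftModule

/-- The object `C` is, up to the differential, the direct sum of a shift of `X` and a shift of `Y`,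
and the differential is zero on `Y` and is given by `f` on `X`. -/
structure Ext (a a' b b' : ℤ) {m : ℤ} {X Y : A.Ob} (f : A.Hom X Y m) (C : A.Ob) where
  ha : a' + a = 0
  hb : b' + b = 0
  hm : b + m = a + 1
  i₁ : A.Hom X C a
  p₁ : A.Hom C X a'
  i₂ : A.Hom Y C b
  p₂ : A.Hom C Y b'
  p₁_i₁ : A.comp ha p₁ i₁ = A.one X
  p₂_i₂ : A.comp hb p₂ i₂ = A.one Y
  p₁_i₂ : A.comp (rfl : a' + b = a' + b) p₁ i₂ = 0
  p₂_i₁ : A.comp (rfl : b' + a = b' + a) p₂ i₁ = 0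
  total : A.comp ((add_comm a a').trans ha) i₁ p₁ + A.comp ((add_comm b b').trans hb) i₂ p₂ = A.one C
  d_i₂ : A.d b (b + 1) rfl i₂ = 0
  d_i₁ : A.d a (a + 1) rfl i₁ = A.comp hm i₂ f


namespace Ext

variable {X Y X' Y' C D : A.Ob} {a a' b b' m : ℤ} {f : A.Hom X Y m} {g : A.Hom X' Y' m}
  (c : Ext a a' b b' f C) (c' : Ext a a' b b' g D)

include c in
lemma sgn_a : sgn a' = sgn a := sgn_eq_of_add_eq_zero c.ha

include c in
lemma sgn_b : sgn b' = sgn b := sgn_eq_of_add_eq_zero c.hb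

include c in
lemma sgn_am : sgn a * sgn m = - sgn b := by
  have h : sgn b * sgn m = sgn a * -1 := by rw [← sgn_add, c.hm, sgn_add, sgn_one]
  linear_combination sgn b * sgn a * h - sgn a * sgn m * sgn_mul_self b - sgn b * sgn_mul_self a

include c in
lemma d_f (m' : ℤ) (hm' : m + 1 = m') : A.d m m' hm' f = 0 := by
  have := c.hb
  have := c.hm
  have h := A.leibniz (q' := b + 1) (p' := m') (r' := a + 1 + 1) c.hm rfl rfl hm' (by omega)
    (by omega) c.i₂ f
  rw [← c.d_i₁, A.d_d, c.d_i₂, map_zero, LinearMap.zero_apply, zero_add] at h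
  have h' := congrArg (fun x => sgn b • A.comp (by omega : b' + (a + 1 + 1) = m') c.p₂ x) h
  simp only [map_zero, smul_zero, map_zsmul, sgn_smul_sgn_smul] at h'
  rw [← A.assoc c.hb (by omega) _ _, c.p₂_i₂, A.one_comp] at h'
  exact h'.symm

lemma p₁_i₂' {r : ℤ} (h : a' + b = r) : A.comp h c.p₁ c.i₂ = 0 := by
  subst h
  exact c.p₁_i₂

lemma p₂_i₁' {r : ℤ} (h : b' + a = r) : A.comp h c.p₂ c.i₁ = 0 := by
  subst h
  exact c.p₂_i₁

lemma hom_ext {W : A.Ob} {n n₁ n₂ : ℤ} {x y : A.Hom C W n} (h₁ : n + a = n₁) (h₂ : n + b = n₂)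
    (e₁ : A.comp h₁ x c.i₁ = A.comp h₁ y c.i₁) (e₂ : A.comp h₂ x c.i₂ = A.comp h₂ y c.i₂) :
    x = y := by
  have := c.ha
  have := c.hb
  rw [← A.comp_one (add_zero n) x, ← A.comp_one (add_zero n) y, ← c.total, map_add, map_add,
    ← A.assoc h₁ (by omega) _ (add_zero n), ← A.assoc h₂ (by omega) _ (add_zero n),
    ← A.assoc h₁ (by omega) _ (add_zero n), ← A.assoc h₂ (by omega) _ (add_zero n), e₁, e₂]

lemma d_p₁ (q : ℤ) (hq : a' + 1 = q) : A.d a' q hq c.p₁ = 0 := by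
  have := c.ha
  have := c.hb
  have := c.hm
  have h₁ := A.leibniz (q' := q) (p' := b + 1) (r' := a' + b + 1) rfl rfl hq rfl (by omega)
    (by omega) c.p₁ c.i₂
  have h₂ := A.leibniz (q' := q) (p' := a + 1) (r' := 1) c.ha (zero_add 1) hq rfl (by omega)
    (by omega) c.p₁ c.i₁
  rw [c.p₁_i₂, c.d_i₂, map_zero, map_zero, smul_zero, add_zero] at h₁
  rw [c.p₁_i₁, A.d_one, c.d_i₁, ← A.assoc rfl (by omega) c.hm (by omega), c.p₁_i₂, map_zero,
    LinearMap.zero_apply, smul_zero, add_zero] at h₂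
  refine c.hom_ext (n₁ := 1) (n₂ := a' + b + 1) (by omega) (by omega) ?_ ?_
  · rw [← h₂, map_zero, LinearMap.zero_apply]
  · rw [← h₁, map_zero, LinearMap.zero_apply]

lemma d_p₂ (q : ℤ) (hq : b' + 1 = q) (h : m + a' = q) :
    A.d b' q hq c.p₂ = - sgn b • A.comp h f c.p₁ := by
  have := c.ha
  have := c.hb
  have := c.hm
  have h₁ := A.leibniz (q' := q) (p' := b + 1) (r' := 1) c.hb (zero_add 1) hq rfl (by omega)
    (by omega) c.p₂ c.i₂
  have h₂ := A.leibniz (q' := q) (p' := a + 1) (r' := b' + a + 1) rfl rfl hq rfl (by omega)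
    (by omega) c.p₂ c.i₁
  rw [c.p₂_i₂, A.d_one, c.d_i₂, map_zero, smul_zero, add_zero] at h₁
  rw [c.p₂_i₁, map_zero, c.d_i₁, ← A.assoc c.hb (by omega : 0 + m = b' + a + 1) c.hm (by omega), c.p₂_i₂] at h₂
  have e : ∀ {l : ℤ} (hl : l = m) (hh : 0 + m = l) (hh' : m + 0 = l), A.comp hh (A.one Y) f =
    A.comp hh' f (A.one X) := by
    rintro l rfl hh hh'
    rw [A.one_comp, A.comp_one]
  rw [e (by omega) _ (by omega), c.sgn_b, eq_comm, add_eq_zero_iff_eq_neg] at h₂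
  refine c.hom_ext (n₁ := b' + a + 1) (n₂ := 1) (by omega) (by omega) ?_ ?_
  · rw [h₂, map_zsmul, LinearMap.smul_apply, neg_smul, A.assoc h _ c.ha (by omega), c.p₁_i₁]
  · rw [← h₁, map_zsmul, LinearMap.smul_apply, A.assoc h (by omega) rfl (by omega), c.p₁_i₂,
      map_zero, smul_zero]

/-- The corresponding structure in the dual DG category. -/
def op : Ext (A := A.op) b' b a' a f C where
  ha := (add_comm b b').trans c.hb
  hb := (add_comm a a').trans c.ha
  hm := by have := c.ha; have := c.hb; have := c.hm; omega
  i₁ := -(sgn b * sgn (a' * m)) • c.p₂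
  p₁ := -(sgn b * sgn (a' * m) * sgn (b * b')) • c.i₂
  i₂ := c.p₁
  p₂ := sgn (a * a') • c.i₁
  p₁_i₁ := by
    simp only [LinearMap.smul_apply, LinearMap.flip_apply, map_zsmul, smul_smul, c.p₂_i₂]
    convert one_zsmul _
    linear_combination sgn (b * b') * sgn (b * b') * (sgn (a' * m) * sgn (a' * m) *
      sgn_mul_self b + sgn_mul_self (a' * m)) + sgn_mul_self (b * b')
  p₂_i₂ := by
    simp only [LinearMap.smul_apply, LinearMap.flip_apply, map_zsmul, smul_smul, c.p₁_i₁,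
      sgn_mul_self, one_smul]
  p₁_i₂ := by
    simp only [LinearMap.smul_apply, LinearMap.flip_apply, map_zsmul]
    rw [c.p₁_i₂', smul_zero, smul_zero]
  p₂_i₁ := by
    simp only [LinearMap.smul_apply, LinearMap.flip_apply, map_zsmul]
    rw [c.p₂_i₁', smul_zero, smul_zero, smul_zero]
  total := by
    simp only [LinearMap.smul_apply, LinearMap.flip_apply, map_zsmul, smul_smul]
    rw [add_comm, ← c.total]
    congr 1
    · convert one_zsmul _
      rw [mul_comm a a', sgn_mul_self]
    · convert one_zsmul _
      rw [mul_comm b' b]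
      linear_combination sgn (b * b') * sgn (b * b') * (sgn (a' * m) * sgn (a' * m) *
        sgn_mul_self b + sgn_mul_self (a' * m)) + sgn_mul_self (b * b')
  d_i₂ := c.d_p₁ _ _
  d_i₁ := by
    have := c.ha
    have := c.hb
    have := c.hm
    simp only [LinearMap.smul_apply, LinearMap.flip_apply, map_zsmul]
    rw [c.d_p₂ _ rfl (by omega), smul_smul]
    congr 1
    linear_combination sgn (a' * m) * sgn_mul_self b

section leftModule

variable {L : LeftModule.{w, v, v₁, u} A}

include c in
lemma isAcyclic (hX : L.IsAcyclic X) (hY : L.IsAcyclic Y) : L.IsAcyclic C := by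
  intro p q r h h' x hx
  have := c.ha
  have := c.hb
  have := c.hm
  obtain ⟨y, hy⟩ := hX (p := a' + p) (q := a' + q) (r := a' + r) (by omega) (by omega)
    (L.act rfl c.p₁ x) (by
      rw [LeftModule.d_act_of_closed rfl (c.d_p₁ _ rfl) _ h' _ rfl, hx, map_zero, smul_zero])
  have hi : L.d p q h (L.act (by omega) c.i₁ y) =
      L.act (by omega : b + (b' + q) = q) c.i₂ (L.act (by omega) f y) +
        sgn a • L.act (by omega) c.i₁ (L.act (rfl : a' + q = a' + q) c.p₁ x) := by
    rw [L.leibniz (q' := a + 1) (p' := a' + q) _ _ rfl (by omega) (by omega) (by omega), hy,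
      c.d_i₁, L.comp_act c.hm _ _ _]
  have hx' : x = L.act (by omega) c.i₁ (L.act (rfl : a' + q = a' + q) c.p₁ x) +
      L.act (by omega) c.i₂ (L.act (rfl : b' + q = b' + q) c.p₂ x) := by
    conv_lhs => rw [← L.one_act (zero_add q) x, ← c.total, map_add, LinearMap.add_apply,
      L.comp_act _ _ rfl (by omega), L.comp_act _ _ rfl (by omega)]
  obtain ⟨z, hz⟩ := hY (p := b' + p) (q := b' + q) (r := b' + r) (by omega) (by omega)
    (L.act rfl c.p₂ x - sgn a • L.act (by omega) f y) (by
      rw [map_sub, L.leibniz (q' := b' + 1) (p' := r) _ _ rfl (by omega) (by omega) (by omega), hx,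
        map_zero, smul_zero, add_zero, c.d_p₂ _ rfl (by omega)]
      simp only [map_zsmul]
      rw [LeftModule.d_act_of_closed rfl (c.d_f _ rfl) _ (by omega : a' + p + 1 = a' + q) _ (by omega), hy,
        ← L.comp_act (by omega : m + a' = b' + 1) (by omega : b' + 1 + q = b' + r) _ (by omega)]
      simp only [LinearMap.smul_apply, neg_smul, LinearMap.neg_apply, smul_smul, c.sgn_am]
      rw [sub_neg_eq_add]
      exact neg_add_cancel _)
  refine ⟨sgn a • L.act (by omega) c.i₁ y + sgn b • L.act (by omega) c.i₂ z, ?_⟩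
  rw [map_add, map_zsmul, map_zsmul, hi,
    LeftModule.d_act_of_closed rfl c.d_i₂ _ (by omega : b' + p + 1 = b' + q) _ (by omega), hz]
  conv_rhs => rw [hx']
  simp only [smul_add, sgn_smul_sgn_smul, map_sub, map_zsmul]
  abel


variable {u' : A.Hom X X' 0} {v' : A.Hom Y Y' 0} {l : ℤ} (e : A.Hom X Y' l)

/-- The morphism of extensions given by a square which commutes up to a homotopy. -/
def map (u' : A.Hom X X' 0) (v' : A.Hom Y Y' 0) (hl : l + 1 = m) (e : A.Hom X Y' l) :
    A.Hom C D 0 :=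
  A.comp (by have := c.ha; omega) c'.i₁ (A.comp (zero_add a') u' c.p₁) +
    A.comp (by have := c.hb; omega) c'.i₂ (A.comp (zero_add b') v' c.p₂) +
      A.comp (by have := c.hm; have := c.ha; omega) (sgn b • c'.i₂) (A.comp rfl e c.p₁)

lemma d_map (hl : l + 1 = m) (hu : A.d 0 1 (zero_add 1) u' = 0) (hv : A.d 0 1 (zero_add 1) v' = 0)
    (he : A.d l m hl e = A.comp (zero_add m) v' f - A.comp (add_zero m) g u') :
    A.d 0 1 (zero_add 1) (c.map c' u' v' hl e) = 0 := by
  have := c.ha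
  have := c.hb
  have := c.hm
  have h₀ : A.d a' (a' + 1) rfl (A.comp (zero_add a') u' c.p₁) = 0 := by
    rw [d_comp_left (zero_add 1) hu _ _ rfl (zero_add _), c.d_p₁, map_zero, smul_zero]
  rw [map, map_zsmul, LinearMap.smul_apply, map_add, map_add, map_zsmul, d_comp_right rfl h₀ _ _ rfl (by omega), c'.d_i₁,
    d_comp_left rfl c'.d_i₂ _ _ (rfl : b' + 1 = b' + 1) (by omega),
    d_comp_left rfl c'.d_i₂ _ _ (by omega : l + a' + 1 = b' + 1) (by omega),
    d_comp_left (zero_add 1) hv _ _ rfl (by omega), d_comp_right rfl (c.d_p₁ _ rfl) _ _ hl (by omega),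
    c.d_p₂ _ rfl (by omega : m + a' = b' + 1), he,
    A.assoc _ _ (by omega : m + a' = b' + 1) (by omega), ← A.assoc (add_zero m) (by omega) _ _]
  simp only [map_zsmul, map_sub, LinearMap.sub_apply, sgn_zero, one_smul, smul_sub]
  rw [← A.assoc (zero_add m) (by omega) _ _]
  simp only [neg_smul, smul_neg, sgn_smul_sgn_smul]
  abel

lemma p₁_map (hl : l + 1 = m) : A.comp (add_zero a') c'.p₁ (c.map c' u' v' hl e) =
    A.comp (zero_add a') u' c.p₁ := by
  have := c.ha
  have := c.hb
  have := c.hm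
  rw [map, map_zsmul, LinearMap.smul_apply, map_add, map_add, map_zsmul, ← A.assoc c'.ha (by omega) _ _,
    ← A.assoc (rfl : a' + b = a' + b) (by omega) _ _, ← A.assoc (rfl : a' + b = a' + b) (by omega) _ _,
    c'.p₁_i₁, c'.p₁_i₂, A.one_comp]
  simp only [map_zero, LinearMap.zero_apply, smul_zero, add_zero]

lemma map_i₂ (hl : l + 1 = m) : A.comp (zero_add b) (c.map c' u' v' hl e) c.i₂ =
    A.comp (add_zero b) c'.i₂ v' := by
  have := c.ha
  have := c.hb
  have := c.hm
  rw [map, map_zsmul, LinearMap.smul_apply, map_add, map_add, LinearMap.add_apply,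
    LinearMap.add_apply, map_zsmul, LinearMap.smul_apply,
    A.assoc _ _ (rfl : a' + b = a' + b) (by omega), A.assoc _ _ (c.hb) (by omega),
    A.assoc _ _ (rfl : l + a' + b = l + a' + b) (by omega),
    A.assoc _ _ (rfl : a' + b = a' + b) (by omega), A.assoc _ _ c.hb (by omega),
    A.assoc _ _ (rfl : a' + b = a' + b) (by omega), c.p₂_i₂, c.p₁_i₂, A.comp_one]
  simp only [map_zero, smul_zero, add_zero, zero_add]

lemma isQis_map (hl : l + 1 = m) (hu : A.d 0 1 (zero_add 1) u' = 0)
    (hv : A.d 0 1 (zero_add 1) v' = 0)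
    (he : A.d l m hl e = A.comp (zero_add m) v' f - A.comp (add_zero m) g u')
    (hLu : L.IsQis u') (hLv : L.IsQis v') : L.IsQis (c.map c' u' v' hl e) := by
  intro o p q r ho h h' x y hx hxy
  have := c.ha
  have := c.hb
  have := c.hm
  have hw := d_map c c' e hl hu hv he
  set w := c.map c' u' v' hl e
  obtain ⟨x₁, y₁, hx₁, hy₁⟩ := hLu (o := a' + o) (p := a' + p) (q := a' + q) (r := a' + r)
    (by omega) (by omega) (by omega) (L.act rfl c.p₁ x) (sgn a • L.act rfl c'.p₁ y) (by
      rw [LeftModule.d_act_of_closed rfl (c.d_p₁ _ rfl) _ h' _ rfl, hx, map_zero, smul_zero]) (by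
      rw [map_zsmul, LeftModule.d_act_of_closed rfl (c'.d_p₁ _ rfl) _ h _ rfl, c.sgn_a,
        sgn_smul_sgn_smul, ← hxy, ← L.comp_act (zero_add a') rfl _ _, ← c.p₁_map c' e hl,
        L.comp_act])
  have hi : L.d p q h (L.act (by omega) c.i₁ x₁) =
      L.act (by omega : b + (b' + q) = q) c.i₂ (L.act (by omega) f x₁) +
        sgn a • L.act (by omega) c.i₁ (L.act (rfl : a' + q = a' + q) c.p₁ x) := by
    rw [L.leibniz (q' := a + 1) (p' := a' + q) _ _ rfl (by omega) (by omega) (by omega), hx₁,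
      c.d_i₁, L.comp_act c.hm _ _ _]
  have htot : ∀ {X Y C : A.Ob} {f : A.Hom X Y m} (c : Ext a a' b b' f C) {n : ℤ} (x : L.X C n),
      x = L.act (by omega) c.i₁ (L.act (rfl : a' + n = a' + n) c.p₁ x) +
      L.act (by omega) c.i₂ (L.act (rfl : b' + n = b' + n) c.p₂ x) := by
    intro X Y C f c n x
    conv_lhs => rw [← L.one_act (zero_add n) x, ← c.total, map_add, LinearMap.add_apply,
      L.comp_act _ _ rfl (by omega), L.comp_act _ _ rfl (by omega)]
  have hinj : ∀ {n n' : ℤ} (hn : b + n = n') (z : L.X Y n), L.act hn c.i₂ z = 0 → z = 0 := by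
    intro n n' hn z hz
    rw [← L.one_act (zero_add n) z, ← c.p₂_i₂, L.comp_act _ _ hn (by omega), hz, map_zero]
  have hinj' : ∀ {n n' : ℤ} (hn : b + n = n') (z : L.X Y' n), L.act hn c'.i₂ z = 0 → z = 0 := by
    intro n n' hn z hz
    rw [← L.one_act (zero_add n) z, ← c'.p₂_i₂, L.comp_act _ _ hn (by omega), hz, map_zero]
  obtain ⟨γ, hγ⟩ : ∃ γ : L.X Y (b' + q), x - sgn a • L.d p q h (L.act (by omega) c.i₁ x₁) =
      L.act (by omega) c.i₂ γ := by
    refine ⟨L.act rfl c.p₂ x - sgn a • L.act (by omega) f x₁, ?_⟩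
    rw [hi, map_sub, map_zsmul, smul_add, sgn_smul_sgn_smul, sub_eq_iff_eq_add]
    exact (htot c x).trans (by abel)
  let y₂ := y - sgn a • L.act (zero_add p) w (L.act (by omega) c.i₁ x₁) -
    L.d o p ho (L.act (by omega : a + (a' + o) = o) c'.i₁ y₁)
  have hy₂ : L.act rfl c'.p₁ y₂ = 0 := by
    have e₁ : L.act rfl c'.p₁ (L.act (zero_add p) w (L.act (by omega) c.i₁ x₁)) =
        L.act (zero_add (a' + p)) u' x₁ := by
      rw [← L.comp_act (add_zero a') (by omega) _ _, p₁_map, L.comp_act _ _ (by omega : a' + p = a' + p) (by omega),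
        ← L.comp_act c.ha (zero_add _) _ _, c.p₁_i₁, L.one_act]
    have e₂ : L.act rfl c'.p₁ (L.d o p ho (L.act (by omega : a + (a' + o) = o) c'.i₁ y₁)) =
        sgn a • L.d (a' + o) (a' + p) (by omega) y₁ := by
      have := LeftModule.d_act_of_closed (L := L) rfl (c'.d_p₁ _ rfl) rfl ho (by omega) rfl
        (L.act (by omega : a + (a' + o) = o) c'.i₁ y₁)
      rw [← L.comp_act c'.ha (zero_add _) _ _, c'.p₁_i₁, L.one_act, c'.sgn_a] at this
      rw [this, sgn_smul_sgn_smul]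
    rw [map_sub, map_sub, map_zsmul, e₁, e₂, sub_sub, ← smul_add, ← hy₁, sgn_smul_sgn_smul,
      sub_self]
  have hy₂' := htot c' y₂
  rw [hy₂, map_zero, zero_add] at hy₂'
  have hwi : ∀ {n n' : ℤ} (hn : b + n = n') (z : L.X Y n), L.act (zero_add n') w (L.act hn c.i₂ z) =
      L.act hn c'.i₂ (L.act (zero_add n) v' z) := by
    intro n n' hn z
    rw [← L.comp_act (zero_add b) hn _ _, map_i₂, L.comp_act (add_zero b) hn (zero_add n) _]
  have hdi : ∀ {X Y C : A.Ob} {f : A.Hom X Y m} (c : Ext a a' b b' f C) {n l n' l' : ℤ}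
      (hn : b + n = n') (hl : b + l = l') (h₁ : n + 1 = l) (h₂ : n' + 1 = l') (z : L.X Y n),
      L.d n' l' h₂ (L.act hn c.i₂ z) = sgn b • L.act hl c.i₂ (L.d n l h₁ z) := by
    intro X Y C f c n l n' l' hn hl h₁ h₂ z
    exact LeftModule.d_act_of_closed rfl c.d_i₂ _ _ _ _ z
  have hdγ : L.d (b' + q) (b' + r) (by omega) γ = 0 := by
    refine hinj (n' := r) (by omega) _ ?_
    rw [← sgn_smul_sgn_smul b (L.act _ c.i₂ _), ← hdi c (by omega) _ _ h', ← hγ, map_sub, hx,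
      map_zsmul, L.d_d, smul_zero, sub_zero, smul_zero]
  have hvγ : L.act (zero_add _) v' γ = L.d (b' + p) (b' + q) (by omega)
      (sgn b • L.act (rfl : b' + p = b' + p) c'.p₂ y₂) := by
    refine sub_eq_zero.1 (hinj' (n' := q) (by omega) _ ?_)
    rw [map_sub, ← hwi, ← hγ, map_zsmul, map_zsmul, ← hdi c' (by omega) _ _ h, ← hy₂', map_sub,
      map_sub, map_sub, hxy, L.d_d, map_zsmul, map_zsmul, LeftModule.d_act_zero hw, sub_zero,
      sub_self]
  obtain ⟨γ', ε', hγ', hε'⟩ := hLv (o := b' + o) (p := b' + p) (q := b' + q) (r := b' + r)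
    (by omega) (by omega) (by omega) _ _ hdγ hvγ
  refine ⟨sgn a • L.act (by omega) c.i₁ x₁ + sgn b • L.act (by omega) c.i₂ γ',
    L.act (by omega) c'.i₁ y₁ + L.act (by omega) c'.i₂ ε', ?_, ?_⟩
  · rw [map_add, map_zsmul, map_zsmul, hdi c _ (by omega : b + (b' + q) = q) (by omega) h, hγ', sgn_smul_sgn_smul, ← hγ,
      add_sub_cancel]
  · rw [map_add, map_add, map_zsmul, map_zsmul, hwi, hdi c' _ (by omega : b + (b' + p) = p) (by omega) ho,
      add_add_add_comm, ← smul_add, ← map_add, ← hε', map_zsmul, sgn_smul_sgn_smul, ← hy₂']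
    simp only [y₂]
    abel

end leftModule

end Ext

end

section quasiIso

variable {k : Type w} [CommRing k]

lemma shortComplex_quasiIso_iff {S T : ShortComplex (ModuleCat.{v} k)} (φ : S ⟶ T) :
    ShortComplex.QuasiIso φ ↔
      (∀ x : S.X₂, S.g x = 0 → ∀ y : T.X₁, φ.τ₂ x = T.f y → ∃ x', S.f x' = x) ∧
      (∀ y : T.X₂, T.g y = 0 → ∃ (x : S.X₂) (y' : T.X₁), S.g x = 0 ∧ y = φ.τ₂ x + T.f y') := by
  let γ : ShortComplex.LeftHomologyMapData φ S.moduleCatLeftHomologyData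
    T.moduleCatLeftHomologyData := default
  rw [γ.quasiIso_iff, ConcreteCategory.isIso_iff_bijective]
  have hπ : ∀ (S : ShortComplex (ModuleCat.{v} k)), Function.Surjective S.moduleCatLeftHomologyData.π :=
    fun S => Submodule.mkQ_surjective _
  have hπ0 : ∀ (S : ShortComplex (ModuleCat.{v} k)) (x : S.moduleCatLeftHomologyData.K),
      S.moduleCatLeftHomologyData.π x = 0 ↔ ∃ x', S.f x' = S.moduleCatLeftHomologyData.i x := by
    intro S x
    refine (Submodule.Quotient.mk_eq_zero _).trans ⟨?_, ?_⟩
    · rintro ⟨x', rfl⟩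
      exact ⟨x', rfl⟩
    · rintro ⟨x', hx'⟩
      exact ⟨x', Subtype.ext hx'⟩
  have hK : ∀ (S : ShortComplex (ModuleCat.{v} k)) (x : S.X₂), S.g x = 0 →
      ∃ z : S.moduleCatLeftHomologyData.K, S.moduleCatLeftHomologyData.i z = x :=
    fun S x hx => ⟨⟨x, hx⟩, rfl⟩
  have hgi : ∀ (S : ShortComplex (ModuleCat.{v} k)) (x : S.moduleCatLeftHomologyData.K),
      S.g (S.moduleCatLeftHomologyData.i x) = 0 := fun S x => x.2
  have hc₁ : ∀ x, γ.φH (S.moduleCatLeftHomologyData.π x) = T.moduleCatLeftHomologyData.π (γ.φK x) :=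
    fun x => ConcreteCategory.congr_hom γ.commπ x
  have hc₂ : ∀ x, T.moduleCatLeftHomologyData.i (γ.φK x) = φ.τ₂ (S.moduleCatLeftHomologyData.i x) :=
    fun x => ConcreteCategory.congr_hom γ.commi x
  refine and_congr ?_ ?_
  · rw [injective_iff_map_eq_zero]
    refine ⟨fun h x hx y hy => ?_, fun h z hz => ?_⟩
    · obtain ⟨z, rfl⟩ := hK S x hx
      rw [← hπ0]
      refine h _ ?_
      rw [hc₁, hπ0, hc₂]
      exact ⟨y, hy.symm⟩
    · obtain ⟨z, rfl⟩ := hπ S z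
      rw [hc₁, hπ0, hc₂] at hz
      obtain ⟨y, hy⟩ := hz
      rw [hπ0]
      exact h _ (hgi S z) y hy.symm
  · refine ⟨fun h y hy => ?_, fun h z => ?_⟩
    · obtain ⟨z, rfl⟩ := hK T y hy
      obtain ⟨x, hx⟩ := h (T.moduleCatLeftHomologyData.π z)
      obtain ⟨x, rfl⟩ := hπ S x
      rw [hc₁, eq_comm, ← sub_eq_zero, ← map_sub, hπ0] at hx
      obtain ⟨y', hy'⟩ := hx
      refine ⟨_, y', hgi S x, ?_⟩
      rw [hy', map_sub, hc₂, add_sub_cancel]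
    · obtain ⟨z, rfl⟩ := hπ T z
      obtain ⟨x, y', hx, hy⟩ := h _ (hgi T z)
      obtain ⟨x, rfl⟩ := hK S x hx
      refine ⟨S.moduleCatLeftHomologyData.π x, ?_⟩
      rw [hc₁, eq_comm, ← sub_eq_zero, ← map_sub, hπ0]
      refine ⟨y', ?_⟩
      rw [map_sub, hy, hc₂, add_sub_cancel_left]

/-- The cone of the map of complexes `f` is acyclic. -/
def ChainQis {X : ℤ → Type v₁} {Y : ℤ → Type v₂} [∀ n, AddCommGroup (X n)] [∀ n, Module k (X n)]
    [∀ n, AddCommGroup (Y n)] [∀ n, Module k (Y n)]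
    (d : ∀ p q : ℤ, p + 1 = q → (X p →ₗ[k] X q)) (d' : ∀ p q : ℤ, p + 1 = q → (Y p →ₗ[k] Y q))
    (f : ∀ n, X n →ₗ[k] Y n) : Prop :=
  ∀ ⦃o p q r : ℤ⦄ (ho : o + 1 = p) (h : p + 1 = q) (h' : q + 1 = r) (x : X q) (y : Y p),
    d q r h' x = 0 → f q x = d' p q h y → ∃ (x' : X p) (y' : Y o), d p q h x' = x ∧
      y = f p x' + d' o p ho y'

lemma quasiIso_mkComplexMap_iff {X Y : ℤ → Type v} [∀ n, AddCommGroup (X n)] [∀ n, Module k (X n)]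
    [∀ n, AddCommGroup (Y n)] [∀ n, Module k (Y n)]
    {d : ∀ p q : ℤ, p + 1 = q → (X p →ₗ[k] X q)} {dd} {d' : ∀ p q : ℤ, p + 1 = q → (Y p →ₗ[k] Y q)}
    {dd'} (f : ∀ n, X n →ₗ[k] Y n) (hf : ∀ p q h x, f q (d p q h x) = d' p q h (f p x)) :
    QuasiIso (mkComplexMap f hf : mkComplex X d dd ⟶ mkComplex Y d' dd') ↔ ChainQis d d' f := by
  have key : ∀ {p q r : ℤ} (h : p + 1 = q) (h' : q + 1 = r),
      QuasiIsoAt (mkComplexMap f hf : mkComplex X d dd ⟶ mkComplex Y d' dd') q ↔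
      (∀ x : X q, d q r h' x = 0 → ∀ y : Y p, f q x = d' p q h y → ∃ x', d p q h x' = x) ∧
      (∀ y : Y q, d' q r h' y = 0 → ∃ (x : X q) (y' : Y p), d q r h' x = 0 ∧
        y = f q x + d' p q h y') := by
    intro p q r h h'
    rw [quasiIsoAt_iff' _ p q r (by simp; omega) (by simp; omega), shortComplex_quasiIso_iff]
    have e₁ : ∀ (Z : ℤ → Type v) [∀ n, AddCommGroup (Z n)] [∀ n, Module k (Z n)]
      (dZ : ∀ p q : ℤ, p + 1 = q → (Z p →ₗ[k] Z q)) (ddZ), ((mkComplex Z dZ ddZ).sc' p q r).f =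
        ModuleCat.ofHom (dZ p q h) := fun Z _ _ dZ ddZ => dif_pos _
    have e₂ : ∀ (Z : ℤ → Type v) [∀ n, AddCommGroup (Z n)] [∀ n, Module k (Z n)]
      (dZ : ∀ p q : ℤ, p + 1 = q → (Z p →ₗ[k] Z q)) (ddZ), ((mkComplex Z dZ ddZ).sc' p q r).g =
        ModuleCat.ofHom (dZ q r h') := fun Z _ _ dZ ddZ => dif_pos _
    rw [e₁, e₁, e₂, e₂]
    rfl
  rw [quasiIso_iff]
  constructor
  · intro H o p q r ho h h' x y hx hxy
    obtain ⟨x', rfl⟩ := ((key h h').1 (H q)).1 x hx y hxy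
    obtain ⟨z, y', hz, hy⟩ := ((key ho h).1 (H p)).2 (y - f p x') (by
      rw [map_sub, ← hxy, ← hf, sub_self])
    refine ⟨x' + z, y', by rw [map_add, hz, add_zero], ?_⟩
    rw [map_add, add_assoc, ← hy, add_sub_cancel]
  · intro H q
    refine (key (sub_add_cancel q 1) rfl).2 ⟨fun x hx y hxy => ?_, fun y hy => ?_⟩
    · obtain ⟨x', -, hx', -⟩ := H (sub_add_cancel _ 1) (sub_add_cancel q 1) rfl x y hx hxy
      exact ⟨x', hx'⟩
    · exact H (sub_add_cancel q 1) rfl rfl 0 y (map_zero _) (by rw [map_zero, hy])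

lemma acyclic_mkComplex_iff {X : ℤ → Type v} [∀ n, AddCommGroup (X n)] [∀ n, Module k (X n)]
    {d : ∀ p q : ℤ, p + 1 = q → (X p →ₗ[k] X q)} {dd} :
    (mkComplex X d dd).Acyclic ↔ ∀ ⦃p q r : ℤ⦄ (h : p + 1 = q) (h' : q + 1 = r) (x : X q),
      d q r h' x = 0 → ∃ y, d p q h y = x := by
  have key : ∀ {p q r : ℤ} (h : p + 1 = q) (h' : q + 1 = r),
      (mkComplex X d dd).ExactAt q ↔ ∀ x : X q, d q r h' x = 0 → ∃ y, d p q h y = x := by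
    intro p q r h h'
    rw [HomologicalComplex.exactAt_iff' _ p q r (by simp; omega) (by simp; omega),
      ShortComplex.moduleCat_exact_iff]
    have e₁ : ((mkComplex X d dd).sc' p q r).f = ModuleCat.ofHom (d p q h) := dif_pos _
    have e₂ : ((mkComplex X d dd).sc' p q r).g = ModuleCat.ofHom (d q r h') := dif_pos _
    rw [e₁, e₂]
    rfl
  exact ⟨fun H p q r h h' => (key h h').1 (H q), fun H q =>
    (key (sub_add_cancel q 1) rfl).2 (H _ _)⟩

end quasiIso

section ho

variable {k : Type w} [CommRing k] {A : DGCategory.{w, v, u} k} {B : DGCategory.{w, v₂, u₂} k}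

/-- The morphism of the homotopy category given by a closed morphism of degree zero. -/
abbrev Ho.mk {X Y : A.Ob} (f : A.Hom X Y 0) (hf : A.d 0 1 (zero_add 1) f = 0) :
    Ho.of X ⟶ Ho.of Y :=
  (Quotient.functor (homotopic A)).map (X := ⟨X⟩) (Y := ⟨Y⟩) ⟨f, hf⟩

lemma Ho.mk_eq_iff {X Y : A.Ob} {f g : A.Hom X Y 0} (hf : A.d 0 1 (zero_add 1) f = 0)
    (hg : A.d 0 1 (zero_add 1) g = 0) :
    Ho.mk f hf = Ho.mk g hg ↔ ∃ h : A.Hom X Y (-1), A.d (-1) 0 (neg_add_cancel 1) h = f - g :=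
  Quotient.functor_map_eq_iff (homotopic A) (X := ⟨X⟩) (Y := ⟨Y⟩) ⟨f, hf⟩ ⟨g, hg⟩

lemma Ho.mk_surj {X Y : A.Ob} (φ : Ho.of X ⟶ Ho.of Y) : ∃ f hf, φ = Ho.mk f hf := by
  obtain ⟨f, rfl⟩ := Quot.exists_rep φ
  exact ⟨f.1, f.2, rfl⟩

lemma closed_comp {X Y Z : A.Ob} {f : A.Hom X Y 0} (hf : A.d 0 1 (zero_add 1) f = 0)
    {g : A.Hom Y Z 0} (hg : A.d 0 1 (zero_add 1) g = 0) :
    A.d 0 1 (zero_add 1) (A.comp (add_zero 0) g f) = 0 := by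
  rw [d_comp_left (zero_add 1) hg _ _ (zero_add 1) (zero_add 1), hf, map_zero, smul_zero]

lemma Ho.mk_comp {X Y Z : A.Ob} {f : A.Hom X Y 0} (hf : A.d 0 1 (zero_add 1) f = 0)
    {g : A.Hom Y Z 0} (hg : A.d 0 1 (zero_add 1) g = 0) :
    Ho.mk f hf ≫ Ho.mk g hg = Ho.mk (A.comp (add_zero 0) g f) (closed_comp hf hg) :=
  ((Quotient.functor (homotopic A)).map_comp (X := ⟨X⟩) (Y := ⟨Y⟩) (Z := ⟨Z⟩) ⟨f, hf⟩ ⟨g, hg⟩).symm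

lemma Ho.mk_one (X : A.Ob) : Ho.mk (A.one X) (A.d_one X 1 (zero_add 1)) = 𝟙 (Ho.of X) := rfl

lemma Ho.map_mk (F : DGFunctor A B) {X Y : A.Ob} (f : A.Hom X Y 0)
    (hf : A.d 0 1 (zero_add 1) f = 0) :
    (Ho.map F).map (Ho.mk f hf) = Ho.mk (F.map 0 f) (by rw [← F.map_d, hf, map_zero]) := rfl

lemma isQis_of_isIso (L : LeftModule.{w, v, v₁, u} A) {X Y : A.Ob} {f : A.Hom X Y 0}
    (hf : A.d 0 1 (zero_add 1) f = 0) (h : IsIso (Ho.mk f hf)) : L.IsQis f := by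
  obtain ⟨g, hg, hgf⟩ := Ho.mk_surj (inv (Ho.mk f hf))
  have h₁ := IsIso.hom_inv_id (Ho.mk f hf)
  have h₂ := IsIso.inv_hom_id (Ho.mk f hf)
  rw [hgf, Ho.mk_comp, ← Ho.mk_one, eq_comm, Ho.mk_eq_iff] at h₁ h₂
  obtain ⟨e, he⟩ := h₁
  obtain ⟨e', he'⟩ := h₂
  exact LeftModule.IsQis.of_homotopyEquiv hf hg e e' he he'

lemma isIso_of_isQis {X Y : A.Ob} {f : A.Hom X Y 0} (hf : A.d 0 1 (zero_add 1) f = 0)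
    (hX : (LeftModule.hom A X).IsQis f) (hY : (LeftModule.hom A Y).IsQis f) :
    IsIso (Ho.mk f hf) := by
  obtain ⟨g, e, hg, he⟩ := hY (o := -1) (p := 0) (q := 1) (r := 2) (by omega) (by omega) (by omega)
    0 (A.one Y) (map_zero _) (by rw [map_zero, A.d_one])
  obtain ⟨e', -, he', -⟩ := hX (o := -2) (p := -1) (q := 0) (r := 1) (by omega) (by omega)
    (by omega) (A.comp (add_zero 0) g f - A.one X) (- A.comp (add_zero (-1)) e f) (by
      rw [map_sub, A.d_one, sub_zero]
      exact closed_comp hf hg) (by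
      change A.comp _ f _ = _
      rw [map_sub, ← A.assoc (add_zero 0) (add_zero 0) _ _, map_neg,
        d_comp_right (zero_add 1) hf _ _ (by omega) (add_zero 0), eq_sub_of_add_eq' he.symm, map_sub,
        LinearMap.sub_apply, A.one_comp, A.comp_one, neg_sub])
  refine ⟨Ho.mk g hg, ?_, ?_⟩
  · rw [Ho.mk_comp, ← Ho.mk_one, Ho.mk_eq_iff]
    exact ⟨e', he'⟩
  · rw [Ho.mk_comp, ← Ho.mk_one, eq_comm, Ho.mk_eq_iff]
    exact ⟨e, eq_sub_of_add_eq' he.symm⟩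

lemma isAcyclic_iff_of_iso (L : LeftModule.{w, v, v₁, u} A) {X Y : A.Ob}
    (e : Ho.of X ≅ Ho.of Y) : L.IsAcyclic X ↔ L.IsAcyclic Y := by
  obtain ⟨f, hf, hfe⟩ := Ho.mk_surj e.hom
  have : L.IsQis f := isQis_of_isIso L hf (by rw [← hfe]; infer_instance)
  exact ⟨fun h => h.of_isQis' hf this, fun h => h.of_isQis hf this⟩

/-- The identity is a coboundary. -/
def Contractible (A : DGCategory.{w, v, u} k) (X : A.Ob) : Prop :=
  ∃ h : A.Hom X X (-1), A.d (-1) 0 (neg_add_cancel 1) h = A.one X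

lemma Contractible.isAcyclic {X : A.Ob} (hX : Contractible A X) (L : LeftModule.{w, v, v₁, u} A) :
    L.IsAcyclic X := by
  obtain ⟨e, he⟩ := hX
  intro p q r h h' x hx
  refine ⟨L.act (by omega) e x, ?_⟩
  rw [L.leibniz (q' := 0) (p' := r) _ _ (neg_add_cancel 1) h' (zero_add q) (by omega), he, L.one_act,
    hx, map_zero, smul_zero, add_zero]

lemma contractible_of_isAcyclic {X : A.Ob} (h : (LeftModule.hom A X).IsAcyclic X) :
    Contractible A X :=
  h (neg_add_cancel 1) (zero_add 1) (A.one X) (A.d_one _ _ _)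

lemma contractible_iff_of_iso {X Y : A.Ob} (e : Ho.of X ≅ Ho.of Y) :
    Contractible A X ↔ Contractible A Y :=
  ⟨fun h => contractible_of_isAcyclic ((isAcyclic_iff_of_iso _ e).1 (h.isAcyclic _)),
    fun h => contractible_of_isAcyclic ((isAcyclic_iff_of_iso _ e).2 (h.isAcyclic _))⟩

lemma Contractible.map {X : A.Ob} (h : Contractible A X) (F : DGFunctor A B) :
    Contractible B (F.obj X) := by
  obtain ⟨e, he⟩ := h
  exact ⟨F.map _ e, by rw [← F.map_d, he, F.map_one]⟩

/-- The extension given by a cone. -/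
def ConeData.ext {X Y C : A.Ob} {f : A.Hom X Y 0} (c : ConeData f C) : Ext (-1) 1 0 0 f C where
  ha := add_neg_cancel 1
  hb := add_zero 0
  hm := by omega
  i₁ := c.inl
  p₁ := c.fst
  i₂ := c.inr
  p₂ := c.snd
  p₁_i₁ := c.fst_inl
  p₂_i₂ := c.snd_inr
  p₁_i₂ := c.fst_inr
  p₂_i₁ := c.snd_inl
  total := c.total
  d_i₂ := c.d_inr
  d_i₁ := c.d_inl

namespace Ext

variable {X Y X' Y' C D : A.Ob} {a a' b b' m : ℤ} {f : A.Hom X Y m} {g : A.Hom X' Y' m}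

/-- The cone given by an extension. -/
def coneData {f : A.Hom X Y 0} (c : Ext (-1) 1 0 0 f C) : ConeData f C where
  inl := c.i₁
  fst := c.p₁
  inr := c.i₂
  snd := c.p₂
  fst_inl := c.p₁_i₁
  snd_inr := c.p₂_i₂
  fst_inr := c.p₁_i₂
  snd_inl := c.p₂_i₁
  total := c.total
  d_inr := c.d_i₂
  d_inl := c.d_i₁

/-- The image of an extension under a DG functor. -/
def mapDG (c : Ext a a' b b' f C) (F : DGFunctor A B) :
    Ext a a' b b' (F.map m f) (F.obj C) where
  ha := c.ha
  hb := c.hb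
  hm := c.hm
  i₁ := F.map _ c.i₁
  p₁ := F.map _ c.p₁
  i₂ := F.map _ c.i₂
  p₂ := F.map _ c.p₂
  p₁_i₁ := by rw [← F.map_comp, c.p₁_i₁, F.map_one]
  p₂_i₂ := by rw [← F.map_comp, c.p₂_i₂, F.map_one]
  p₁_i₂ := by rw [← F.map_comp, c.p₁_i₂, map_zero]
  p₂_i₁ := by rw [← F.map_comp, c.p₂_i₁, map_zero]
  total := by rw [← F.map_comp, ← F.map_comp, ← map_add, c.total, F.map_one]
  d_i₂ := by rw [← F.map_d, c.d_i₂, map_zero]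
  d_i₁ := by rw [← F.map_d, c.d_i₁, F.map_comp]

lemma contractible (c : Ext a a' b b' f C) (hX : Contractible A X) (hY : Contractible A Y) :
    Contractible A C :=
  contractible_of_isAcyclic (c.isAcyclic (hX.isAcyclic _) (hY.isAcyclic _))

/-- Extensions of homotopy equivalent data are homotopy equivalent. -/
lemma nonempty_iso (c : Ext a a' b b' f C) (c' : Ext a a' b b' g D) {u' : A.Hom X X' 0}
    {v' : A.Hom Y Y' 0} {l : ℤ} (hl : l + 1 = m) (e : A.Hom X Y' l)
    (hu : A.d 0 1 (zero_add 1) u' = 0) (hv : A.d 0 1 (zero_add 1) v' = 0)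
    (he : A.d l m hl e = A.comp (zero_add m) v' f - A.comp (add_zero m) g u')
    (hu' : IsIso (Ho.mk u' hu)) (hv' : IsIso (Ho.mk v' hv)) :
    Nonempty (Ho.of C ≅ Ho.of D) := by
  have hw := d_map c c' e hl hu hv he
  have : IsIso (Ho.mk _ hw) := isIso_of_isQis hw
    (c.isQis_map c' e hl hu hv he (isQis_of_isIso _ hu hu') (isQis_of_isIso _ hv hv'))
    (c.isQis_map c' e hl hu hv he (isQis_of_isIso _ hu hu') (isQis_of_isIso _ hv hv'))
  exact ⟨asIso (Ho.mk _ hw)⟩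

variable {L : LeftModule.{w, v, v₁, u} A}

/-- A map acts as a quasi-isomorphism if and only if its cone is acyclic. -/
lemma isQis_of_isAcyclic {f : A.Hom X Y 0} (c : Ext (-1) 1 0 0 f C) (h : L.IsAcyclic C) :
    L.IsQis f := by
  intro o p q r ho hp hq x y hx hxy
  obtain ⟨z, hz⟩ := h ho hp (L.act (by omega) c.i₁ x - L.act (zero_add p) c.i₂ y) (by
    have := LeftModule.d_act_of_closed (L := L) rfl c.d_i₂ (zero_add p) hp hp (by omega) y
    rw [map_sub, L.leibniz (q' := -1 + 1) (p' := r) _ _ rfl hq (by omega) (by omega), hx, map_zero,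
      smul_zero, add_zero, c.d_i₁, L.comp_act c.hm (by omega) (zero_add q) (by omega), hxy, this,
      sgn_zero, one_smul, sub_self])
  have h₁ := LeftModule.d_act_of_closed (L := L) rfl (c.d_p₁ _ rfl) (by omega : 1 + o = p) ho hp
    (by omega) z
  have h₂ := L.leibniz (q' := 0 + 1) (p' := p) (zero_add o) ho rfl ho (by omega) (zero_add p) c.p₂ z
  rw [hz, map_sub, ← L.comp_act c.ha (zero_add q) _ _, ← L.comp_act (rfl : (1 : ℤ) + 0 = 1 + 0)
    (by omega) _ _, c.p₁_i₁, c.p₁_i₂, L.one_act, map_zero, LinearMap.zero_apply, sub_zero, sgn_one,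
    neg_smul, one_smul] at h₁
  rw [hz, map_sub, ← L.comp_act c.hb (zero_add p) _ _, ← L.comp_act (rfl : (0 : ℤ) + -1 = 0 + -1)
    (by omega) _ _, c.p₂_i₁, c.p₂_i₂, L.one_act, map_zero, LinearMap.zero_apply, zero_sub,
    c.d_p₂ _ rfl (by omega), sgn_zero, one_smul, neg_smul, one_smul, map_neg, LinearMap.neg_apply,
    L.comp_act (by omega) (by omega) (by omega : 1 + o = p) (zero_add p)] at h₂
  refine ⟨-L.act (by omega) c.p₁ z, -L.act (by omega) c.p₂ z, ?_, ?_⟩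
  · rw [map_neg, h₁, neg_neg]
  · rw [map_neg, map_neg, h₂]
    abel

lemma isAcyclic_of_isQis {f : A.Hom X Y 0} (c : Ext (-1) 1 0 0 f C) (h : L.IsQis f) :
    L.IsAcyclic C := by
  intro p q r hp hq x hx
  have h₁ := LeftModule.d_act_of_closed (L := L) rfl (c.d_p₁ _ rfl) (by omega : 1 + q = r) hq rfl
    (by omega : 1 + r = r + 1) x
  have h₂ := L.leibniz (q' := 0 + 1) (p' := r) (zero_add q) hq rfl hq (by omega) (zero_add r) c.p₂ x
  rw [hx, map_zero, smul_zero] at h₁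
  rw [hx, map_zero, smul_zero, add_zero, c.d_p₂ _ rfl (by omega), sgn_zero, neg_smul, one_smul,
    map_neg, LinearMap.neg_apply,
    L.comp_act (by omega) (by omega) (by omega : 1 + q = r) (zero_add r)] at h₂
  obtain ⟨x', y', hx', hy'⟩ := h hp hq rfl _ (-L.act (zero_add q) c.p₂ x) h₁ (by
    rw [map_neg, h₂, neg_neg])
  refine ⟨-(L.act (by omega) c.i₁ x' + L.act (zero_add p) c.i₂ y'), ?_⟩
  rw [map_neg, map_add, LeftModule.d_act_zero c.d_i₂, L.leibniz (q' := -1 + 1) (p' := r) _ _ rfl hq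
    (by omega) (by omega), hx', c.d_i₁, L.comp_act c.hm (by omega) (zero_add q) (by omega),
    sgn_neg_one, neg_smul, one_smul, neg_add, neg_add, neg_neg, add_right_comm, ← neg_add, ← map_add,
    ← hy', map_neg, neg_neg, ← L.comp_act (neg_add_cancel 1) (zero_add q) _ _,
    ← L.comp_act (add_zero 0) (zero_add q) _ _, ← LinearMap.add_apply, ← map_add, add_comm, c.total, L.one_act]

end Ext

/-- The object `X'` is the shift of `X` by `r`. -/
structure ShiftData (A : DGCategory.{w, v, u} k) (r r' : ℤ) (X X' : A.Ob) where
  h : r' + r = 0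
  i : A.Hom X X' r
  p : A.Hom X' X r'
  p_i : A.comp h p i = A.one X
  i_p : A.comp ((add_comm r r').trans h) i p = A.one X'
  d_i : A.d r (r + 1) rfl i = 0
  d_p : A.d r' (r' + 1) rfl p = 0

namespace ShiftData

variable {X X' Y C : A.Ob} {r r' : ℤ}

/-- The shift in the dual DG category. -/
def op (s : ShiftData A r r' X X') : ShiftData A.op r' r X X' where
  h := (add_comm r r').trans s.h
  i := s.p
  p := sgn (r * r') • s.i
  p_i := by
    simp only [LinearMap.smul_apply, LinearMap.flip_apply, map_zsmul, smul_smul, s.p_i,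
      sgn_mul_self, one_smul]
  i_p := by
    simp only [LinearMap.smul_apply, LinearMap.flip_apply, map_zsmul, smul_smul, s.i_p,
      mul_comm r' r, sgn_mul_self, one_smul]
  d_i := s.d_p
  d_p := by simp only [map_zsmul]; rw [s.d_i, smul_zero]

/-- The image of a shift under a DG functor. -/
def map (s : ShiftData A r r' X X') (F : DGFunctor A B) :
    ShiftData B r r' (F.obj X) (F.obj X') where
  h := s.h
  i := F.map _ s.i
  p := F.map _ s.p
  p_i := by rw [← F.map_comp, s.p_i, F.map_one]
  i_p := by rw [← F.map_comp, s.i_p, F.map_one]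
  d_i := by rw [← F.map_d, s.d_i, map_zero]
  d_p := by rw [← F.map_d, s.d_p, map_zero]

lemma isAcyclic_iff (s : ShiftData A r r' X X') (L : LeftModule.{w, v, v₁, u} A) :
    L.IsAcyclic X' ↔ L.IsAcyclic X := by
  have := s.h
  constructor
  · intro H p q n hp hq x hx
    obtain ⟨y, hy⟩ := H (p := r + p) (r := r + n) (by omega) (by omega) (L.act (rfl : r + q = r + q) s.i x) (by
      rw [LeftModule.d_act_of_closed rfl s.d_i _ hq (by omega) rfl, hx, map_zero, smul_zero])
    refine ⟨sgn r' • L.act (by omega : r' + (r + p) = p) s.p y, ?_⟩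
    rw [map_zsmul, LeftModule.d_act_of_closed rfl s.d_p _ (by omega : r + p + 1 = r + q) hp (by omega), hy,
      ← L.comp_act s.h (zero_add q) _ _, s.p_i, L.one_act, sgn_smul_sgn_smul]
  · intro H p q n hp hq x hx
    obtain ⟨y, hy⟩ := H (p := r' + p) (r := r' + n) (by omega) (by omega) (L.act (rfl : r' + q = r' + q) s.p x) (by
      rw [LeftModule.d_act_of_closed rfl s.d_p _ hq (by omega) rfl, hx, map_zero, smul_zero])
    refine ⟨sgn r • L.act (by omega : r + (r' + p) = p) s.i y, ?_⟩
    rw [map_zsmul, LeftModule.d_act_of_closed rfl s.d_i _ (by omega : r' + p + 1 = r' + q) hp (by omega), hy,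
      ← L.comp_act ((add_comm r r').trans s.h) (zero_add q) _ _, s.i_p, L.one_act, sgn_smul_sgn_smul]

/-- An extension given by a morphism of any degree is an extension by the shift of the source. -/
def ext {l : ℤ} {f : A.Hom X Y l} (s : ShiftData A r r' X X') (hl : l = r + 1) (h : l + r' = 1)
    (c : Ext 0 0 0 0 (A.comp h f s.p) C) : Ext r r' 0 0 f C where
  ha := s.h
  hb := by omega
  hm := by omega
  i₁ := A.comp (by omega) c.i₁ s.i
  p₁ := A.comp (by omega) s.p c.p₁
  i₂ := c.i₂
  p₂ := c.p₂
  p₁_i₁ := by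
    rw [A.assoc _ _ (zero_add r) (by have := s.h; omega), ← A.assoc (add_zero 0) (zero_add r) _ _,
      c.p₁_i₁, A.one_comp, s.p_i]
  p₂_i₂ := c.p₂_i₂
  p₁_i₂ := by rw [A.assoc _ _ (add_zero 0) (by omega), c.p₁_i₂', map_zero]
  p₂_i₁ := by
    rw [← A.assoc (add_zero 0) (by omega) _ _, c.p₂_i₁', map_zero, LinearMap.zero_apply]
  total := by
    have := s.h
    rw [A.assoc _ _ (by omega : r + r' = 0) (add_zero 0), ← A.assoc (by omega : r + r' = 0)
      (zero_add 0) _ _, s.i_p, A.one_comp, c.total]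
  d_i₂ := c.d_i₂
  d_i₁ := by
    have := s.h
    rw [d_comp_right _ s.d_i _ _ (zero_add 1) (by omega),
      show A.d 0 1 (zero_add 1) c.i₁ = _ from c.d_i₁,
      A.assoc _ _ (by omega : 1 + r = l) (by omega), A.assoc _ _ s.h (by omega), s.p_i, A.comp_one]

end ShiftData

end ho

section rightModules

variable {k : Type u} [CommRing k] {A : DGCategory.{u, u, u} k}

/-- Evaluation of right modules at an object. -/
abbrev evalMod (Y : A.Ob) : LeftModule.{u, u, u, u + 1} (rightMod A) where
  X M n := M.X Y n
  d {M} p q h := M.d p q h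
  act {M N q p r} h := LinearMap.mk₂ k (fun f m => app f.1 Y p r ((add_comm p q).trans h) m)
    (fun f g m => rfl) (fun c f m => rfl) (fun f m m' => map_add _ _ _)
    (fun c f m => map_smul _ _ _)
  d_d {M} p q r h h' m := M.d_d p q r h h' m
  one_act {M p} h m := familyOne_apply M Y p _ m
  comp_act h₁ h₂ h₃ h₄ f g m := familyComp_apply h₁ f.1 g.1 Y _ _ (by omega) m
  leibniz {M N p p' q q' r r'} h hr hq hp h₁ h₂ f m := by
    simp only [LinearMap.mk₂_apply]
    change _ = app (familyD q q' hq f.1) Y p r' _ m + _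
    rw [familyD_apply hq f.1 Y _ (by omega : p + q = r) hr hp (by omega), sub_add_cancel]

lemma isAcyclic_iff {M : RightModule A} : IsAcyclic M ↔ ∀ Y, (evalMod Y).IsAcyclic M :=
  forall_congr' fun _ => acyclic_mkComplex_iff

/-- Being a quasi-isomorphism, for a closed morphism of right modules. -/
def IsModQis {M N : RightModule A} (f : (rightMod A).Hom M N 0) : Prop :=
  ∀ Y, (evalMod Y).IsQis f

lemma app_d {M N : RightModule A} {l l' : ℤ} (h : l + 1 = l') (f : (rightMod A).Hom M N l) (Y : A.Ob)
    {p p₁ q₁ q : ℤ} (hq : p + l' = q) (h₁ : p + l = q₁) (h₂ : q₁ + 1 = q) (h₃ : p + 1 = p₁)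
    (h₄ : p₁ + l = q) (m : M.X Y p) :
    app ((rightMod A).d l l' h f).1 Y p q hq m =
      N.d q₁ q h₂ (app f.1 Y p q₁ h₁ m) - sgn l • app f.1 Y p₁ q h₄ (M.d p p₁ h₃ m) :=
  familyD_apply h f.1 Y hq h₁ h₂ h₃ h₄ m

lemma app_comp {M N L : RightModule A} {b a c : ℤ} (h : b + a = c) (g : (rightMod A).Hom N L b)
    (f : (rightMod A).Hom M N a) (Y : A.Ob) {p s q : ℤ} (hq : p + c = q) (hs : p + a = s)
    (hs' : s + b = q) (m : M.X Y p) :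
    app ((rightMod A).comp h g f).1 Y p q hq m = app g.1 Y s q hs' (app f.1 Y p s hs m) :=
  familyComp_apply h g.1 f.1 Y hq hs hs' m

lemma app_one {M : RightModule A} {Y : A.Ob} {p : ℤ} (h : p + 0 = p) (m : M.X Y p) :
    app ((rightMod A).one M).1 Y p p h m = m := rfl

/-- A morphism of right modules commutes, up to a sign, with the differential if it is closed. -/
lemma app_closed {M N : RightModule A} {l l' : ℤ} {h : l + 1 = l'} {f : (rightMod A).Hom M N l}
    (hf : (rightMod A).d l l' h f = 0) (Y : A.Ob)
    {p p₁ q₁ q : ℤ} (h₁ : p + l = q₁) (h₂ : q₁ + 1 = q) (h₃ : p + 1 = p₁)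
    (h₄ : p₁ + l = q) (m : M.X Y p) :
    N.d q₁ q h₂ (app f.1 Y p q₁ h₁ m) = sgn l • app f.1 Y p₁ q h₄ (M.d p p₁ h₃ m) := by
  have := app_d h f Y (by omega) h₁ h₂ h₃ h₄ m
  rw [hf] at this
  exact (sub_eq_zero.1 this.symm)

/-- Homogeneous generators of a right module which freely generate it when the differential is
disregarded, such that the differential of a generator involves only generators of smaller rank. -/
structure Cells (M : RightModule A) where
  G : Type u
  x : G → A.Ob
  n : G → ℤ
  e : ∀ g, M.X (x g) (n g)
  bij : ∀ Z p, Function.Bijective (combination M e Z p)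
  rank : G → ℕ
  rank_lt : ∀ g a, combination M e (x g) (n g + 1) a = M.d (n g) (n g + 1) rfl (e g) →
    ∀ g', a g' ≠ 0 → rank g' < rank g

namespace Cells

variable {M N : RightModule A} (c : Cells M)

/-- The coefficients of an element. -/
def coeffs (Z : A.Ob) (p : ℤ) :
    M.X Z p ≃ₗ[k] DirectSum c.G fun g => A.Hom Z (c.x g) (p - c.n g) :=
  (LinearEquiv.ofBijective _ (c.bij Z p)).symm

lemma coeffs_combination {Z : A.Ob} {p : ℤ} (a) : c.coeffs Z p (combination M c.e Z p a) = a :=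
  (LinearEquiv.ofBijective _ (c.bij Z p)).symm_apply_apply a

lemma combination_coeffs {Z : A.Ob} {p : ℤ} (m) : combination M c.e Z p (c.coeffs Z p m) = m :=
  (LinearEquiv.ofBijective _ (c.bij Z p)).apply_symm_apply m

lemma coeffs_act_e [DecidableEq c.G] {Z : A.Ob} {p : ℤ} (g : c.G) (f : A.Hom Z (c.x g) (p - c.n g)) :
    c.coeffs Z p (M.act (add_sub_cancel _ _) (c.e g) f) =
      DirectSum.lof k c.G (fun g => A.Hom Z (c.x g) (p - c.n g)) g f := by
  rw [← combination_lof M c.e g f, coeffs_combination]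

lemma coeffs_e_eq_zero {g g' : c.G} (h : g' ≠ g) : c.coeffs _ _ (c.e g) g' = 0 := by
  classical
  have h' : ∀ (j : ℤ) (hj : j = 0) (hh : c.n g + j = c.n g),
      M.act hh (c.e g) (A.oneOf (c.x g) hj) = c.e g := by
    rintro j rfl hh
    exact M.act_one hh _
  have := c.coeffs_act_e g (A.oneOf (c.x g) (sub_self (c.n g)))
  rw [h' _ (sub_self _)] at this
  rw [this]
  exact (DirectSum.component.of k (M := fun g' => A.Hom (c.x g) (c.x g') (c.n g - c.n g'))
    g' g _).trans (dif_neg h.symm)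

lemma rank_lt' {g g' : c.G} (h : c.coeffs _ _ (M.d (c.n g) (c.n g + 1) rfl (c.e g)) g' ≠ 0) :
    c.rank g' < c.rank g :=
  c.rank_lt g _ (c.combination_coeffs _) g' h

lemma linearMap_ext {Z : A.Ob} {p : ℤ} {V : Type*} [AddCommGroup V] [Module k V]
    {φ ψ : M.X Z p →ₗ[k] V}
    (h : ∀ (g : c.G) (f : A.Hom Z (c.x g) (p - c.n g)),
      φ (M.act (add_sub_cancel _ _) (c.e g) f) = ψ (M.act (add_sub_cancel _ _) (c.e g) f)) :
    φ = ψ := by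
  classical
  have : φ.comp (combination M c.e Z p) = ψ.comp (combination M c.e Z p) :=
    DirectSum.linearMap_ext k fun g => LinearMap.ext fun f => by
      simp only [LinearMap.comp_apply, combination_lof, h]
  ext m
  obtain ⟨a, rfl⟩ := (c.bij Z p).2 m
  exact LinearMap.congr_fun this a

/-- Linear maps which agree on the generators involved in `m` agree on `m`. -/
lemma linearMap_congr {Z : A.Ob} {p : ℤ} {V : Type*} [AddCommGroup V] [Module k V]
    {φ ψ : M.X Z p →ₗ[k] V} (m : M.X Z p)
    (h : ∀ (g : c.G) (f : A.Hom Z (c.x g) (p - c.n g)), c.coeffs Z p m g ≠ 0 →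
      φ (M.act (add_sub_cancel _ _) (c.e g) f) = ψ (M.act (add_sub_cancel _ _) (c.e g) f)) :
    φ m = ψ m := by
  classical
  rw [← c.combination_coeffs m, ← DirectSum.sum_support_of (c.coeffs Z p m), map_sum, map_sum,
    map_sum]
  refine Finset.sum_congr rfl fun g hg => ?_
  have := combination_lof M c.e (Z := Z) (p := p) g (c.coeffs Z p m g)
  rw [DirectSum.lof_eq_of] at this
  rw [this]
  exact h g _ (by simpa using hg)

/-- The morphism of degree `l` with given values on the generators. -/
def lift {l : ℤ} (v : ∀ g, N.X (c.x g) (c.n g + l)) : (rightMod A).Hom M N l :=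
  letI := Classical.decEq c.G
  ⟨fun Z t => (DirectSum.toModule k c.G (N.X Z t.1.2)
    (fun g => N.act (by have := t.2; omega : c.n g + l + (t.1.1 - c.n g) = t.1.2) (v g))).comp
      (c.coeffs Z t.1.1).toLinearMap, ⟨fun {Y Z p p' a q q'} hp hq h h' m f => by
    classical
    refine LinearMap.congr_fun (c.linearMap_ext
      (φ := (DirectSum.toModule k c.G (N.X Z q')
        (fun g => N.act (by omega : c.n g + l + (q - c.n g) = q') (v g))).comp
          ((c.coeffs Z q).toLinearMap.comp ((M.act h).flip f)))
      (ψ := ((N.act h').flip f).comp ((DirectSum.toModule k c.G (N.X Y p')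
        (fun g => N.act (by omega : c.n g + l + (p - c.n g) = p') (v g))).comp
          (c.coeffs Y p).toLinearMap)) fun g f' => ?_) m
    simp only [LinearMap.comp_apply, LinearMap.flip_apply, LinearEquiv.coe_coe]
    rw [M.act_comp (add_sub_cancel _ _) h (by omega : _ = q - c.n g) (add_sub_cancel _ _),
      coeffs_act_e, coeffs_act_e, DirectSum.toModule_lof, DirectSum.toModule_lof,
      N.act_comp _ h' (by omega : _ = q - c.n g)]⟩⟩

lemma lift_act {l : ℤ} (v : ∀ g, N.X (c.x g) (c.n g + l)) (g : c.G) {Z : A.Ob} {a p q : ℤ}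
    (h : c.n g + a = p) (hq : p + l = q) (h' : c.n g + l + a = q) (f : A.Hom Z (c.x g) a) :
    app (c.lift v).1 Z p q hq (M.act h (c.e g) f) = N.act h' (v g) f := by
  classical
  obtain rfl : a = p - c.n g := by omega
  change DirectSum.toModule k c.G _ _ (c.coeffs _ _ _) = _
  rw [coeffs_act_e]
  exact DirectSum.toModule_lof ..

lemma lift_e {l : ℤ} (v : ∀ g, N.X (c.x g) (c.n g + l)) (g : c.G) :
    app (c.lift v).1 (c.x g) (c.n g) (c.n g + l) rfl (c.e g) = v g := by
  have := c.lift_act v g (add_zero _) rfl (add_zero _) (A.one _)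
  rwa [M.act_one, N.act_one] at this

lemma hom_ext {l : ℤ} {f f' : (rightMod A).Hom M N l}
    (h : ∀ g, app f.1 (c.x g) (c.n g) (c.n g + l) rfl (c.e g) =
      app f'.1 (c.x g) (c.n g) (c.n g + l) rfl (c.e g)) : f = f' := by
  refine family_ext fun Z p q hq m => LinearMap.congr_fun (c.linearMap_ext fun g a => ?_) m
  rw [f.2.app_act rfl hq _ (by omega), f'.2.app_act rfl hq _ (by omega), h]

end Cells

/-- Morphisms from a semi-free module to an acyclic module form an acyclic complex. -/
lemma Cells.isAcyclic_hom {M N : RightModule A} (c : Cells M) (hN : ∀ Y, (evalMod Y).IsAcyclic N) :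
    (LeftModule.hom (rightMod A) M).IsAcyclic N := by
  classical
  intro p q r hp hq f hf
  let cut (g : c.G) (ih : ∀ g', c.rank g' < c.rank g → N.X (c.x g') (c.n g' + p)) (g' : c.G) :
      N.X (c.x g') (c.n g' + p) := if h : c.rank g' < c.rank g then ih g' h else 0
  let rhs (g : c.G) (ih : ∀ g', c.rank g' < c.rank g → N.X (c.x g') (c.n g' + p)) :
      N.X (c.x g) (c.n g + q) := app f.1 _ _ _ rfl (c.e g) +
        sgn p • app (c.lift (cut g ih)).1 _ _ _ (by omega) (M.d (c.n g) (c.n g + 1) rfl (c.e g))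
  let y : ∀ g, N.X (c.x g) (c.n g + p) := WellFounded.fix (measure c.rank).wf fun g ih =>
    if h : ∃ z, N.d (c.n g + p) (c.n g + q) (by omega) z = rhs g ih then h.choose else 0
  have hy : ∀ g, (∃ z, N.d (c.n g + p) (c.n g + q) (by omega) z = rhs g fun g' _ => y g') →
      N.d (c.n g + p) (c.n g + q) (by omega) (y g) = rhs g fun g' _ => y g' := by
    intro g h
    have : y g = h.choose := (WellFounded.fix_eq _ _ _).trans (dif_pos h)
    rw [this]
    exact h.choose_spec
  have hcut : ∀ g, rhs g (fun g' _ => y g') = app f.1 _ _ _ rfl (c.e g) +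
        sgn p • app (c.lift y).1 _ _ _ (by omega) (M.d (c.n g) (c.n g + 1) rfl (c.e g)) := by
    intro g
    simp only [rhs]
    congr 2
    refine c.linearMap_congr _ fun g' a hg' => ?_
    rw [c.lift_act _ _ _ _ (by omega), c.lift_act _ _ _ _ (by omega)]
    simp only [cut]
    rw [dif_pos (c.rank_lt' hg')]
  have hd : ∀ g, (∃ z, N.d (c.n g + p) (c.n g + q) (by omega) z = rhs g fun g' _ => y g') →
      app ((rightMod A).d p q hp (c.lift y)).1 _ (c.n g) _ rfl (c.e g) =
        app f.1 _ _ _ rfl (c.e g) := by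
    intro g h
    rw [app_d hp _ _ _ rfl (by omega) rfl (by omega), lift_e, hy g h, hcut, add_sub_cancel_right]
  have key : ∀ (i : ℕ) g, c.rank g < i →
      ∃ z, N.d (c.n g + p) (c.n g + q) (by omega) z = rhs g fun g' _ => y g' := by
    intro i
    induction i with
    | zero => intro g hg; omega
    | succ i ih =>
      intro g hg
      refine hN (c.x g) (by omega) (by omega : c.n g + q + 1 = c.n g + r) _ ?_
      have h₂ : app ((rightMod A).d p q hp (c.lift y)).1 (c.x g) (c.n g + 1) (c.n g + r) (by omega)
          (M.d (c.n g) (c.n g + 1) rfl (c.e g)) = app f.1 _ _ _ (by omega)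
          (M.d (c.n g) (c.n g + 1) rfl (c.e g)) := by
        refine c.linearMap_congr _ fun g' a hg' => ?_
        have := c.rank_lt' hg'
        rw [f.2.app_act rfl _ _ (by omega),
          ((rightMod A).d p q hp (c.lift y)).2.app_act rfl _ _ (by omega), hd g' (ih g' (by omega))]
      rw [app_d hp _ _ _ (by omega : c.n g + 1 + p = c.n g + q) (by omega) rfl (by omega), M.d_d,
        map_zero, smul_zero, sub_zero] at h₂
      rw [hcut, map_add, map_zsmul]
      change N.d _ _ _ _ + _ • N.d _ _ _ _ = 0
      rw [h₂, app_closed hf _ _ _ rfl (by omega), ← add_smul,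
        show sgn q = -sgn p by rw [← hp, sgn_add, sgn_one, mul_neg_one], neg_add_cancel, zero_smul]
  exact ⟨c.lift y, c.hom_ext fun g => hd g (key _ g (Nat.lt_succ_self _))⟩

lemma coeff_combination {M : RightModule A} {G : Type u} {x : G → A.Ob} {n : G → ℤ}
    (e : ∀ g, M.X (x g) (n g)) (coeff : ∀ g Z p, M.X Z p →ₗ[k] A.Hom Z (x g) (p - n g))
    (coeff_self : ∀ g Z p f, coeff g Z p (M.act (add_sub_cancel (n g) p) (e g) f) = f)
    (coeff_ne : ∀ g g', g' ≠ g → ∀ Z p f, coeff g' Z p (M.act (add_sub_cancel (n g) p) (e g) f) = 0)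
    (Z : A.Ob) (p : ℤ) (a) (g : G) : coeff g Z p (combination M e Z p a) = a g := by
  classical
  refine LinearMap.congr_fun (f := (coeff g Z p).comp (combination M e Z p))
    (g := DirectSum.component k G (fun g => A.Hom Z (x g) (p - n g)) g)
    (DirectSum.linearMap_ext k fun g' => LinearMap.ext fun f => ?_) a
  simp only [LinearMap.comp_apply, combination_lof]
  by_cases h : g = g'
  · subst h
    rw [coeff_self, DirectSum.component.lof_self]
  · rw [coeff_ne _ _ h, DirectSum.component.of, dif_neg (Ne.symm h)]

/-- Constructor of cells from coefficient functionals. -/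
abbrev Cells.ofCoeff {M : RightModule A} {G : Type u} {x : G → A.Ob} {n : G → ℤ}
    (e : ∀ g, M.X (x g) (n g)) (coeff : ∀ g Z p, M.X Z p →ₗ[k] A.Hom Z (x g) (p - n g))
    (coeff_self : ∀ g Z p f, coeff g Z p (M.act (add_sub_cancel (n g) p) (e g) f) = f)
    (coeff_ne : ∀ g g', g' ≠ g → ∀ Z p f, coeff g' Z p (M.act (add_sub_cancel (n g) p) (e g) f) = 0)
    (span : ∀ Z p (S : Submodule k (M.X Z p)),
      (∀ g f, M.act (add_sub_cancel (n g) p) (e g) f ∈ S) → S = ⊤)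
    (rank : G → ℕ)
    (rank_lt : ∀ g g', coeff g' _ _ (M.d (n g) (n g + 1) rfl (e g)) ≠ 0 → rank g' < rank g) :
    Cells M where
  G := G
  x := x
  n := n
  e := e
  bij Z p := by
    classical
    refine ⟨fun a b h => DFinsupp.ext fun g => ?_, ?_⟩
    · rw [← coeff_combination e coeff coeff_self coeff_ne, h,
        coeff_combination e coeff coeff_self coeff_ne]
    · rw [← LinearMap.range_eq_top]
      refine span _ _ _ fun g f => ⟨DirectSum.lof k G (fun g => A.Hom Z (x g) (p - n g)) g f, ?_⟩
      exact combination_lof M e g f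
  rank := rank
  rank_lt g a ha g' hg' := rank_lt g g' (by
    rw [← ha, coeff_combination e coeff coeff_self coeff_ne]
    exact hg')

namespace Cells

variable {M N : RightModule A} (c : Cells M)

/-- The coefficient of a generator. -/
def coeff (g : c.G) (Z : A.Ob) (p : ℤ) : M.X Z p →ₗ[k] A.Hom Z (c.x g) (p - c.n g) :=
  (DirectSum.component k c.G (fun g => A.Hom Z (c.x g) (p - c.n g)) g).comp
    (c.coeffs Z p).toLinearMap

lemma coeff_self (g : c.G) (Z : A.Ob) (p : ℤ) (f : A.Hom Z (c.x g) (p - c.n g)) :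
    c.coeff g Z p (M.act (add_sub_cancel _ _) (c.e g) f) = f := by
  classical
  change c.coeffs _ _ _ g = f
  rw [coeffs_act_e]
  exact DirectSum.component.lof_self k (M := fun g => A.Hom Z (c.x g) (p - c.n g)) g f

lemma coeff_ne {g g' : c.G} (h : g' ≠ g) (Z : A.Ob) (p : ℤ) (f : A.Hom Z (c.x g) (p - c.n g)) :
    c.coeff g' Z p (M.act (add_sub_cancel _ _) (c.e g) f) = 0 := by
  classical
  change c.coeffs _ _ _ g' = 0
  rw [coeffs_act_e]
  exact (DirectSum.component.of k (M := fun g => A.Hom Z (c.x g) (p - c.n g)) g' g _).trans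
    (dif_neg h.symm)

lemma span (Z : A.Ob) (p : ℤ) (S : Submodule k (M.X Z p))
    (h : ∀ g f, M.act (add_sub_cancel (c.n g) p) (c.e g) f ∈ S) : S = ⊤ := by
  rw [← Submodule.ker_mkQ S, LinearMap.ker_eq_top]
  refine c.linearMap_ext fun g f => ?_
  exact (Submodule.Quotient.mk_eq_zero _).2 (h g f)

lemma coeff_act (g : c.G) {Z W : A.Ob} {p b q : ℤ} (h : p + b = q) (h' : p - c.n g + b = q - c.n g)
    (m : M.X Z p) (f : A.Hom W Z b) :
    c.coeff g W q (M.act h m f) = A.comp h' (c.coeff g Z p m) f := by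
  refine LinearMap.congr_fun (f := (c.coeff g W q).comp ((M.act h).flip f))
    (g := ((A.comp h').flip f).comp (c.coeff g Z p)) (c.linearMap_ext fun g' a => ?_) m
  simp only [LinearMap.comp_apply, LinearMap.flip_apply]
  rw [M.act_comp _ _ (by omega : _ = q - c.n g') (add_sub_cancel _ _)]
  by_cases hg : g = g'
  · subst hg
    rw [coeff_self, coeff_self]
  · rw [c.coeff_ne hg, c.coeff_ne hg, map_zero, LinearMap.zero_apply]

lemma coeff_d_e {g g' : c.G} (h : c.rank g ≤ c.rank g') :
    c.coeff g' _ _ (M.d (c.n g) (c.n g + 1) rfl (c.e g)) = 0 := by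
  by_contra h'
  have := c.rank_lt' h'
  omega

/-- The coefficients of the differential of an element. -/
lemma coeff_d_eq_zero {i : ℕ} {Z : A.Ob} {p q : ℤ} (hp : p + 1 = q) (m : M.X Z p)
    (hm : ∀ g, i ≤ c.rank g → c.coeff g Z p m = 0) (g : c.G) (hg : i ≤ c.rank g) :
    c.coeff g Z q (M.d p q hp m) = 0 := by
  have := c.linearMap_congr (φ := (c.coeff g Z q).comp (M.d p q hp)) (ψ := 0) m fun g' a hg' => ?_
  · exact this
  have hlt : c.rank g' < i := by
    by_contra h
    exact hg' (hm g' (not_lt.1 h))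
  rw [LinearMap.comp_apply, M.leibniz (q' := c.n g' + 1) (p' := q - c.n g') _ _ rfl (by omega) (by omega)
    (by omega), map_add, c.coeff_act g _ (by omega), c.coeff_d_e (by omega), map_zero,
    LinearMap.zero_apply, map_zsmul, c.coeff_ne (by rintro rfl; omega), smul_zero, add_zero]
  rfl

lemma isSemiFree (c : Cells M) : IsSemiFree M := by
  classical
  let Φ (i : ℕ) : DGSubmodule M :=
    { X Y n := ⨅ g : {g : c.G // i ≤ c.rank g}, LinearMap.ker (c.coeff g.1 Y n)
      d_mem p q h m hm := by
        simp only [Submodule.mem_iInf, LinearMap.mem_ker, Subtype.forall] at hm ⊢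
        exact c.coeff_d_eq_zero h m hm
      act_mem h m f hm := by
        simp only [Submodule.mem_iInf, LinearMap.mem_ker, Subtype.forall] at hm ⊢
        intro g hg
        rw [c.coeff_act g h (by omega), hm g hg, map_zero, LinearMap.zero_apply] }
  have hΦ : ∀ {i Y n} {m : M.X Y n}, m ∈ (Φ i).X Y n ↔ ∀ g, i ≤ c.rank g → c.coeff g Y n m = 0 := by
    intro i Y n m
    simp only [Φ, Submodule.mem_iInf, LinearMap.mem_ker, Subtype.forall]
  refine ⟨Φ, fun Y n => ?_, fun i Y n m hm => ?_, fun Y n m => ?_, fun i => ?_⟩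
  · refine (Submodule.eq_bot_iff _).2 fun m hm => ?_
    rw [hΦ] at hm
    refine (c.coeffs Y n).map_eq_zero_iff.1 (DFinsupp.ext fun g => hm g (Nat.zero_le _))
  · rw [hΦ] at hm ⊢
    exact fun g hg => hm g (by omega)
  · refine ⟨(DFinsupp.support (c.coeffs Y n m)).sup c.rank + 1, hΦ.2 fun g hg => ?_⟩
    by_contra h
    have := Finset.le_sup (f := c.rank) ((DFinsupp.mem_support_toFun (c.coeffs Y n m) g).2 h)
    omega
  · have hs : ∀ (s : {g : c.G // c.rank g = i}) Z p (a : DirectSum {g : c.G // c.rank g = i}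
        fun s => A.Hom Z (c.x s.1) (p - c.n s.1)),
        c.coeff s.1 Z p (combination M (fun s : {g : c.G // c.rank g = i} => c.e s.1) Z p a) =
          a s := by
      intro s Z p a
      refine LinearMap.congr_fun (f := (c.coeff s.1 Z p).comp (combination M _ Z p))
        (g := DirectSum.component k {g : c.G // c.rank g = i}
          (fun s => A.Hom Z (c.x s.1) (p - c.n s.1)) s)
        (DirectSum.linearMap_ext k fun g' => LinearMap.ext fun f => ?_) a
      simp only [LinearMap.comp_apply, combination_lof]
      by_cases h : s = g'
      · subst h
        rw [coeff_self, DirectSum.component.lof_self]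
      · rw [c.coeff_ne (fun h' => h (Subtype.ext h')), DirectSum.component.of, dif_neg (Ne.symm h)]
    refine ⟨{g // c.rank g = i}, fun s => c.x s.1, fun s => c.n s.1, fun s => c.e s.1, fun s => ?_,
      fun s => ?_, fun Z p m hm => ?_⟩
    · rw [hΦ]
      exact fun g hg => c.coeffs_e_eq_zero (by rintro rfl; have := s.2; omega)
    · rw [hΦ]
      exact fun g hg => c.coeff_d_e (by have := s.2; omega)
    · rw [hΦ] at hm
      have hmem : ∀ a : DirectSum {g : c.G // c.rank g = i}
          fun s => A.Hom Z (c.x s.1) (p - c.n s.1), (m - combination M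
            (fun s : {g : c.G // c.rank g = i} => c.e s.1) Z p a ∈ (Φ i).X Z p ↔
          ∀ s : {g : c.G // c.rank g = i}, c.coeff s.1 Z p m = a s) := by
        intro a
        rw [hΦ]
        constructor
        · intro h s
          have := h s.1 s.2.ge
          rwa [map_sub, hs, sub_eq_zero] at this
        · intro h g hg
          rcases hg.eq_or_lt with h' | h'
          · have := h ⟨g, h'.symm⟩
            rw [map_sub, hs ⟨g, h'.symm⟩, this, sub_self]
          · rw [map_sub, hm g h', zero_sub, neg_eq_zero]
            refine LinearMap.congr_fun (f := (c.coeff g Z p).comp (combination M _ Z p)) (g := 0)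
              (DirectSum.linearMap_ext k fun g' => LinearMap.ext fun f => ?_) a
            simp only [LinearMap.comp_apply, combination_lof]
            exact c.coeff_ne (by rintro rfl; have := g'.2; omega) _ _ _
      refine ⟨DFinsupp.comapDomain Subtype.val Subtype.val_injective (c.coeffs Z p m), ?_, ?_⟩
      · exact (hmem _).2 fun s => (DFinsupp.comapDomain_apply _ _ _ s).symm
      · intro a ha
        refine DFinsupp.ext fun s => ?_
        rw [← (hmem a).1 ha s]
        exact (DFinsupp.comapDomain_apply _ _ _ s).symm

end Cells

lemma SemiBasis.d_comb_ne {M : RightModule A} (b : SemiBasis M) (t t' : Σ i, b.S i)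
    (h : b.coeff t' _ _ (M.d (b.n t.1 t.2) (b.n t.1 t.2 + 1) rfl (b.e t.1 t.2)) ≠ 0) :
    t'.1 < t.1 := by
  by_contra h'
  exact h (b.coeff_eq_zero t' (not_lt.1 h') _ (b.d_mem t.1 t.2))

lemma IsSemiFree.nonempty_cells {M : RightModule A} (h : IsSemiFree M) : Nonempty (Cells M) := by
  obtain ⟨Φ, h₀, h₁, h₂, h₃⟩ := h
  choose S x n e he hd hu using h₃
  let b : SemiBasis M := ⟨Φ, h₀, h₁, h₂, S, x, n, e, he, hd, hu⟩
  exact ⟨{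
    G := Σ i, b.S i
    x := fun t => b.x t.1 t.2
    n := fun t => b.n t.1 t.2
    e := allGen M b.e
    bij := b.bijective
    rank := Sigma.fst
    rank_lt := fun t a ha t' h' => b.d_comb_ne t t' (by rw [← ha, b.coeff_comb]; exact h') }⟩

lemma IsSemiFree.isAcyclic_hom {M N : RightModule A} (h : IsSemiFree M)
    (hN : ∀ Y, (evalMod Y).IsAcyclic N) : (LeftModule.hom (rightMod A) M).IsAcyclic N := by
  obtain ⟨c⟩ := h.nonempty_cells
  exact c.isAcyclic_hom hN

end rightModules

section freeModule

variable {k : Type u} [CommRing k] {A : DGCategory.{u, u, u} k} {G : Type u} (x : G → A.Ob)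
  (n : G → ℤ)

/-- The graded right module with free generators in given degrees. -/
abbrev FreeX (Z : A.Ob) (p : ℤ) : Type u := DirectSum G fun g => A.Hom Z (x g) (p - n g)

/-- A multiple of a generator. -/
abbrev freeOf (g : G) {Z : A.Ob} {p : ℤ} : A.Hom Z (x g) (p - n g) →ₗ[k] FreeX x n Z p :=
  letI := Classical.decEq G
  DirectSum.lof k G (fun g => A.Hom Z (x g) (p - n g)) g

/-- Linear maps out of a free graded module. -/
abbrev freeDesc {Z : A.Ob} {p : ℤ} {V : Type*} [AddCommGroup V] [Module k V]
    (φ : ∀ g, A.Hom Z (x g) (p - n g) →ₗ[k] V) : FreeX x n Z p →ₗ[k] V :=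
  letI := Classical.decEq G
  DirectSum.toModule k G V φ

lemma freeDesc_of {Z : A.Ob} {p : ℤ} {V : Type*} [AddCommGroup V] [Module k V]
    (φ : ∀ g, A.Hom Z (x g) (p - n g) →ₗ[k] V) (g : G) (f : A.Hom Z (x g) (p - n g)) :
    freeDesc x n φ (freeOf x n g f) = φ g f := by
  let := Classical.decEq G
  exact DirectSum.toModule_lof ..

variable {x n} in
lemma free_ext {Z : A.Ob} {p : ℤ} {V : Type*} [AddCommGroup V] [Module k V]
    {φ ψ : FreeX x n Z p →ₗ[k] V} (h : ∀ g f, φ (freeOf x n g f) = ψ (freeOf x n g f)) : φ = ψ := by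
  let := Classical.decEq G
  exact DirectSum.linearMap_ext k fun g => LinearMap.ext fun f => h g f

/-- The action on a free graded module. -/
def freeAct {Y Z : A.Ob} {q p r : ℤ} (h : q + p = r) :
    FreeX x n Y q →ₗ[k] A.Hom Z Y p →ₗ[k] FreeX x n Z r :=
  freeDesc x n fun g => (A.comp (by omega : q - n g + p = r - n g)).compr₂ (freeOf x n g)

lemma freeAct_of {Y Z : A.Ob} {q p r : ℤ} (h : q + p = r) (g : G) (h' : q - n g + p = r - n g)
    (a : A.Hom Y (x g) (q - n g)) (f : A.Hom Z Y p) :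
    freeAct x n h (freeOf x n g a) f = freeOf x n g (A.comp h' a f) := by
  rw [freeAct, freeDesc_of]
  rfl

lemma freeAct_comp {Y Z W : A.Ob} {a b c ab bc abc : ℤ} (h₁ : a + b = ab) (h₂ : ab + c = abc)
    (h₃ : b + c = bc) (h₄ : a + bc = abc) (m : FreeX x n Y a) (f : A.Hom Z Y b) (g : A.Hom W Z c) :
    freeAct x n h₂ (freeAct x n h₁ m f) g = freeAct x n h₄ m (A.comp h₃ f g) := by
  refine LinearMap.congr_fun (f := ((freeAct x n h₂).flip g).comp ((freeAct x n h₁).flip f))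
    (g := (freeAct x n h₄).flip (A.comp h₃ f g)) (free_ext fun s a => ?_) m
  simp only [LinearMap.comp_apply, LinearMap.flip_apply]
  rw [freeAct_of x n h₁ s (by omega), freeAct_of x n h₂ s (by omega), freeAct_of x n h₄ s (by omega),
    A.assoc]

variable (D : ∀ g, FreeX x n (x g) (n g + 1))

/-- The differential on a free graded module with given values on the generators. -/
def freeD {Z : A.Ob} (p q : ℤ) (h : p + 1 = q) : FreeX x n Z p →ₗ[k] FreeX x n Z q :=
  freeDesc x n fun g => freeAct x n (by omega : n g + 1 + (p - n g) = q) (D g) +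
    sgn (n g) • (freeOf x n g).comp (A.d (p - n g) (q - n g) (by omega))

lemma freeD_of {Z : A.Ob} {p q : ℤ} (h : p + 1 = q) (g : G) (h₁ : n g + 1 + (p - n g) = q)
    (h₂ : p - n g + 1 = q - n g) (f : A.Hom Z (x g) (p - n g)) :
    freeD x n D p q h (freeOf x n g f) = freeAct x n h₁ (D g) f +
      sgn (n g) • freeOf x n g (A.d (p - n g) (q - n g) h₂ f) := by
  rw [freeD, freeDesc_of]
  rfl

lemma freeD_act {Y Z : A.Ob} {p p' q q' r r' : ℤ} (h : q + p = r) (hr : r + 1 = r')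
    (hq : q + 1 = q') (hp : p + 1 = p') (h₁ : q' + p = r') (h₂ : q + p' = r')
    (m : FreeX x n Y q) (f : A.Hom Z Y p) :
    freeD x n D r r' hr (freeAct x n h m f) = freeAct x n h₁ (freeD x n D q q' hq m) f +
      sgn q • freeAct x n h₂ m (A.d p p' hp f) := by
  refine LinearMap.congr_fun (f := (freeD x n D r r' hr).comp ((freeAct x n h).flip f))
    (g := ((freeAct x n h₁).flip f).comp (freeD x n D q q' hq) +
      sgn q • (freeAct x n h₂).flip (A.d p p' hp f)) (free_ext fun g a => ?_) m
  simp only [LinearMap.comp_apply, LinearMap.flip_apply, LinearMap.add_apply, LinearMap.smul_apply]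
  rw [freeAct_of x n h g (by omega), freeD_of x n D hr g (by omega) (by omega),
    freeD_of x n D hq g (by omega) (by omega), freeAct_of x n h₂ g (by omega),
    map_add, LinearMap.add_apply, map_zsmul, LinearMap.smul_apply,
    freeAct_of x n h₁ g (by omega),
    freeAct_comp x n (by omega : n g + 1 + (q - n g) = q') h₁ (by omega : _ = r - n g) (by omega),
    A.leibniz (q' := q' - n g) (p' := p') _ _ (by omega) hp (by omega) (by omega), map_add,
    map_zsmul, smul_add, smul_smul, ← add_assoc, ← sgn_add]
  congr 3
  omega

variable (hD : ∀ g, freeD x n D _ _ rfl (D g) = 0)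

/-- The right DG module with given free generators and given differentials of the generators. -/
def freeModule : RightModule A where
  X Z p := FreeX x n Z p
  d p q h := freeD x n D p q h
  act h := freeAct x n h
  d_d {Z} p q r h h' m := by
    refine LinearMap.congr_fun (f := (freeD x n D q r h').comp (freeD x n D p q h)) (g := 0)
      (free_ext fun g a => ?_) m
    rw [LinearMap.comp_apply, freeD_of x n D h g (by omega) (by omega), map_add, map_zsmul,
      freeD_of x n D h' g (by omega) (by omega),
      freeD_act x n D _ h' rfl (by omega) (by omega) (by omega : _ + (q - n g) = _), hD, A.d_d]
    simp only [map_zero, LinearMap.zero_apply, smul_zero, zero_add, add_zero]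
    rw [sgn_add, sgn_one]
    module
  act_one {Y p} h m := by
    refine LinearMap.congr_fun (f := (freeAct x n h).flip (A.one Y)) (g := LinearMap.id)
      (free_ext fun g a => ?_) m
    rw [LinearMap.flip_apply, freeAct_of x n h g (by omega), A.comp_one]
    rfl
  act_comp h₁ h₂ h₃ h₄ m f g := freeAct_comp x n h₁ h₂ h₃ h₄ m f g
  leibniz h hr hq hp h₁ h₂ m f := freeD_act x n D h hr hq hp h₁ h₂ m f

/-- The generators of a free module. -/
def freeGen (g : G) : FreeX x n (x g) (n g) := freeOf x n g (A.oneOf (x g) (sub_self (n g)))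

lemma freeAct_gen (g : G) {Z : A.Ob} {a p : ℤ} (h : n g + a = p) (h' : 0 + a = p - n g)
    (f : A.Hom Z (x g) a) :
    freeAct x n h (freeGen x n g) f = freeOf x n g (A.comp h' (A.one _) f) := by
  obtain rfl : a = p - n g := by omega
  rw [freeGen, freeAct_of x n h g (by omega), A.oneOf_comp, A.one_comp]

lemma freeD_gen (g : G) : freeD x n D (n g) (n g + 1) rfl (freeGen x n g) = D g := by
  have h : ∀ {i : ℤ} (hi : i = 0) (h : n g + 1 + i = n g + 1),
      freeAct x n h (D g) (A.oneOf (x g) hi) = D g := by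
    rintro i rfl h
    refine LinearMap.congr_fun (f := (freeAct x n h).flip (A.one (x g))) (g := LinearMap.id)
      (free_ext fun g a => ?_) (D g)
    rw [LinearMap.flip_apply, freeAct_of x n h g (by omega), A.comp_one]
    rfl
  have h' : ∀ {i j : ℤ} (hi : i = 0) (h : i + 1 = j), A.d i j h (A.oneOf (x g) hi) = 0 := by
    rintro i j rfl h
    exact A.d_one _ _ _
  rw [freeGen, freeD_of x n D rfl g (by omega) (by omega), h, h', map_zero, smul_zero, add_zero]

/-- The tautological generators of a free module. -/
def freeCells (rank : G → ℕ) (h : ∀ g g', D g g' ≠ 0 → rank g' < rank g) :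
    Cells (freeModule x n D hD) :=
  Cells.ofCoeff (M := freeModule x n D hD) (freeGen x n)
    (fun g Z p => DirectSum.component k G (fun g => A.Hom Z (x g) (p - n g)) g)
    (fun g Z p f => by
      let := Classical.decEq G
      have e := freeAct_gen x n g (add_sub_cancel (n g) p) (zero_add _) f
      rw [A.one_comp] at e
      refine (congrArg (DirectSum.component k G (fun g => A.Hom Z (x g) (p - n g)) g) e).trans ?_
      exact DirectSum.component.lof_self k (M := fun g => A.Hom Z (x g) (p - n g)) g f)
    (fun g g' h Z p f => by
      let := Classical.decEq G
      have e := freeAct_gen x n g (add_sub_cancel (n g) p) (zero_add _) f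
      rw [A.one_comp] at e
      refine (congrArg (DirectSum.component k G (fun g => A.Hom Z (x g) (p - n g)) g') e).trans ?_
      exact (DirectSum.component.of k (M := fun g => A.Hom Z (x g) (p - n g)) g' g f).trans
        (dif_neg h.symm))
    (fun Z p S h => by
      rw [← Submodule.ker_mkQ S, LinearMap.ker_eq_top]
      refine free_ext fun g f => (Submodule.Quotient.mk_eq_zero _).2 ?_
      have e := freeAct_gen x n g (add_sub_cancel (n g) p) (zero_add _) f
      rw [A.one_comp] at e
      rw [← e]
      exact h g f)
    rank
    (fun g g' h' => h g g' (by
      rw [← freeD_gen x n D]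
      exact h'))

end freeModule

section resolution

variable {k : Type u} [CommRing k] {A : DGCategory.{u, u, u} k} (N : RightModule A)

/-- Names for the generators of a semi-free resolution: a name contains a value, and the
differential of the generator as a formal combination of generators. -/
inductive Name : A.Ob → ℤ → Type u
  | mk {Y : A.Ob} {p : ℤ} (v : N.X Y p) (r : ℕ) (W : Fin r → A.Ob) (q : Fin r → ℤ)
    (c : ∀ i, Name (W i) (q i)) (a : ∀ i, A.Hom Y (W i) (p + 1 - q i)) : Name Y p

namespace Name

/-- All names. -/
abbrev All := Σ (Y : A.Ob) (p : ℤ), Name N Y p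

abbrev obj (g : All N) : A.Ob := g.1

abbrev deg (g : All N) : ℤ := g.2.1

variable {N}

lemma data_aux₁ (p q : ℤ) : q + 1 + (p + 1 - q) = p + 1 + 1 := by omega

lemma data_aux₂ (p q : ℤ) : p + 1 - q + 1 = p + 1 + 1 - q := by omega

/-- The differential and the value of the generator with a given name; both are zero unless they
are compatible. -/
def data : ∀ {Y : A.Ob} {p : ℤ}, Name N Y p → FreeX (obj N) (deg N) Y (p + 1) × N.X Y p
  | _, p, mk v _ W q c a =>
    letI := Classical.propDecidable
    if ∑ i, (freeAct (obj N) (deg N) (data_aux₁ p (q i))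
        (data (c i)).1 (a i) + sgn (q i) • freeOf (obj N) (deg N) ⟨W i, q i, c i⟩
          (A.d (p + 1 - q i) (p + 1 + 1 - q i) (data_aux₂ p (q i)) (a i))) = 0 ∧
        ∑ i, N.act (add_sub_cancel (q i) (p + 1)) (data (c i)).2 (a i) =
          N.d p (p + 1) rfl v then
      (∑ i, freeOf (obj N) (deg N) ⟨W i, q i, c i⟩ (a i), v) else 0

/-- The depth of a name. -/
def depth : ∀ {Y : A.Ob} {p : ℤ}, Name N Y p → ℕ
  | _, _, mk _ r _ _ c _ => (Finset.univ : Finset (Fin r)).sup (fun i => depth (c i)) + 1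

/-- The differential of a generator. -/
abbrev D (g : All N) : FreeX (obj N) (deg N) (obj N g) (deg N g + 1) := (data g.2.2).1

/-- The value of a generator. -/
abbrev val (g : All N) : N.X (obj N g) (deg N g) := (data g.2.2).2

/-- The linear maps which extend the values of the generators. -/
def eval (Z : A.Ob) (p : ℤ) : FreeX (obj N) (deg N) Z p →ₗ[k] N.X Z p :=
  freeDesc _ _ fun g => N.act (add_sub_cancel (deg N g) p) (val g)

lemma eval_of {Z : A.Ob} {p : ℤ} (g : All N) (f : A.Hom Z g.1 (p - g.2.1)) :
    eval Z p (freeOf (obj N) (deg N) g f) = N.act (add_sub_cancel (deg N g) p) (val g) f :=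
  freeDesc_of ..

lemma data_mk {Y : A.Ob} {p : ℤ} (v : N.X Y p) (r : ℕ) (W : Fin r → A.Ob) (q : Fin r → ℤ)
    (c : ∀ i, Name N (W i) (q i)) (a : ∀ i, A.Hom Y (W i) (p + 1 - q i))
    (h : freeD (obj N) (deg N) D _ _ rfl
      (∑ i, freeOf (obj N) (deg N) ⟨W i, q i, c i⟩ (a i)) = 0 ∧
      eval Y (p + 1) (∑ i, freeOf (obj N) (deg N) ⟨W i, q i, c i⟩ (a i)) = N.d p (p + 1) rfl v) :
    data (mk v r W q c a) = (∑ i, freeOf (obj N) (deg N) ⟨W i, q i, c i⟩ (a i), v) := by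
  rw [data]
  refine if_pos ?_
  rw [map_sum, map_sum] at h
  refine ⟨(Finset.sum_congr rfl fun i _ => ?_).trans h.1,
    (Finset.sum_congr rfl fun i _ => ?_).trans h.2⟩
  · exact (freeD_of (obj N) (deg N) D rfl ⟨W i, q i, c i⟩ _ _ (a i)).symm
  · exact (eval_of ⟨W i, q i, c i⟩ (a i)).symm

lemma data_spec (g : All N) : freeD (obj N) (deg N) D _ _ rfl (D g) = 0 ∧
    eval _ _ (D g) = N.d _ _ rfl (val g) := by
  obtain ⟨Y, p, ⟨v, r, W, q, c, a⟩⟩ := g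
  by_cases h : freeD (obj N) (deg N) D _ _ rfl
      (∑ i, freeOf (obj N) (deg N) ⟨W i, q i, c i⟩ (a i)) = 0 ∧
      eval Y (p + 1) (∑ i, freeOf (obj N) (deg N) ⟨W i, q i, c i⟩ (a i)) = N.d p (p + 1) rfl v
  · have h' := data_mk v r W q c a h
    dsimp only [D, val, obj, deg]
    rw [h']
    exact h
  · have h' : data (mk v r W q c a) = 0 := by
      rw [data]
      refine if_neg fun h' => h ?_
      rw [map_sum, map_sum]
      refine ⟨(Finset.sum_congr rfl fun i _ => ?_).trans h'.1,
        (Finset.sum_congr rfl fun i _ => ?_).trans h'.2⟩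
      · exact (freeD_of (obj N) (deg N) D rfl ⟨W i, q i, c i⟩ _ _ (a i))
      · exact (eval_of ⟨W i, q i, c i⟩ (a i))
    dsimp only [D, val, obj, deg]
    rw [h']
    exact ⟨map_zero _, (map_zero _).trans (map_zero _).symm⟩

lemma depth_lt (g g' : All N) (h : D g g' ≠ 0) : depth g'.2.2 < depth g.2.2 := by
  obtain ⟨Y, p, ⟨v, r, W, q, c, a⟩⟩ := g
  obtain ⟨i, hi⟩ : ∃ i, g' = ⟨W i, q i, c i⟩ := by
    let := Classical.decEq (All N)
    by_contra! hg
    refine h ?_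
    dsimp only [D]
    rw [data]
    split_ifs with h'
    · refine (map_sum (DirectSum.component k (All N)
        (fun g => A.Hom Y g.1 (p + 1 - g.2.1)) g') _ _).trans (Finset.sum_eq_zero fun i _ => ?_)
      exact (DirectSum.component.of k (M := fun g : All N => A.Hom Y g.1 (p + 1 - g.2.1)) _ _ _).trans
        (dif_neg (hg i).symm)
    · rfl
  rw [hi, depth]
  exact Nat.lt_succ_of_le (Finset.le_sup (f := fun i => depth (c i)) (Finset.mem_univ i))

end Name

/-- The semi-free module of a resolution. -/
def resolution : RightModule A :=
  freeModule (Name.obj N) (Name.deg N) Name.D fun g => (Name.data_spec g).1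

/-- The generators of the resolution. -/
def resolutionCells : Cells (resolution N) :=
  freeCells _ _ _ _ (fun g : Name.All N => Name.depth g.2.2) Name.depth_lt

lemma isSemiFree_resolution : IsSemiFree (resolution N) := (resolutionCells N).isSemiFree

/-- The map from the resolution. -/
def resolutionMap : (rightMod A).Hom (resolution N) N 0 :=
  ⟨fun Z t => (add_zero t.1.1).symm.trans t.2 ▸ Name.eval Z t.1.1,
    ⟨fun {Y Z p p' a q q'} hp hq h h' m f => by
      obtain rfl : p = p' := by omega
      obtain rfl : q = q' := by omega
      change Name.eval Z q (freeAct _ _ h m f) = N.act h (Name.eval Y p m) f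
      refine LinearMap.congr_fun (f := (Name.eval Z q).comp ((freeAct _ _ h).flip f))
        (g := ((N.act h).flip f).comp (Name.eval Y p)) (free_ext fun g a => ?_) m
      simp only [LinearMap.comp_apply, LinearMap.flip_apply]
      rw [freeAct_of _ _ h g (by omega), Name.eval_of, Name.eval_of,
        N.act_comp _ h (by dsimp only [Name.deg]; omega : _ = q - Name.deg N g)]⟩⟩

lemma resolutionMap_closed : (rightMod A).d 0 1 (zero_add 1) (resolutionMap N) = 0 := by
  refine (resolutionCells N).hom_ext fun (g : Name.All N) => ?_
  refine (app_d (q₁ := g.2.1) (p₁ := g.2.1 + 1) (zero_add 1) (resolutionMap N) g.1 rfl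
    (add_zero _) rfl rfl (add_zero _) _).trans ?_
  change N.d _ _ _ (Name.eval _ _ (freeGen (Name.obj N) (Name.deg N) g)) - _ • Name.eval _ _
    (freeD (Name.obj N) (Name.deg N) Name.D g.2.1 (g.2.1 + 1) rfl
      (freeGen (Name.obj N) (Name.deg N) g)) = 0
  have h : ∀ {i : ℤ} (hi : i = 0) (h : g.2.1 + i = g.2.1),
      N.act h (Name.val g) (A.oneOf g.1 hi) = Name.val g := by
    rintro i rfl h
    exact N.act_one h _
  rw [freeD_gen, (Name.data_spec g).2, freeGen, Name.eval_of, h, sgn_zero, one_smul, sub_self]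

lemma resolutionMap_isModQis : IsModQis (resolutionMap N) := by
  intro Y o p q r ho hp hq m y hm hy
  subst hp
  change FreeX (Name.obj N) (Name.deg N) Y (p + 1) at m
  change Name.eval Y (p + 1) m = _ at hy
  change freeD _ _ Name.D _ _ hq m = 0 at hm
  classical
  let S := DFinsupp.support m
  let t (i : Fin S.card) : Name.All N := (S.equivFin.symm i).1
  let g : Name N Y p := Name.mk y S.card (fun i => (t i).1) (fun i => (t i).2.1)
    (fun i => (t i).2.2) fun i => m (t i)
  have hsum : ∑ i, freeOf (Name.obj N) (Name.deg N) (t i) (m (t i)) = m := by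
    rw [S.equivFin.symm.sum_comp (fun s : S =>
      freeOf (Name.obj N) (Name.deg N) s.1 (m s.1)), Finset.sum_coe_sort S (fun s =>
      freeOf (Name.obj N) (Name.deg N) s (m s))]
    conv_rhs => rw [← DirectSum.sum_support_of m]
    refine Finset.sum_congr rfl fun s _ => ?_
    rw [← DirectSum.lof_eq_of k]
    congr!
  have hg : Name.data g = (m, y) := by
    have := Name.data_mk y S.card (fun i => (t i).1) (fun i => (t i).2.1)
      (fun i => (t i).2.2) (fun i => m (t i)) (by
        subst hq
        exact ⟨(congrArg _ hsum).trans hm, (congrArg _ hsum).trans hy⟩)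
    rw [this]
    exact congrArg (fun z => (z, y)) hsum
  refine ⟨freeGen (Name.obj N) (Name.deg N) ⟨Y, p, g⟩, 0, ?_, ?_⟩
  · refine (freeD_gen (Name.obj N) (Name.deg N) Name.D ⟨Y, p, g⟩).trans ?_
    exact congrArg Prod.fst hg
  · change y = Name.eval Y p (freeGen (Name.obj N) (Name.deg N) ⟨Y, p, g⟩) + _
    have h : ∀ {i : ℤ} (hi : i = 0) (h : p + i = p) (z : N.X Y p),
        N.act h z (A.oneOf Y hi) = z := by
      rintro i rfl h z
      exact N.act_one h _
    rw [map_zero, add_zero, freeGen, Name.eval_of, h]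
    exact (congrArg Prod.snd hg).symm

end resolution

section shift

variable {k : Type u} [CommRing k] {A : DGCategory.{u, u, u} k}

namespace RightModule

variable (M : RightModule A)

/-- Transport along an equality of degrees. -/
def cast {Y : A.Ob} {p q : ℤ} (h : p = q) : M.X Y p →ₗ[k] M.X Y q :=
  (M.act ((add_zero p).trans h)).flip (A.one Y)

@[simp] lemma cast_rfl {Y : A.Ob} {p : ℤ} (m : M.X Y p) : M.cast rfl m = m := M.act_one _ m

lemma cast_cast {Y : A.Ob} {p q r : ℤ} (h : p = q) (h' : q = r) (m : M.X Y p) :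
    M.cast h' (M.cast h m) = M.cast (h.trans h') m := by
  subst h h'
  simp

lemma d_cast {Y : A.Ob} {p q p' q' : ℤ} (h : p = q) (h' : p' = q') (hq : q + 1 = q') (hp : p + 1 = p')
    (m : M.X Y p) : M.d q q' hq (M.cast h m) = M.cast h' (M.d p p' hp m) := by
  subst h h'
  simp

lemma act_cast {Y Z : A.Ob} {p q a p' q' : ℤ} (h : p = q) (h' : p' = q') (hq : q + a = q')
    (hp : p + a = p') (m : M.X Y p) (f : A.Hom Z Y a) :
    M.act hq (M.cast h m) f = M.cast h' (M.act hp m f) := by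
  subst h h'
  simp

/-- The shift of a right DG module. -/
abbrev shift (r : ℤ) : RightModule A where
  X Y n := M.X Y (n + r)
  d p q h := sgn r • M.d (p + r) (q + r) (by omega)
  act h := M.act (by omega)
  d_d p q s h h' m := by simp [M.d_d]
  act_one h m := M.act_one _ m
  act_comp h₁ h₂ h₃ h₄ m f g := M.act_comp _ _ h₃ _ m f g
  leibniz {Y Z p p' q q' s s'} h hr hq hp h₁ h₂ m f := by
    simp only [LinearMap.smul_apply, map_zsmul]
    rw [M.leibniz (q' := q' + r) (p' := p') _ _ (by omega) hp (by omega) (by omega), smul_add,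
      smul_smul]
    congr 2
    rw [sgn_add]
    linear_combination sgn q * sgn_mul_self r

/-- The extension of right modules given by a closed morphism of degree one. -/
def ext {M N : RightModule A} (f : (rightMod A).Hom M N 1) (hf : (rightMod A).d 1 2 rfl f = 0) :
    RightModule A where
  X Y n := M.X Y n × N.X Y n
  d {Y} p q h := (M.d p q h).comp (LinearMap.fst k _ _) |>.prod
    ((app f.1 Y p q h).comp (LinearMap.fst k _ _) + (N.d p q h).comp (LinearMap.snd k _ _))
  act {Y Z q p r} h := LinearMap.mk₂ k (fun m a => (M.act h m.1 a, N.act h m.2 a))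
    (fun m m' a => by simp) (fun c m a => by simp) (fun m a a' => by simp) (fun c m a => by simp)
  d_d {Y} p q r h h' m := by
    refine Prod.ext (M.d_d _ _ _ _ _ _) ?_
    change app f.1 Y q r h' (M.d p q h m.1) + N.d q r h' (app f.1 Y p q h m.1 + N.d p q h m.2) = 0
    rw [map_add, N.d_d, app_closed hf Y h h' h h', sgn_one, neg_one_zsmul, add_zero,
      add_neg_cancel]
  act_one h m := Prod.ext (M.act_one h _) (N.act_one h _)
  act_comp h₁ h₂ h₃ h₄ m a b := Prod.ext (M.act_comp h₁ h₂ h₃ h₄ _ a b) (N.act_comp h₁ h₂ h₃ h₄ _ a b)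
  leibniz {Y Z p p' q q' r r'} h hr hq hp h₁ h₂ m a := by
    refine Prod.ext (M.leibniz h hr hq hp h₁ h₂ _ a) ?_
    change app f.1 Z r r' hr (M.act h m.1 a) + N.d r r' hr (N.act h m.2 a) =
      N.act h₁ (app f.1 Y q q' hq m.1 + N.d q q' hq m.2) a + sgn q • N.act h₂ m.2 (A.d p p' hp a)
    rw [f.2.app_act hq hr h h₁, N.leibniz h hr hq hp h₁ h₂, map_add, LinearMap.add_apply, add_assoc]

/-- The zero module. -/
def zero : RightModule A where
  X _ _ := PUnit
  d _ _ _ := 0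
  act _ := 0
  d_d _ _ _ _ _ _ := rfl
  act_one _ _ := rfl
  act_comp _ _ _ _ _ _ _ := rfl
  leibniz _ _ _ _ _ _ _ _ := rfl

end RightModule

/-- A morphism of right modules given by compatible maps. -/
def mkHom {M N : RightModule A} (l : ℤ) (φ : ∀ (Y : A.Ob) (p q : ℤ), p + l = q → (M.X Y p →ₗ[k] N.X Y q))
    (hφ : ∀ {Y Z : A.Ob} {p p' a q q' : ℤ} (hp : p + l = p') (hq : q + l = q')
    (h : p + a = q) (h' : p' + a = q') (m : M.X Y p) (x : A.Hom Z Y a),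
    φ Z q q' hq (M.act h m x) = N.act h' (φ Y p p' hp m) x) : (rightMod A).Hom M N l :=
  ⟨fun Y t => φ Y t.1.1 t.1.2 t.2, ⟨fun hp hq h h' m x => hφ hp hq h h' m x⟩⟩

/-- The shift of a module is a shift in the DG category of modules. -/
def shiftData (M : RightModule A) (r r' : ℤ) (h : r' + r = 0) :
    ShiftData (rightMod A) r r' M (M.shift r') where
  h := h
  i := mkHom (N := M.shift r') r (fun Y p q hq => M.cast (by omega : p = q + r'))
    fun hp hq h h' m x => (M.act_cast _ _ _ _ m x).symm
  p := mkHom (M := M.shift r') r' (fun Y p q hq => M.cast (by omega : p + r' = q))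
    fun hp hq h h' m x => (M.act_cast _ _ _ _ m x).symm
  p_i := family_ext fun Y p q hq m => by
    obtain rfl : p = q := by omega
    rw [app_comp h _ _ Y hq rfl (by omega)]
    exact (M.cast_cast (by omega : p = p + r + r') (by omega : p + r + r' = p) m).trans (M.cast_rfl m)
  i_p := family_ext fun Y p q hq m => by
    obtain rfl : p = q := by omega
    rw [app_comp _ _ _ Y hq rfl (by omega)]
    exact (M.cast_rfl _).trans (M.cast_rfl m)
  d_i := family_ext fun Y p q hq m => by
    rw [app_d rfl _ Y hq rfl (by omega) rfl (by omega)]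
    change sgn r' • M.d (p + r + r') (q + r') (by omega) (M.cast (by omega : p = p + r + r') m) -
      sgn r • M.cast (by omega : p + 1 = q + r') (M.d p (p + 1) rfl m) = 0
    rw [M.d_cast (by omega) (by omega) (by omega) rfl, sgn_eq_of_add_eq_zero h, sub_self]
  d_p := family_ext fun Y p q hq (m : M.X Y (p + r')) => by
    rw [app_d rfl _ Y hq rfl (by omega) rfl (by omega)]
    change M.d (p + r') q (by omega) (M.cast rfl m) - sgn r' • M.cast (by omega : p + 1 + r' = q)
      (sgn r' • M.d (p + r') (p + 1 + r') (by omega) m) = 0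
    rw [M.d_cast (by omega) (by omega : p + 1 + r' = q) _ (by omega), map_zsmul,
      sgn_smul_sgn_smul, sub_self]

/-- The extension module is an extension in the DG category of modules. -/
def moduleExt {M N : RightModule A} (f : (rightMod A).Hom M N 1)
    (hf : (rightMod A).d 1 2 rfl f = 0) : Ext (A := rightMod A) 0 0 0 0 f (RightModule.ext f hf) where
  ha := add_zero 0
  hb := add_zero 0
  hm := add_comm 0 1
  i₁ := mkHom (N := RightModule.ext f hf) 0 (fun Y p q hq =>
    LinearMap.inl k _ _ ∘ₗ M.cast (by omega : p = q)) fun {Y Z p p' a q q'} hp hq h h' m x => by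
      obtain rfl : p = p' := by omega
      obtain rfl : q = q' := by omega
      exact Prod.ext ((M.cast_rfl _).trans (congrArg (fun z => M.act h' z x) (M.cast_rfl m).symm))
        ((LinearMap.congr_fun (map_zero (N.act h')) x).symm)
  p₁ := mkHom (M := RightModule.ext f hf) 0 (fun Y p q hq =>
    M.cast (by omega : p = q) ∘ₗ LinearMap.fst k _ _) fun {Y Z p p' a q q'} hp hq h h' m x => by
      obtain rfl : p = p' := by omega
      obtain rfl : q = q' := by omega
      exact (M.cast_rfl _).trans (congrArg (fun z => M.act h' z x) (M.cast_rfl m.1).symm)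
  i₂ := mkHom (N := RightModule.ext f hf) 0 (fun Y p q hq =>
    LinearMap.inr k _ _ ∘ₗ N.cast (by omega : p = q)) fun {Y Z p p' a q q'} hp hq h h' m x => by
      obtain rfl : p = p' := by omega
      obtain rfl : q = q' := by omega
      exact Prod.ext ((LinearMap.congr_fun (map_zero (M.act h')) x).symm)
        ((N.cast_rfl _).trans (congrArg (fun z => N.act h' z x) (N.cast_rfl m).symm))
  p₂ := mkHom (M := RightModule.ext f hf) 0 (fun Y p q hq =>
    N.cast (by omega : p = q) ∘ₗ LinearMap.snd k _ _) fun {Y Z p p' a q q'} hp hq h h' m x => by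
      obtain rfl : p = p' := by omega
      obtain rfl : q = q' := by omega
      exact (N.cast_rfl _).trans (congrArg (fun z => N.act h' z x) (N.cast_rfl m.2).symm)
  p₁_i₁ := family_ext fun Y p q hq m => by
    obtain rfl : p = q := by omega
    rw [app_comp _ _ _ Y hq hq hq]
    exact (M.cast_rfl _).trans (M.cast_rfl m)
  p₂_i₂ := family_ext fun Y p q hq m => by
    obtain rfl : p = q := by omega
    rw [app_comp _ _ _ Y hq hq hq]
    exact (N.cast_rfl _).trans (N.cast_rfl m)
  p₁_i₂ := family_ext fun Y p q hq m => by
    obtain rfl : p = q := by omega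
    rw [app_comp _ _ _ Y hq hq hq]
    exact M.cast_rfl _
  p₂_i₁ := family_ext fun Y p q hq m => by
    obtain rfl : p = q := by omega
    rw [app_comp _ _ _ Y hq hq hq]
    exact N.cast_rfl _
  total := family_ext fun Y p q hq m => by
    obtain rfl : p = q := by omega
    change app ((rightMod A).comp _ _ _).1 Y p p hq m + app ((rightMod A).comp _ _ _).1 Y p p hq m = m
    rw [app_comp _ _ _ Y hq hq hq, app_comp _ _ _ Y hq hq hq]
    refine Prod.ext ?_ ?_
    · exact (add_zero _).trans ((M.cast_rfl _).trans (M.cast_rfl m.1))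
    · exact (zero_add _).trans ((N.cast_rfl _).trans (N.cast_rfl m.2))
  d_i₂ := family_ext fun Y p q hq m => by
    rw [app_d rfl _ Y hq (add_zero p) (by omega) rfl (by omega), sgn_zero, one_smul]
    obtain rfl : p + 1 = q := by omega
    refine Prod.ext ?_ ?_
    · change M.d _ _ _ 0 - 0 = 0
      rw [map_zero, sub_zero]
    · change app f.1 Y p (p + 1) rfl 0 + N.d p (p + 1) rfl (N.cast rfl m) -
        N.cast rfl (N.d p (p + 1) rfl m) = 0
      rw [map_zero, zero_add, N.cast_rfl, N.cast_rfl, sub_self]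
  d_i₁ := family_ext fun Y p q hq m => by
    rw [app_d rfl _ Y hq (add_zero p) (by omega) rfl (by omega), sgn_zero, one_smul]
    obtain rfl : p + 1 = q := by omega
    rw [app_comp _ _ f Y hq (rfl : p + 1 = p + 1) (add_zero _)]
    refine Prod.ext ?_ ?_
    · change M.d p (p + 1) rfl (M.cast rfl m) - M.cast rfl (M.d p (p + 1) rfl m) = 0
      rw [M.cast_rfl, M.cast_rfl, sub_self]
    · change app f.1 Y p (p + 1) rfl (M.cast rfl m) + N.d p (p + 1) rfl 0 - 0 =
        N.cast rfl (app f.1 Y p (p + 1) rfl m)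
      rw [map_zero, add_zero, sub_zero, N.cast_rfl, M.cast_rfl]

end shift

section semifree

variable {k : Type u} [CommRing k] {A : DGCategory.{u, u, u} k}

lemma exists_rank {G : Type*} (R : G → G → Prop) (φ : G → ℕ ×ₗ ℕ) (hφ : ∀ g' g, R g' g → φ g' < φ g)
    (hR : ∀ g, {g' | R g' g}.Finite) : ∃ rank : G → ℕ, ∀ g' g, R g' g → rank g' < rank g := by
  classical
  have wf : WellFounded R := Subrelation.wf (h₁ := fun {g' g} h => hφ g' g h)
    (InvImage.wf φ wellFounded_lt)
  let rank : G → ℕ := wf.fix fun g ih =>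
    (hR g).toFinset.attach.sup (fun g' => ih g'.1 ((hR g).mem_toFinset.1 g'.2)) + 1
  refine ⟨rank, fun g' g h => ?_⟩
  have e : rank g = (hR g).toFinset.attach.sup (fun g' => rank g'.1) + 1 := wf.fix_eq _ _
  rw [e, Nat.lt_succ_iff]
  exact Finset.le_sup (f := fun g' : (hR g).toFinset => rank g'.1) (b := ⟨g', (hR g).mem_toFinset.2 h⟩)
    (Finset.mem_attach _ _)

namespace Cells

variable {M N C : RightModule A} (c : Cells M)

lemma finite_coeff {Z : A.Ob} {p : ℤ} (m : M.X Z p) : {g | c.coeff g Z p m ≠ 0}.Finite := by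
  classical
  refine (DFinsupp.support (c.coeffs Z p m)).finite_toSet.subset fun g hg => ?_
  exact (DFinsupp.mem_support_toFun _ g).2 hg

lemma coeff_self' (g : c.G) {Z : A.Ob} {a p : ℤ} (h : c.n g + a = p) (h' : 0 + a = p - c.n g)
    (f : A.Hom Z (c.x g) a) :
    c.coeff g Z p (M.act h (c.e g) f) = A.comp h' (A.one _) f := by
  obtain rfl : a = p - c.n g := by omega
  rw [coeff_self, A.one_comp]

lemma coeff_ne' {g g' : c.G} (hg : g' ≠ g) {Z : A.Ob} {a p : ℤ} (h : c.n g + a = p)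
    (f : A.Hom Z (c.x g) a) : c.coeff g' Z p (M.act h (c.e g) f) = 0 := by
  obtain rfl : a = p - c.n g := by omega
  exact c.coeff_ne hg _ _ f

include c in
/-- The generators of a shift. -/
lemma nonempty_shift (r : ℤ) : Nonempty (Cells (M.shift r)) := by
  refine ⟨Cells.ofCoeff (M := M.shift r) (x := c.x) (n := fun g => c.n g - r)
    (fun g => M.cast (by omega : c.n g = c.n g - r + r) (c.e g))
    (fun g Z p => (A.comp (by omega : 0 + (p + r - c.n g) = p - (c.n g - r)) (A.one _)).comp
      (c.coeff g Z (p + r))) (fun g Z p f => ?_) (fun g g' hg Z p f => ?_) (fun Z p S h => ?_) c.rank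
      (fun g g' h => c.rank_lt' (g := g) (g' := g') fun h' => h ?_)⟩
  · change A.comp _ _ (c.coeff g Z (p + r) (M.act (by omega) (M.cast _ (c.e g)) f)) = f
    rw [M.act_cast _ rfl _ (by omega), M.cast_rfl, c.coeff_self' g _ (by omega),
      ← A.assoc (add_zero 0) (by omega) _ (by omega), A.one_comp, A.one_comp]
  · change A.comp _ _ (c.coeff g' Z (p + r) (M.act (by omega) (M.cast _ (c.e g)) f)) = 0
    rw [M.act_cast _ rfl _ (by omega), M.cast_rfl, c.coeff_ne' hg, map_zero]
  · refine c.span Z (p + r) S fun g f => ?_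
    have h' : M.act (by omega : c.n g - r + r + (p - (c.n g - r)) = p + r) (M.cast (by omega) (c.e g))
      (A.comp (by omega : 0 + (p + r - c.n g) = p - (c.n g - r)) (A.one _) f) ∈ S := h g _
    rw [M.act_cast (by omega) rfl _ (by omega), M.cast_rfl,
      ← M.act_comp (add_zero (c.n g)) _ _ _, M.act_one] at h'
    exact h'
  · have h₀ : ∀ {Y : A.Ob} {p q : ℤ} (h : p = q) (m : M.X Y p), c.coeff g' Y p m = 0 →
        c.coeff g' Y q (M.cast h m) = 0 := by
      rintro Y p _ rfl m hm
      rw [M.cast_rfl, hm]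
    change A.comp _ _ (c.coeff g' _ _ (sgn r • M.d (c.n g - r + r) (c.n g - r + 1 + r) (by omega)
      (M.cast (by omega) (c.e g)))) = 0
    rw [M.d_cast (by omega) (by omega) _ rfl, map_zsmul, h₀ _ _ h', smul_zero, map_zero]

lemma nonempty_zero : Nonempty (Cells (RightModule.zero : RightModule A)) := by
  refine ⟨Cells.ofCoeff (M := RightModule.zero) (G := PEmpty) (x := PEmpty.elim) (n := PEmpty.elim)
    (fun g => g.elim) (fun g => g.elim) (fun g => g.elim) (fun g => g.elim) (fun Z p S _ => ?_)
    PEmpty.elim (fun g => g.elim)⟩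
  refine eq_top_iff.2 fun m _ => ?_
  obtain rfl : m = 0 := rfl
  exact S.zero_mem

variable {c} in
/-- The generators of an extension. -/
lemma nonempty_ext (c : Cells M) (c' : Cells N) {f : (rightMod A).Hom M N 1}
    (E : Ext (A := rightMod A) 0 0 0 0 f C) : Nonempty (Cells C) := by
  classical
  have hcomp : ∀ {K L P : RightModule A} (g : (rightMod A).Hom L P 0) (f : (rightMod A).Hom K L 0)
      {Z : A.Ob} {p : ℤ} (m : K.X Z p), app g.1 Z p p (add_zero p) (app f.1 Z p p (add_zero p) m) =
      app ((rightMod A).comp (add_zero 0) g f).1 Z p p (add_zero p) m := by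
    intro K L P g f Z p m
    rw [app_comp _ _ _ Z (add_zero p) (add_zero p) (add_zero p)]
  have h₁₁ : ∀ {Z : A.Ob} {p : ℤ} (m : M.X Z p), app E.p₁.1 Z p p (add_zero p)
      (app E.i₁.1 Z p p (add_zero p) m) = m := by
    intro Z p m
    rw [hcomp, E.p₁_i₁]
    rfl
  have h₂₂ : ∀ {Z : A.Ob} {p : ℤ} (m : N.X Z p), app E.p₂.1 Z p p (add_zero p)
      (app E.i₂.1 Z p p (add_zero p) m) = m := by
    intro Z p m
    rw [hcomp, E.p₂_i₂]
    rfl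
  have h₁₂ : ∀ {Z : A.Ob} {p : ℤ} (m : N.X Z p), app E.p₁.1 Z p p (add_zero p)
      (app E.i₂.1 Z p p (add_zero p) m) = 0 := by
    intro Z p m
    rw [hcomp, E.p₁_i₂']
    rfl
  have h₂₁ : ∀ {Z : A.Ob} {p : ℤ} (m : M.X Z p), app E.p₂.1 Z p p (add_zero p)
      (app E.i₁.1 Z p p (add_zero p) m) = 0 := by
    intro Z p m
    rw [hcomp, E.p₂_i₁']
    rfl
  have htot : ∀ {Z : A.Ob} {p : ℤ} (m : C.X Z p), app E.i₁.1 Z p p (add_zero p)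
      (app E.p₁.1 Z p p (add_zero p) m) + app E.i₂.1 Z p p (add_zero p)
      (app E.p₂.1 Z p p (add_zero p) m) = m := by
    intro Z p m
    rw [hcomp, hcomp]
    exact congrArg (fun h => app h.1 Z p p (add_zero p) m) E.total
  have hd : ∀ {K L : RightModule A} {g : (rightMod A).Hom K L 0}
      (_ : (rightMod A).d 0 1 (zero_add 1) g = 0) {Z : A.Ob} {p q : ℤ} (hp : p + 1 = q)
      (m : K.X Z p), app g.1 Z q q (add_zero q) (K.d p q hp m) =
        L.d p q hp (app g.1 Z p p (add_zero p) m) := by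
    intro K L g hg Z p q hp m
    rw [app_closed hg Z (add_zero p) hp hp (add_zero q), sgn_zero, one_smul]
  let x : c'.G ⊕ c.G → A.Ob := Sum.elim c'.x c.x
  let n : c'.G ⊕ c.G → ℤ := Sum.elim c'.n c.n
  let e : ∀ g, C.X (x g) (n g)
    | Sum.inl g => app E.i₂.1 _ _ _ (add_zero (c'.n g)) (c'.e g)
    | Sum.inr g => app E.i₁.1 _ _ _ (add_zero (c.n g)) (c.e g)
  let co : ∀ g Z p, C.X Z p →ₗ[k] A.Hom Z (x g) (p - n g)
    | Sum.inl g, Z, p => (c'.coeff g Z p).comp (app E.p₂.1 Z p p (add_zero p))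
    | Sum.inr g, Z, p => (c.coeff g Z p).comp (app E.p₁.1 Z p p (add_zero p))
  have he : ∀ (g : c.G) {Z : A.Ob} {a p : ℤ} (h : c.n g + a = p) (f : A.Hom Z (c.x g) a),
      C.act h (e (Sum.inr g)) f = app E.i₁.1 _ _ _ (add_zero p) (M.act h (c.e g) f) :=
    fun g Z a p h f => (E.i₁.2.app_act (add_zero _) (add_zero p) h h _ f).symm
  have he' : ∀ (g : c'.G) {Z : A.Ob} {a p : ℤ} (h : c'.n g + a = p) (f : A.Hom Z (c'.x g) a),
      C.act h (e (Sum.inl g)) f = app E.i₂.1 _ _ _ (add_zero p) (N.act h (c'.e g) f) :=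
    fun g Z a p h f => (E.i₂.2.app_act (add_zero _) (add_zero p) h h _ f).symm
  obtain ⟨rank, hrank⟩ := exists_rank
    (fun g' g => co g' _ _ (C.d (n g) (n g + 1) rfl (e g)) ≠ 0)
    (Sum.elim (fun g => toLex (0, c'.rank g)) (fun g => toLex (1, c.rank g))) (by
      rintro (g' | g') (g | g) h
      · refine Prod.Lex.right _ (c'.rank_lt' fun h' => h ?_)
        change c'.coeff g' _ (c'.n g + 1) (app E.p₂.1 _ (c'.n g + 1) _ (add_zero _) (C.d (c'.n g) _ rfl
          (app E.i₂.1 _ (c'.n g) (c'.n g) (add_zero _) (c'.e g)))) = 0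
        rw [← hd E.d_i₂, h₂₂]
        exact h'
      · exact Prod.Lex.left _ _ Nat.zero_lt_one
      · refine absurd ?_ h
        change c.coeff g' _ (c'.n g + 1) (app E.p₁.1 _ (c'.n g + 1) _ (add_zero _) (C.d (c'.n g) _ rfl
          (app E.i₂.1 _ (c'.n g) (c'.n g) (add_zero _) (c'.e g)))) = 0
        rw [← hd E.d_i₂, h₁₂, map_zero]
      · refine Prod.Lex.right _ (c.rank_lt' fun h' => h ?_)
        change c.coeff g' _ (c.n g + 1) (app E.p₁.1 _ (c.n g + 1) _ (add_zero _) (C.d (c.n g) _ rfl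
          (app E.i₁.1 _ (c.n g) (c.n g) (add_zero _) (c.e g)))) = 0
        rw [hd (E.d_p₁ _ _), h₁₁]
        exact h')
    (fun g => (((c'.finite_coeff (app E.p₂.1 _ _ _ (add_zero _)
      (C.d (n g) (n g + 1) rfl (e g)))).image Sum.inl).union
      ((c.finite_coeff (app E.p₁.1 _ _ _ (add_zero _)
        (C.d (n g) (n g + 1) rfl (e g)))).image Sum.inr)).subset (by
      rintro (g' | g') h
      · exact Or.inl ⟨g', h, rfl⟩
      · exact Or.inr ⟨g', h, rfl⟩))
  refine ⟨Cells.ofCoeff e co ?_ ?_ ?_ rank fun g g' h => hrank g' g h⟩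
  · rintro (g | g) Z p f
    · change A.Hom Z (c'.x g) (p - c'.n g) at f
      refine (congrArg (fun m => c'.coeff g Z p (app E.p₂.1 Z p p (add_zero p) m))
        (he' g (add_sub_cancel _ _) f)).trans ?_
      rw [h₂₂]
      exact c'.coeff_self g Z p f
    · change A.Hom Z (c.x g) (p - c.n g) at f
      refine (congrArg (fun m => c.coeff g Z p (app E.p₁.1 Z p p (add_zero p) m))
        (he g (add_sub_cancel _ _) f)).trans ?_
      rw [h₁₁]
      exact c.coeff_self g Z p f
  · rintro (g | g) (g' | g') h Z p f
    · change A.Hom Z (c'.x g) (p - c'.n g) at f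
      refine (congrArg (fun m => c'.coeff g' Z p (app E.p₂.1 Z p p (add_zero p) m))
        (he' g (add_sub_cancel _ _) f)).trans ?_
      rw [h₂₂]
      exact c'.coeff_ne (fun h' => h (congrArg _ h')) Z p f
    · change A.Hom Z (c'.x g) (p - c'.n g) at f
      refine (congrArg (fun m => c.coeff g' Z p (app E.p₁.1 Z p p (add_zero p) m))
        (he' g (add_sub_cancel _ _) f)).trans ?_
      rw [h₁₂, map_zero]
      rfl
    · change A.Hom Z (c.x g) (p - c.n g) at f
      refine (congrArg (fun m => c'.coeff g' Z p (app E.p₂.1 Z p p (add_zero p) m))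
        (he g (add_sub_cancel _ _) f)).trans ?_
      rw [h₂₁, map_zero]
      rfl
    · change A.Hom Z (c.x g) (p - c.n g) at f
      refine (congrArg (fun m => c.coeff g' Z p (app E.p₁.1 Z p p (add_zero p) m))
        (he g (add_sub_cancel _ _) f)).trans ?_
      rw [h₁₁]
      exact c.coeff_ne (fun h' => h (congrArg _ h')) Z p f
  · intro Z p S h
    refine eq_top_iff.2 fun m _ => ?_
    have h₁ : S.comap (app E.i₁.1 Z p p (add_zero p)) = ⊤ := c.span Z p _ fun g f => by
      rw [Submodule.mem_comap, ← he]
      exact h (Sum.inr g) f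
    have h₂ : S.comap (app E.i₂.1 Z p p (add_zero p)) = ⊤ := c'.span Z p _ fun g f => by
      rw [Submodule.mem_comap, ← he']
      exact h (Sum.inl g) f
    rw [← htot m]
    exact S.add_mem (h₁.ge (Submodule.mem_top : app E.p₁.1 Z p p (add_zero p) m ∈ _))
      (h₂.ge (Submodule.mem_top : app E.p₂.1 Z p p (add_zero p) m ∈ _))

end Cells

lemma IsSemiFree.shift {M : RightModule A} (h : IsSemiFree M) (r : ℤ) : IsSemiFree (M.shift r) := by
  obtain ⟨c⟩ := h.nonempty_cells
  exact (c.nonempty_shift r).some.isSemiFree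

lemma isSemiFree_zero : IsSemiFree (RightModule.zero : RightModule A) :=
  Cells.nonempty_zero.some.isSemiFree

lemma IsSemiFree.ext {M N C : RightModule A} (hM : IsSemiFree M) (hN : IsSemiFree N)
    {f : (rightMod A).Hom M N 1} (E : Ext (A := rightMod A) 0 0 0 0 f C) : IsSemiFree C := by
  obtain ⟨c⟩ := hM.nonempty_cells
  obtain ⟨c'⟩ := hN.nonempty_cells
  exact (c.nonempty_ext c' E).some.isSemiFree

lemma exists_moduleCone {M N : RightModule A} (f : (rightMod A).Hom M N 0)
    (hf : (rightMod A).d 0 1 (zero_add 1) f = 0) :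
    ∃ C : RightModule A, Nonempty (Ext (A := rightMod A) (-1) 1 0 0 f C) ∧
      (IsSemiFree M → IsSemiFree N → IsSemiFree C) := by
  let s := shiftData M (-1) 1 (add_neg_cancel 1)
  have hf' : (rightMod A).d 1 2 rfl ((rightMod A).comp (zero_add 1) f s.p) = 0 := by
    rw [d_comp_left (p' := 2) (zero_add 1) hf _ _ rfl (by omega)]
    have : (rightMod A).d 1 2 rfl s.p = 0 := s.d_p
    rw [this, map_zero, smul_zero]
  exact ⟨_, ⟨s.ext (by omega) _ (moduleExt _ hf')⟩, fun h h' => (h.shift 1).ext h' (moduleExt _ hf')⟩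

/-- Semi-free modules do not distinguish quasi-isomorphic modules. -/
lemma IsSemiFree.isQis_hom {M N L : RightModule A} (hM : IsSemiFree M) {f : (rightMod A).Hom N L 0}
    (hf₀ : (rightMod A).d 0 1 (zero_add 1) f = 0) (hf : IsModQis f) :
    (LeftModule.hom (rightMod A) M).IsQis f := by
  obtain ⟨C, ⟨E⟩, -⟩ := exists_moduleCone f hf₀
  exact E.isQis_of_isAcyclic (hM.isAcyclic_hom fun Y => E.isAcyclic_of_isQis (hf Y))

/-- A quasi-isomorphism between semi-free modules is a homotopy equivalence. -/
lemma IsSemiFree.isIso {M N : RightModule A} (hM : IsSemiFree M) (hN : IsSemiFree N)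
    {f : (rightMod A).Hom M N 0} (hf₀ : (rightMod A).d 0 1 (zero_add 1) f = 0) (hf : IsModQis f) :
    IsIso (Ho.mk f hf₀) :=
  isIso_of_isQis hf₀ (hM.isQis_hom hf₀ hf) (hN.isQis_hom hf₀ hf)

end semifree

section adjunction

variable {k : Type w} [CommRing k] {A : DGCategory.{w, v, u} k} {B : DGCategory.{w, v₂, u₂} k}

/-- An adjunction between DG functors. -/
structure DGAdj (F : DGFunctor A B) (G : DGFunctor B A) where
  unit : ∀ X, A.Hom X (G.obj (F.obj X)) 0
  counit : ∀ Y, B.Hom (F.obj (G.obj Y)) Y 0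
  d_unit : ∀ X, A.d 0 1 (zero_add 1) (unit X) = 0
  d_counit : ∀ Y, B.d 0 1 (zero_add 1) (counit Y) = 0
  unit_nat : ∀ {X Y : A.Ob} {n : ℤ} (f : A.Hom X Y n),
    A.comp (add_zero n) (G.map n (F.map n f)) (unit X) = A.comp (zero_add n) (unit Y) f
  counit_nat : ∀ {X Y : B.Ob} {n : ℤ} (f : B.Hom X Y n),
    B.comp (zero_add n) (counit Y) (F.map n (G.map n f)) = B.comp (add_zero n) f (counit X)
  left_triangle : ∀ X, B.comp (add_zero 0) (counit (F.obj X)) (F.map 0 (unit X)) = B.one (F.obj X)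
  right_triangle : ∀ Y, A.comp (add_zero 0) (G.map 0 (counit Y)) (unit (G.obj Y)) = A.one (G.obj Y)

namespace DGAdj

variable {F : DGFunctor A B} {G : DGFunctor B A} (adj : DGAdj F G)

/-- The adjunction between homotopy categories. -/
def ho : Ho.map F ⊣ Ho.map G where
  unit :=
    { app X := Ho.mk (adj.unit X.as.ob) (adj.d_unit _)
      naturality := by
        rintro ⟨⟨X⟩⟩ ⟨⟨Y⟩⟩ φ
        obtain ⟨f, hf, rfl⟩ := Ho.mk_surj φ
        refine (Ho.mk_comp hf (adj.d_unit Y)).trans (Eq.trans ?_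
          (Ho.mk_comp (adj.d_unit X) (g := G.map 0 (F.map 0 f)) (by
            rw [← G.map_d, ← F.map_d, hf, map_zero, map_zero])).symm)
        exact (Ho.mk_eq_iff _ _).2 ⟨0, by rw [map_zero]; exact (sub_eq_zero.2 (adj.unit_nat f).symm).symm⟩ }
  counit :=
    { app Y := Ho.mk (adj.counit Y.as.ob) (adj.d_counit _)
      naturality := by
        rintro ⟨⟨X⟩⟩ ⟨⟨Y⟩⟩ φ
        obtain ⟨f, hf, rfl⟩ := Ho.mk_surj φ
        refine (Ho.mk_comp (f := F.map 0 (G.map 0 f)) (by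
            rw [← F.map_d, ← G.map_d, hf, map_zero, map_zero]) (adj.d_counit Y)).trans (Eq.trans ?_
          (Ho.mk_comp (adj.d_counit X) hf).symm)
        exact (Ho.mk_eq_iff _ _).2 ⟨0, by rw [map_zero]; exact (sub_eq_zero.2 (adj.counit_nat f)).symm⟩ }
  left_triangle_components X := by
    refine (Ho.mk_comp (f := F.map 0 (adj.unit X.as.ob)) (by
      rw [← F.map_d, adj.d_unit, map_zero]) (adj.d_counit _)).trans ?_
    have h := adj.left_triangle X.as.ob
    exact ((Ho.mk_eq_iff _ (B.d_one _ _ _)).2 ⟨0, by rw [h, map_zero, sub_self]⟩).trans (Ho.mk_one _)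
  right_triangle_components Y := by
    refine (Ho.mk_comp (adj.d_unit _) (g := G.map 0 (adj.counit Y.as.ob)) (by
      rw [← G.map_d, adj.d_counit, map_zero])).trans ?_
    have h := adj.right_triangle Y.as.ob
    exact ((Ho.mk_eq_iff _ (A.d_one _ _ _)).2 ⟨0, by rw [h, map_zero, sub_self]⟩).trans (Ho.mk_one _)

lemma ext {X : A.Ob} {Y : B.Ob} {n : ℤ} {f g : B.Hom (F.obj X) Y n}
    (h : A.comp (add_zero n) (G.map n f) (adj.unit X) = A.comp (add_zero n) (G.map n g) (adj.unit X)) :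
    f = g := by
  have key : ∀ f : B.Hom (F.obj X) Y n, B.comp (zero_add n) (adj.counit Y)
      (F.map n (A.comp (add_zero n) (G.map n f) (adj.unit X))) = f := by
    intro f
    rw [F.map_comp, ← B.assoc (zero_add n) (add_zero n) (add_zero n) (zero_add n), adj.counit_nat,
      B.assoc (add_zero n) (add_zero n) (add_zero 0) (add_zero n), adj.left_triangle, B.comp_one]
  rw [← key f, h, key]

lemma exists_eq {X : A.Ob} {Y : B.Ob} {n : ℤ} (g : A.Hom X (G.obj Y) n) :
    ∃ f : B.Hom (F.obj X) Y n, A.comp (add_zero n) (G.map n f) (adj.unit X) = g := by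
  refine ⟨B.comp (zero_add n) (adj.counit Y) (F.map n g), ?_⟩
  rw [G.map_comp, A.assoc (zero_add n) (add_zero n) (add_zero n) (zero_add n), adj.unit_nat,
    ← A.assoc (add_zero 0) (zero_add n) (zero_add n) (zero_add n), adj.right_triangle, A.one_comp]

/-- If the unit at `Y` is invertible up to quasi-isomorphism, as seen by `X`, then the left adjoint
is a quasi-isomorphism on the morphisms from `X` to `Y`. -/
lemma chainQis {X Y : A.Ob} (h : (LeftModule.hom A X).IsQis (adj.unit Y)) :
    ChainQis (fun p q h => A.d (X := X) (Y := Y) p q h) (fun p q h => B.d p q h) F.map := by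
  have hc : ∀ {n n' : ℤ} (hn : n + 1 = n') (f : B.Hom (F.obj X) (F.obj Y) n),
      A.d n n' hn (A.comp (add_zero n) (G.map n f) (adj.unit X)) =
        A.comp (add_zero n') (G.map n' (B.d n n' hn f)) (adj.unit X) := by
    intro n n' hn f
    rw [d_comp_right (zero_add 1) (adj.d_unit X) _ _ hn (add_zero n'), G.map_d]
  intro o p q r ho hp hq x y hx hxy
  obtain ⟨x', z, hx', hz⟩ := h ho hp hq x (A.comp (add_zero p) (G.map p y) (adj.unit X)) hx (by
    change A.comp _ (adj.unit Y) x = A.d p q hp _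
    rw [← adj.unit_nat, hxy, hc])
  obtain ⟨y', rfl⟩ := adj.exists_eq z
  refine ⟨x', y', hx', adj.ext ?_⟩
  rw [hz, map_add, map_add, LinearMap.add_apply, adj.unit_nat, hc]

end DGAdj

lemma full_of_chainQis (F : DGFunctor A B)
    (h : ∀ X Y : A.Ob, ChainQis (fun p q h => A.d (X := X) (Y := Y) p q h) (fun p q h => B.d p q h)
      F.map) : (Ho.map F).Full where
  map_surjective {X Y} φ := by
    obtain ⟨f, hf, rfl⟩ := Ho.mk_surj (X := F.obj X.as.ob) (Y := F.obj Y.as.ob) φ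
    obtain ⟨x, y, hx, hy⟩ := h X.as.ob Y.as.ob (neg_add_cancel 1) (zero_add 1)
      (rfl : (1 : ℤ) + 1 = 2) 0 f (map_zero _) (by rw [map_zero, hf])
    refine ⟨Ho.mk x hx, (Ho.map_mk F x hx).trans ((Ho.mk_eq_iff _ _).2 ⟨-y, ?_⟩)⟩
    rw [hy, map_neg, sub_add_cancel_left]

lemma faithful_of_chainQis (F : DGFunctor A B)
    (h : ∀ X Y : A.Ob, ChainQis (fun p q h => A.d (X := X) (Y := Y) p q h) (fun p q h => B.d p q h)
      F.map) : (Ho.map F).Faithful where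
  map_injective {X Y} φ ψ e := by
    obtain ⟨f, hf, rfl⟩ := Ho.mk_surj (X := X.as.ob) (Y := Y.as.ob) φ
    obtain ⟨g, hg, rfl⟩ := Ho.mk_surj (X := X.as.ob) (Y := Y.as.ob) ψ
    obtain ⟨y, hy⟩ := (Ho.mk_eq_iff (X := F.obj X.as.ob) (Y := F.obj Y.as.ob) _ _).1
      ((Ho.map_mk F f hf).symm.trans (e.trans (Ho.map_mk F g hg)))
    obtain ⟨x, -, hx, -⟩ := h X.as.ob Y.as.ob (by omega : -2 + 1 = -1) (neg_add_cancel 1)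
      (zero_add 1) (f - g) y (by rw [map_sub, hf, hg, sub_zero]) (by rw [hy, map_sub])
    exact (Ho.mk_eq_iff _ _).2 ⟨x, hx⟩

end adjunction

section ind

variable {k : Type u} [CommRing k] {A B : DGCategory.{u, u, u} k} (F : DGFunctor A B)

/-- The map `m ↦ m ⊗ 1`. -/
def indUnit (M : RightModule A) : (rightMod A).Hom M ((res F).obj ((ind F).obj M)) 0 :=
  mkHom (N := (res F).obj ((ind F).obj M)) 0
    (fun Y p q hq => (tmul F M hq).flip (B.one (F.obj Y))) fun {Y Z p p' a q q'} hp hq h h' m x => by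
      change tmul F M hq (M.act h m x) (B.one _) = indAct F M h' (tmul F M hp m (B.one _)) (F.map a x)
      rw [tmul_act F M h (add_zero a) hq (by omega), indAct_tmul F M h' hp (zero_add a) (by omega),
        B.comp_one, B.one_comp]

lemma indUnit_apply {M : RightModule A} {Y : A.Ob} {p q : ℤ} (hq : p + 0 = q) (m : M.X Y p) :
    app (indUnit F M).1 Y p q hq m = tmul F M hq m (B.one (F.obj Y)) := rfl

/-- The components of the map `n ⊗ v ↦ n v`. -/
def indCounitMap (N : RightModule B) (Y : B.Ob) (p q : ℤ) (hq : p + 0 = q) :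
    IndX F ((res F).obj N) Y p →ₗ[k] N.X Y q :=
  indLift F ((res F).obj N) (fun X a b h => N.act (by omega : a + b = q))
    fun h h' hn hn' m f v => N.act_comp h _ h' _ m (F.map _ f) v

lemma indCounitMap_tmul {N : RightModule B} {Y : B.Ob} {p q : ℤ} (hq : p + 0 = q) {X : A.Ob}
    {a b : ℤ} (h : a + b = p) (h' : a + b = q) (m : N.X (F.obj X) a) (v : B.Hom Y (F.obj X) b) :
    indCounitMap F N Y p q hq (tmul F ((res F).obj N) h m v) = N.act h' m v :=
  indLift_tmul F ((res F).obj N) _ _ h m v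

/-- The map `n ⊗ v ↦ n v`. -/
def indCounit (N : RightModule B) : (rightMod B).Hom ((ind F).obj ((res F).obj N)) N 0 :=
  mkHom (M := (ind F).obj ((res F).obj N)) 0 (indCounitMap F N)
    fun {Y Z p p' a q q'} hp hq h h' m x => by
      refine LinearMap.congr_fun
        (f := (indCounitMap F N _ _ _ hq).comp ((indAct F ((res F).obj N) h).flip x))
        (g := ((N.act h').flip x).comp (indCounitMap F N _ _ _ hp))
        (ind_ext F _ fun X b c hn m v => ?_) m
      simp only [LinearMap.comp_apply, LinearMap.flip_apply]
      rw [indAct_tmul F _ h hn rfl (by omega)]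
      refine (indCounitMap_tmul F _ _ (by omega) m _).trans (Eq.trans ?_ (congrArg
        (fun z => N.act h' z x) (indCounitMap_tmul F hp hn (by omega) m v)).symm)
      exact (N.act_comp _ h' rfl _ m v x).symm

lemma indCounit_tmul {N : RightModule B} {Y : B.Ob} {p q : ℤ} (hq : p + 0 = q) {X : A.Ob} {a b : ℤ}
    (h : a + b = p) (h' : a + b = q) (m : N.X (F.obj X) a) (v : B.Hom Y (F.obj X) b) :
    app (indCounit F N).1 Y p q hq (tmul F ((res F).obj N) h m v) = N.act h' m v :=
  indCounitMap_tmul F hq h h' m v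

lemma indHom_ext {M : RightModule A} {N : RightModule B} {n : ℤ}
    {f g : (rightMod B).Hom ((ind F).obj M) N n}
    (h : ∀ (X : A.Ob) (p r : ℤ) (hr : p + n = r) (m : M.X X p),
      app f.1 (F.obj X) p r hr (tmul F M (add_zero p) m (B.one _)) =
        app g.1 (F.obj X) p r hr (tmul F M (add_zero p) m (B.one _))) : f = g := by
  refine family_ext fun Y p q hq m => LinearMap.congr_fun
    (ind_ext F M (f := app f.1 Y p q hq) (g := app g.1 Y p q hq) fun X a b hab m v => ?_) m
  have e : tmul F M hab m v = indAct F M hab (tmul F M (add_zero a) m (B.one _)) v := by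
    rw [indAct_tmul F M hab (add_zero a) (zero_add b) hab, B.one_comp]
  rw [e]
  exact (f.2.app_act rfl hq hab (by omega) _ v).trans ((congrArg (fun z => N.act _ z v)
    (h X a _ rfl m)).trans (g.2.app_act rfl hq hab (by omega) _ v).symm)

/-- Induction is left adjoint to restriction. -/
def indResAdj : DGAdj (ind F) (res F) where
  unit := indUnit F
  counit := indCounit F
  d_unit M := family_ext fun Y p q hq m => by
    obtain rfl : p + 1 = q := by omega
    rw [app_d (zero_add 1) (indUnit F M) Y hq (add_zero p) rfl rfl (add_zero _), sgn_zero, one_smul,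
      indUnit_apply, indUnit_apply]
    change indD F M p (p + 1) rfl _ - _ = _
    rw [indD_tmul F M rfl (add_zero p) rfl (zero_add 1) (add_zero _) (by omega), B.d_one, map_zero,
      smul_zero, add_zero, sub_self]
    rfl
  d_counit N := indHom_ext F fun Y p q hq m => by
    obtain rfl : p + 1 = q := by omega
    refine (app_d (zero_add 1) (indCounit F N) _ hq (add_zero p) rfl rfl (add_zero _) _).trans ?_
    rw [sgn_zero, one_smul]
    refine sub_eq_zero.2 ?_
    refine (congrArg (N.d p (p + 1) rfl)
      (indCounit_tmul F (add_zero p) (add_zero p) (add_zero p) m (B.one _))).trans ?_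
    refine Eq.trans ?_ (congrArg (app (indCounit F N).1 _ _ _ (add_zero (p + 1)))
      (indD_tmul F ((res F).obj N) rfl (add_zero p) rfl (zero_add 1) (add_zero _) rfl m
        (B.one _))).symm
    rw [B.d_one, map_zero, smul_zero, add_zero]
    refine Eq.trans ?_ (indCounit_tmul F (add_zero (p + 1)) (add_zero (p + 1)) (add_zero (p + 1))
      (N.d p (p + 1) rfl m) (B.one _)).symm
    exact (congrArg (N.d p (p + 1) rfl) (N.act_one _ m)).trans (N.act_one _ _).symm
  unit_nat {M N n} f := family_ext fun Y p q hq m => by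
    refine (app_comp (add_zero n) _ _ Y hq (add_zero p) hq m).trans (Eq.trans ?_
      (app_comp (zero_add n) _ _ Y hq hq (add_zero q) m).symm)
    exact indFamily_tmul F f hq (add_zero p) hq (add_zero q) m (B.one _)
  counit_nat {M N n} f := indHom_ext F fun Y p q hq m => by
    refine (app_comp (zero_add n) _ _ _ hq hq (add_zero q) _).trans
      (Eq.trans ?_ (app_comp (add_zero n) _ _ _ hq (add_zero p) hq _).symm)
    refine (congrArg (app (indCounit F N).1 _ _ _ (add_zero q)) (indFamily_tmul F ((res F).map n f) hq
      (add_zero p) hq (add_zero q) m (B.one _))).trans ?_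
    refine (indCounit_tmul F (add_zero q) (add_zero q) (add_zero q) _ (B.one _)).trans ?_
    refine Eq.trans ?_ (congrArg (app f.1 _ _ _ hq)
      (indCounit_tmul F (add_zero p) (add_zero p) (add_zero p) m (B.one _))).symm
    exact (N.act_one _ _).trans (congrArg (app f.1 _ _ _ hq) (M.act_one _ m)).symm
  left_triangle M := indHom_ext F fun Y p q hq m => by
    obtain rfl : p = q := by omega
    refine (app_comp (add_zero 0) _ _ _ hq hq hq _).trans ?_
    refine (congrArg (app (indCounit F ((ind F).obj M)).1 _ _ _ hq) (indFamily_tmul F (indUnit F M) hq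
      (add_zero p) hq (add_zero p) m (B.one _))).trans ?_
    refine (indCounit_tmul F hq (add_zero p) (add_zero p) _ (B.one _)).trans ?_
    exact ((indModule F M).act_one _ _).trans (app_one _ _).symm
  right_triangle N := family_ext fun Y p q hq m => by
    obtain rfl : p = q := by omega
    rw [app_comp _ _ _ _ hq hq hq, indUnit_apply]
    refine (indCounit_tmul F _ _ (add_zero p) m (B.one _)).trans ?_
    exact N.act_one _ _

lemma isModQis_of_res (hF : (Ho.map F).EssSurj) {M N : RightModule B} {g : (rightMod B).Hom M N 0}
    (hg : (rightMod B).d 0 1 (zero_add 1) g = 0) (h : IsModQis ((res F).map 0 g)) : IsModQis g := by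
  obtain ⟨C, ⟨E⟩, -⟩ := exists_moduleCone g hg
  intro Y
  refine E.isQis_of_isAcyclic ?_
  obtain ⟨X, ⟨e⟩⟩ := hF.mem_essImage (Ho.of Y)
  obtain ⟨v, hv, hev⟩ := Ho.mk_surj (X := F.obj X.as.ob) e.hom
  obtain ⟨u, hu, heu⟩ := Ho.mk_surj (Y := F.obj X.as.ob) e.inv
  have huv : Ho.mk u hu ≫ Ho.mk v hv = 𝟙 (Ho.of Y) := by
    rw [← hev, ← heu]
    exact e.inv_hom_id
  rw [Ho.mk_comp, ← Ho.mk_one, Ho.mk_eq_iff] at huv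
  obtain ⟨s, hs⟩ := huv
  have hX : (evalMod (F.obj X.as.ob)).IsAcyclic C := E.isAcyclic_of_isQis (h X.as.ob)
  intro p q r hp hq m hm
  obtain ⟨m', hm'⟩ := hX hp hq (C.act (add_zero q) m v) (by
    change C.d q r hq _ = 0
    change C.d q r hq m = 0 at hm
    rw [C.leibniz (q' := r) (p' := 1) _ hq hq (zero_add 1) (add_zero r) hq, hm, hv, map_zero,
      map_zero, LinearMap.zero_apply, smul_zero, add_zero])
  refine ⟨C.act (add_zero p) m' u - sgn q • C.act (by omega : q + -1 = p) m s, ?_⟩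
  change C.d p q hp m' = _ at hm'
  change C.d p q hp _ = m
  change C.d q r hq m = 0 at hm
  rw [map_sub, map_zsmul, C.leibniz (q' := q) (p' := 1) _ hp hp (zero_add 1) (add_zero q) hp, hm', hu, map_zero, smul_zero, add_zero,
    C.leibniz (q' := r) (p' := 0) _ hp hq (neg_add_cancel 1) (by omega) (add_zero q), hm, hs,
    map_zero, LinearMap.zero_apply, zero_add, sgn_smul_sgn_smul,
    C.act_comp (add_zero q) (add_zero q) (add_zero 0) (add_zero q), map_sub, C.act_one,
    sub_sub_cancel]

end ind

section pretriangulated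

variable {k : Type w} [CommRing k]

/-- A DG category which contains a zero object, the shifts of its objects, and the extensions given
by closed morphisms of degree one. -/
structure Pretriangulated (E : DGCategory.{w, v, u} k) : Prop where
  exists_zero : ∃ Z, E.one Z = 0
  exists_shift : ∀ {r r' : ℤ} (_ : r' + r = 0) (X : E.Ob), ∃ X', Nonempty (ShiftData E r r' X X')
  exists_ext : ∀ {X Y : E.Ob} (f : E.Hom X Y 1), E.d 1 2 rfl f = 0 →
    ∃ C, Nonempty (Ext 0 0 0 0 f C)

lemma Pretriangulated.op {E : DGCategory.{w, v, u} k} (h : Pretriangulated E) :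
    Pretriangulated E.op where
  exists_zero := h.exists_zero
  exists_shift {r r'} hr X := by
    obtain ⟨X', ⟨s⟩⟩ := h.exists_shift ((add_comm r r').trans hr) X
    exact ⟨X', ⟨s.op⟩⟩
  exists_ext f hf := by
    obtain ⟨C, ⟨c⟩⟩ := h.exists_ext (X := _) (Y := _) f hf
    exact ⟨C, ⟨c.op⟩⟩

lemma Pretriangulated.exists_cone {E : DGCategory.{w, v, u} k} (h : Pretriangulated E) {X Y : E.Ob}
    (f : E.Hom X Y 0) (hf : E.d 0 1 (zero_add 1) f = 0) : ∃ C, Nonempty (Ext (-1) 1 0 0 f C) := by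
  obtain ⟨X', ⟨s⟩⟩ := h.exists_shift (add_neg_cancel (1 : ℤ)) X
  obtain ⟨C, ⟨c⟩⟩ := h.exists_ext (E.comp (zero_add 1) f s.p) (by
    rw [d_comp_left (zero_add 1) hf _ _ one_add_one_eq_two (zero_add 2),
      show E.d 1 2 one_add_one_eq_two s.p = 0 from s.d_p, map_zero, smul_zero])
  exact ⟨C, ⟨s.ext (by omega) _ c⟩⟩

lemma Pretriangulated.exists_ext' {E : DGCategory.{w, v, u} k} (h : Pretriangulated E) {X Y : E.Ob}
    {r r' l m : ℤ} (hr : r' + r = 0) (hl : l = r + 1) (hm : l + 1 = m) (f : E.Hom X Y l)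
    (hf : E.d l m hm f = 0) : ∃ C, Nonempty (Ext r r' 0 0 f C) := by
  obtain ⟨X', ⟨s⟩⟩ := h.exists_shift hr X
  obtain ⟨C, ⟨c⟩⟩ := h.exists_ext (E.comp (by omega) f s.p) (by
    rw [d_comp_left hm hf _ one_add_one_eq_two rfl (by omega : l + (r' + 1) = 2),
      s.d_p, map_zero, smul_zero])
  exact ⟨C, ⟨s.ext hl _ c⟩⟩

end pretriangulated

section twist

variable {k : Type w} [CommRing k] {B : DGCategory.{w, v, u} k}

/-- The shift of a twisted object. -/
def ShiftData.twist {r r' : ℤ} {X : Twisted B} {X' : Twisted B}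
    (s : ShiftData B r r' X.obj X'.obj)
    (hq : X'.q = sgn r • B.comp (by have := s.h; omega : r + (1 + r') = 1) s.i
      (B.comp rfl X.q s.p)) : ShiftData (DG.twist B) r r' X X' where
  h := s.h
  i := s.i
  p := s.p
  p_i := s.p_i
  i_p := s.i_p
  d_i := by
    have := s.h
    change B.d r (r + 1) rfl s.i + B.comp _ X'.q s.i - sgn r • B.comp _ s.i X.q = 0
    rw [s.d_i, hq, map_zsmul, LinearMap.smul_apply, B.assoc _ _ (by omega : 1 + r' + r = 1) rfl,
      B.assoc _ _ s.h (add_zero 1), s.p_i, B.comp_one, zero_add, sub_self]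
  d_p := by
    have := s.h
    change B.d r' (r' + 1) rfl s.p + B.comp _ X.q s.p - sgn r' • B.comp _ s.p X'.q = 0
    have e : ∀ {l : ℤ} (h₁ : r' + 1 = l) (h₂ : 1 + r' = l), B.comp h₁ s.p
        (B.comp (by omega : r + (1 + r') = 1) s.i (B.comp rfl X.q s.p)) = B.comp h₂ X.q s.p := by
      rintro _ h₁ rfl
      rw [← B.assoc s.h (zero_add (1 + r')) _ _, s.p_i, B.one_comp]
    rw [s.d_p, hq, map_zsmul, e _ (by omega : 1 + r' = r' + 1), sgn_eq_of_add_eq_zero s.h, sgn_smul_sgn_smul, zero_add, sub_self]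

lemma shift_twist_eq {r r' : ℤ} {X : Twisted B} {Y : B.Ob} (s : ShiftData B r r' X.obj Y) :
    B.d 1 2 rfl (sgn r • B.comp (by have := s.h; omega : r + (1 + r') = 1) s.i
      (B.comp rfl X.q s.p)) + B.comp one_add_one_eq_two
      (sgn r • B.comp (by have := s.h; omega : r + (1 + r') = 1) s.i (B.comp rfl X.q s.p))
      (sgn r • B.comp (by have := s.h; omega : r + (1 + r') = 1) s.i (B.comp rfl X.q s.p)) = 0 := by
  have := s.h
  rw [map_zsmul, d_comp_left rfl s.d_i _ _ (by omega : 1 + r' + 1 = 2 + r') (by omega),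
    d_comp_right rfl s.d_p _ _ one_add_one_eq_two rfl, sgn_smul_sgn_smul]
  simp only [map_zsmul, LinearMap.smul_apply]
  rw [sgn_smul_sgn_smul, B.assoc _ _ (by omega : 1 + r' + 1 = 2 + r') (by omega), ← map_add,
    B.assoc _ _ (by omega : r' + 1 = 1 + r') (by omega),
    ← B.assoc s.h (zero_add (1 + r')) _ (by omega), s.p_i, B.one_comp,
    ← B.assoc one_add_one_eq_two (by omega) _ _, ← LinearMap.add_apply, ← map_add, X.eq,
    map_zero, LinearMap.zero_apply, map_zero]

/-- The differential of an extension of twisted objects. -/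
def extQ {X Y : Twisted B} {C : B.Ob} (f : B.Hom X.obj Y.obj 1)
    (c : Ext 0 0 0 0 (0 : B.Hom X.obj Y.obj 1) C) : B.Hom C C 1 :=
  B.comp (zero_add 1) c.i₂ (B.comp (add_zero 1) Y.q c.p₂) +
    B.comp (zero_add 1) c.i₁ (B.comp (add_zero 1) X.q c.p₁) +
      B.comp (zero_add 1) c.i₂ (B.comp (add_zero 1) f c.p₁)

section

variable {X Y : Twisted B} {C : B.Ob} (f : B.Hom X.obj Y.obj 1)
    (c : Ext 0 0 0 0 (0 : B.Hom X.obj Y.obj 1) C)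

lemma extQ_i₁ : B.comp (add_zero 1) (extQ f c) c.i₁ =
    B.comp (zero_add 1) c.i₁ X.q + B.comp (zero_add 1) c.i₂ f := by
  simp only [extQ, map_add, LinearMap.add_apply]
  rw [B.assoc _ _ (add_zero 1) (zero_add 1), B.assoc _ _ (add_zero 1) (zero_add 1),
    B.assoc _ _ (add_zero 1) (zero_add 1), B.assoc _ _ (add_zero 0) (add_zero 1),
    B.assoc _ _ (add_zero 0) (add_zero 1), B.assoc _ _ (add_zero 0) (add_zero 1),
    c.p₁_i₁, c.p₂_i₁', map_zero, map_zero, B.comp_one, B.comp_one, zero_add]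

lemma extQ_i₂ : B.comp (add_zero 1) (extQ f c) c.i₂ = B.comp (zero_add 1) c.i₂ Y.q := by
  simp only [extQ, map_add, LinearMap.add_apply]
  rw [B.assoc _ _ (add_zero 1) (zero_add 1), B.assoc _ _ (add_zero 1) (zero_add 1),
    B.assoc _ _ (add_zero 1) (zero_add 1), B.assoc _ _ (add_zero 0) (add_zero 1),
    B.assoc _ _ (add_zero 0) (add_zero 1), B.assoc _ _ (add_zero 0) (add_zero 1),
    c.p₂_i₂, c.p₁_i₂', map_zero, map_zero, map_zero, map_zero, B.comp_one, add_zero, add_zero]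

lemma d_extQ (hf : B.d 1 2 rfl f + B.comp one_add_one_eq_two Y.q f +
      B.comp one_add_one_eq_two f X.q = 0) :
    B.d 1 2 rfl (extQ f c) + B.comp one_add_one_eq_two (extQ f c) (extQ f c) = 0 := by
  have h₁ : B.d 0 1 (zero_add 1) c.i₁ = 0 := by
    rw [show B.d 0 1 (zero_add 1) c.i₁ = _ from c.d_i₁, map_zero]
  have h₂ : B.d 0 1 (zero_add 1) c.i₂ = 0 := c.d_i₂
  have h₃ : B.d 0 1 (zero_add 1) c.p₁ = 0 := c.d_p₁ _ _
  have h₄ : B.d 0 1 (zero_add 1) c.p₂ = 0 := by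
    rw [c.d_p₂ _ _ (add_zero 1), map_zero, LinearMap.zero_apply, smul_zero]
  have e : B.comp one_add_one_eq_two (extQ f c) (extQ f c) =
      B.comp (zero_add 2) c.i₂ (B.comp (add_zero 2) (B.comp one_add_one_eq_two Y.q Y.q) c.p₂) +
      (B.comp (zero_add 2) c.i₁ (B.comp (add_zero 2) (B.comp one_add_one_eq_two X.q X.q) c.p₁) +
      B.comp (zero_add 2) c.i₂ (B.comp (add_zero 2) (B.comp one_add_one_eq_two f X.q) c.p₁)) +
      B.comp (zero_add 2) c.i₂ (B.comp (add_zero 2) (B.comp one_add_one_eq_two Y.q f) c.p₁) := by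
    conv_lhs => rw [show B.comp one_add_one_eq_two (extQ f c) (extQ f c) =
      B.comp one_add_one_eq_two (extQ f c) (B.comp (zero_add 1) c.i₂ (B.comp (add_zero 1) Y.q c.p₂) +
    B.comp (zero_add 1) c.i₁ (B.comp (add_zero 1) X.q c.p₁) +
      B.comp (zero_add 1) c.i₂ (B.comp (add_zero 1) f c.p₁)) from rfl]
    rw [map_add, map_add, ← B.assoc (add_zero 1) rfl _ rfl, ← B.assoc (add_zero 1) rfl _ rfl,
      ← B.assoc (add_zero 1) rfl _ rfl, extQ_i₁, extQ_i₂, map_add, LinearMap.add_apply]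
    congr 1
    · congr 1
      · rw [B.assoc (zero_add 1) one_add_one_eq_two one_add_one_eq_two (zero_add 2), B.assoc one_add_one_eq_two (add_zero 2) (add_zero 1) one_add_one_eq_two]
      · rw [B.assoc (zero_add 1) one_add_one_eq_two one_add_one_eq_two (zero_add 2), B.assoc one_add_one_eq_two (add_zero 2) (add_zero 1) one_add_one_eq_two,
          B.assoc (zero_add 1) one_add_one_eq_two one_add_one_eq_two (zero_add 2),
          B.assoc one_add_one_eq_two (add_zero 2) (add_zero 1) one_add_one_eq_two]
    · rw [B.assoc (zero_add 1) one_add_one_eq_two one_add_one_eq_two (zero_add 2), B.assoc one_add_one_eq_two (add_zero 2) (add_zero 1) one_add_one_eq_two]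
  rw [e, extQ, map_add, map_add, d_comp_left (zero_add 1) h₂ _ _ one_add_one_eq_two (zero_add 2),
    d_comp_left (zero_add 1) h₂ _ _ one_add_one_eq_two (zero_add 2),
    d_comp_left (zero_add 1) h₁ _ _ one_add_one_eq_two (zero_add 2),
    d_comp_right (zero_add 1) h₄ _ _ one_add_one_eq_two (add_zero 2),
    d_comp_right (zero_add 1) h₃ _ _ one_add_one_eq_two (add_zero 2),
    d_comp_right (zero_add 1) h₃ _ _ one_add_one_eq_two (add_zero 2),
    eq_neg_of_add_eq_zero_left X.eq, eq_neg_of_add_eq_zero_left Y.eq,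
    eq_neg_of_add_eq_zero_left ((add_assoc _ _ _).symm.trans hf)]
  simp only [sgn_zero, one_smul, map_neg, LinearMap.neg_apply, map_add, LinearMap.add_apply]
  abel

/-- The extension of twisted objects given by a direct sum of the underlying objects. -/
def Ext.twist {Z : Twisted B} (c : Ext 0 0 0 0 (0 : B.Hom X.obj Y.obj 1) Z.obj)
    (hZ : Z.q = extQ f c) : Ext (A := DG.twist B) (X := X) (Y := Y) 0 0 0 0 f Z where
  ha := c.ha
  hb := c.hb
  hm := c.hm
  i₁ := c.i₁
  p₁ := c.p₁
  i₂ := c.i₂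
  p₂ := c.p₂
  p₁_i₁ := c.p₁_i₁
  p₂_i₂ := c.p₂_i₂
  p₁_i₂ := c.p₁_i₂
  p₂_i₁ := c.p₂_i₁
  total := c.total
  d_i₂ := by
    change B.d 0 1 (zero_add 1) c.i₂ + B.comp (add_zero 1) Z.q c.i₂ - sgn 0 • B.comp (zero_add 1) c.i₂ Y.q = 0
    rw [show B.d 0 1 (zero_add 1) c.i₂ = 0 from c.d_i₂, hZ, extQ_i₂, sgn_zero, one_smul, zero_add, sub_self]
  d_i₁ := by
    change B.d 0 1 (zero_add 1) c.i₁ + B.comp (add_zero 1) Z.q c.i₁ - sgn 0 • B.comp (zero_add 1) c.i₁ X.q = _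
    rw [show B.d 0 1 (zero_add 1) c.i₁ = _ from c.d_i₁, hZ, extQ_i₁, sgn_zero, one_smul, map_zero, zero_add, add_sub_cancel_left]

end

end twist

section fullSub

variable {k : Type w} [CommRing k] {B : DGCategory.{w, v, u} k} {P : B.Ob → Prop}

/-- A shift in a full DG subcategory. -/
def ShiftData.sub {r r' : ℤ} {X X' : B.Ob} (s : ShiftData B r r' X X') (hX : P X) (hX' : P X') :
    ShiftData (fullSub B P) r r' ⟨X, hX⟩ ⟨X', hX'⟩ where
  h := s.h
  i := s.i
  p := s.p
  p_i := s.p_i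
  i_p := s.i_p
  d_i := s.d_i
  d_p := s.d_p

/-- An extension in a full DG subcategory. -/
def Ext.sub {a a' b b' m : ℤ} {X Y C : B.Ob} {f : B.Hom X Y m} (c : Ext a a' b b' f C) (hX : P X)
    (hY : P Y) (hC : P C) :
    Ext (A := fullSub B P) (X := ⟨X, hX⟩) (Y := ⟨Y, hY⟩) a a' b b' f ⟨C, hC⟩ where
  ha := c.ha
  hb := c.hb
  hm := c.hm
  i₁ := c.i₁
  p₁ := c.p₁
  i₂ := c.i₂
  p₂ := c.p₂
  p₁_i₁ := c.p₁_i₁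
  p₂_i₂ := c.p₂_i₂
  p₁_i₂ := c.p₁_i₂
  p₂_i₁ := c.p₂_i₁
  total := c.total
  d_i₂ := c.d_i₂
  d_i₁ := c.d_i₁

end fullSub

section hulls

variable {k : Type w} [CommRing k] {A : DGCategory.{w, v, u} k}

/-- The identity of `X`, as a morphism to an equal object, in a degree which is equal to zero. -/
def DGCategory.oneCast (A : DGCategory.{w, v, u} k) {X Y : A.Ob} (e : X = Y) {n : ℤ} (hn : n = 0) :
    A.Hom X Y n := e ▸ A.oneOf X hn

lemma oneCast_comp_oneCast {X Y Z : A.Ob} (e : Y = Z) (e' : X = Y) {n p q : ℤ} (hn : n = 0)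
    (hp : p = 0) (h : n + p = q) : A.comp h (A.oneCast e hn) (A.oneCast e' hp) =
      A.oneCast (e'.trans e) (by omega : q = 0) := by
  subst hn hp e e'
  obtain rfl : q = 0 := by omega
  exact A.one_comp h _

lemma d_oneCast {X Y : A.Ob} (e : X = Y) {n m : ℤ} (hn : n = 0) (h : n + 1 = m) :
    A.d n m h (A.oneCast e hn) = 0 := by
  subst hn e
  exact A.d_one _ _ _

/-- The shift of a formal shift. -/
def shiftHullShift {r r' : ℤ} (h : r' + r = 0) (X : (shiftHull A).Ob) :
    ShiftData (shiftHull A) r r' X (X.1, X.2 + r') where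
  h := h
  i := A.oneOf X.1 (by change r + (X.2 + r') - X.2 = 0; omega)
  p := A.oneOf X.1 (by change r' + X.2 - (X.2 + r') = 0; omega)
  p_i := oneCast_comp_oneCast rfl rfl (by change r' + X.2 - (X.2 + r') = 0; omega)
    (by change r + (X.2 + r') - X.2 = 0; omega) _
  i_p := oneCast_comp_oneCast rfl rfl (by change r + (X.2 + r') - X.2 = 0; omega)
    (by change r' + X.2 - (X.2 + r') = 0; omega) _
  d_i := (congrArg (fun z => sgn (X.2 + r') • z) (d_oneCast (A := A) (rfl : X.1 = X.1)
    (by omega : r + (X.2 + r') - X.2 = 0)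
    (by omega : r + (X.2 + r') - X.2 + 1 = r + 1 + (X.2 + r') - X.2))).trans (smul_zero _)
  d_p := (congrArg (fun z => sgn X.2 • z) (d_oneCast (A := A) (rfl : X.1 = X.1)
    (by omega : r' + X.2 - (X.2 + r') = 0)
    (by omega : r' + X.2 - (X.2 + r') + 1 = r' + 1 + X.2 - (X.2 + r')))).trans (smul_zero _)

lemma addHull_comp_eq_zero {X Y Z : (addHull A).Ob} {q p r : ℤ} (h : q + p = r)
    {g : (addHull A).Hom Y Z q} {f : (addHull A).Hom X Y p} {i : Fin Z.1} {j : Fin X.1}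
    (hz : ∀ s, A.comp h (g i s) (f s j) = 0) : (addHull A).comp h g f i j = 0 := by
  change ∑ s, A.comp h (g i s) (f s j) = 0
  exact Finset.sum_eq_zero fun s _ => hz s

/-- The diagonal matrix with the given entries. -/
def diag {n : ℕ} {X Y : Fin n → A.Ob} {l : ℤ} (u : ∀ i, A.Hom (X i) (Y i) l) :
    (addHull A).Hom ⟨n, X⟩ ⟨n, Y⟩ l :=
  fun i j => if e : j = i then e ▸ u j else 0

lemma diag_self {n : ℕ} {X Y : Fin n → A.Ob} {l : ℤ} (u : ∀ i, A.Hom (X i) (Y i) l) (i : Fin n) :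
    diag u i i = u i := dif_pos rfl

lemma diag_ne {n : ℕ} {X Y : Fin n → A.Ob} {l : ℤ} (u : ∀ i, A.Hom (X i) (Y i) l) {i j : Fin n}
    (h : j ≠ i) : diag u i j = 0 := dif_neg h

lemma diag_comp {n : ℕ} {X Y : Fin n → A.Ob} {Z : (addHull A).Ob} {l p q : ℤ}
    (u : ∀ i, A.Hom (X i) (Y i) l) (h : l + p = q) (f : (addHull A).Hom Z ⟨n, X⟩ p)
    (i : Fin n) (j : Fin Z.1) :
    (addHull A).comp h (diag u) f i j = A.comp h (u i) (f i j) := by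
  change ∑ s, A.comp h (diag u i s) (f s j) = _
  rw [Finset.sum_eq_single i, diag_self]
  · intro s _ hs
    rw [diag_ne u hs, map_zero, LinearMap.zero_apply]
  · simp

lemma comp_diag {n : ℕ} {X Y : Fin n → A.Ob} {Z : (addHull A).Ob} {l p q : ℤ}
    (u : ∀ i, A.Hom (X i) (Y i) l) (h : p + l = q) (f : (addHull A).Hom ⟨n, Y⟩ Z p)
    (i : Fin Z.1) (j : Fin n) :
    (addHull A).comp h f (diag u) i j = A.comp h (f i j) (u j) := by
  change ∑ s, A.comp h (f i s) (diag u s j) = _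
  rw [Finset.sum_eq_single j, diag_self]
  · intro s _ hs
    rw [diag_ne u hs.symm, map_zero]
  · simp

lemma one_diag {n : ℕ} (X : Fin n → A.Ob) :
    (addHull A).one ⟨n, X⟩ = diag fun i => A.one (X i) := by
  funext i j
  by_cases h : j = i
  · subst h
    exact (dif_pos rfl).trans (diag_self (fun i => A.one (X i)) j).symm
  · exact (dif_neg h).trans (diag_ne _ h).symm

lemma d_diag {n : ℕ} {X Y : Fin n → A.Ob} {l m : ℤ} (u : ∀ i, A.Hom (X i) (Y i) l) (h : l + 1 = m) :
    (addHull A).d l m h (diag u) = diag fun i => A.d l m h (u i) := by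
  funext i j
  change A.d l m h (diag u i j) = _
  by_cases h : j = i
  · subst h
    rw [diag_self, diag_self]
  · rw [diag_ne _ h, diag_ne _ h, map_zero]

lemma diag_comp_diag {n : ℕ} {X Y Z : Fin n → A.Ob} {l p q : ℤ} (u : ∀ i, A.Hom (Y i) (Z i) l)
    (v : ∀ i, A.Hom (X i) (Y i) p) (h : l + p = q) :
    (addHull A).comp h (diag u) (diag v) = diag fun i => A.comp h (u i) (v i) := by
  funext i j
  rw [diag_comp]
  by_cases h : j = i
  · subst h
    rw [diag_self, diag_self]
  · rw [diag_ne _ h, diag_ne _ h, map_zero]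

lemma diag_zero {n : ℕ} {X Y : Fin n → A.Ob} {l : ℤ} :
    diag (fun i => (0 : A.Hom (X i) (Y i) l)) = 0 := by
  funext i j
  by_cases h : j = i
  · subst h
    rw [diag_self]
    rfl
  · rw [diag_ne _ h]
    rfl

/-- The shift of a formal direct sum. -/
def addHullShift {r r' : ℤ} {n : ℕ} {X Y : Fin n → A.Ob} (h : r' + r = 0)
    (s : ∀ i, ShiftData A r r' (X i) (Y i)) : ShiftData (addHull A) r r' ⟨n, X⟩ ⟨n, Y⟩ where
  h := h
  i := diag fun i => (s i).i
  p := diag fun i => (s i).p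
  p_i := by
    rw [diag_comp_diag, one_diag]
    exact congrArg diag (funext fun i => (s i).p_i)
  i_p := by
    rw [diag_comp_diag, one_diag]
    exact congrArg diag (funext fun i => (s i).i_p)
  d_i := by
    rw [d_diag, ← diag_zero]
    exact congrArg diag (funext fun i => (s i).d_i)
  d_p := by
    rw [d_diag, ← diag_zero]
    exact congrArg diag (funext fun i => (s i).d_p)

lemma pretr_exists_shift {r r' : ℤ} (h : r' + r = 0) (X : (pretr A).Ob) :
    ∃ X', Nonempty (ShiftData (pretr A) r r' X X') := by
  obtain ⟨⟨⟨n, X⟩, q, hq⟩, hX⟩ := X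
  let T : Twisted (addHull (shiftHull A)) := ⟨⟨n, X⟩, q, hq⟩
  let s : ShiftData (addHull (shiftHull A)) r r' T.obj ⟨n, fun i => ((X i).1, (X i).2 + r')⟩ :=
    addHullShift h fun i => shiftHullShift h (X i)
  let T' : Twisted (addHull (shiftHull A)) := ⟨⟨n, fun i => ((X i).1, (X i).2 + r')⟩, _,
    shift_twist_eq s⟩
  refine ⟨⟨T', fun i j hij => ?_⟩, ⟨(ShiftData.twist (X := T) (X' := T') s rfl).sub hX _⟩⟩
  refine (congrArg (fun z => sgn r • z) ?_).trans (smul_zero _)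
  refine (diag_comp _ _ _ _ _).trans ?_
  refine (congrArg _ ((comp_diag (fun i => (shiftHullShift h (X i)).p) rfl q i j).trans ?_)).trans
    (map_zero _)
  rw [show q i j = 0 from hX i j hij, map_zero, LinearMap.zero_apply]

section directSum

variable {m n : ℕ} (X : Fin m → A.Ob) (Y : Fin n → A.Ob)

/-- The direct sum of two formal direct sums. -/
def addSum : (addHull A).Ob := ⟨m + n, fun i => Sum.elim X Y (finSumFinEquiv.symm i)⟩

/-- The components of the first inclusion. -/
def inlEntry : ∀ (t : Fin m ⊕ Fin n) (j : Fin m), A.Hom (X j) (Sum.elim X Y t) 0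
  | .inl i, j => if e : j = i then A.oneEq (congrArg X e) else 0
  | .inr _, _ => 0

/-- The components of the second inclusion. -/
def inrEntry : ∀ (t : Fin m ⊕ Fin n) (j : Fin n), A.Hom (Y j) (Sum.elim X Y t) 0
  | .inl _, _ => 0
  | .inr i, j => if e : j = i then A.oneEq (congrArg Y e) else 0

/-- The components of the first projection. -/
def fstEntry : ∀ (i : Fin m) (t : Fin m ⊕ Fin n), A.Hom (Sum.elim X Y t) (X i) 0
  | i, .inl j => if e : j = i then A.oneEq (congrArg X e) else 0
  | _, .inr _ => 0

/-- The components of the second projection. -/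
def sndEntry : ∀ (i : Fin n) (t : Fin m ⊕ Fin n), A.Hom (Sum.elim X Y t) (Y i) 0
  | _, .inl _ => 0
  | i, .inr j => if e : j = i then A.oneEq (congrArg Y e) else 0

lemma inlEntry_ne {t : Fin m ⊕ Fin n} {j : Fin m} (h : t ≠ .inl j) : inlEntry X Y t j = 0 := by
  rcases t with i | i
  · exact dif_neg (by rintro rfl; exact h rfl)
  · rfl

lemma inrEntry_ne {t : Fin m ⊕ Fin n} {j : Fin n} (h : t ≠ .inr j) : inrEntry X Y t j = 0 := by
  rcases t with i | i
  · rfl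
  · exact dif_neg (by rintro rfl; exact h rfl)

lemma fstEntry_ne {t : Fin m ⊕ Fin n} {i : Fin m} (h : t ≠ .inl i) : fstEntry X Y i t = 0 := by
  rcases t with j | j
  · exact dif_neg (by rintro rfl; exact h rfl)
  · rfl

lemma sndEntry_ne {t : Fin m ⊕ Fin n} {i : Fin n} (h : t ≠ .inr i) : sndEntry X Y i t = 0 := by
  rcases t with j | j
  · rfl
  · exact dif_neg (by rintro rfl; exact h rfl)

lemma inlEntry_self (i : Fin m) : inlEntry X Y (.inl i) i = A.one (X i) := dif_pos rfl
lemma inrEntry_self (i : Fin n) : inrEntry X Y (.inr i) i = A.one (Y i) := dif_pos rfl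
lemma fstEntry_self (i : Fin m) : fstEntry X Y i (.inl i) = A.one (X i) := dif_pos rfl
lemma sndEntry_self (i : Fin n) : sndEntry X Y i (.inr i) = A.one (Y i) := dif_pos rfl

lemma sum_addSum {M : Type*} [AddCommMonoid M] (f : Fin m ⊕ Fin n → M) :
    ∑ s : Fin (m + n), f (finSumFinEquiv.symm s) = ∑ t, f t :=
  Equiv.sum_comp finSumFinEquiv.symm f

/-- The direct sum as an extension. -/
def sumExt : Ext (A := addHull A) (X := ⟨n, Y⟩) (Y := ⟨m, X⟩) 0 0 0 0 (m := 1) 0 (addSum X Y) where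
  ha := rfl
  hb := rfl
  hm := rfl
  i₁ := fun i j => inrEntry X Y (finSumFinEquiv.symm i) j
  p₁ := fun i j => sndEntry X Y i (finSumFinEquiv.symm j)
  i₂ := fun i j => inlEntry X Y (finSumFinEquiv.symm i) j
  p₂ := fun i j => fstEntry X Y i (finSumFinEquiv.symm j)
  p₁_i₁ := by
    funext i j
    refine (sum_addSum fun t => A.comp (add_zero 0) (sndEntry X Y i t) (inrEntry X Y t j)).trans ?_
    rw [Finset.sum_eq_single (.inr i), sndEntry_self]
    · exact (A.one_comp (zero_add 0) (inrEntry X Y (.inr i) j)).trans rfl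
    · intro t _ ht
      rw [sndEntry_ne X Y ht, map_zero, LinearMap.zero_apply]
    · simp
  p₂_i₂ := by
    funext i j
    refine (sum_addSum fun t => A.comp (add_zero 0) (fstEntry X Y i t) (inlEntry X Y t j)).trans ?_
    rw [Finset.sum_eq_single (.inl i), fstEntry_self]
    · exact (A.one_comp (zero_add 0) (inlEntry X Y (.inl i) j)).trans rfl
    · intro t _ ht
      rw [fstEntry_ne X Y ht, map_zero, LinearMap.zero_apply]
    · simp
  p₁_i₂ := by
    funext i j
    refine (sum_addSum fun t => A.comp (add_zero 0) (sndEntry X Y i t) (inlEntry X Y t j)).trans ?_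
    refine Finset.sum_eq_zero fun t _ => ?_
    rcases t with t | t
    · rw [sndEntry_ne X Y (by simp), map_zero, LinearMap.zero_apply]
    · rw [inlEntry_ne X Y (by simp), map_zero]
  p₂_i₁ := by
    funext i j
    refine (sum_addSum fun t => A.comp (add_zero 0) (fstEntry X Y i t) (inrEntry X Y t j)).trans ?_
    refine Finset.sum_eq_zero fun t _ => ?_
    rcases t with t | t
    · rw [inrEntry_ne X Y (by simp), map_zero]
    · rw [fstEntry_ne X Y (by simp), map_zero, LinearMap.zero_apply]
  total := by
    funext i j
    change ∑ s, A.comp _ (inrEntry X Y (finSumFinEquiv.symm i) s) (sndEntry X Y s (finSumFinEquiv.symm j)) +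
      ∑ s, A.comp _ (inlEntry X Y (finSumFinEquiv.symm i) s) (fstEntry X Y s (finSumFinEquiv.symm j)) = _
    by_cases h : j = i
    · subst h
      refine Eq.trans ?_ (dif_pos rfl).symm
      change _ = A.one (Sum.elim X Y (finSumFinEquiv.symm j))
      generalize finSumFinEquiv.symm j = t
      rcases t with t | t
      · rw [Finset.sum_eq_zero, Finset.sum_eq_single t, inlEntry_self, fstEntry_self, zero_add]
        · exact A.one_comp _ _
        · intro s _ hs
          rw [inlEntry_ne X Y (by simpa using hs.symm), map_zero, LinearMap.zero_apply]
        · simp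
        · intro s _
          rw [inrEntry_ne X Y (by simp), map_zero, LinearMap.zero_apply]
      · rw [Finset.sum_eq_single t, Finset.sum_eq_zero, inrEntry_self, sndEntry_self, add_zero]
        · exact A.one_comp _ _
        · intro s _
          rw [inlEntry_ne X Y (by simp), map_zero, LinearMap.zero_apply]
        · intro s _ hs
          rw [inrEntry_ne X Y (by simpa using hs.symm), map_zero, LinearMap.zero_apply]
        · simp
    · refine Eq.trans ?_ (dif_neg h).symm
      refine (congrArg₂ (· + ·) (Finset.sum_eq_zero ?_) (Finset.sum_eq_zero ?_)).trans (add_zero _)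
      swap
      · intro s _
        by_cases h' : finSumFinEquiv.symm i = .inl s
        · rw [fstEntry_ne X Y (fun h'' => h (finSumFinEquiv.symm.injective (h''.trans h'.symm))),
            map_zero]
        · rw [inlEntry_ne X Y h', map_zero, LinearMap.zero_apply]
      · intro s _
        by_cases h' : finSumFinEquiv.symm i = .inr s
        · rw [sndEntry_ne X Y (fun h'' => h (finSumFinEquiv.symm.injective (h''.trans h'.symm))),
            map_zero]
        · rw [inrEntry_ne X Y h', map_zero, LinearMap.zero_apply]
  d_i₂ := by
    funext i j
    change A.d 0 1 _ (inlEntry X Y _ j) = 0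
    generalize finSumFinEquiv.symm i = t
    by_cases h : t = .inl j
    · subst h
      rw [inlEntry_self]
      exact A.d_one _ _ _
    · rw [inlEntry_ne X Y h, map_zero]
  d_i₁ := by
    rw [map_zero]
    funext i j
    change A.d 0 1 _ (inrEntry X Y _ j) = 0
    generalize finSumFinEquiv.symm i = t
    by_cases h : t = .inr j
    · subst h
      rw [inrEntry_self]
      exact A.d_one _ _ _
    · rw [inrEntry_ne X Y h, map_zero]

end directSum

lemma pretr_exists_ext {X Y : (pretr A).Ob} (f : (pretr A).Hom X Y 1)
    (hf : (pretr A).d 1 2 rfl f = 0) : ∃ C, Nonempty (Ext (A := pretr A) 0 0 0 0 f C) := by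
  let c := sumExt (A := shiftHull A) Y.1.obj.2 X.1.obj.2
  have hf' : (addHull (shiftHull A)).d 1 2 rfl f +
      (addHull (shiftHull A)).comp one_add_one_eq_two Y.1.q f +
        (addHull (shiftHull A)).comp one_add_one_eq_two f X.1.q = 0 := by
    refine Eq.trans ?_ hf
    change _ = _ - sgn 1 • (addHull (shiftHull A)).comp one_add_one_eq_two f X.1.q
    rw [sgn_one, neg_smul, one_smul, sub_neg_eq_add]
    rfl
  let T : Twisted (addHull (shiftHull A)) := ⟨_, _, d_extQ (X := X.1) (Y := Y.1) f c hf'⟩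
  refine ⟨⟨T, fun i j hij => ?_⟩, ⟨(Ext.twist (X := X.1) (Y := Y.1) (Z := T) f c rfl).sub X.2 Y.2 _⟩⟩
  have hij' : ∀ {a b : Fin Y.1.obj.1 ⊕ Fin X.1.obj.1}, finSumFinEquiv.symm i = a →
      finSumFinEquiv.symm j = b → (finSumFinEquiv b : ℕ) ≤ finSumFinEquiv a := by
    rintro _ _ rfl rfl
    exact ((congrArg Fin.val (finSumFinEquiv.apply_symm_apply j)).trans_le hij).trans
      (congrArg Fin.val (finSumFinEquiv.apply_symm_apply i)).ge
  have z₁ : (addHull (shiftHull A)).comp (zero_add 1) c.i₂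
      ((addHull (shiftHull A)).comp (add_zero 1) Y.1.q c.p₂) i j = 0 := by
    refine addHull_comp_eq_zero _ fun s => ?_
    by_cases h : finSumFinEquiv.symm i = .inl s
    · refine (congrArg _ (addHull_comp_eq_zero _ fun t => ?_)).trans (map_zero _)
      by_cases h' : finSumFinEquiv.symm j = .inl t
      · have := hij' h h'
        simp at this
        rw [Y.2 s t this]
        exact (LinearMap.congr_fun (map_zero _) _).trans rfl
      · exact (congrArg _ (fstEntry_ne _ _ h')).trans (map_zero _)
    · exact (congrArg (fun z => (shiftHull A).comp _ z _) (inlEntry_ne _ _ h)).trans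
        ((LinearMap.congr_fun (map_zero _) _).trans rfl)
  have z₂ : (addHull (shiftHull A)).comp (zero_add 1) c.i₁
      ((addHull (shiftHull A)).comp (add_zero 1) X.1.q c.p₁) i j = 0 := by
    refine addHull_comp_eq_zero _ fun s => ?_
    by_cases h : finSumFinEquiv.symm i = .inr s
    · refine (congrArg _ (addHull_comp_eq_zero _ fun t => ?_)).trans (map_zero _)
      by_cases h' : finSumFinEquiv.symm j = .inr t
      · have := hij' h h'
        simp at this
        rw [X.2 s t this]
        exact (LinearMap.congr_fun (map_zero _) _).trans rfl
      · exact (congrArg _ (sndEntry_ne _ _ h')).trans (map_zero _)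
    · exact (congrArg (fun z => (shiftHull A).comp _ z _) (inrEntry_ne _ _ h)).trans
        ((LinearMap.congr_fun (map_zero _) _).trans rfl)
  have z₃ : (addHull (shiftHull A)).comp (zero_add 1) c.i₂
      ((addHull (shiftHull A)).comp (add_zero 1) f c.p₁) i j = 0 := by
    refine addHull_comp_eq_zero _ fun s => ?_
    by_cases h : finSumFinEquiv.symm i = .inl s
    · refine (congrArg _ (addHull_comp_eq_zero _ fun t => ?_)).trans (map_zero _)
      by_cases h' : finSumFinEquiv.symm j = .inr t
      · have := hij' h h'
        simp at this
        omega
      · exact (congrArg _ (sndEntry_ne _ _ h')).trans (map_zero _)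
    · exact (congrArg (fun z => (shiftHull A).comp _ z _) (inlEntry_ne _ _ h)).trans
        ((LinearMap.congr_fun (map_zero _) _).trans rfl)
  change (addHull (shiftHull A)).comp (zero_add 1) c.i₂
      ((addHull (shiftHull A)).comp (add_zero 1) Y.1.q c.p₂) i j +
    (addHull (shiftHull A)).comp (zero_add 1) c.i₁
      ((addHull (shiftHull A)).comp (add_zero 1) X.1.q c.p₁) i j +
    (addHull (shiftHull A)).comp (zero_add 1) c.i₂
      ((addHull (shiftHull A)).comp (add_zero 1) f c.p₁) i j = 0
  rw [z₁, z₂, z₃, add_zero, add_zero]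

/-- The DG category of one-sided twisted complexes is pretriangulated. -/
lemma pretr_pretriangulated (A : DGCategory.{w, v, u} k) : Pretriangulated (pretr A) where
  exists_zero := ⟨⟨⟨⟨0, fun i => i.elim0⟩, fun i => i.elim0, funext fun i => i.elim0⟩,
    fun i => i.elim0⟩, funext fun i => i.elim0⟩
  exists_shift := pretr_exists_shift
  exists_ext := pretr_exists_ext

end hulls

section cell

variable {k : Type w} [CommRing k] {A : DGCategory.{w, v₁, u₁} k} {B : DGCategory.{w, v₂, u₂} k}

/-- Transport of morphisms along an equality of degrees. -/
def DGCategory.castHom (A : DGCategory.{w, v, u} k) {X Y : A.Ob} {p q : ℤ} (h : p = q) :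
    A.Hom X Y p →ₗ[k] A.Hom X Y q := h ▸ LinearMap.id

lemma castHom_bijective {X Y : A.Ob} {p q : ℤ} (h : p = q) :
    Function.Bijective (A.castHom h : A.Hom X Y p →ₗ[k] A.Hom X Y q) := by
  subst h
  exact Function.bijective_id

lemma d_castHom {X Y : A.Ob} {p q p' q' : ℤ} (h : p = p') (h' : q = q') (hp : p + 1 = q)
    (hp' : p' + 1 = q') (f : A.Hom X Y p) :
    A.d p' q' hp' (A.castHom h f) = A.castHom h' (A.d p q hp f) := by
  subst h h'
  rfl

lemma castHom_comp {X Y Z : A.Ob} {q p r q' p' r' : ℤ} (h : q + p = r) (hq : q = q') (hp : p = p')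
    (hr : r = r') (h' : q' + p' = r') (g : A.Hom Y Z q) (f : A.Hom X Y p) :
    A.castHom hr (A.comp h g f) = A.comp h' (A.castHom hq g) (A.castHom hp f) := by
  subst hq hp hr
  rfl

lemma castHom_one {X : A.Ob} {n : ℤ} (h : 0 = n) : A.castHom h (A.one X) = A.oneOf X h.symm := by
  subst h
  rfl

lemma map_castHom (F : DGFunctor A B) {X Y : A.Ob} {p q : ℤ} (h : p = q) (f : A.Hom X Y p) :
    F.map q (A.castHom h f) = B.castHom h (F.map p f) := by
  subst h
  rfl

lemma eq_add_zero_sub_zero (n : ℤ) : n = n + 0 - 0 := by rw [add_zero, sub_zero]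

/-- The formal direct sum with one summand, which is not shifted. -/
abbrev cellOb (X : B.Ob) : (addHull (shiftHull B)).Ob := ⟨1, fun _ => (X, 0)⟩

/-- The matrix with one entry. -/
def cellMap (X Y : B.Ob) (n : ℤ) :
    B.Hom X Y n →ₗ[k] (addHull (shiftHull B)).Hom (cellOb X) (cellOb Y) n where
  toFun f _ _ := B.castHom (eq_add_zero_sub_zero n) f
  map_add' f g := by
    funext i j
    exact map_add _ _ _
  map_smul' c f := by
    funext i j
    exact map_smul _ _ _

lemma d_cellMap {X Y : B.Ob} {n m : ℤ} (h : n + 1 = m) (f : B.Hom X Y n) :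
    (addHull (shiftHull B)).d n m h (cellMap X Y n f) = cellMap X Y m (B.d n m h f) := by
  funext i j
  change sgn 0 • B.d (n + 0 - 0) (m + 0 - 0) (by omega)
    (B.castHom (eq_add_zero_sub_zero n) f) = B.castHom (eq_add_zero_sub_zero m) (B.d n m h f)
  rw [sgn_zero, one_smul, d_castHom _ (eq_add_zero_sub_zero m) h]

lemma cellMap_one (X : B.Ob) : cellMap X X 0 (B.one X) = (addHull (shiftHull B)).one (cellOb X) := by
  funext i j
  obtain rfl : j = i := Subsingleton.elim _ _
  refine Eq.trans ?_ (dif_pos rfl).symm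
  exact castHom_one (A := B) (eq_add_zero_sub_zero 0)

lemma cellMap_comp {X Y Z : B.Ob} {q p r : ℤ} (h : q + p = r) (g : B.Hom Y Z q) (f : B.Hom X Y p) :
    cellMap X Z r (B.comp h g f) = (addHull (shiftHull B)).comp h (cellMap Y Z q g)
      (cellMap X Y p f) := by
  funext i j
  change B.castHom (eq_add_zero_sub_zero r) (B.comp h g f) =
    ∑ s : Fin 1, B.comp (by omega : q + 0 - 0 + (p + 0 - 0) = r + 0 - 0)
      (B.castHom (eq_add_zero_sub_zero q) g) (B.castHom (eq_add_zero_sub_zero p) f)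
  rw [Fintype.sum_subsingleton _ (0 : Fin 1)]
  exact castHom_comp h (eq_add_zero_sub_zero q) (eq_add_zero_sub_zero p)
    (eq_add_zero_sub_zero r) _ g f

lemma cellMap_bijective (X Y : B.Ob) (n : ℤ) : Function.Bijective (cellMap X Y n) := by
  refine ⟨fun f g h => ?_, fun f => ?_⟩
  · exact (castHom_bijective (A := B) (eq_add_zero_sub_zero n)).1
      (congrFun (congrFun h (0 : Fin 1)) (0 : Fin 1))
  · obtain ⟨g, hg⟩ := (castHom_bijective (A := B) (eq_add_zero_sub_zero n)).2
      (f (0 : Fin 1) (0 : Fin 1))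
    refine ⟨g, funext fun i => funext fun j => ?_⟩
    obtain rfl : i = (0 : Fin 1) := Subsingleton.elim _ _
    obtain rfl : j = (0 : Fin 1) := Subsingleton.elim _ _
    exact hg

/-- The twisted complex with one term. (The zero endomorphism of degree one is allowed to be written
in another way.) -/
def cellTwisted (X : B.Ob) (q : (addHull (shiftHull B)).Hom (cellOb X) (cellOb X) 1) (hq : q = 0) :
    (pretr B).Ob :=
  ⟨⟨cellOb X, q, by rw [hq, map_zero, map_zero, add_zero]⟩, fun i j _ => by
    change q i j = 0
    rw [hq]
    rfl⟩

lemma d_cellTwisted {X Y : B.Ob} {q : (addHull (shiftHull B)).Hom (cellOb X) (cellOb X) 1}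
    {q' : (addHull (shiftHull B)).Hom (cellOb Y) (cellOb Y) 1} (hq : q = 0) (hq' : q' = 0)
    {n m : ℤ} (h : n + 1 = m) (f : B.Hom X Y n) :
    (pretr B).d (X := cellTwisted X q hq) (Y := cellTwisted Y q' hq') n m h (cellMap X Y n f) =
      cellMap X Y m (B.d n m h f) := by
  subst hq hq'
  change (addHull (shiftHull B)).d n m h (cellMap X Y n f) +
    (addHull (shiftHull B)).comp ((add_comm 1 n).trans h) 0 (cellMap X Y n f) -
      sgn n • (addHull (shiftHull B)).comp h (cellMap X Y n f) 0 = _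
  rw [map_zero, map_zero, LinearMap.zero_apply, smul_zero, add_zero, sub_zero, d_cellMap]

/-- A DG functor, as a functor to one-sided twisted complexes with one term. -/
def cellWith (F : DGFunctor A B) (q : ∀ X : A.Ob, (addHull (shiftHull B)).Hom
    (cellOb (F.obj X)) (cellOb (F.obj X)) 1) (hq : ∀ X, q X = 0) : DGFunctor A (pretr B) where
  obj X := cellTwisted (F.obj X) (q X) (hq X)
  map {X Y} n := (cellMap (F.obj X) (F.obj Y) n).comp (F.map n)
  map_d {X Y} n m h f := by
    refine Eq.trans ?_ (d_cellTwisted (hq X) (hq Y) h (F.map n f)).symm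
    exact congrArg (cellMap (F.obj X) (F.obj Y) m) (F.map_d n m h f)
  map_one X := (congrArg (cellMap (F.obj X) (F.obj X) 0) (F.map_one X)).trans (cellMap_one _)
  map_comp h g f := (congrArg (cellMap _ _ _) (F.map_comp h g f)).trans (cellMap_comp h _ _)

lemma cellWith_congr (F : DGFunctor A B) {q q' : ∀ X : A.Ob, (addHull (shiftHull B)).Hom
    (cellOb (F.obj X)) (cellOb (F.obj X)) 1} (hq : ∀ X, q X = 0)
    (hq' : ∀ X, q' X = 0) : cellWith F q hq = cellWith F q' hq' := by
  obtain rfl : q = q' := funext fun X => (hq X).trans (hq' X).symm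
  rfl

/-- The inclusion of a DG category in its one-sided twisted complexes. -/
def cell (A : DGCategory.{w, v, u} k) : DGFunctor A (pretr A) :=
  cellWith { obj := fun X => X, map := fun _ => LinearMap.id, map_d := fun _ _ _ _ => rfl,
             map_one := fun _ => rfl, map_comp := fun _ _ _ => rfl } (fun _ => 0) fun _ => rfl

lemma DGFunctor.congr_map {F G : DGFunctor A B} (hobj : F.obj = G.obj)
    (hmap : ∀ (X Y : A.Ob) (n : ℤ) (f : A.Hom X Y n), HEq (F.map n f) (G.map n f)) : F = G := by
  obtain ⟨o, m, _, _, _⟩ := F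
  obtain ⟨o', m', _, _, _⟩ := G
  obtain rfl : o = o' := hobj
  obtain rfl : @m = @m' := by
    funext X Y n
    exact LinearMap.ext fun f => eq_of_heq (hmap X Y n f)
  rfl

lemma cell_pretrMap (F : DGFunctor A B) : (cell A).comp (pretrMap F) = F.comp (cell B) := by
  have h₁ : (cell A).comp (pretrMap F) = cellWith F (fun X i j => F.map _ 0)
      (fun X => funext fun i => funext fun j => map_zero _) :=
    DGFunctor.congr_map rfl fun X Y n f => heq_of_eq (funext fun i => funext fun j =>
      map_castHom F (eq_add_zero_sub_zero n) f)
  have h₂ : F.comp (cell B) = cellWith F (fun X => 0) (fun X => rfl) := rfl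
  rw [h₁, h₂]
  exact cellWith_congr F _ _

lemma cell_bijective (X Y : A.Ob) (n : ℤ) :
    Function.Bijective ((cell A).map n : A.Hom X Y n →ₗ[k] _) := cellMap_bijective X Y n

end cell

section frame

variable {k : Type w} [CommRing k] {A : DGCategory.{w, v₁, u₁} k} {T : DGCategory.{w, v₂, u₂} k}

/-- A decomposition of `Z` as a direct sum of shifts of objects `ι (x a)`, up to the differential,
which is triangular. -/
structure Frame (ι : DGFunctor A T) (Z : T.Ob) where
  n : ℕ
  x : Fin n → A.Ob
  m : Fin n → ℤ
  m' : Fin n → ℤ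
  hm : ∀ a, m' a + m a = 0
  i : ∀ a, T.Hom (ι.obj (x a)) Z (m a)
  p : ∀ a, T.Hom Z (ι.obj (x a)) (m' a)
  p_i : ∀ a, T.comp (hm a) (p a) (i a) = T.one _
  p_i_ne : ∀ a b, a ≠ b → T.comp (rfl : m' a + m b = m' a + m b) (p a) (i b) = 0
  total : ∑ a, T.comp ((add_comm _ _).trans (hm a)) (i a) (p a) = T.one Z
  tri : ∀ a b, b ≤ a → T.comp (rfl : m' a + (m b + 1) = m' a + (m b + 1)) (p a)
    (T.d (m b) (m b + 1) rfl (i b)) = 0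

namespace Frame

variable {ι : DGFunctor A T} {Z : T.Ob} (c : Frame ι Z)

lemma p_i_ne' {a b : Fin c.n} (h : a ≠ b) {r : ℤ} (hr : c.m' a + c.m b = r) :
    T.comp hr (c.p a) (c.i b) = 0 := by
  subst hr
  exact c.p_i_ne a b h

lemma p_d_i {a b : Fin c.n} (h : b ≤ a) {q r : ℤ} (hq : c.m b + 1 = q) (hr : c.m' a + q = r) :
    T.comp hr (c.p a) (T.d (c.m b) q hq (c.i b)) = 0 := by
  subst hq hr
  exact c.tri a b h

lemma d_p_i_const (a b : Fin c.n) {r s : ℤ} (hr : c.m' a + c.m b = r) (hs : r + 1 = s) :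
    T.d r s hs (T.comp hr (c.p a) (c.i b)) = 0 := by
  rcases eq_or_ne a b with rfl | e
  · obtain rfl : r = 0 := hr.symm.trans (c.hm a)
    rw [c.p_i, T.d_one]
  · rw [c.p_i_ne' e, map_zero]

lemma d_p_i {a b : Fin c.n} (h : b ≤ a) {q r : ℤ} (hq : c.m' a + 1 = q) (hr : q + c.m b = r) :
    T.comp hr (T.d (c.m' a) q hq (c.p a)) (c.i b) = 0 := by
  have hl := T.leibniz (p' := c.m b + 1) (q' := q) rfl (by omega) hq rfl hr (by omega) (c.p a) (c.i b)
  rw [c.d_p_i_const, c.p_d_i h, smul_zero, add_zero] at hl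
  exact hl.symm

/-- The decomposition in the dual DG category. -/
def op : Frame ι.op Z where
  n := c.n
  x a := c.x a.rev
  m a := c.m' a.rev
  m' a := c.m a.rev
  hm a := (add_comm _ _).trans (c.hm a.rev)
  i a := c.p a.rev
  p a := sgn (c.m a.rev * c.m' a.rev) • c.i a.rev
  p_i a := by
    change sgn (c.m a.rev * c.m' a.rev) • T.comp (c.hm a.rev) (c.p a.rev)
      (sgn (c.m a.rev * c.m' a.rev) • c.i a.rev) = T.one (ι.obj (c.x a.rev))
    rw [map_zsmul, sgn_smul_sgn_smul, c.p_i]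
  p_i_ne a b h := by
    change sgn (c.m a.rev * c.m' b.rev) • T.comp (add_comm _ _) (c.p b.rev)
      (sgn (c.m a.rev * c.m' a.rev) • c.i a.rev) = 0
    rw [map_zsmul, c.p_i_ne' (fun h' => h (Fin.rev_injective h'.symm)), smul_zero, smul_zero]
  total := by
    rw [← c.total]
    refine Eq.trans ?_ (Equiv.sum_comp Fin.revPerm (fun a => T.comp _ (c.i a) (c.p a)))
    refine Finset.sum_congr rfl fun a _ => ?_
    change sgn (c.m' a.rev * c.m a.rev) • T.comp ((add_comm _ _).trans (c.hm a.rev))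
      (sgn (c.m a.rev * c.m' a.rev) • c.i a.rev) (c.p a.rev) = _
    rw [map_zsmul, LinearMap.smul_apply, mul_comm, sgn_smul_sgn_smul]
    rfl
  tri a b h := by
    change sgn (c.m a.rev * (c.m' b.rev + 1)) • T.comp (add_comm _ _)
      (T.d (c.m' b.rev) (c.m' b.rev + 1) rfl (c.p b.rev))
      (sgn (c.m a.rev * c.m' a.rev) • c.i a.rev) = 0
    rw [map_zsmul, c.d_p_i (Fin.rev_le_rev.2 h), smul_zero, smul_zero]

end Frame

section addHull

variable {n : ℕ} {X x : Fin n → A.Ob} {m : Fin n → ℤ}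

/-- The column with one nonzero entry. -/
def inclCol (u : ∀ a, A.Hom (x a) (X a) (m a)) (a : Fin n) :
    (addHull A).Hom ⟨1, fun _ => x a⟩ ⟨n, X⟩ (m a) :=
  fun i _ => Pi.single (M := fun i => A.Hom (x a) (X i) (m a)) a (u a) i

/-- The row with one nonzero entry. -/
def projRow (v : ∀ a, A.Hom (X a) (x a) (m a)) (a : Fin n) :
    (addHull A).Hom ⟨n, X⟩ ⟨1, fun _ => x a⟩ (m a) :=
  fun _ j => Pi.single (M := fun j => A.Hom (X j) (x a) (m a)) a (v a) j

lemma comp_inclCol (u : ∀ a, A.Hom (x a) (X a) (m a)) (a : Fin n) {W : (addHull A).Ob} {p q : ℤ}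
    (h : p + m a = q) (f : (addHull A).Hom ⟨n, X⟩ W p) (i j) :
    (addHull A).comp h f (inclCol u a) i j = A.comp h (f i a) (u a) := by
  change ∑ s, A.comp h (f i s) (inclCol u a s j) = _
  rw [Finset.sum_eq_single a]
  · exact congrArg _ (Pi.single_eq_same _ _)
  · intro s _ hs
    rw [show inclCol u a s j = 0 from Pi.single_eq_of_ne hs _, map_zero]
  · simp

lemma projRow_comp (v : ∀ a, A.Hom (X a) (x a) (m a)) (a : Fin n) {W : (addHull A).Ob} {p q : ℤ}
    (h : m a + p = q) (f : (addHull A).Hom W ⟨n, X⟩ p) (i j) :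
    (addHull A).comp h (projRow v a) f i j = A.comp h (v a) (f a j) := by
  change ∑ s, A.comp h (projRow v a i s) (f s j) = _
  rw [Finset.sum_eq_single a]
  · exact congrArg (fun z => A.comp h z (f a j)) (Pi.single_eq_same _ _)
  · intro s _ hs
    rw [show projRow v a i s = 0 from Pi.single_eq_of_ne hs _, map_zero, LinearMap.zero_apply]
  · simp

lemma d_inclCol (u : ∀ a, A.Hom (x a) (X a) (m a)) (a : Fin n) {q : ℤ} (h : m a + 1 = q)
    (hu : A.d _ _ h (u a) = 0) : (addHull A).d _ _ h (inclCol u a) = 0 := by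
  funext i j
  change A.d _ _ h (inclCol u a i j) = 0
  by_cases e : i = a
  · subst e
    rw [show inclCol u i i j = u i from Pi.single_eq_same _ _, hu]
  · rw [show inclCol u a i j = 0 from Pi.single_eq_of_ne e _, map_zero]

lemma sum_inclCol_projRow {m' : Fin n → ℤ} (u : ∀ a, A.Hom (x a) (X a) (m a))
    (v : ∀ a, A.Hom (X a) (x a) (m' a)) (h : ∀ a, m a + m' a = 0)
    (huv : ∀ a, A.comp (h a) (u a) (v a) = A.one (X a)) :
    ∑ a, (addHull A).comp (h a) (inclCol u a) (projRow v a) = (addHull A).one ⟨n, X⟩ := by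
  funext i j
  have hs : ∀ f : Fin n → (addHull A).Hom ⟨n, X⟩ ⟨n, X⟩ 0, (∑ a, f a) i j = ∑ a, f a i j := by
    intro f
    induction (Finset.univ : Finset (Fin n)) using Finset.induction_on with
    | empty => rfl
    | insert a s ha ih =>
      rw [Finset.sum_insert ha, Finset.sum_insert ha, ← ih]
      rfl
  have hc : ∀ a, (addHull A).comp (h a) (inclCol u a) (projRow v a) i j =
      A.comp (h a) (inclCol u a i 0) (projRow v a 0 j) := fun a =>
    Fintype.sum_subsingleton (fun s : Fin 1 => A.comp (h a) (inclCol u a i s) (projRow v a s j)) 0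
  rw [hs, Finset.sum_eq_single i, hc, show inclCol u i i 0 = u i from Pi.single_eq_same _ _]
  · by_cases e : j = i
    · subst e
      rw [show projRow v j 0 j = v j from Pi.single_eq_same _ _, huv]
      rw [one_diag]
      exact (diag_self (fun i => A.one (X i)) j).symm
    · rw [show projRow v i 0 j = 0 from Pi.single_eq_of_ne e _, map_zero, one_diag]
      exact (diag_ne _ e).symm
  · intro a _ ha
    rw [hc, show inclCol u a i 0 = 0 from Pi.single_eq_of_ne ha.symm _, map_zero,
      LinearMap.zero_apply]
  · simp

lemma projRow_comp_inclCol_self {m' : Fin n → ℤ} (u : ∀ a, A.Hom (x a) (X a) (m a))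
    (v : ∀ a, A.Hom (X a) (x a) (m' a)) (a : Fin n) (h : m' a + m a = 0)
    (hvu : A.comp h (v a) (u a) = A.one (x a)) :
    (addHull A).comp h (projRow v a) (inclCol u a) = (addHull A).one ⟨1, fun _ => x a⟩ := by
  funext i j
  obtain rfl : j = i := Subsingleton.elim _ _
  rw [projRow_comp, show inclCol u a a j = u a from Pi.single_eq_same _ _, hvu, one_diag]
  exact (diag_self (fun _ => A.one (x a)) j).symm

lemma projRow_comp_inclCol_ne {m' : Fin n → ℤ} (u : ∀ a, A.Hom (x a) (X a) (m a))
    (v : ∀ a, A.Hom (X a) (x a) (m' a)) {a b : Fin n} (hab : a ≠ b) {r : ℤ} (h : m' a + m b = r) :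
    (addHull A).comp h (projRow v a) (inclCol u b) = 0 := by
  funext i j
  rw [projRow_comp, show inclCol u b a j = 0 from Pi.single_eq_of_ne hab _, map_zero]
  rfl

lemma projRow_comp_comp_inclCol {m' : Fin n → ℤ} (u : ∀ a, A.Hom (x a) (X a) (m a))
    (v : ∀ a, A.Hom (X a) (x a) (m' a)) {a b : Fin n} {q r s : ℤ} (h : q + m b = r)
    (h' : m' a + r = s) {f : (addHull A).Hom ⟨n, X⟩ ⟨n, X⟩ q} (hf : f a b = 0) :
    (addHull A).comp h' (projRow v a) ((addHull A).comp h f (inclCol u b)) = 0 := by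
  funext i j
  rw [projRow_comp, comp_inclCol, hf, map_zero, LinearMap.zero_apply, map_zero]
  rfl

end addHull

/-- The identity, as a morphism to a formal shift. -/
def toShift {k : Type w} [CommRing k] {A : DGCategory.{w, v, u} k} (X : A.Ob) (r : ℤ) :
    (shiftHull A).Hom (X, 0) (X, r) (-r) :=
  A.oneOf X (show -r + r - 0 = 0 by omega)

/-- The identity, as a morphism from a formal shift. -/
def ofShift {k : Type w} [CommRing k] {A : DGCategory.{w, v, u} k} (X : A.Ob) (r : ℤ) :
    (shiftHull A).Hom (X, r) (X, 0) r :=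
  A.oneOf X (show r + 0 - r = 0 by omega)

lemma oneOf_comp_oneOf {X : A.Ob} {p q r : ℤ} (hp : p = 0) (hq : q = 0) (h : q + p = r) :
    A.comp h (A.oneOf X hq) (A.oneOf X hp) = A.oneOf X (by omega : r = 0) := by
  subst hp hq
  obtain rfl : r = 0 := by omega
  exact A.one_comp h _

lemma ofShift_comp_toShift (X : A.Ob) (r : ℤ) : (shiftHull A).comp (add_neg_cancel r)
    (ofShift X r) (toShift X r) = (shiftHull A).one (X, 0) :=
  oneOf_comp_oneOf (A := A) _ _ _

lemma toShift_comp_ofShift (X : A.Ob) (r : ℤ) : (shiftHull A).comp (neg_add_cancel r)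
    (toShift X r) (ofShift X r) = (shiftHull A).one (X, r) :=
  oneOf_comp_oneOf (A := A) _ _ _

lemma d_toShift (X : A.Ob) (r : ℤ) {q : ℤ} (h : -r + 1 = q) :
    (shiftHull A).d (-r) q h (toShift X r) = 0 := by
  have : ∀ {n m : ℤ} (hn : n = 0) (h : n + 1 = m), A.d n m h (A.oneOf X hn) = 0 := by
    rintro _ _ rfl h
    exact A.d_one _ _ _
  change sgn r • A.d (-r + r - 0) (q + r - 0) (by omega) (A.oneOf X _) = 0
  rw [this, smul_zero]

section cellFrame

variable {k : Type w} [CommRing k] {A : DGCategory.{w, v, u} k} (Z : (addHull (shiftHull A)).Ob)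

/-- The inclusions of the terms of a formal direct sum of formal shifts. -/
def cellIncl (a : Fin Z.1) : (addHull (shiftHull A)).Hom (cellOb (Z.2 a).1) Z (-(Z.2 a).2) :=
  inclCol (A := shiftHull A) (X := Z.2) (x := fun a => ((Z.2 a).1, 0)) (m := fun a => -(Z.2 a).2)
    (fun a => toShift (Z.2 a).1 (Z.2 a).2) a

/-- The projections to the terms of a formal direct sum of formal shifts. -/
def cellProj (a : Fin Z.1) : (addHull (shiftHull A)).Hom Z (cellOb (Z.2 a).1) (Z.2 a).2 :=
  projRow (A := shiftHull A) (X := Z.2) (x := fun a => ((Z.2 a).1, 0)) (m := fun a => (Z.2 a).2)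
    (fun a => ofShift (Z.2 a).1 (Z.2 a).2) a

lemma cellProj_comp_cellIncl_self (a : Fin Z.1) : (addHull (shiftHull A)).comp (add_neg_cancel _)
    (cellProj Z a) (cellIncl Z a) = (addHull (shiftHull A)).one (cellOb (Z.2 a).1) :=
  projRow_comp_inclCol_self (A := shiftHull A) (X := Z.2) (x := fun a => ((Z.2 a).1, 0))
    (m := fun a => -(Z.2 a).2) (m' := fun a => (Z.2 a).2) _ _ a _ (ofShift_comp_toShift _ _)

lemma cellProj_comp_cellIncl_ne {a b : Fin Z.1} (h : a ≠ b) {r : ℤ}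
    (hr : (Z.2 a).2 + -(Z.2 b).2 = r) :
    (addHull (shiftHull A)).comp hr (cellProj Z a) (cellIncl Z b) = 0 :=
  projRow_comp_inclCol_ne (A := shiftHull A) (X := Z.2) (x := fun a => ((Z.2 a).1, 0))
    (m := fun a => -(Z.2 a).2) (m' := fun a => (Z.2 a).2) _ _ h hr

lemma sum_cellIncl_cellProj : ∑ a, (addHull (shiftHull A)).comp (neg_add_cancel _)
    (cellIncl Z a) (cellProj Z a) = (addHull (shiftHull A)).one Z :=
  sum_inclCol_projRow (A := shiftHull A) (X := Z.2) (x := fun a => ((Z.2 a).1, 0))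
    (m := fun a => -(Z.2 a).2) (m' := fun a => (Z.2 a).2) _ _ (fun _ => neg_add_cancel _)
    fun _ => toShift_comp_ofShift _ _

lemma d_cellIncl (a : Fin Z.1) {q : ℤ} (h : -(Z.2 a).2 + 1 = q) :
    (addHull (shiftHull A)).d _ q h (cellIncl Z a) = 0 :=
  d_inclCol (A := shiftHull A) (X := Z.2) (x := fun a => ((Z.2 a).1, 0))
    (m := fun a => -(Z.2 a).2) _ a h (d_toShift _ _ h)

lemma cellProj_comp_comp_cellIncl {a b : Fin Z.1} {q r s : ℤ} (h : q + -(Z.2 b).2 = r)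
    (h' : (Z.2 a).2 + r = s) {f : (addHull (shiftHull A)).Hom Z Z q} (hf : f a b = 0) :
    (addHull (shiftHull A)).comp h' (cellProj Z a)
      ((addHull (shiftHull A)).comp h f (cellIncl Z b)) = 0 :=
  projRow_comp_comp_inclCol (A := shiftHull A) (X := Z.2) (x := fun a => ((Z.2 a).1, 0))
    (m := fun a => -(Z.2 a).2) (m' := fun a => (Z.2 a).2) _ _ h h' hf

lemma d_cellIncl_twisted (Z : (pretr A).Ob) (a : Fin Z.1.obj.1) {q : ℤ}
    (h : -(Z.1.obj.2 a).2 + 1 = q) :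
    (pretr A).d (X := (cell A).obj (Z.1.obj.2 a).1) (Y := Z) (-(Z.1.obj.2 a).2) q h
      (cellIncl Z.1.obj a) =
    (addHull (shiftHull A)).comp ((add_comm _ _).trans h) Z.1.q (cellIncl Z.1.obj a) := by
  change (addHull (shiftHull A)).d _ q h (cellIncl Z.1.obj a) +
    (addHull (shiftHull A)).comp ((add_comm _ _).trans h) Z.1.q (cellIncl Z.1.obj a) -
      sgn (-(Z.1.obj.2 a).2) • (addHull (shiftHull A)).comp h (cellIncl Z.1.obj a) 0 = _
  rw [d_cellIncl, map_zero, smul_zero, zero_add, sub_zero]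

/-- The terms of a one-sided twisted complex. -/
def cellFrame (Z : (pretr A).Ob) : Frame (cell A) Z where
  n := Z.1.obj.1
  x a := (Z.1.obj.2 a).1
  m a := -(Z.1.obj.2 a).2
  m' a := (Z.1.obj.2 a).2
  hm _ := add_neg_cancel _
  i := cellIncl Z.1.obj
  p := cellProj Z.1.obj
  p_i := cellProj_comp_cellIncl_self Z.1.obj
  p_i_ne _ _ h := cellProj_comp_cellIncl_ne Z.1.obj h rfl
  total := sum_cellIncl_cellProj Z.1.obj
  tri a b h := (congrArg _ (d_cellIncl_twisted Z b rfl)).trans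
    (cellProj_comp_comp_cellIncl Z.1.obj _ _ (Z.2 a b h))

end cellFrame

end frame

section rightModule

variable {k : Type u} [CommRing k] {A T : DGCategory.{u, u, u} k} {ι : DGFunctor A T} {Z : T.Ob}

namespace Frame

lemma isAcyclic (c : Frame ι Z) {N : RightModule T}
    (h : ∀ a, (evalMod (ι.obj (c.x a))).IsAcyclic N) : (evalMod Z).IsAcyclic N := by
  intro p q r hp hq m hm
  subst hp
  suffices H : ∀ l ≤ c.n, ∃ y : N.X Z p, ∀ a : Fin c.n, a.1 < l →
      N.act rfl (m - N.d p (p + 1) rfl y) (c.i a) = 0 by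
    obtain ⟨y, hy⟩ := H c.n le_rfl
    refine ⟨y, (sub_eq_zero.1 ?_).symm⟩
    rw [← N.act_one (add_zero (p + 1)) (m - _), ← c.total, map_sum]
    refine Finset.sum_eq_zero fun a _ => ?_
    rw [← N.act_comp rfl (by have := c.hm a; omega) _ _, hy a a.2, map_zero, LinearMap.zero_apply]
  intro l hl
  induction l with
  | zero => exact ⟨0, fun a ha => absurd ha (Nat.not_lt_zero _)⟩
  | succ l ih =>
    obtain ⟨y, hy⟩ := ih (by omega)
    let t : Fin c.n := ⟨l, hl⟩
    have hc : N.d (p + 1) r hq (m - N.d p (p + 1) rfl y) = 0 := by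
      rw [map_sub, N.d_d, show N.d (p + 1) r hq m = 0 from hm, sub_zero]
    set m₁ := m - N.d p (p + 1) rfl y with hm₁
    have hd : ∀ {q s : ℤ} (hq : c.m t + 1 = q) (hs : p + 1 + q = s),
        N.act hs m₁ (T.d (c.m t) q hq (c.i t)) = 0 := by
      intro q s hq hs
      have e := T.one_comp (zero_add q) (T.d (c.m t) q hq (c.i t))
      rw [← e, ← c.total, map_sum, LinearMap.sum_apply, map_sum]
      refine Finset.sum_eq_zero fun a _ => ?_
      rw [T.assoc _ (zero_add q) (rfl : c.m' a + q = c.m' a + q) (by have := c.hm a; omega)]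
      rcases lt_or_ge a t with hat | hat
      · rw [← N.act_comp rfl (by have := c.hm a; omega), hy a hat, map_zero, LinearMap.zero_apply]
      · rw [c.p_d_i hat, map_zero, map_zero]
    obtain ⟨w, hw⟩ := h t (p := p + c.m t) (q := p + 1 + c.m t) (r := p + 1 + c.m t + 1) (by omega)
      rfl (N.act rfl m₁ (c.i t)) (by
        change N.d _ _ _ (N.act _ _ _) = 0
        rw [N.leibniz (q' := r) (p' := c.m t + 1) rfl rfl hq rfl (by omega) (by omega), hc, hd,
          map_zero, LinearMap.zero_apply, smul_zero, add_zero])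
    change N.d _ _ _ w = _ at hw
    refine ⟨y + N.act (by have := c.hm t; omega) w (c.p t), fun a ha => ?_⟩
    rw [map_add, ← sub_sub, ← hm₁, map_sub, LinearMap.sub_apply,
      N.leibniz (q' := p + 1 + c.m t) (p' := c.m' t + 1) _ rfl (by omega) rfl
        (by have := c.hm t; omega) (by have := c.hm t; omega), hw, map_add, LinearMap.add_apply,
      map_zsmul, LinearMap.smul_apply,
      N.act_comp (bc := c.m' t + 1 + c.m a) _ _ rfl (by have := c.hm t; omega) w,
      c.d_p_i (show a ≤ t from Nat.lt_succ_iff.1 ha), map_zero, smul_zero, add_zero,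
      N.act_comp (bc := c.m' t + c.m a) _ _ rfl (by have := c.hm t; omega)]
    rcases eq_or_ne a t with rfl | hat
    · have : ∀ {s : ℤ} (hs : c.m' t + c.m t = s) (hr : p + 1 + c.m t + s = p + 1 + c.m t),
          N.act hr (N.act rfl m₁ (c.i t)) (T.comp hs (c.p t) (c.i t)) = N.act rfl m₁ (c.i t) := by
        rintro s hs hr
        obtain rfl : s = 0 := hs.symm.trans (c.hm t)
        rw [c.p_i, N.act_one]
      rw [this, sub_self]
    · have hat' : a.1 < l := lt_of_le_of_ne (Nat.lt_succ_iff.1 ha) fun h' => hat (Fin.ext h')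
      rw [hy a hat', c.p_i_ne' hat.symm, map_zero, sub_zero]

lemma isQis (c : Frame ι Z) {M N : RightModule T} {f : (rightMod T).Hom M N 0}
    (hf : (rightMod T).d 0 1 (zero_add 1) f = 0)
    (h : ∀ a, (evalMod (ι.obj (c.x a))).IsQis f) : (evalMod Z).IsQis f := by
  obtain ⟨C, ⟨E⟩, -⟩ := exists_moduleCone f hf
  exact E.isQis_of_isAcyclic (c.isAcyclic fun a => E.isAcyclic_of_isQis (h a))

end Frame

end rightModule

section indCells

variable {k : Type u} [CommRing k] {A B : DGCategory.{u, u, u} k} {M : RightModule A}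

/-- The components `m ↦ m ⊗ 1` of the unit. -/
def indUnitMap (F : DGFunctor A B) (M : RightModule A) (Y : A.Ob) (p : ℤ) :
    M.X Y p →ₗ[k] (indModule F M).X (F.obj Y) p :=
  (tmul F M (add_zero p)).flip (B.one (F.obj Y))

lemma indUnitMap_act (F : DGFunctor A B) {Y Z : A.Ob} {p a q : ℤ} (h : p + a = q) (m : M.X Y p)
    (f : A.Hom Z Y a) : indUnitMap F M Z q (M.act h m f) =
      (indModule F M).act h (indUnitMap F M Y p m) (F.map a f) :=
  (indUnit F M).2.app_act (add_zero p) (add_zero q) h h m f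

lemma d_indUnitMap (F : DGFunctor A B) {Y : A.Ob} {p q : ℤ} (h : p + 1 = q) (m : M.X Y p) :
    (indModule F M).d p q h (indUnitMap F M Y p m) = indUnitMap F M Y q (M.d p q h m) := by
  have := app_closed ((indResAdj F).d_unit M) Y (add_zero p) h h (add_zero q) m
  rw [sgn_zero, one_smul] at this
  exact this

namespace Cells

variable (c : Cells M)

lemma coeff_e_self (g : c.G) : c.coeff g _ _ (c.e g) = A.oneOf (c.x g) (sub_self (c.n g)) := by
  have h : ∀ (j : ℤ) (hj : j = 0) (hh : c.n g + j = c.n g),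
      M.act hh (c.e g) (A.oneOf (c.x g) hj) = c.e g := by
    rintro j rfl hh
    exact M.act_one hh _
  have := c.coeff_self g _ _ (A.oneOf (c.x g) (sub_self (c.n g)))
  rwa [h _ (sub_self _)] at this

lemma ext_coeff {Z : A.Ob} {p : ℤ} {m m' : M.X Z p} (h : ∀ g, c.coeff g Z p m = c.coeff g Z p m') :
    m = m' :=
  (c.coeffs Z p).injective (DFinsupp.ext h)

lemma coeff_sum (S : Finset c.G) {Z : A.Ob} {p : ℤ} (a : ∀ g, A.Hom Z (c.x g) (p - c.n g))
    (ha : ∀ g ∉ S, a g = 0) (g : c.G) :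
    c.coeff g Z p (∑ g ∈ S, M.act (add_sub_cancel _ _) (c.e g) (a g)) = a g := by
  classical
  rw [map_sum]
  by_cases hg : g ∈ S
  · rw [Finset.sum_eq_single_of_mem g hg fun g' _ h => c.coeff_ne h.symm _ _ _, c.coeff_self]
  · rw [ha g hg]
    exact Finset.sum_eq_zero fun g' hg' => c.coeff_ne (by rintro rfl; exact hg hg') _ _ _

lemma eq_sum (S : Finset c.G) {Z : A.Ob} {p : ℤ} (m : M.X Z p)
    (hm : ∀ g ∉ S, c.coeff g Z p m = 0) :
    m = ∑ g ∈ S, M.act (add_sub_cancel _ _) (c.e g) (c.coeff g Z p m) :=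
  c.ext_coeff fun g => (c.coeff_sum S _ hm g).symm

lemma coeff_d_of_le {Z : A.Ob} {p q : ℤ} (hp : p + 1 = q) (m : M.X Z p) (g : c.G)
    (hm : ∀ g', c.rank g < c.rank g' → c.coeff g' Z p m = 0) (h : p - c.n g + 1 = q - c.n g) :
    c.coeff g Z q (M.d p q hp m) = sgn (c.n g) • A.d _ _ h (c.coeff g Z p m) := by
  refine c.linearMap_congr (φ := (c.coeff g Z q).comp (M.d p q hp))
    (ψ := sgn (c.n g) • (A.d _ _ h).comp (c.coeff g Z p)) m fun g' a hg' => ?_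
  have hle : c.rank g' ≤ c.rank g := by
    by_contra h'
    exact hg' (hm g' (not_le.1 h'))
  rw [LinearMap.comp_apply, LinearMap.smul_apply, LinearMap.comp_apply,
    M.leibniz (q' := c.n g' + 1) (p' := q - c.n g') _ _ rfl (by omega) (by omega) (by omega), map_add,
    c.coeff_act g _ (by omega), c.coeff_d_e hle, map_zero, LinearMap.zero_apply, zero_add, map_zsmul]
  by_cases e : g' = g
  · subst e
    rw [c.coeff_self, c.coeff_self]
  · rw [c.coeff_ne (Ne.symm e), c.coeff_ne (Ne.symm e), map_zero, smul_zero, smul_zero]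

variable (F : DGFunctor A B)

/-- The coefficient of one generator, on the induced module. -/
def indCoeff (g : c.G) (Y : B.Ob) (n : ℤ) :
    (indModule F M).X Y n →ₗ[k] B.Hom Y (F.obj (c.x g)) (n - c.n g) :=
  indLift F M
    (fun X p q h => (B.comp (by omega : p - c.n g + q = n - c.n g)).comp
      ((F.map (p - c.n g)).comp (c.coeff g X p)))
    (fun {X X' p a p' q q'} h h' hn hn' m f v => by
      simp only [LinearMap.comp_apply]
      rw [c.coeff_act g h (by omega), F.map_comp, B.assoc _ _ h' (by omega)])

lemma indCoeff_tmul (g : c.G) {Y : B.Ob} {n : ℤ} {X : A.Ob} {p q : ℤ} (h : p + q = n)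
    (m : M.X X p) (v : B.Hom Y (F.obj X) q) :
    c.indCoeff F g Y n (tmul F M h m v) =
      B.comp (by omega : p - c.n g + q = n - c.n g) (F.map (p - c.n g) (c.coeff g X p m)) v :=
  indLift_tmul F M _ _ h m v

lemma indAct_gen (g : c.G) {Y : B.Ob} {n a : ℤ} (h : c.n g + a = n) (v : B.Hom Y (F.obj (c.x g)) a) :
    (indModule F M).act h (tmul F M (add_zero (c.n g)) (c.e g) (B.one _)) v =
      tmul F M h (c.e g) v := by
  refine (indAct_tmul F M h (add_zero _) (zero_add a) h _ _ _).trans ?_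
  rw [B.one_comp]

/-- The generators of an induced module. -/
abbrev ind : Cells (indModule F M) :=
  Cells.ofCoeff (x := fun g => F.obj (c.x g)) (n := c.n)
    (fun g => tmul F M (add_zero (c.n g)) (c.e g) (B.one _)) (c.indCoeff F)
    (fun g Z p f => by
      rw [c.indAct_gen, indCoeff_tmul, c.coeff_e_self, F.map_oneOf]
      exact B.oneOf_comp _ _ _)
    (fun g g' h Z p f => by
      rw [c.indAct_gen, indCoeff_tmul, show c.coeff g' _ _ (c.e g) = 0 from c.coeffs_e_eq_zero h,
        map_zero, map_zero, LinearMap.zero_apply])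
    (fun Z p S h => by
      rw [← Submodule.ker_mkQ S, LinearMap.ker_eq_top]
      refine ind_ext F M fun X a b hab m v => ?_
      refine LinearMap.congr_fun (f := S.mkQ.comp ((tmul F M hab).flip v)) (g := 0)
        (c.linearMap_ext fun g f => ?_) m
      refine (Submodule.Quotient.mk_eq_zero _).2 ?_
      have := h g (B.comp (by omega : a - c.n g + b = p - c.n g) (F.map _ f) v)
      rw [c.indAct_gen] at this
      rwa [LinearMap.flip_apply, tmul_act F M _ (by omega : a - c.n g + b = p - c.n g) _ (by omega)])
    c.rank
    (fun g g' h => c.rank_lt' fun h' => h (by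
      change c.indCoeff F g' _ _ (indD F M _ _ rfl _) = 0
      rw [indD_tmul F M rfl (add_zero _) rfl (zero_add 1) (add_zero _) (by omega), B.d_one, map_zero,
        smul_zero, add_zero, indCoeff_tmul, show c.coeff g' _ _ (M.d _ _ rfl (c.e g)) = 0 from h',
        map_zero, map_zero, LinearMap.zero_apply]))

lemma ind_coeff_unit (g : c.G) {Y : A.Ob} {p : ℤ} (m : M.X Y p) :
    (c.ind F).coeff g (F.obj Y) p (indUnitMap F M Y p m) =
      F.map (p - c.n g) (c.coeff g Y p m) := by
  refine LinearMap.congr_fun (f := ((c.ind F).coeff g (F.obj Y) p).comp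
    (indUnitMap F M Y p)) (g := (F.map (p - c.n g)).comp (c.coeff g Y p))
    (c.linearMap_ext fun g' f => ?_) m
  have e : indUnitMap F M Y p (M.act (add_sub_cancel _ _) (c.e g') f) =
      (indModule F M).act (add_sub_cancel (c.n g') p) ((c.ind F).e g') (F.map _ f) :=
    indUnitMap_act F (add_sub_cancel (c.n g') p) (c.e g') f
  rw [LinearMap.comp_apply, LinearMap.comp_apply, e]
  by_cases h : g' = g
  · subst h
    rw [c.coeff_self]
    exact (c.ind F).coeff_self g' _ _ _
  · rw [c.coeff_ne (Ne.symm h), map_zero]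
    exact (c.ind F).coeff_ne (Ne.symm h) _ _ _

include c in
lemma indUnit_isModQis (hF : ∀ X Y : A.Ob, ChainQis (fun p q h => A.d (X := X) (Y := Y) p q h)
    (fun p q h => B.d p q h) F.map) : IsModQis (indUnit F M) := by
  classical
  intro Y o p q r ho hp hq x y hx hxy
  have key : ∀ (i : ℕ) (x : M.X Y q) (y : (indModule F M).X (F.obj Y) p),
      (∀ g, i ≤ c.rank g → c.coeff g Y q x = 0) →
      (∀ g, i ≤ c.rank g → (c.ind F).coeff g (F.obj Y) p y = 0) → M.d q r hq x = 0 →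
      indUnitMap F M Y q x = (indModule F M).d p q hp y →
      ∃ (x' : M.X Y p) (y' : (indModule F M).X (F.obj Y) o), M.d p q hp x' = x ∧
        y = indUnitMap F M Y p x' + (indModule F M).d o p ho y' := by
    intro i
    induction i with
    | zero =>
      intro x y hx₀ hy₀ _ _
      obtain rfl : x = 0 := c.ext_coeff fun g => by rw [hx₀ g (Nat.zero_le _), map_zero]
      obtain rfl : y = 0 := (c.ind F).ext_coeff fun g => by rw [hy₀ g (Nat.zero_le _), map_zero]
      exact ⟨0, 0, map_zero _, by rw [map_zero, map_zero, add_zero]⟩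
    | succ i ih =>
      intro x y hx₀ hy₀ hx hxy
      let S : Finset c.G := (c.finite_coeff x).toFinset ∪ ((c.ind F).finite_coeff y).toFinset
      have hS : ∀ g ∉ S, c.coeff g Y q x = 0 ∧ (c.ind F).coeff g (F.obj Y) p y = 0 := by
        intro g hg
        simp only [S, Finset.mem_union, Set.Finite.mem_toFinset, Set.mem_ofPred_eq, not_or,
          not_not] at hg
        exact hg
      have h₁ : ∀ g, c.rank g = i → sgn (c.n g) • A.d (q - c.n g) (r - c.n g) (by omega)
          (c.coeff g Y q x) = 0 := fun g hg => by
        rw [← c.coeff_d_of_le hq x g (fun g' h => hx₀ g' (by omega)), hx, map_zero]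
      have h₂ : ∀ g, c.rank g = i → F.map (q - c.n g) (c.coeff g Y q x) =
          sgn (c.n g) • B.d (p - c.n g) (q - c.n g) (by omega) ((c.ind F).coeff g (F.obj Y) p y) :=
        fun g hg => by
        rw [← c.ind_coeff_unit F, hxy]
        exact (c.ind F).coeff_d_of_le hp y g (fun g' h => hy₀ g' (by
          change c.rank g < c.rank g' at h; omega)) _
      have h₃ : ∀ g, ∃ (a : A.Hom Y (c.x g) (p - c.n g)) (b : B.Hom (F.obj Y) (F.obj (c.x g)) (o - c.n g)),
          (c.rank g = i → A.d _ _ (by omega) a = sgn (c.n g) • c.coeff g Y q x ∧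
            (c.ind F).coeff g (F.obj Y) p y = F.map _ a + B.d _ _ (by omega) b) ∧
          (c.rank g ≠ i ∨ g ∉ S → a = 0 ∧ b = 0) := by
        intro g
        by_cases hg : c.rank g = i ∧ g ∈ S
        · obtain ⟨a, b, ha, hb⟩ := hF Y (c.x g) (by omega : o - c.n g + 1 = p - c.n g)
            (by omega : p - c.n g + 1 = q - c.n g) (by omega : q - c.n g + 1 = r - c.n g)
            (sgn (c.n g) • c.coeff g Y q x) ((c.ind F).coeff g (F.obj Y) p y)
            (by rw [map_zsmul, h₁ g hg.1]) (by rw [map_zsmul, h₂ g hg.1, sgn_smul_sgn_smul])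
          exact ⟨a, b, fun _ => ⟨ha, hb⟩, fun h => by
            rcases h with h | h
            · exact absurd hg.1 h
            · exact absurd hg.2 h⟩
        · refine ⟨0, 0, fun hi => ?_, fun _ => ⟨rfl, rfl⟩⟩
          obtain ⟨e₁, e₂⟩ := hS g fun h => hg ⟨hi, h⟩
          rw [e₁, e₂, map_zero, map_zero, map_zero, smul_zero, add_zero]
          exact ⟨rfl, rfl⟩
      choose a b h₄ h₅ using h₃
      let X' : M.X Y p := ∑ g ∈ S, M.act (add_sub_cancel _ _) (c.e g) (a g)
      let Y' : (indModule F M).X (F.obj Y) o := ∑ g ∈ S, (indModule F M).act (add_sub_cancel _ _)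
        ((c.ind F).e g) (sgn (c.n g) • b g)
      have hX' : ∀ g, c.coeff g Y p X' = a g :=
        c.coeff_sum S a fun g hg => (h₅ g (Or.inr hg)).1
      have hY' : ∀ g, (c.ind F).coeff g (F.obj Y) o Y' = sgn (c.n g) • b g :=
        (c.ind F).coeff_sum S (fun g => sgn (c.n g) • b g) fun g hg => by
          rw [(h₅ g (Or.inr hg)).2, smul_zero]
      have hclosed : indUnitMap F M Y q (M.d p q hp X') =
          (indModule F M).d p q hp (indUnitMap F M Y p X') :=
        (d_indUnitMap F hp X').symm
      have h₇ : ∀ g, i ≤ c.rank g → c.coeff g Y q (x - M.d p q hp X') = 0 := by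
        intro g hg
        have hr : ∀ g', c.rank g < c.rank g' → c.coeff g' Y p X' = 0 := fun g' h => by
          rw [hX', (h₅ g' (Or.inl (by omega))).1]
        rw [map_sub, c.coeff_d_of_le hp X' g hr (by omega), hX']
        rcases eq_or_lt_of_le hg with h | h
        · rw [(h₄ g h.symm).1, sgn_smul_sgn_smul, sub_self]
        · rw [(h₅ g (Or.inl (by omega))).1, map_zero, smul_zero, sub_zero, hx₀ g h]
      have h₈ : ∀ g, i ≤ c.rank g → (c.ind F).coeff g (F.obj Y) p
          (y - indUnitMap F M Y p X' - (indModule F M).d o p ho Y') = 0 := by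
        intro g hg
        have hr : ∀ g', c.rank g < c.rank g' → (c.ind F).coeff g' (F.obj Y) o Y' = 0 := fun g' h => by
          rw [hY', (h₅ g' (Or.inl (by omega))).2, smul_zero]
        have h₆ := (c.ind F).coeff_d_of_le ho Y' g hr (by change o - c.n g + 1 = p - c.n g; omega)
        rw [map_sub, map_sub, c.ind_coeff_unit F, h₆, hX', hY', map_zsmul]
        change _ - _ - sgn (c.n g) • sgn (c.n g) • _ = _
        rw [sgn_smul_sgn_smul]
        rcases eq_or_lt_of_le hg with h | h
        · rw [(h₄ g h.symm).2, add_sub_cancel_left]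
          exact sub_self _
        · rw [(h₅ g (Or.inl (by omega))).1, (h₅ g (Or.inl (by omega))).2, map_zero, map_zero,
            hy₀ g h, sub_zero, sub_zero]
      obtain ⟨x', y', hx', hy'⟩ := ih (x - M.d p q hp X')
        (y - indUnitMap F M Y p X' - (indModule F M).d o p ho Y') h₇ h₈
        (by rw [map_sub, hx, M.d_d, sub_zero])
        (by rw [map_sub, map_sub, map_sub, (indModule F M).d_d, sub_zero, hxy, hclosed])
      refine ⟨x' + X', y' + Y', by rw [map_add, hx', sub_add_cancel], ?_⟩
      rw [map_add, map_add, add_add_add_comm, ← hy']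
      abel
  obtain ⟨i, hi⟩ : ∃ i : ℕ, ∀ g, i ≤ c.rank g →
      c.coeff g Y q x = 0 ∧ (c.ind F).coeff g (F.obj Y) p y = 0 := by
    let S : Finset c.G := (c.finite_coeff x).toFinset ∪ ((c.ind F).finite_coeff y).toFinset
    refine ⟨S.sup c.rank + 1, fun g hg => ?_⟩
    have hgS : g ∉ S := fun h => by
      have := Finset.le_sup (f := c.rank) h
      omega
    simp only [S, Finset.mem_union, Set.Finite.mem_toFinset, Set.mem_ofPred_eq, not_or,
      not_not] at hgS
    exact hgS
  exact key i x y (fun g hg => (hi g hg).1) (fun g hg => (hi g hg).2) hx hxy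

end Cells

lemma IsSemiFree.indUnit_isModQis (hM : IsSemiFree M) (F : DGFunctor A B)
    (hF : ∀ X Y : A.Ob, ChainQis (fun p q h => A.d (X := X) (Y := Y) p q h)
    (fun p q h => B.d p q h) F.map) : IsModQis (indUnit F M) :=
  Cells.indUnit_isModQis hM.nonempty_cells.some F hF

end indCells

section H0

variable {k : Type u} [CommRing k] {T T' : DGCategory.{u, u, u} k}

namespace RightModule

/-- Cocycles of degree zero, up to coboundaries. -/
def setoid (N : RightModule T) (Z : T.Ob) : Setoid {m : N.X Z 0 // N.d 0 1 (zero_add 1) m = 0} where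
  r m m' := ∃ n, N.d (-1) 0 (neg_add_cancel 1) n = m.1 - m'.1
  iseqv := ⟨fun m => ⟨0, by rw [map_zero, sub_self]⟩,
    fun ⟨n, h⟩ => ⟨-n, by rw [map_neg, h, neg_sub]⟩,
    fun ⟨n, h⟩ ⟨n', h'⟩ => ⟨n + n', by rw [map_add, h, h', sub_add_sub_cancel]⟩⟩

lemma d_act_closed (N : RightModule T) {X Y : T.Ob} {p q : ℤ} (h : p + 1 = q) {f : T.Hom X Y 0}
    (hf : T.d 0 1 (zero_add 1) f = 0) (m : N.X Y p) :
    N.d p q h (N.act (add_zero p) m f) = N.act (add_zero q) (N.d p q h m) f := by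
  rw [N.leibniz (add_zero p) h h (zero_add 1) (add_zero q) h, hf, map_zero, smul_zero, add_zero]

lemma d_act_cocycle (N : RightModule T) {X Y : T.Ob} {p q r s a : ℤ} (hq : p + 1 = q) {m : N.X Y p}
    (hm : N.d p q hq m = 0) {b : ℤ} (hab : a + 1 = b) (h : p + a = r) (hs : r + 1 = s)
    (h' : p + b = s) (f : T.Hom X Y a) :
    N.d r s hs (N.act h m f) = sgn p • N.act h' m (T.d a b hab f) := by
  rw [N.leibniz h hs hq hab (by omega : q + a = s) h', hm, map_zero, LinearMap.zero_apply, zero_add]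

/-- The action of a closed morphism on classes of cocycles. -/
def classMap (N : RightModule T) {X Y : Z0 T} (f : X ⟶ Y) :
    Quotient (N.setoid Y.ob) → Quotient (N.setoid X.ob) :=
  Quotient.map' (fun m => ⟨N.act (add_zero 0) m.1 f.1, by
    rw [d_act_closed _ _ f.2, m.2, map_zero, LinearMap.zero_apply]⟩) fun m m' ⟨n, h⟩ =>
      ⟨N.act (add_zero (-1)) n f.1, by
        rw [d_act_closed _ _ f.2, h, map_sub, LinearMap.sub_apply]⟩

/-- The cohomology in degree zero of a right DG module, as a contravariant functor on the homotopy
category. -/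
def H0 (N : RightModule T) : Ho T ⥤ (Type u)ᵒᵖ :=
  CategoryTheory.Quotient.lift _
    { obj Z := Opposite.op (Quotient (N.setoid Z.ob))
      map f := (TypeCat.ofHom (N.classMap f)).op
      map_id Z := by
        refine congrArg Quiver.Hom.op (ConcreteCategory.hom_ext _ _ fun x => ?_)
        obtain ⟨m, hm⟩ := Quotient.exists_rep x
        subst hm
        exact congrArg (Quotient.mk _) (Subtype.ext (N.act_one _ m.1))
      map_comp f g := by
        refine congrArg Quiver.Hom.op (ConcreteCategory.hom_ext _ _ fun x => ?_)
        obtain ⟨m, hm⟩ := Quotient.exists_rep x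
        subst hm
        exact congrArg (Quotient.mk _) (Subtype.ext (N.act_comp _ _ (add_zero 0) _ m.1 g.1 f.1).symm) }
    fun X Y f g ⟨h, e⟩ => by
      refine congrArg Quiver.Hom.op (ConcreteCategory.hom_ext _ _ fun x => ?_)
      obtain ⟨m, hm⟩ := Quotient.exists_rep x
      subst hm
      refine Quotient.sound ⟨N.act (zero_add (-1)) m.1 h, ?_⟩
      rw [N.d_act_cocycle (zero_add 1) m.2 (neg_add_cancel 1) _ _ (zero_add 0), e, sgn_zero, one_smul,
        map_sub]

/-- The class of a cocycle. -/
def H0mk (N : RightModule T) {Z : T.Ob} (m : N.X Z 0) (hm : N.d 0 1 (zero_add 1) m = 0) :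
    (N.H0.obj (Ho.of Z)).unop := Quotient.mk (N.setoid Z) ⟨m, hm⟩

variable (N : RightModule T)

lemma H0mk_surj {Z : T.Ob} (x : (N.H0.obj (Ho.of Z)).unop) : ∃ m hm, x = N.H0mk m hm := by
  obtain ⟨m, rfl⟩ := Quotient.exists_rep x
  exact ⟨m.1, m.2, rfl⟩

lemma H0mk_eq_iff {Z : T.Ob} {m m' : N.X Z 0} {hm : N.d 0 1 (zero_add 1) m = 0}
    {hm' : N.d 0 1 (zero_add 1) m' = 0} :
    N.H0mk m hm = N.H0mk m' hm' ↔ ∃ n, N.d (-1) 0 (neg_add_cancel 1) n = m - m' :=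
  Quotient.eq (r := N.setoid Z)

lemma H0_map_mk {X Y : T.Ob} {f : T.Hom X Y 0} (hf : T.d 0 1 (zero_add 1) f = 0) {m : N.X Y 0}
    (hm : N.d 0 1 (zero_add 1) m = 0) :
    (N.H0.map (Ho.mk f hf)).unop (N.H0mk m hm) = N.H0mk (N.act (add_zero 0) m f) (by
      rw [d_act_closed _ _ hf, hm, map_zero, LinearMap.zero_apply]) := rfl

/-- A closed morphism whose cone is sent to an acyclic complex is inverted. -/
lemma isIso_H0_map {X Y C : T.Ob} {f : T.Hom X Y 0} (hf : T.d 0 1 (zero_add 1) f = 0)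
    {a a' b b' : ℤ} (c : Ext a a' b b' f C) (hN : (evalMod C).IsAcyclic N) :
    IsIso (N.H0.map (Ho.mk f hf)) := by
  have hab : b = a + 1 := by have := c.hm; omega
  have ha := c.ha
  have hb := c.hb
  suffices h : Function.Bijective (N.H0.map (Ho.mk f hf)).unop by
    have : IsIso (N.H0.map (Ho.mk f hf)).unop := (isIso_iff_bijective _).2 h
    exact inferInstanceAs (IsIso (N.H0.map (Ho.mk f hf)).unop.op)
  constructor
  · intro x x' hx
    obtain ⟨m, hm, rfl⟩ := N.H0mk_surj x
    obtain ⟨m', hm', rfl⟩ := N.H0mk_surj x'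
    obtain ⟨n, hn⟩ := (H0mk_eq_iff N).1 hx
    change N.d _ _ _ n = N.act _ m f - N.act _ m' f at hn
    rw [← LinearMap.sub_apply, ← map_sub] at hn
    have hmm : N.d 0 1 (zero_add 1) (m - m') = 0 := by rw [map_sub, hm, hm', sub_zero]
    have h₁ : N.d b' (b' + 1) rfl (N.act (zero_add b') (m - m') c.p₂) =
        -(sgn b • N.act (by omega) (N.act (add_zero 0) (m - m') f) c.p₁) := by
      rw [N.d_act_cocycle (zero_add 1) hmm rfl _ _ (zero_add _),
        c.d_p₂ _ rfl (by omega : 0 + a' = b' + 1), N.act_comp (add_zero 0) _ (by omega : 0 + a' = b' + 1)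
        (zero_add _), sgn_zero, one_smul, neg_smul, map_neg, map_zsmul]
    have h₂ : N.d b' (b' + 1) rfl (N.act (by omega) n c.p₁) =
        N.act (by omega) (N.act (add_zero 0) (m - m') f) c.p₁ := by
      rw [N.leibniz (q' := 0) (p' := a' + 1) _ _ (by omega) rfl (by omega)
        (by omega), c.d_p₁, hn, map_zero, smul_zero, add_zero]
    have hd : N.d b' (b' + 1) rfl (N.act (zero_add b') (m - m') c.p₂ +
        sgn b • N.act (by omega) n c.p₁) = 0 := by
      rw [map_add, map_zsmul, h₁, h₂, neg_add_cancel]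
    obtain ⟨w, hw⟩ := hN (by omega : b' - 1 + 1 = b') rfl _ hd
    change N.d _ _ _ w = _ at hw
    refine (H0mk_eq_iff N).2 ⟨N.act (by omega) w c.i₂, ?_⟩
    rw [N.leibniz (q' := b') (p' := b + 1) _ _ (by omega) rfl (by omega) (by omega), hw, c.d_i₂,
      map_zero, smul_zero, add_zero, map_add, LinearMap.add_apply, map_zsmul, LinearMap.smul_apply,
      N.act_comp _ _ c.hb (add_zero 0), c.p₂_i₂, N.act_one, N.act_comp _ _ rfl (by omega), c.p₁_i₂,
      map_zero, smul_zero, add_zero]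
  · intro x
    obtain ⟨m, hm, rfl⟩ := N.H0mk_surj x
    obtain ⟨w, hw⟩ := hN (p := a' - 1) (q := a') (r := a' + 1) (by omega) rfl (N.act (zero_add a') m c.p₁) (by
      change N.d _ _ _ (N.act _ m c.p₁) = 0
      rw [N.d_act_cocycle (zero_add 1) hm rfl _ _ (zero_add _), c.d_p₁, map_zero, smul_zero])
    change N.d _ _ _ w = _ at hw
    have hx : N.d 0 1 (zero_add 1) (N.act (by omega : a' - 1 + b = 0) w c.i₂) = 0 := by
      rw [N.leibniz (q' := a') (p' := b + 1) _ _ (by omega) rfl (by omega) (by omega), hw, c.d_i₂,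
        map_zero, smul_zero, add_zero, N.act_comp _ _ rfl (by omega), c.p₁_i₂, map_zero]
    refine ⟨N.H0mk (sgn a' • N.act (by omega) w c.i₂) (by rw [map_zsmul, hx, smul_zero]), ?_⟩
    refine (H0_map_mk N hf _).trans ((H0mk_eq_iff N).2 ⟨-N.act (by omega) w c.i₁, ?_⟩)
    rw [map_neg, N.leibniz (q' := a') (p' := a + 1) _ _ (by omega) rfl (by omega) (by omega), hw,
      c.d_i₁, N.act_comp _ _ c.ha (add_zero 0), c.p₁_i₁, N.act_one, map_zsmul, LinearMap.smul_apply,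
      N.act_comp _ _ c.hm (by omega), sgn_sub, sgn_one]
    simp only [mul_neg, mul_one, neg_smul]
    abel

end RightModule

end H0

section stages

variable {k : Type u} [CommRing k] {T : DGCategory.{u, u, u} k} {M : RightModule T}

namespace Cells

variable (c : Cells M)

/-- Finite sets of generators which span a DG submodule. -/
def IsClosed (S : Finset c.G) : Prop :=
  ∀ s ∈ S, ∀ t, c.coeff t _ _ (M.d (c.n s) (c.n s + 1) rfl (c.e s)) ≠ 0 → t ∈ S

lemma exists_isClosed (S : Finset c.G) : ∃ S' : Finset c.G, S ⊆ S' ∧ c.IsClosed S' := by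
  classical
  have union : ∀ {ι : Type u} (J : Finset ι) (f : ι → Finset c.G), (∀ j, c.IsClosed (f j)) →
      c.IsClosed (J.biUnion f) := by
    intro ι J f hf s hs t ht
    obtain ⟨j, hj, hs⟩ := Finset.mem_biUnion.1 hs
    exact Finset.mem_biUnion.2 ⟨j, hj, hf j s hs t ht⟩
  have key : ∀ (i : ℕ) (g : c.G), ∃ S' : Finset c.G, (c.rank g < i → g ∈ S') ∧ c.IsClosed S' := by
    intro i
    induction i with
    | zero => exact fun g => ⟨∅, fun h => absurd h (Nat.not_lt_zero _), by simp [IsClosed]⟩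
    | succ i ih =>
      intro g
      by_cases hg : c.rank g < i + 1
      · choose f hf hf' using ih
        have hU := union (c.finite_coeff (M.d (c.n g) (c.n g + 1) rfl (c.e g))).toFinset f hf'
        refine ⟨insert g ((c.finite_coeff (M.d (c.n g) (c.n g + 1) rfl (c.e g))).toFinset.biUnion f),
          fun _ => Finset.mem_insert_self _ _, fun s hs t ht => ?_⟩
        rcases Finset.mem_insert.1 hs with rfl | hs
        · have := c.rank_lt' ht
          exact Finset.mem_insert_of_mem (Finset.mem_biUnion.2
            ⟨t, (Set.Finite.mem_toFinset _).2 ht, hf t (by omega)⟩)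
        · exact Finset.mem_insert_of_mem (hU s hs t ht)
      · exact ⟨∅, fun h => absurd h hg, by simp [IsClosed]⟩
  choose f hf hf' using fun g => key (c.rank g + 1) g
  exact ⟨S.biUnion f, fun g hg => Finset.mem_biUnion.2 ⟨g, hg, hf g (Nat.lt_succ_self _)⟩,
    union S f hf'⟩

/-- A morphism from a representable module onto the DG submodule spanned by finitely many
generators. -/
structure Stage (S : Finset c.G) where
  Z : T.Ob
  φ : M.X Z 0
  i : ∀ s, T.Hom (c.x s) Z (c.n s)
  p : ∀ s, T.Hom Z (c.x s) (-c.n s)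
  d_φ : M.d 0 1 (zero_add 1) φ = 0
  φ_i : ∀ s ∈ S, M.act (zero_add (c.n s)) φ (i s) = c.e s
  φ_eq : φ = ∑ s ∈ S, M.act (add_neg_cancel (c.n s)) (c.e s) (p s)
  total : ∑ s ∈ S, T.comp (add_neg_cancel (c.n s)) (i s) (p s) = T.one Z

variable {c}

namespace Stage

variable {S : Finset c.G} (σ : Stage c S)

lemma act_φ {W : T.Ob} {a : ℤ} (v : T.Hom W σ.Z a) : M.act (zero_add a) σ.φ v =
    ∑ s ∈ S, M.act (add_sub_cancel (c.n s) a) (c.e s)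
      (T.comp (by omega : -c.n s + a = a - c.n s) (σ.p s) v) := by
  rw [σ.φ_eq, map_sum, LinearMap.sum_apply]
  exact Finset.sum_congr rfl fun s _ => M.act_comp _ _ _ _ _ _ _

lemma eq_zero {W : T.Ob} {a : ℤ} (v : T.Hom W σ.Z a) (h : ∀ s ∈ S,
    T.comp (by omega : -c.n s + a = a - c.n s) (σ.p s) v = 0) : v = 0 := by
  rw [← T.one_comp (zero_add a) v, ← σ.total, map_sum, LinearMap.sum_apply]
  refine Finset.sum_eq_zero fun s hs => ?_
  rw [T.assoc _ _ (by omega : -c.n s + a = a - c.n s) (by omega), h s hs, map_zero]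

lemma injective {W : T.Ob} {a : ℤ} (v : T.Hom W σ.Z a) (h : M.act (zero_add a) σ.φ v = 0) :
    v = 0 := by
  classical
  refine σ.eq_zero v fun s hs => ?_
  have := c.coeff_sum S (fun s => if s ∈ S then
    T.comp (by omega : -c.n s + a = a - c.n s) (σ.p s) v else 0) (fun g hg => if_neg hg) s
  rw [if_pos hs, Finset.sum_congr rfl fun s hs => by rw [if_pos hs], ← σ.act_φ, h, map_zero] at this
  exact this.symm

lemma exists_act {W : T.Ob} {a : ℤ} (m : M.X W a) (hm : ∀ g ∉ S, c.coeff g W a m = 0) :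
    ∃ v : T.Hom W σ.Z a, M.act (zero_add a) σ.φ v = m := by
  refine ⟨∑ s ∈ S, T.comp (add_sub_cancel (c.n s) a) (σ.i s) (c.coeff s W a m), ?_⟩
  rw [map_sum]
  refine Eq.trans (Finset.sum_congr rfl fun s hs => ?_) (c.eq_sum S m hm).symm
  rw [← M.act_comp (zero_add (c.n s)) (add_sub_cancel _ _), σ.φ_i s hs]

end Stage

variable (c)

lemma exists_stage (hT : Pretriangulated T) (S : Finset c.G) (hS : c.IsClosed S) :
    Nonempty (Stage c S) := by
  classical
  induction hn : S.card generalizing S with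
  | zero =>
    obtain rfl := Finset.card_eq_zero.1 hn
    obtain ⟨Z, hZ⟩ := hT.exists_zero
    exact ⟨⟨Z, 0, 0, 0, map_zero _, by simp, by simp, by rw [hZ]; simp⟩⟩
  | succ n ih =>
    obtain ⟨s, hs, hmax⟩ := S.exists_max_image c.rank (Finset.card_pos.1 (by omega))
    have hcl : c.IsClosed (S.erase s) := fun t ht t' ht' => by
      refine Finset.mem_erase.2 ⟨?_, hS t (Finset.mem_of_mem_erase ht) t' ht'⟩
      rintro rfl
      have := c.rank_lt' ht'
      have := hmax t (Finset.mem_of_mem_erase ht)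
      omega
    obtain ⟨σ⟩ := ih (S.erase s) hcl (by rw [Finset.card_erase_of_mem hs]; omega)
    obtain ⟨w, hw⟩ := σ.exists_act (M.d (c.n s) (c.n s + 1) rfl (c.e s)) fun g hg => by
      by_contra h
      refine hg (Finset.mem_erase.2 ⟨?_, hS s hs g h⟩)
      rintro rfl
      exact lt_irrefl _ (c.rank_lt' h)
    have hdw : T.d (c.n s + 1) (c.n s + 1 + 1) rfl w = 0 := by
      refine σ.injective _ ?_
      have := M.d_act_cocycle (zero_add 1) σ.d_φ rfl (zero_add _) rfl (zero_add _) w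
      rw [hw, M.d_d, sgn_zero, one_smul] at this
      exact this.symm
    obtain ⟨C, ⟨E⟩⟩ := hT.exists_ext' (neg_add_cancel (c.n s)) rfl rfl w hdw
    have hp₂ : T.d 0 1 (zero_add 1) E.p₂ = -T.comp (by omega) w E.p₁ := by
      rw [E.d_p₂ 1 (zero_add 1) (by omega), sgn_zero, neg_smul, one_smul]
    refine ⟨⟨C, M.act (zero_add 0) σ.φ E.p₂ + M.act (add_neg_cancel _) (c.e s) E.p₁,
      fun t => if h : t = s then h ▸ E.i₁ else T.comp (zero_add _) E.i₂ (σ.i t),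
      fun t => if h : t = s then h ▸ E.p₁ else T.comp (add_zero _) (σ.p t) E.p₂, ?_, ?_, ?_, ?_⟩⟩
    · rw [map_add, M.d_act_cocycle (zero_add 1) σ.d_φ (zero_add 1) _ _ (zero_add 1), hp₂, sgn_zero,
        one_smul, map_neg, M.leibniz (p' := -c.n s + 1) _ _ rfl rfl (by omega) (by omega), ← hw,
        show T.d _ _ rfl E.p₁ = 0 from E.d_p₁ _ rfl, map_zero, smul_zero, add_zero,
        ← M.act_comp (zero_add (c.n s + 1)) (by omega) _ _, neg_add_cancel]
    · intro t ht
      by_cases h : t = s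
      · subst h
        rw [dif_pos rfl, map_add, LinearMap.add_apply, M.act_comp _ _ (zero_add _) (zero_add _),
          M.act_comp _ _ (neg_add_cancel (c.n t)) (add_zero _), E.p₁_i₁, M.act_one, E.p₂_i₁', map_zero,
          zero_add]
      · rw [dif_neg h, ← M.act_comp (add_zero 0) (zero_add _) _ _, map_add, LinearMap.add_apply,
          M.act_comp _ _ (add_zero 0) (add_zero 0), E.p₂_i₂, M.act_one,
          M.act_comp _ _ (add_zero _) (by omega), E.p₁_i₂', map_zero, add_zero,
          σ.φ_i t (Finset.mem_erase.2 ⟨h, ht⟩)]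
    · rw [← Finset.add_sum_erase S _ hs, dif_pos rfl, add_comm]
      congr 1
      conv_lhs => rw [σ.φ_eq]
      rw [map_sum, LinearMap.sum_apply]
      refine Finset.sum_congr rfl fun t ht => ?_
      rw [dif_neg (Finset.mem_erase.1 ht).1, M.act_comp _ _ (add_zero _) (add_neg_cancel _)]
    · rw [← Finset.add_sum_erase S _ hs, dif_pos rfl, dif_pos rfl, ← E.total]
      congr 1
      conv_rhs => rw [← T.one_comp (zero_add 0) E.p₂, ← σ.total]
      rw [map_sum, LinearMap.sum_apply, map_sum]
      refine Finset.sum_congr rfl fun t ht => ?_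
      rw [dif_neg (Finset.mem_erase.1 ht).1, dif_neg (Finset.mem_erase.1 ht).1]
      rw [T.assoc (zero_add _) _ (by omega : c.n t + -c.n t = 0) (add_zero 0),
        ← T.assoc (add_neg_cancel (c.n t)) (zero_add 0) _ _]

/-- The stage of an induced module. -/
abbrev Stage.ind {S : Finset c.G} {B : DGCategory.{u, u, u} k} (F : DGFunctor T B) (σ : Stage c S) :
    Stage (c.ind F) S where
  Z := F.obj σ.Z
  φ := indUnitMap F M σ.Z 0 σ.φ
  i s := F.map _ (σ.i s)
  p s := F.map _ (σ.p s)
  d_φ := by rw [d_indUnitMap, σ.d_φ, map_zero]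
  φ_i s hs := by
    rw [← indUnitMap_act, σ.φ_i s hs]
    rfl
  φ_eq := by
    conv_lhs => rw [σ.φ_eq]
    rw [map_sum]
    exact Finset.sum_congr rfl fun s _ => indUnitMap_act F _ _ _
  total := by
    rw [← F.map_one, ← σ.total, map_sum]
    exact Finset.sum_congr rfl fun s _ => (F.map_comp _ _ _).symm

end Cells

end stages

section hoQis

variable {k : Type w} [CommRing k] {E : DGCategory.{w, v, u} k} (L : LeftModule.{w, v, v₁, u} E)

/-- The morphisms of the homotopy category which act on `L` as quasi-isomorphisms. -/
def HoQis {X Y : Ho E} (φ : X ⟶ Y) : Prop :=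
  ∃ (f : E.Hom X.as.ob Y.as.ob 0) (hf : _), φ = Ho.mk f hf ∧ L.IsQis f

variable {L}

lemma hoQis_mk_iff {X Y : E.Ob} {f : E.Hom X Y 0} (hf : E.d 0 1 (zero_add 1) f = 0) :
    HoQis L (Ho.mk f hf) ↔ L.IsQis f := by
  refine ⟨fun ⟨g, hg, e, h⟩ => ?_, fun h => ⟨f, hf, rfl, h⟩⟩
  obtain ⟨s, hs⟩ := (Ho.mk_eq_iff hg hf).1 e.symm
  exact h.of_homotopic s hs

lemma HoQis.of_isIso {X Y : Ho E} (φ : X ⟶ Y) [hφ : IsIso φ] : HoQis L φ := by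
  obtain ⟨f, hf, rfl⟩ := Ho.mk_surj (X := X.as.ob) (Y := Y.as.ob) φ
  exact ⟨f, hf, rfl, isQis_of_isIso L hf hφ⟩

lemma HoQis.comp_iff_left {X Y Z : Ho E} {φ : X ⟶ Y} (h : HoQis L φ) (ψ : Y ⟶ Z) :
    HoQis L (φ ≫ ψ) ↔ HoQis L ψ := by
  obtain ⟨f, hf, rfl, h⟩ := h
  obtain ⟨g, hg, rfl⟩ := Ho.mk_surj (X := Y.as.ob) (Y := Z.as.ob) ψ
  refine Iff.trans (Iff.of_eq (congrArg (HoQis L) (Ho.mk_comp hf hg))) ?_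
  refine (hoQis_mk_iff _).trans (Iff.trans ?_ (hoQis_mk_iff _).symm)
  exact ⟨h.of_comp_right hf hg, h.comp hf hg⟩

lemma HoQis.comp_iff_right {X Y Z : Ho E} (φ : X ⟶ Y) {ψ : Y ⟶ Z} (h : HoQis L ψ) :
    HoQis L (φ ≫ ψ) ↔ HoQis L φ := by
  obtain ⟨g, hg, rfl, h⟩ := h
  obtain ⟨f, hf, rfl⟩ := Ho.mk_surj (X := X.as.ob) (Y := Y.as.ob) φ
  refine Iff.trans (Iff.of_eq (congrArg (HoQis L) (Ho.mk_comp hf hg))) ?_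
  refine (hoQis_mk_iff _).trans (Iff.trans ?_ (hoQis_mk_iff _).symm)
  exact ⟨fun h' => h.of_comp_left hf hg h', fun h' => h'.comp hf hg h⟩

end hoQis

section units

variable {k : Type w} [CommRing k] {E : DGCategory.{w, v, u} k} (L : LeftModule.{w, v, v₁, u} E)
  {C₂ C₃ : Type*} [Category* C₂] [Category* C₃] {F : Ho E ⥤ C₂} {G : C₂ ⥤ C₃} {H : Ho E ⥤ C₃}
  {F' : C₂ ⥤ Ho E} {G' : C₃ ⥤ C₂} {H' : C₃ ⥤ Ho E}

lemma hoQis_unit_comp_iff (adj₁ : F ⊣ F') (adj₂ : G ⊣ G') (adj : H ⊣ H') (i : G' ⋙ F' ≅ H') (X : Ho E) :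
    HoQis L (adj.unit.app X) ↔ HoQis L (adj₁.unit.app X ≫ F'.map (adj₂.unit.app (F.obj X))) := by
  have e := Adjunction.unit_leftAdjointUniq_hom_app ((adj₁.comp adj₂).ofNatIsoRight i) adj X
  have e' : ((adj₁.comp adj₂).ofNatIsoRight i).unit.app X =
      (adj₁.unit.app X ≫ F'.map (adj₂.unit.app (F.obj X))) ≫ i.hom.app _ := by
    simp [Adjunction.ofNatIsoRight]
  rw [← e, HoQis.comp_iff_right _ (HoQis.of_isIso _), e', HoQis.comp_iff_right _ (HoQis.of_isIso _)]

end units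

section mapComp

variable {k : Type w} [CommRing k] {A : DGCategory.{w, v₁, u₁} k} {B : DGCategory.{w, v₂, u₂} k}
  {C : DGCategory.{w, v₃, u₃} k}

/-- Homotopy categories are functorial. -/
def Ho.mapComp (F : DGFunctor A B) (G : DGFunctor B C) :
    Ho.map F ⋙ Ho.map G ≅ Ho.map (F.comp G) :=
  NatIso.ofComponents (fun _ => Iso.refl _) fun {X Y} φ => by
    obtain ⟨f, hf, rfl⟩ := Ho.mk_surj (X := X.as.ob) (Y := Y.as.ob) φ
    exact (Category.comp_id _).trans (Category.id_comp _).symm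

end mapComp

section comparison

variable {k : Type u} [CommRing k] {A B C D : DGCategory.{u, u, u} k}

/-- Restriction along a composition. -/
def resComp (F : DGFunctor A B) (G : DGFunctor B C) :
    Ho.map (res G) ⋙ Ho.map (res F) ≅ Ho.map (res (F.comp G)) :=
  Ho.mapComp (res G) (res F)

lemma d_indUnit (F : DGFunctor A B) (M : RightModule A) :
    (rightMod A).d 0 1 (zero_add 1) (indUnit F M) = 0 := (indResAdj F).d_unit M

lemma indUnit_comp_isQis_iff (F : DGFunctor A B) (G : DGFunctor B C) (M : RightModule A) (Y : A.Ob) :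
    (evalMod Y).IsQis (indUnit (F.comp G) M) ↔
      HoQis (evalMod Y) (Ho.mk (indUnit F M) (d_indUnit F M) ≫
        (Ho.map (res F)).map (Ho.mk (indUnit G ((ind F).obj M)) (d_indUnit G _))) := by
  refine (hoQis_mk_iff (E := rightMod A) (L := evalMod Y) (d_indUnit (F.comp G) M)).symm.trans ?_
  exact hoQis_unit_comp_iff (evalMod Y) (indResAdj F).ho (indResAdj G).ho (indResAdj (F.comp G)).ho
    (resComp F G) (Ho.of M)

/-- The effect on units of a square of DG functors whose vertical sides are quasi-isomorphisms on
complexes of morphisms. -/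
lemma indUnit_isQis_iff_of_square {F : DGFunctor A B} {G : DGFunctor C D} {ι : DGFunctor A C}
    {ι' : DGFunctor B D} (e : ι.comp G = F.comp ι')
    (hι : ∀ X Y, ChainQis (fun p q h => A.d (X := X) (Y := Y) p q h) (fun p q h => C.d p q h) ι.map)
    (hι' : ∀ X Y, ChainQis (fun p q h => B.d (X := X) (Y := Y) p q h) (fun p q h => D.d p q h) ι'.map)
    {M : RightModule A} (hM : IsSemiFree M) (Y : A.Ob) :
    (evalMod (ι.obj Y)).IsQis (indUnit G ((ind ι).obj M)) ↔ (evalMod Y).IsQis (indUnit F M) := by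
  have h₁ := (indUnit_comp_isQis_iff ι G M Y).trans ((((hoQis_mk_iff (d_indUnit ι M)).2
    (hM.indUnit_isModQis ι hι Y)).comp_iff_left _).trans (hoQis_mk_iff (E := rightMod A)
      (L := evalMod Y) (f := (res ι).map 0 (indUnit G ((ind ι).obj M))) _))
  have h₂ := indUnit_comp_isQis_iff F ι' M Y
  rw [e, h₂] at h₁
  refine h₁.symm.trans ((HoQis.comp_iff_right _ ?_).trans (hoQis_mk_iff _))
  exact (hoQis_mk_iff (E := rightMod A) (L := evalMod Y)
    (f := (res F).map 0 (indUnit ι' ((ind F).obj M))) _).2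
      ((hM.ind F).indUnit_isModQis ι' hι' (F.obj Y))

end comparison

section H0

variable {k : Type u} [CommRing k] {T B : DGCategory.{u, u, u} k} {M N : RightModule T}

lemma d_app_closed {f : (rightMod T).Hom M N 0} (hf : (rightMod T).d 0 1 (zero_add 1) f = 0)
    {Z : T.Ob} {p q : ℤ} (h : p + 1 = q) (m : M.X Z p) :
    N.d p q h (app f.1 Z p p (add_zero p) m) = app f.1 Z q q (add_zero q) (M.d p q h m) := by
  have := app_closed hf Z (add_zero p) h h (add_zero q) m
  rwa [sgn_zero, one_smul] at this

lemma IsModQis.of_H0 (hT : Pretriangulated T) {f : (rightMod T).Hom M N 0}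
    (hf : (rightMod T).d 0 1 (zero_add 1) f = 0)
    (h₁ : ∀ (Z : T.Ob) (n : N.X Z 0), N.d 0 1 (zero_add 1) n = 0 → ∃ m b,
      M.d 0 1 (zero_add 1) m = 0 ∧ n = app f.1 Z 0 0 (zero_add 0) m + N.d (-1) 0 (neg_add_cancel 1) b)
    (h₂ : ∀ (Z : T.Ob) (m : M.X Z 0) (b : N.X Z (-1)), M.d 0 1 (zero_add 1) m = 0 →
      app f.1 Z 0 0 (zero_add 0) m = N.d (-1) 0 (neg_add_cancel 1) b →
        ∃ m', M.d (-1) 0 (neg_add_cancel 1) m' = m) : IsModQis f := by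
  have closed : ∀ {L : RightModule T} {Z Z' : T.Ob} {r r' p q s : ℤ} (s : ShiftData T r r' Z Z')
      (hp : p + 1 = q) (hr : p + r' = 0) (m : L.X Z p), L.d p q hp m = 0 →
      L.d 0 1 (zero_add 1) (L.act hr m s.p) = 0 := by
    intro L Z Z' r r' p q _ s hp hr m hm
    rw [L.d_act_cocycle hp hm rfl _ _ (by omega), s.d_p, map_zero, smul_zero]
  have back : ∀ {L : RightModule T} {Z Z' : T.Ob} {r r' p : ℤ} (s : ShiftData T r r' Z Z')
      (hr : p + r' = 0) (hr' : 0 + r = p) (m : L.X Z p), L.act hr' (L.act hr m s.p) s.i = m := by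
    intro L Z Z' r r' p s hr hr' m
    rw [L.act_comp _ _ s.h (add_zero p), s.p_i, L.act_one]
  have dback : ∀ {L : RightModule T} {Z Z' : T.Ob} {r r' a b p q : ℤ} (s : ShiftData T r r' Z Z')
      (hp : p + 1 = q) (h : a + 1 = b) (h₁ : a + r = p) (h₂ : b + r = q) (m : L.X Z' a),
      L.d p q hp (L.act h₁ m s.i) = L.act h₂ (L.d a b h m) s.i := by
    intro L Z Z' r r' a b p q s hp h h₁ h₂ m
    rw [L.leibniz h₁ hp h rfl h₂ (by omega), s.d_i, map_zero, smul_zero, add_zero]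
  have I : ∀ {Z : T.Ob} {o p q : ℤ} (ho : o + 1 = p) (hp : p + 1 = q) (m : M.X Z p) (b : N.X Z o),
      M.d p q hp m = 0 → app f.1 Z p p (add_zero p) m = N.d o p ho b → ∃ m', M.d o p ho m' = m := by
    intro Z o p q ho hp m b hm hmb
    obtain ⟨Z', ⟨s⟩⟩ := hT.exists_shift (neg_add_cancel p) Z
    obtain ⟨m', hm'⟩ := h₂ Z' (M.act (add_neg_cancel p) m s.p) (N.act (by omega) b s.p)
      (closed (s := 0) s hp _ m hm) (by
        rw [f.2.app_act (add_zero p) (zero_add 0) _ (add_neg_cancel p), hmb,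
          N.leibniz (p' := -p + 1) (by omega) (neg_add_cancel 1) ho rfl (add_neg_cancel p) (by omega),
          s.d_p, map_zero, smul_zero, add_zero])
    refine ⟨M.act (by omega) m' s.i, ?_⟩
    rw [dback s ho (neg_add_cancel 1) _ (zero_add p), hm', back]
  intro Z o p q r ho hp hq x y hx hxy
  change app f.1 Z q q _ x = N.d p q hp y at hxy
  obtain ⟨x₀, rfl⟩ := I hp hq x y hx hxy
  obtain ⟨Z', ⟨s⟩⟩ := hT.exists_shift (neg_add_cancel p) Z
  have hy : N.d p q hp (y - app f.1 Z p p (add_zero p) x₀) = 0 := by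
    rw [map_sub, d_app_closed hf, hxy, sub_self]
  obtain ⟨m, b, hm, hmb⟩ := h₁ Z' (N.act (add_neg_cancel p) (y - app f.1 Z p p (add_zero p) x₀) s.p)
    (closed (s := 0) s hp _ _ hy)
  refine ⟨x₀ + M.act (zero_add p) m s.i, N.act (by omega) b s.i, ?_, ?_⟩
  · rw [map_add, dback s hp (zero_add 1) _ (by omega), hm, map_zero, LinearMap.zero_apply, add_zero]
  · change y = app f.1 Z p p _ _ + _
    have := congrArg (fun n => N.act (zero_add p) n s.i) hmb
    simp only [map_add, LinearMap.add_apply] at this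
    rw [back] at this
    rw [map_add, f.2.app_act (zero_add 0) (add_zero p) _ (zero_add p),
      dback s ho (neg_add_cancel 1) _ (zero_add p), add_assoc, ← this, add_sub_cancel]

namespace RightModule

/-- The map on classes of cocycles induced by a closed morphism of right modules. -/
def homClassMap (f : (rightMod T).Hom M N 0) (hf : (rightMod T).d 0 1 (zero_add 1) f = 0) (Z : T.Ob) :
    Quotient (M.setoid Z) → Quotient (N.setoid Z) :=
  Quotient.map' (fun m => ⟨app f.1 Z 0 0 (zero_add 0) m.1, by
      rw [d_app_closed hf, m.2, map_zero]⟩)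
    fun m m' ⟨n, h⟩ => ⟨app f.1 Z (-1) (-1) (add_zero (-1)) n, by
      rw [d_app_closed hf, h, map_sub]⟩

/-- The natural transformation induced by a closed morphism of right modules. -/
def H0Hom (f : (rightMod T).Hom M N 0) (hf : (rightMod T).d 0 1 (zero_add 1) f = 0) :
    N.H0 ⟶ M.H0 where
  app Z := (TypeCat.ofHom (homClassMap f hf Z.as.ob)).op
  naturality := by
    rintro ⟨⟨X⟩⟩ ⟨⟨Y⟩⟩ φ
    obtain ⟨g, hg, rfl⟩ := Ho.mk_surj φ
    refine congrArg Quiver.Hom.op (ConcreteCategory.hom_ext _ _ fun x => ?_)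
    obtain ⟨m, hm⟩ := Quotient.exists_rep x
    subst hm
    exact congrArg (Quotient.mk _) (Subtype.ext (f.2.app_act _ _ _ _ m.1 g).symm)

lemma H0Hom_mk {f : (rightMod T).Hom M N 0} (hf : (rightMod T).d 0 1 (zero_add 1) f = 0) {Z : T.Ob}
    {m : M.X Z 0} (hm : M.d 0 1 (zero_add 1) m = 0)
    (hm' : N.d 0 1 (zero_add 1) (app f.1 Z 0 0 (zero_add 0) m) = 0) :
    ((H0Hom f hf).app (Ho.of Z)).unop (M.H0mk m hm) = N.H0mk (app f.1 Z 0 0 (zero_add 0) m) hm' := rfl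

lemma isIso_H0Hom {f : (rightMod T).Hom M N 0} (hf : (rightMod T).d 0 1 (zero_add 1) f = 0)
    (h : IsModQis f) : IsIso (H0Hom f hf) := by
  have : ∀ Z, IsIso ((H0Hom f hf).app Z) := by
    rintro ⟨⟨Z⟩⟩
    suffices h : Function.Bijective ((H0Hom f hf).app (Ho.of Z)).unop by
      have : IsIso ((H0Hom f hf).app (Ho.of Z)).unop := (isIso_iff_bijective _).2 h
      exact inferInstanceAs (IsIso ((H0Hom f hf).app (Ho.of Z)).unop.op)
    constructor
    · intro x x' hx
      obtain ⟨m, hm, rfl⟩ := M.H0mk_surj x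
      obtain ⟨m', hm', rfl⟩ := M.H0mk_surj x'
      obtain ⟨n, hn⟩ := (H0mk_eq_iff N).1 hx
      obtain ⟨y, -, hy, -⟩ := h Z (by omega : -2 + 1 = -1) (neg_add_cancel 1) (zero_add 1) (m - m') n
        (by rw [map_sub]; exact (congrArg₂ (· - ·) hm hm').trans (sub_self _))
        ((map_sub _ _ _).trans hn.symm)
      exact (H0mk_eq_iff M).2 ⟨y, hy⟩
    · intro x
      obtain ⟨n, hn, rfl⟩ := N.H0mk_surj x
      obtain ⟨m, b, hm, hb⟩ := h Z (neg_add_cancel 1) (zero_add 1) one_add_one_eq_two 0 n (map_zero _)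
        ((map_zero _).trans hn.symm)
      refine ⟨M.H0mk m hm, (H0mk_eq_iff N).2 ⟨-b, ?_⟩⟩
      change n = app f.1 Z 0 0 _ m + N.d _ _ _ b at hb
      change N.d _ _ _ (-b) = app f.1 Z 0 0 _ m - n
      rw [hb, map_neg]
      abel
  exact NatIso.isIso_of_isIso_app _

end RightModule

end H0

section localization

variable {𝒞 𝒟 ℰ : Type*} [Category* 𝒞] [Category* 𝒟] [Category* ℰ] (G : 𝒞 ⥤ 𝒟)
  (W : MorphismProperty 𝒞) [G.IsLocalization W] {F : 𝒞 ⥤ ℰ}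

include W in
lemma exists_factor_of_isLocalization (hF : W.IsInvertedBy F) {H : 𝒟 ⥤ ℰ} (a : G ⋙ H ⟶ F) {X Y : 𝒞}
    (g : G.obj X ⟶ G.obj Y) : ∃ m : F.obj X ⟶ F.obj Y, H.map g ≫ a.app Y = a.app X ≫ m := by
  let _ : Localization.Lifting G W (G ⋙ H) H := ⟨Iso.refl _⟩
  let α := Localization.liftNatTrans G W (G ⋙ H) F H (Localization.lift F hF G) a
  have h := α.naturality g
  have e : ∀ X, α.app (G.obj X) ≫ (Localization.fac F hF G).hom.app X = a.app X := fun X => by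
    rw [Localization.liftNatTrans_app, Category.assoc, Category.assoc]
    refine (Category.id_comp _).trans ?_
    refine (congrArg (a.app X ≫ ·) ((Localization.fac F hF G).inv_hom_id_app X)).trans ?_
    exact Category.comp_id _
  refine ⟨(Localization.fac F hF G).inv.app X ≫ (Localization.lift F hF G).map g ≫
    (Localization.fac F hF G).hom.app Y, ?_⟩
  rw [← e, ← e, reassoc_of% h, Category.assoc, Iso.hom_inv_id_app_assoc]

include W in
lemma map_eq_of_isLocalization (hF : W.IsInvertedBy F) {X Y : 𝒞} {f g : X ⟶ Y}
    (h : G.map f = G.map g) : F.map f = F.map g := by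
  have e := Localization.fac F hF G
  rw [← cancel_epi (e.hom.app X), ← e.hom.naturality, ← e.hom.naturality, Functor.comp_map, h,
    Functor.comp_map]

end localization

section

variable {k : Type u} [CommRing k] {T T' B : DGCategory.{u, u, u} k}

/-- The unit, on classes of cocycles. -/
def indUnitNat (F : DGFunctor T B) (M : RightModule T) : Ho.map F ⋙ (indModule F M).H0 ⟶ M.H0 where
  app Z := (RightModule.H0Hom (indUnit F M) (d_indUnit F M)).app Z
  naturality := by
    rintro ⟨⟨X⟩⟩ ⟨⟨Y⟩⟩ φ
    obtain ⟨g, hg, rfl⟩ := Ho.mk_surj φ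
    exact (RightModule.H0Hom (indUnit F M) (d_indUnit F M)).naturality (Ho.mk g hg)

lemma indUnitNat_mk (F : DGFunctor T B) {M : RightModule T} {Z : T.Ob} {m : M.X Z 0}
    (hm : M.d 0 1 (zero_add 1) m = 0)
    (hm' : (indModule F M).d 0 1 (zero_add 1) (indUnitMap F M Z 0 m) = 0) :
    ((indUnitNat F M).app (Ho.of Z)).unop (M.H0mk m hm) =
      (indModule F M).H0mk (indUnitMap F M Z 0 m) hm' :=
  RightModule.H0Hom_mk (N := (res F).obj ((ind F).obj M)) (d_indUnit F M) hm hm'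

/-- The unit at a module whose cohomology factors through the localization. -/
lemma indUnit_isModQis_of_isLocalization (hT : Pretriangulated T) (F : DGFunctor T B)
    (W : MorphismProperty (Ho T)) [(Ho.map F).IsLocalization W] {M : RightModule T}
    (hM : IsSemiFree M) (hW : W.IsInvertedBy M.H0) : IsModQis (indUnit F M) := by
  classical
  obtain ⟨c⟩ := hM.nonempty_cells
  let a := indUnitNat F M
  refine IsModQis.of_H0 hT (d_indUnit F M) (fun Z n hn => ?_) fun Z m b hm hmb => ?_
  · obtain ⟨S, hS, hS'⟩ := c.exists_isClosed ((c.ind F).finite_coeff n).toFinset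
    obtain ⟨σ⟩ := c.exists_stage hT S hS'
    obtain ⟨g, hg⟩ := (σ.ind c F).exists_act n fun t ht => by
      by_contra h
      exact ht (hS ((Set.Finite.mem_toFinset _).2 h))
    have hg₀ : B.d 0 1 (zero_add 1) g = 0 := by
      refine (σ.ind c F).injective _ ?_
      have := RightModule.d_act_cocycle _ (zero_add 1) (σ.ind c F).d_φ (zero_add 1) (zero_add 0)
        (zero_add 1) (zero_add 1) g
      rw [hg, sgn_zero, one_smul] at this
      exact this.symm.trans hn
    obtain ⟨μ, hμ⟩ := exists_factor_of_isLocalization (Ho.map F) W hW a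
      (X := Ho.of Z) (Y := Ho.of σ.Z) (Ho.mk g hg₀)
    obtain ⟨m, hm, hm'⟩ := M.H0mk_surj (μ.unop (M.H0mk σ.φ σ.d_φ))
    have h := congrArg (fun ψ => ψ.unop (M.H0mk σ.φ σ.d_φ)) hμ
    simp only [unop_comp, ConcreteCategory.comp_apply] at h
    rw [hm', indUnitNat_mk F hm (by rw [d_indUnitMap, hm, map_zero]),
      indUnitNat_mk F σ.d_φ (σ.ind c F).d_φ] at h
    obtain ⟨b, hb⟩ := (RightModule.H0mk_eq_iff _).1
      ((RightModule.H0_map_mk _ hg₀ (σ.ind c F).d_φ).symm.trans h)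
    refine ⟨m, b, hm, ?_⟩
    have hg' : (indModule F M).act (add_zero 0) (indUnitMap F M σ.Z 0 σ.φ) g = n := hg
    rw [hg'] at hb
    change n = indUnitMap F M Z 0 m + (indModule F M).d (-1) 0 (neg_add_cancel 1) b
    rw [hb]
    exact (add_sub_cancel _ _).symm
  · obtain ⟨S, hS, hS'⟩ := c.exists_isClosed
      ((c.finite_coeff m).toFinset ∪ ((c.ind F).finite_coeff b).toFinset)
    obtain ⟨σ⟩ := c.exists_stage hT S hS'
    obtain ⟨v, hv⟩ := σ.exists_act m fun t ht => by
      by_contra h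
      exact ht (hS (Finset.mem_union_left _ ((Set.Finite.mem_toFinset _).2 h)))
    obtain ⟨g, hg⟩ := (σ.ind c F).exists_act b fun t ht => by
      by_contra h
      exact ht (hS (Finset.mem_union_right _ ((Set.Finite.mem_toFinset _).2 h)))
    have hv₀ : T.d 0 1 (zero_add 1) v = 0 := by
      refine σ.injective _ ?_
      have := M.d_act_cocycle (zero_add 1) σ.d_φ (zero_add 1) (zero_add 0) (zero_add 1) (zero_add 1) v
      rw [hv, sgn_zero, one_smul] at this
      exact this.symm.trans hm
    have hgv : B.d (-1) 0 (neg_add_cancel 1) g = F.map 0 v := by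
      rw [← sub_eq_zero]
      refine (σ.ind c F).injective _ ?_
      have := RightModule.d_act_cocycle _ (zero_add 1) (σ.ind c F).d_φ (neg_add_cancel 1)
        (zero_add (-1)) (neg_add_cancel 1) (zero_add 0) g
      rw [hg, sgn_zero, one_smul] at this
      rw [map_sub, ← this, sub_eq_zero]
      refine hmb.symm.trans ?_
      rw [← hv]
      exact indUnitMap_act F (zero_add 0) σ.φ v
    have h₀ : (Ho.map F).map (Ho.mk v hv₀) = (Ho.map F).map (Ho.mk 0 (map_zero _)) :=
      (Ho.mk_eq_iff _ _).2 ⟨g, by rw [hgv, map_zero, sub_zero]⟩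
    have h := congrArg (fun ψ => ψ.unop (M.H0mk σ.φ σ.d_φ))
      (map_eq_of_isLocalization (Ho.map F) W hW h₀)
    obtain ⟨n, hn⟩ := (RightModule.H0mk_eq_iff M).1 h
    exact ⟨n, by rw [hn, hv, map_zero, sub_zero]⟩

end

section chainQis

variable {k : Type w} [CommRing k]

lemma chainQis_of_bijective {A : DGCategory.{w, v₁, u₁} k} {T : DGCategory.{w, v₂, u₂} k}
    (ι : DGFunctor A T) {X Y : A.Ob}
    (h : ∀ n, Function.Bijective (ι.map n : A.Hom X Y n → T.Hom (ι.obj X) (ι.obj Y) n)) :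
    ChainQis (fun p q h => A.d (X := X) (Y := Y) p q h) (fun p q h => T.d p q h) ι.map := by
  intro o p q r ho hp hq x y hx hxy
  obtain ⟨x', rfl⟩ := (h p).2 y
  refine ⟨x', 0, (h q).1 ?_, by rw [map_zero, add_zero]⟩
  rw [ι.map_d, hxy]

lemma DGFunctor.IsQuasiEquivalence.chainQis {A' : DGCategory.{w, v, u₁} k} {A : DGCategory.{w, v, u₂} k} {π : DGFunctor A' A} (h : π.IsQuasiEquivalence)
    (X Y : A'.Ob) :
    ChainQis (fun p q h => A'.d (X := X) (Y := Y) p q h) (fun p q h => A.d p q h) π.map :=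
  (quasiIso_mkComplexMap_iff _ _).1 (h.quasiIso X Y)

end chainQis

section envelope

variable {k : Type u} [CommRing k]

/-- A fully faithful DG functor to a pretriangulated DG category whose objects are twisted complexes
over the source. -/
structure IsEnvelope {A T : DGCategory.{u, u, u} k} (ι : DGFunctor A T) : Prop where
  pretriangulated : Pretriangulated T
  bijective : ∀ X Y n, Function.Bijective (ι.map n : A.Hom X Y n → T.Hom (ι.obj X) (ι.obj Y) n)
  nonempty_frame : ∀ Z, Nonempty (Frame ι Z)

lemma isEnvelope_cell (A : DGCategory.{u, u, u} k) : IsEnvelope (cell A) :=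
  ⟨pretr_pretriangulated A, cell_bijective, fun Z => ⟨cellFrame Z⟩⟩

variable {A' A C T' T B : DGCategory.{u, u, u} k}

lemma IsEnvelope.op {ι : DGFunctor A T} (h : IsEnvelope ι) : IsEnvelope ι.op :=
  ⟨h.pretriangulated.op, fun X Y n => h.bijective Y X n, fun Z => ⟨(h.nonempty_frame Z).some.op⟩⟩

lemma IsEnvelope.chainQis {ι : DGFunctor A T} (h : IsEnvelope ι) (X Y : A.Ob) :
    ChainQis (fun p q h => A.d (X := X) (Y := Y) p q h) (fun p q h => T.d p q h) ι.map :=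
  chainQis_of_bijective ι (h.bijective X Y)

lemma isAcyclic_of_iso_obj (N : RightModule T) {X Y : T.Ob} (e : Ho.of X ≅ Ho.of Y)
    (h : (evalMod X).IsAcyclic N) : (evalMod Y).IsAcyclic N := by
  obtain ⟨f, hf, hfe⟩ := Ho.mk_surj e.hom
  obtain ⟨g, hg, hge⟩ := Ho.mk_surj e.inv
  have h₁ := e.inv_hom_id
  rw [hfe, hge, Ho.mk_comp, ← Ho.mk_one, Ho.mk_eq_iff] at h₁
  obtain ⟨s, hs⟩ := h₁
  intro p q r hp hq x hx
  change N.d q r hq x = 0 at hx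
  obtain ⟨y, hy⟩ := h hp hq (N.act (add_zero q) x f) (by
    refine (N.d_act_closed hq hf x).trans ?_
    rw [hx, map_zero, LinearMap.zero_apply])
  change N.d p q hp y = _ at hy
  refine ⟨N.act (add_zero p) y g - sgn q • N.act (by omega) x s, ?_⟩
  change N.d p q hp _ = x
  rw [map_sub, map_zsmul, N.d_act_closed hp hg, hy, N.d_act_cocycle hq hx (neg_add_cancel 1) _ _
    (add_zero q), hs, sgn_smul_sgn_smul, map_sub, N.act_one, N.act_comp _ _ (add_zero 0) (add_zero q)]
  exact sub_sub_cancel _ _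

/-- The objects which become isomorphic to an object satisfying `P`. -/
def PreimageOf (π : DGFunctor A' A) (P : A.Ob → Prop) (X : A'.Ob) : Prop :=
  ∃ Z, P Z ∧ Nonempty (Ho.of (π.obj X) ≅ Ho.of Z)

variable {π : DGFunctor A' A} {Φ : DGFunctor T' T} {ι' : DGFunctor A' T'} {ι : DGFunctor A T}
  {P : A.Ob → Prop} {M : RightModule A'}

lemma isAcyclic_envelope (hι' : IsEnvelope ι') (hι : IsEnvelope ι) (e : ι'.comp Φ = π.comp ι)
    (hπ : π.IsQuasiEquivalence) (hM : IsSemiFree M)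
    (h : ∀ X, PreimageOf π P X → (evalMod X).IsAcyclic M) {Z : T.Ob} (c : Frame ι Z)
    (hc : ∀ a, P (c.x a)) : (evalMod Z).IsAcyclic ((ind Φ).obj ((ind ι').obj M)) := by
  refine c.isAcyclic fun a => ?_
  obtain ⟨⟨X⟩, ⟨i⟩⟩ := hπ.essSurj.mem_essImage (Ho.of (c.x a))
  have h₁ : (evalMod (ι'.obj X.ob)).IsAcyclic ((ind ι').obj M) :=
    LeftModule.IsAcyclic.of_isQis' (L := evalMod X.ob) (d_indUnit ι' M)
      (h X.ob ⟨_, hc a, ⟨i⟩⟩) (hM.indUnit_isModQis ι' hι'.chainQis X.ob)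
  have h₂ : (evalMod (ι'.obj X.ob)).IsQis (indUnit Φ ((ind ι').obj M)) :=
    (indUnit_isQis_iff_of_square e hι'.chainQis hι.chainQis hM X.ob).2
      (hM.indUnit_isModQis π hπ.chainQis X.ob)
  have h₃ : (evalMod (Φ.obj (ι'.obj X.ob))).IsAcyclic ((ind Φ).obj ((ind ι').obj M)) :=
    LeftModule.IsAcyclic.of_isQis' (L := evalMod (ι'.obj X.ob)) (d_indUnit Φ _) h₁ h₂
  rw [show Φ.obj (ι'.obj X.ob) = ι.obj (π.obj X.ob) from
    congrArg (fun F : DGFunctor A' T => F.obj X.ob) e] at h₃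
  exact isAcyclic_of_iso_obj _ ((Ho.map ι).mapIso i) h₃

lemma isIso_H0_envelope (hι' : IsEnvelope ι') (hι : IsEnvelope ι) (e : ι'.comp Φ = π.comp ι)
    (hπ : π.IsQuasiEquivalence) (hM : IsSemiFree M)
    (h : ∀ X, PreimageOf π P X → (evalMod X).IsAcyclic M) {X Y : T'.Ob} {f : T'.Hom X Y 0}
    (hf : T'.d 0 1 (zero_add 1) f = 0) {g : T.Hom (Φ.obj X) (Φ.obj Y) 0}
    (hg : T.d 0 1 (zero_add 1) g = 0) (hfg : (Ho.map Φ).map (Ho.mk f hf) = Ho.mk g hg)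
    {a a' b b' : ℤ} {D Z : T.Ob} (E : Ext a a' b b' g D) (i : Ho.of D ≅ Ho.of Z) (c : Frame ι Z)
    (hc : ∀ a, P (c.x a)) : IsIso (((ind ι').obj M).H0.map (Ho.mk f hf)) := by
  have hD : (evalMod D).IsAcyclic ((ind Φ).obj ((ind ι').obj M)) :=
    isAcyclic_of_iso_obj _ i.symm (isAcyclic_envelope hι' hι e hπ hM h c hc)
  have h₁ : IsIso (((ind Φ).obj ((ind ι').obj M)).H0.map ((Ho.map Φ).map (Ho.mk f hf))) := by
    rw [hfg]
    exact RightModule.isIso_H0_map _ hg E hD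
  have h₂ : IsModQis (indUnit Φ ((ind ι').obj M)) := fun W =>
    (hι'.nonempty_frame W).some.isQis (d_indUnit Φ _) fun a =>
      (indUnit_isQis_iff_of_square e hι'.chainQis hι.chainQis hM _).2
        (hM.indUnit_isModQis π hπ.chainQis _)
  have h₃ := RightModule.isIso_H0Hom (d_indUnit Φ _) h₂
  exact (NatIso.isIso_map_iff (asIso (RightModule.H0Hom _ (d_indUnit Φ ((ind ι').obj M)))) _).1 h₁

/-- Modules which vanish on the objects to be killed are not changed by induction to a DG quotient. -/
lemma indUnit_isModQis_of_envelope {ξ : DGFunctor A' C} {Ξ : DGFunctor T' B} {ιC : DGFunctor C B}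
    (hι' : IsEnvelope ι') (hι : IsEnvelope ι) (hιC : IsEnvelope ιC) (e : ι'.comp Φ = π.comp ι)
    (eξ : ι'.comp Ξ = ξ.comp ιC) (hπ : π.IsQuasiEquivalence) (W : MorphismProperty (Ho T'))
    [(Ho.map Ξ).IsLocalization W]
    (hW : ∀ {X Y : T'.Ob} {f : T'.Hom X Y 0} (hf : T'.d 0 1 (zero_add 1) f = 0), W (Ho.mk f hf) →
      ∃ (g : T.Hom (Φ.obj X) (Φ.obj Y) 0) (hg : T.d 0 1 (zero_add 1) g = 0) (a a' b b' : ℤ)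
        (D Z : T.Ob) (c : Frame ι Z), (Ho.map Φ).map (Ho.mk f hf) = Ho.mk g hg ∧
          Nonempty (Ext a a' b b' g D) ∧ Nonempty (Ho.of D ≅ Ho.of Z) ∧ ∀ a, P (c.x a))
    (hM : IsSemiFree M) (h : ∀ X, PreimageOf π P X → (evalMod X).IsAcyclic M) :
    IsModQis (indUnit ξ M) := by
  intro Y
  refine (indUnit_isQis_iff_of_square eξ hι'.chainQis hιC.chainQis hM Y).1 ?_
  refine indUnit_isModQis_of_isLocalization hι'.pretriangulated Ξ W (hM.ind ι') ?_ _
  rintro ⟨⟨X⟩⟩ ⟨⟨Z⟩⟩ φ hφ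
  obtain ⟨f, hf, rfl⟩ := Ho.mk_surj φ
  obtain ⟨g, hg, a, a', b, b', D, Z, c, hfg, ⟨E⟩, ⟨i⟩, hc⟩ := hW hf hφ
  exact isIso_H0_envelope hι' hι e hπ hM h hf hg hfg E i c hc

end envelope

section frames

variable {k : Type w} [CommRing k]

lemma comp_comp_comp {T : DGCategory.{w, v, u} k} {X₁ X₂ X₃ X₄ X₅ : T.Ob}
    {a b c d ab cd bc bcd e : ℤ} (h : ab + cd = e) (h₁ : a + b = ab) (h₂ : c + d = cd)
    (h₃ : b + c = bc) (h₄ : bc + d = bcd) (h₅ : a + bcd = e) (x : T.Hom X₄ X₅ a) (y : T.Hom X₃ X₄ b)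
    (z : T.Hom X₂ X₃ c) (t : T.Hom X₁ X₂ d) :
    T.comp h (T.comp h₁ x y) (T.comp h₂ z t) = T.comp h₅ x (T.comp h₄ (T.comp h₃ y z) t) := by
  rw [T.assoc h₁ h (by omega : b + cd = bcd) h₅, T.assoc h₃ h₄ h₂ (by omega)]

lemma exists_ext_lift {D : DGCategory.{w, v, u₁} k} {T : DGCategory.{w, v, u₂} k}
    (hD : Pretriangulated D) (Ψ : DGFunctor D T)
    (hΨ : ∀ X Y, ChainQis (fun p q h => D.d (X := X) (Y := Y) p q h) (fun p q h => T.d p q h) Ψ.map)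
    {r r' l : ℤ} {X Y C : T.Ob} {f : T.Hom X Y l} (hf : T.d l (l + 1) rfl f = 0)
    (E : Ext r r' 0 0 f C) {X₀ Y₀ : D.Ob} (i : Ho.of (Ψ.obj X₀) ≅ Ho.of X)
    (j : Ho.of (Ψ.obj Y₀) ≅ Ho.of Y) : ∃ C₀, Nonempty (Ho.of (Ψ.obj C₀) ≅ Ho.of C) := by
  obtain ⟨a, ha, hae⟩ := Ho.mk_surj i.hom
  obtain ⟨b, hb, hbe⟩ := Ho.mk_surj j.hom
  obtain ⟨b', hb', hbe'⟩ := Ho.mk_surj j.inv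
  have hl : l = r + 1 := by have := E.hm; omega
  have h₁ := j.inv_hom_id
  rw [hbe, hbe', Ho.mk_comp, ← Ho.mk_one, Ho.mk_eq_iff] at h₁
  obtain ⟨s, hs⟩ := h₁
  have hfa : T.d l (l + 1) rfl (T.comp (add_zero l) f a) = 0 := by
    rw [d_comp_left rfl hf _ rfl (zero_add 1) rfl, ha, map_zero, smul_zero]
  obtain ⟨f₀, e, hf₀, hfe⟩ := hΨ X₀ Y₀ (sub_add_cancel l 1) rfl rfl 0
    (T.comp (zero_add l) b' (T.comp (add_zero l) f a)) (map_zero _) (by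
      rw [map_zero, d_comp_left (zero_add 1) hb' _ rfl rfl (zero_add _), hfa, map_zero, smul_zero])
  obtain ⟨C₀, ⟨E₀⟩⟩ := hD.exists_ext' E.ha hl rfl f₀ hf₀
  have hd : T.d (l - 1) l (sub_add_cancel l 1) (T.comp (by omega) s (T.comp (add_zero l) f a) -
      T.comp (zero_add _) b e) = T.comp (zero_add l) b (Ψ.map l f₀) - T.comp (add_zero l) f a := by
    have h₂ := congrArg (T.comp (zero_add l) b) hfe
    rw [map_add, ← T.assoc (add_zero 0) (zero_add l) _ _] at h₂
    rw [map_sub, d_comp_right rfl hfa _ _ (neg_add_cancel 1) (zero_add l), hs, map_sub,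
      LinearMap.sub_apply, T.one_comp, h₂, d_comp_left (zero_add 1) hb _ _ (sub_add_cancel l 1)
      (zero_add l), sgn_zero, one_smul]
    abel
  exact ⟨C₀, Ext.nonempty_iso (E₀.mapDG Ψ) E (sub_add_cancel l 1) _ ha hb hd
    (by rw [← hae]; infer_instance) (by rw [← hbe]; infer_instance)⟩

/-- An object with terms in the image of a pretriangulated DG category belongs to the image. -/
lemma Frame.exists_lift {A : DGCategory.{w, v₁, u₁} k} {D : DGCategory.{w, v, u₂} k}
    {T : DGCategory.{w, v, u₃} k} (hD : Pretriangulated D) (hT : Pretriangulated T)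
    (Ψ : DGFunctor D T)
    (hΨ : ∀ X Y, ChainQis (fun p q h => D.d (X := X) (Y := Y) p q h) (fun p q h => T.d p q h) Ψ.map)
    {ι : DGFunctor A T} {Z : T.Ob} (c : Frame ι Z)
    (h : ∀ a, ∃ V, Nonempty (Ho.of (Ψ.obj V) ≅ Ho.of (ι.obj (c.x a)))) :
    ∃ V, Nonempty (Ho.of (Ψ.obj V) ≅ Ho.of Z) := by
  classical
  suffices H : ∀ l ≤ c.n, ∃ (Z' : T.Ob) (v : T.Hom Z' Z 0) (r : T.Hom Z Z' 0),
      (∃ V, Nonempty (Ho.of (Ψ.obj V) ≅ Ho.of Z')) ∧ T.d 0 1 (zero_add 1) v = 0 ∧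
        T.comp (add_zero 0) r v = T.one Z' ∧ T.comp (add_zero 0) v r =
          ∑ a with a.1 < l, T.comp ((add_comm _ _).trans (c.hm a)) (c.i a) (c.p a) by
    obtain ⟨Z', v, r, ⟨V, ⟨i⟩⟩, hv, hrv, hvr⟩ := H c.n le_rfl
    rw [Finset.filter_true_of_mem fun a _ => a.2, c.total] at hvr
    have hr : T.d 0 1 (zero_add 1) r = 0 := by
      have h₁ := congrArg (T.d 0 1 (zero_add 1)) hvr
      rw [T.d_one, d_comp_left (zero_add 1) hv _ _ (zero_add 1) (zero_add 1), sgn_zero, one_smul] at h₁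
      have h₂ := congrArg (T.comp (zero_add 1) r) h₁
      rwa [← T.assoc (add_zero 0) (zero_add 1) _ _, hrv, T.one_comp, map_zero] at h₂
    refine ⟨V, ⟨i ≪≫ ⟨Ho.mk v hv, Ho.mk r hr, ?_, ?_⟩⟩⟩
    · rw [Ho.mk_comp, ← Ho.mk_one]
      congr 1
    · rw [Ho.mk_comp, ← Ho.mk_one]
      congr 1
  intro l hl
  induction l with
  | zero =>
    obtain ⟨V, hV⟩ := hD.exists_zero
    refine ⟨Ψ.obj V, 0, 0, ⟨V, ⟨Iso.refl _⟩⟩, map_zero _, ?_, ?_⟩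
    · rw [← Ψ.map_one, hV, map_zero, map_zero]
    · simp
  | succ l ih =>
    obtain ⟨Z', v, r, ⟨V, ⟨i⟩⟩, hv, hrv, hvr⟩ := ih (by omega)
    let a : Fin c.n := ⟨l, hl⟩
    obtain ⟨V', ⟨j⟩⟩ := h a
    have inj : ∀ {W : T.Ob} {q : ℤ} (f : T.Hom W Z' q), T.comp (zero_add q) v f = 0 → f = 0 := by
      intro W q f hf
      rw [← T.one_comp (zero_add q) f, ← hrv, T.assoc _ _ (zero_add q) (zero_add q), hf, map_zero]
    have hsum : ∀ {W : T.Ob} {q : ℤ} (f : T.Hom W Z q),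
        (∀ b : Fin c.n, b.1 < l → T.comp (rfl : c.m' b + q = _) (c.p b) f = 0) →
        T.comp (zero_add q) (T.comp (add_zero 0) v r) f = 0 := by
      intro W q f hf
      rw [hvr, map_sum, LinearMap.sum_apply]
      refine Finset.sum_eq_zero fun b hb => ?_
      have := c.hm b
      rw [T.assoc _ _ rfl (by omega), hf b (Finset.mem_filter.1 hb).2, map_zero]
    have hri : T.comp (zero_add _) r (c.i a) = 0 := by
      refine inj _ ?_
      rw [← T.assoc (add_zero 0) (zero_add _) _ _]
      exact hsum _ fun b hb => c.p_i_ne b a (by rintro rfl; exact lt_irrefl _ hb)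
    have hpv : T.comp (add_zero _) (c.p a) v = 0 := by
      have e : v = T.comp (add_zero 0) (T.comp (add_zero 0) v r) v := by
        rw [T.assoc _ _ (add_zero 0) (add_zero 0), hrv, T.comp_one]
      rw [e, hvr, map_sum, LinearMap.sum_apply, map_sum]
      refine Finset.sum_eq_zero fun b hb => ?_
      have := c.hm b
      rw [T.assoc _ _ (add_zero _) (by omega), ← T.assoc rfl (by omega) _ (by omega),
        c.p_i_ne a b (by rintro rfl; exact lt_irrefl _ (Finset.mem_filter.1 hb).2), map_zero,
        LinearMap.zero_apply]
    have hw : T.comp (zero_add _) v (T.comp (zero_add _) r (T.d _ _ rfl (c.i a))) =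
        T.d _ _ rfl (c.i a) := by
      rw [← T.assoc (add_zero 0) (zero_add _) _ _]
      conv_rhs => rw [← T.one_comp (zero_add _) (T.d _ _ rfl (c.i a)), ← c.total]
      rw [hvr, map_sum, LinearMap.sum_apply, map_sum, LinearMap.sum_apply]
      refine Finset.sum_subset (Finset.subset_univ _) fun b _ hb => ?_
      have := c.hm b
      rw [T.assoc _ _ rfl (by omega), c.p_d_i (Fin.le_def.2 (by simpa [a] using hb)) rfl rfl, map_zero]
    have hdw : T.d (c.m a + 1) (c.m a + 1 + 1) rfl
        (T.comp (zero_add _) r (T.d _ _ rfl (c.i a))) = 0 := by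
      refine inj _ ?_
      have := d_comp_left (zero_add 1) hv (zero_add (c.m a + 1)) rfl rfl (zero_add _)
        (T.comp (zero_add _) r (T.d _ _ rfl (c.i a)))
      rw [hw, T.d_d, sgn_zero, one_smul] at this
      exact this.symm
    obtain ⟨C, ⟨E⟩⟩ := hT.exists_ext' (c.hm a) rfl rfl _ hdw
    obtain ⟨V₁, hV₁⟩ := exists_ext_lift hD Ψ hΨ hdw E j i
    refine ⟨C, T.comp (add_zero 0) v E.p₂ + T.comp ((add_comm _ _).trans (c.hm a)) (c.i a) E.p₁,
      T.comp (add_zero 0) E.i₂ r + T.comp ((add_comm _ _).trans (c.hm a)) E.i₁ (c.p a),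
      ⟨V₁, hV₁⟩, ?_, ?_, ?_⟩
    · have := c.hm a
      rw [map_add, d_comp_left (zero_add 1) hv _ _ (zero_add 1) (zero_add 1),
        E.d_p₂ 1 (zero_add 1) (by omega), sgn_zero, neg_smul, one_smul, one_smul, map_neg,
        ← T.assoc (zero_add (c.m a + 1)) (by omega) _ _, hw, d_comp_right rfl (E.d_p₁ _ rfl) _ _ rfl
        (by omega), neg_add_cancel]
    · have := c.hm a
      have e₁ : T.comp (add_zero 0) (T.comp (add_zero 0) E.i₂ r) (T.comp (add_zero 0) v E.p₂) =
          T.comp (add_zero 0) E.i₂ E.p₂ := by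
        rw [comp_comp_comp _ _ _ (add_zero 0) (add_zero 0) (add_zero 0),
          hrv, T.one_comp]
      have e₂ : T.comp (add_zero 0) (T.comp (add_zero 0) E.i₂ r)
          (T.comp ((add_comm _ _).trans (c.hm a)) (c.i a) E.p₁) = 0 := by
        rw [comp_comp_comp _ _ _ (zero_add _) (by omega) (add_zero 0),
          hri, map_zero, LinearMap.zero_apply, map_zero]
      have e₃ : T.comp (add_zero 0) (T.comp ((add_comm _ _).trans (c.hm a)) E.i₁ (c.p a))
          (T.comp (add_zero 0) v E.p₂) = 0 := by
        rw [comp_comp_comp _ _ _ (add_zero _) (add_zero _) (by omega),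
          hpv, map_zero, LinearMap.zero_apply, map_zero]
      have e₄ : T.comp (add_zero 0) (T.comp ((add_comm _ _).trans (c.hm a)) E.i₁ (c.p a))
          (T.comp ((add_comm _ _).trans (c.hm a)) (c.i a) E.p₁) = T.comp (by omega) E.i₁ E.p₁ := by
        rw [comp_comp_comp _ _ _ (c.hm a) (zero_add _) (by omega),
          c.p_i, T.one_comp]
      rw [map_add, map_add, LinearMap.add_apply, LinearMap.add_apply, e₁, e₂, e₃, e₄, add_zero,
        zero_add, add_comm]
      exact E.total
    · have := c.hm a
      have e₁ : T.comp (add_zero 0) (T.comp (add_zero 0) v E.p₂) (T.comp (add_zero 0) E.i₂ r) =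
          T.comp (add_zero 0) v r := by
        rw [comp_comp_comp _ _ _ (add_zero 0) (add_zero 0) (add_zero 0),
          E.p₂_i₂, T.one_comp]
      have e₂ : T.comp (add_zero 0) (T.comp (add_zero 0) v E.p₂)
          (T.comp ((add_comm _ _).trans (c.hm a)) E.i₁ (c.p a)) = 0 := by
        rw [comp_comp_comp _ _ _ (zero_add _) (by omega) (add_zero 0),
          E.p₂_i₁', map_zero, LinearMap.zero_apply, map_zero]
      have e₃ : T.comp (add_zero 0) (T.comp ((add_comm _ _).trans (c.hm a)) (c.i a) E.p₁)
          (T.comp (add_zero 0) E.i₂ r) = 0 := by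
        rw [comp_comp_comp _ _ _ (add_zero _) (add_zero _) (by omega),
          E.p₁_i₂', map_zero, LinearMap.zero_apply, map_zero]
      have e₄ : T.comp (add_zero 0) (T.comp ((add_comm _ _).trans (c.hm a)) (c.i a) E.p₁)
          (T.comp ((add_comm _ _).trans (c.hm a)) E.i₁ (c.p a)) =
          T.comp ((add_comm _ _).trans (c.hm a)) (c.i a) (c.p a) := by
        rw [comp_comp_comp _ _ _ (c.hm a) (zero_add _) (by omega),
          E.p₁_i₁, T.one_comp]
      have hins : (Finset.univ.filter fun b : Fin c.n => b.1 < l + 1) =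
          insert a (Finset.univ.filter fun b : Fin c.n => b.1 < l) := by
        ext b
        simp [a, Fin.ext_iff]
        omega
      rw [map_add, map_add, LinearMap.add_apply, LinearMap.add_apply, e₁, e₂, e₃, e₄, zero_add,
        add_zero, hvr, hins, Finset.sum_insert (by simp [a]), add_comm]

end frames

section hoFunctors

variable {k : Type w} [CommRing k] {A : DGCategory.{w, v₁, u₁} k} {B : DGCategory.{w, v₂, u₂} k}
  {C : DGCategory.{w, v₃, u₃} k}

/-- The homotopy category of the dual DG category. -/
def Ho.opFunctor (A : DGCategory.{w, v₁, u₁} k) : Ho A.op ⥤ (Ho A)ᵒᵖ :=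
  CategoryTheory.Quotient.lift _
    { obj X := Opposite.op (Ho.of X.ob)
      map {X Y} f := (Ho.mk (A := A) (X := Y.ob) (Y := X.ob) f.1 f.2).op
      map_id X := rfl
      map_comp {X Y Z} f g := by
        rw [← op_comp, Ho.mk_comp (A := A) g.2 f.2]
        refine congrArg Quiver.Hom.op (congrArg _ (Subtype.ext ?_))
        change sgn (0 * 0) • A.comp (add_zero 0) f.1 g.1 = _
        rw [mul_zero, sgn_zero, one_smul] }
    fun X Y f g ⟨h, e⟩ => congrArg Quiver.Hom.op ((Ho.mk_eq_iff (A := A) f.2 g.2).2 ⟨h, e⟩)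

instance : (Ho.opFunctor A).Full where
  map_surjective {X Y} φ := by
    obtain ⟨f, hf, h⟩ := Ho.mk_surj (A := A) (X := Y.as.ob) (Y := X.as.ob) φ.unop
    exact ⟨Ho.mk (A := A.op) f hf, congrArg Quiver.Hom.op h.symm⟩

instance : (Ho.opFunctor A).Faithful where
  map_injective {X Y} φ ψ h := by
    obtain ⟨f, hf, rfl⟩ := Ho.mk_surj (A := A.op) (X := X.as.ob) (Y := Y.as.ob) φ
    obtain ⟨g, hg, rfl⟩ := Ho.mk_surj (A := A.op) (X := X.as.ob) (Y := Y.as.ob) ψ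
    exact (Ho.mk_eq_iff (A := A.op) hf hg).2 ((Ho.mk_eq_iff (A := A) hf hg).1 (Quiver.Hom.op_inj h))

instance : (Ho.opFunctor A).EssSurj where
  mem_essImage X := ⟨Ho.of (A := A.op) X.unop.as.ob, ⟨Iso.refl _⟩⟩

instance : (Ho.opFunctor A).IsEquivalence where

/-- Duality, on homotopy categories. -/
def Ho.opMap (F : DGFunctor A B) :
    Ho.opFunctor A ⋙ (Ho.map F).op ≅ Ho.map F.op ⋙ Ho.opFunctor B :=
  NatIso.ofComponents (fun _ => Iso.refl _) fun {X Y} φ => by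
    obtain ⟨f, hf, rfl⟩ := Ho.mk_surj (A := A.op) (X := X.as.ob) (Y := Y.as.ob) φ
    exact (Category.comp_id _).trans (Category.id_comp _).symm

lemma isLocalization_op (F : DGFunctor A B) (W : MorphismProperty (Ho A))
    [(Ho.map F).IsLocalization W] :
    (Ho.map F.op).IsLocalization (W.op.inverseImage (Ho.opFunctor A)) := by
  have h : (Ho.map F).op.IsLocalization W.op := inferInstance
  let _ : CatCommSq (Ho.opFunctor A).asEquivalence.symm.functor (Ho.map F).op (Ho.map F.op)
    (Ho.opFunctor B).asEquivalence.symm.functor :=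
      CatCommSq.hInv (Ho.opFunctor A).asEquivalence _ _ (Ho.opFunctor B).asEquivalence
        ⟨Ho.opMap F⟩
  refine Functor.IsLocalization.of_equivalences (Ho.map F).op W.op (Ho.map F.op) _
    (Ho.opFunctor A).asEquivalence.symm (Ho.opFunctor B).asEquivalence.symm ?_ ?_
  · rintro ⟨⟨⟨X⟩⟩⟩ ⟨⟨⟨Y⟩⟩⟩ φ hφ
    obtain ⟨ψ, rfl⟩ := Functor.map_surjective (Ho.opFunctor A) (X := Ho.of (A := A.op) X)
      (Y := Ho.of (A := A.op) Y) φ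
    refine ⟨_, _, ψ, hφ, ⟨?_⟩⟩
    exact Arrow.isoOfNatIso (Ho.opFunctor A).asEquivalence.unitIso (Arrow.mk ψ)
  · intro X Y φ hφ
    have h₁ : IsIso ((Ho.map F).op.map ((Ho.opFunctor A).map φ)) :=
      Localization.inverts (Ho.map F).op W.op _ hφ
    have h₂ : IsIso ((Ho.opFunctor B).map ((Ho.map F.op).map φ)) :=
      (NatIso.isIso_map_iff (Ho.opMap F) φ).1 h₁
    exact isIso_of_reflects_iso _ (Ho.opFunctor B)

end hoFunctors

section pretriangulatedQuotient

variable {k : Type w} [CommRing k]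

lemma Ext.contractible_of_isIso {E : DGCategory.{w, v, u} k} {X Y C : E.Ob} {f : E.Hom X Y 0}
    (c : Ext (-1) 1 0 0 f C) {hf : E.d 0 1 (zero_add 1) f = 0} (h : IsIso (Ho.mk f hf)) :
    Contractible E C :=
  contractible_of_isAcyclic (c.isAcyclic_of_isQis (isQis_of_isIso _ hf h))

lemma Ext.isIso_of_contractible {E : DGCategory.{w, v, u} k} {X Y C : E.Ob} {f : E.Hom X Y 0}
    (c : Ext (-1) 1 0 0 f C) (hf : E.d 0 1 (zero_add 1) f = 0) (h : Contractible E C) :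
    IsIso (Ho.mk f hf) :=
  isIso_of_isQis hf (c.isQis_of_isAcyclic (h.isAcyclic _)) (c.isQis_of_isAcyclic (h.isAcyclic _))

lemma Ext.nonempty_iso_of_mk_eq {E : DGCategory.{w, v, u} k} {X Y C D : E.Ob} {f g : E.Hom X Y 0}
    (c : Ext (-1) 1 0 0 f C) (c' : Ext (-1) 1 0 0 g D) {hf : E.d 0 1 (zero_add 1) f = 0}
    {hg : E.d 0 1 (zero_add 1) g = 0} (h : Ho.mk f hf = Ho.mk g hg) :
    Nonempty (Ho.of C ≅ Ho.of D) := by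
  obtain ⟨s, hs⟩ := (Ho.mk_eq_iff _ _).1 h
  refine c.nonempty_iso c' (u' := E.one X) (v' := E.one Y) (neg_add_cancel 1) s (E.d_one _ _ _)
    (E.d_one _ _ _) (by rw [hs, E.one_comp, E.comp_one]) ?_ ?_
  · rw [Ho.mk_one]; infer_instance
  · rw [Ho.mk_one]; infer_instance

lemma cell_chainQis {E : DGCategory.{w, v, u} k} (X Y : E.Ob) :
    ChainQis (fun p q h => E.d (X := X) (Y := Y) p q h) (fun p q h => (pretr E).d p q h)
      (cell E).map :=
  chainQis_of_bijective _ (cell_bijective X Y)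

lemma cell_isEquivalence {E : DGCategory.{w, v, u} k} (hE : Pretriangulated E) :
    (Ho.map (cell E)).IsEquivalence := by
  have := full_of_chainQis (cell E) cell_chainQis
  have := faithful_of_chainQis (cell E) cell_chainQis
  have : (Ho.map (cell E)).EssSurj := ⟨fun Z => by
    obtain ⟨V, hV⟩ := (cellFrame Z.as.ob).exists_lift hE (pretr_pretriangulated E) (cell E)
      cell_chainQis fun a => ⟨_, ⟨Iso.refl _⟩⟩
    exact ⟨Ho.of V, hV⟩⟩
  exact {}

lemma ChainQis.comp {X Y Z : ℤ → Type*} [∀ n, AddCommGroup (X n)] [∀ n, Module k (X n)]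
    [∀ n, AddCommGroup (Y n)] [∀ n, Module k (Y n)] [∀ n, AddCommGroup (Z n)] [∀ n, Module k (Z n)]
    {d : ∀ p q : ℤ, p + 1 = q → (X p →ₗ[k] X q)} {d' : ∀ p q : ℤ, p + 1 = q → (Y p →ₗ[k] Y q)}
    {d'' : ∀ p q : ℤ, p + 1 = q → (Z p →ₗ[k] Z q)} {f : ∀ n, X n →ₗ[k] Y n} {g : ∀ n, Y n →ₗ[k] Z n}
    (hf : ChainQis d d' f) (hg : ChainQis d' d'' g)
    (hfd : ∀ p q h x, f q (d p q h x) = d' p q h (f p x))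
    (hgd : ∀ p q h x, g q (d' p q h x) = d'' p q h (g p x)) :
    ChainQis d d'' fun n => (g n).comp (f n) := by
  intro o p q r ho hp hq x z hx hxz
  obtain ⟨y, z', hy, rfl⟩ := hg ho hp hq (f q x) z (by rw [← hfd, hx, map_zero]) hxz
  obtain ⟨x', y', hx', rfl⟩ := hf ho hp hq x y hx hy.symm
  exact ⟨x', g o y' + z', hx', by rw [map_add, map_add, hgd, add_assoc]; rfl⟩

/-- The extensions of an object of a DG category which is inverted by a DG functor. -/
lemma Pretriangulated.contractible_sub {E C : DGCategory.{w, v, u} k} (hE : Pretriangulated E)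
    (F : DGFunctor E C) : Pretriangulated (fullSub E fun X => Contractible C (F.obj X)) where
  exists_zero := by
    obtain ⟨Z, hZ⟩ := hE.exists_zero
    exact ⟨⟨Z, 0, by rw [← F.map_one, hZ, map_zero, map_zero]⟩, hZ⟩
  exists_shift {r r'} hr X := by
    obtain ⟨X', ⟨s⟩⟩ := hE.exists_shift hr X.1
    have h : Contractible C (F.obj X') :=
      contractible_of_isAcyclic (((s.map F).isAcyclic_iff _).2 (X.2.isAcyclic _))
    exact ⟨⟨X', h⟩, ⟨s.sub X.2 h⟩⟩
  exists_ext {X Y} f hf := by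
    obtain ⟨D, ⟨c⟩⟩ := hE.exists_ext (X := X.1) (Y := Y.1) f hf
    have h : Contractible C (F.obj D) := (c.mapDG F).contractible X.2 Y.2
    exact ⟨⟨D, h⟩, ⟨c.sub X.2 Y.2 h⟩⟩

variable {E' E C : DGCategory.{w, v, u} k} {π : DGFunctor E' E} {ξ : DGFunctor E' C}
  {P : E.Ob → Prop}

lemma contractible_pretrMap (hE' : Pretriangulated E')
    (hπ : π.IsQuasiEquivalence)
    (hP : ∀ X, Contractible C (ξ.obj X) ↔ ∃ Z, P Z ∧ Nonempty (Ho.of (π.obj X) ≅ Ho.of Z))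
    {V : (pretr E').Ob} {Z : (pretr E).Ob} (hZ : pretrSub P Z)
    (e : Ho.of ((pretrMap π).obj V) ≅ Ho.of Z) : Contractible (pretr C) ((pretrMap ξ).obj V) := by
  have := full_of_chainQis (cell E) cell_chainQis
  have := faithful_of_chainQis (cell E) cell_chainQis
  have := full_of_chainQis π hπ.chainQis
  have := faithful_of_chainQis π hπ.chainQis
  have := cell_isEquivalence hE'
  obtain ⟨⟨⟨N⟩⟩, ⟨i⟩⟩ := Functor.EssSurj.mem_essImage (F := Ho.map (cell E')) (Ho.of V)
  have hcomp : ∀ {B : DGCategory.{w, v, u} k} (F : DGFunctor E' B) (N : E'.Ob),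
      (pretrMap F).obj ((cell E').obj N) = (cell B).obj (F.obj N) := fun F N =>
    congrArg (fun G : DGFunctor E' _ => G.obj N) (cell_pretrMap F)
  let Ψ : DGFunctor (fullSub E' fun X => Contractible C (ξ.obj X)) (pretr E) :=
    ((inclusion E' _).comp π).comp (cell E)
  obtain ⟨⟨N', hN'⟩, ⟨j⟩⟩ := (cellFrame Z).exists_lift (hE'.contractible_sub ξ)
    (pretr_pretriangulated E) Ψ
    (fun X Y => ChainQis.comp (hπ.chainQis X.1 Y.1) (cell_chainQis (π.obj X.1) (π.obj Y.1))
      (fun p q h x => π.map_d p q h x) fun p q h x => (cell E).map_d p q h x) fun a => by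
    obtain ⟨⟨⟨X⟩⟩, ⟨l⟩⟩ := hπ.essSurj.mem_essImage (Ho.of (Z.1.obj.2 a).1)
    exact ⟨⟨X, (hP X).2 ⟨_, hZ a, ⟨l⟩⟩⟩, ⟨(Ho.map (cell E)).mapIso l⟩⟩
  have i' : Ho.of ((cell E).obj (π.obj N)) ≅ Ho.of ((pretrMap π).obj V) :=
    eqToIso (congrArg Ho.of (hcomp π N)).symm ≪≫ (Ho.map (pretrMap π)).mapIso i
  let m : Ho.of (π.obj N) ≅ Ho.of (π.obj N') := (Ho.map (cell E)).preimageIso (i' ≪≫ e ≪≫ j.symm)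
  let m' : Ho.of N ≅ Ho.of N' := (Ho.map π).preimageIso m
  have h₁ : Contractible C (ξ.obj N) := (contractible_iff_of_iso ((Ho.map ξ).mapIso m')).2 hN'
  refine (contractible_iff_of_iso ((Ho.map (pretrMap ξ)).mapIso i)).1 ?_
  have h₂ := h₁.map (cell C)
  rwa [← hcomp ξ N] at h₂

theorem isDGQuotient_of_pretriangulated (hE' : Pretriangulated E') (hC : Pretriangulated C) (hπ : π.IsQuasiEquivalence) (W : MorphismProperty (Ho E'))
    [(Ho.map ξ).IsLocalization W]
    (hP : ∀ X, Contractible C (ξ.obj X) ↔ ∃ Z, P Z ∧ Nonempty (Ho.of (π.obj X) ≅ Ho.of Z)) :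
    IsDGQuotient π ξ P where
  quasiEquivalence := hπ
  essSurj := Localization.essSurj (Ho.map ξ) W
  isLocalization := by
    have h₁ := cell_isEquivalence hE'
    have h₂ := cell_isEquivalence hC
    let _ : CatCommSq (Ho.map (cell E')).asEquivalence.functor (Ho.map ξ) (Tr.map ξ)
      (Ho.map (cell C)).asEquivalence.functor :=
        ⟨Ho.mapComp (cell E') (pretrMap ξ) ≪≫ eqToIso (congrArg Ho.map (cell_pretrMap ξ)) ≪≫
          (Ho.mapComp ξ (cell C)).symm⟩
    refine Functor.IsLocalization.of_equivalences (Ho.map ξ) W (Tr.map ξ) _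
      (Ho.map (cell E')).asEquivalence (Ho.map (cell C)).asEquivalence ?_ ?_
    · rintro ⟨⟨X⟩⟩ ⟨⟨Y⟩⟩ φ hφ
      refine MorphismProperty.le_isoClosure _ _ ?_
      obtain ⟨f, hf, rfl⟩ := Ho.mk_surj φ
      obtain ⟨D, ⟨c⟩⟩ := hE'.exists_cone f hf
      have hD : Contractible C (ξ.obj D) := (c.mapDG ξ).contractible_of_isIso
        (Localization.inverts (Ho.map ξ) W _ hφ)
      obtain ⟨Z, hZ, ⟨i⟩⟩ := (hP D).1 hD
      refine ⟨(Z0.map (pretrMap π)).map ((Z0.map (cell E')).map ⟨f, hf⟩), _, (cell E).obj Z, rfl,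
        ⟨((c.mapDG (cell E')).mapDG (pretrMap π)).coneData⟩, fun _ => hZ, ⟨?_⟩⟩
      exact eqToIso (congrArg Ho.of (congrArg (fun G : DGFunctor E' _ => G.obj D) (cell_pretrMap π)))
        ≪≫ (Ho.map (cell E)).mapIso i
    · rintro ⟨⟨X⟩⟩ ⟨⟨Y⟩⟩ φ ⟨⟨g, hg⟩, D, Z, hgφ, ⟨c⟩, hZ, ⟨i⟩⟩
      obtain ⟨f, hf, rfl⟩ := Ho.mk_surj φ
      obtain ⟨V, ⟨c'⟩⟩ := (pretr_pretriangulated E').exists_cone f hf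
      obtain ⟨e⟩ := (c'.mapDG (pretrMap π)).nonempty_iso_of_mk_eq c.ext hgφ.symm
      exact (c'.mapDG (pretrMap ξ)).isIso_of_contractible _
        (contractible_pretrMap hE' hπ hP hZ (e ≪≫ i))

end pretriangulatedQuotient

section opIso

variable {k : Type w} [CommRing k] {A : DGCategory.{w, v₁, u₁} k}

lemma nonempty_iso_op_iff {X Y : A.Ob} : Nonempty (Ho.of (A := A.op) X ≅ Ho.of (A := A.op) Y) ↔
    Nonempty (Ho.of (A := A) X ≅ Ho.of (A := A) Y) :=
  ⟨fun ⟨e⟩ => ⟨((Ho.opFunctor A).mapIso e).unop.symm⟩,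
    fun ⟨e⟩ => ⟨(Ho.opFunctor A).preimageIso (X := Ho.of (A := A.op) X) (Y := Ho.of (A := A.op) Y)
      e.symm.op⟩⟩

lemma essSurj_op {A' : DGCategory.{w, v₁, u₂} k} {π : DGFunctor A' A} (h : (Ho.map π).EssSurj) :
    (Ho.map π.op).EssSurj := ⟨fun Z => by
  obtain ⟨X, ⟨i⟩⟩ := h.mem_essImage (Ho.of Z.as.ob)
  exact ⟨Ho.of (A := A'.op) X.as.ob, nonempty_iso_op_iff.2 ⟨i⟩⟩⟩

lemma DGFunctor.IsQuasiEquivalence.op {A' : DGCategory.{w, v₁, u₂} k} {π : DGFunctor A' A}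
    (h : π.IsQuasiEquivalence) : π.op.IsQuasiEquivalence :=
  ⟨fun X Y => h.quasiIso Y X, essSurj_op h.essSurj⟩

lemma preimageOf_op {k : Type u} [CommRing k] {A' A : DGCategory.{u, u, u} k} {π : DGFunctor A' A}
    {P : A.Ob → Prop} {X : A'.Ob} : PreimageOf π.op P X ↔ PreimageOf π P X :=
  exists_congr fun Z => and_congr_right fun _ =>
    nonempty_iso_op_iff (A := A) (X := π.obj X) (Y := Z)

end opIso

section quotients

variable {k : Type u} [CommRing k] {A' A C : DGCategory.{u, u, u} k}

/-- The properties of a DG quotient which determine its effect on derived categories. -/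
structure IsModuleQuotient (π : DGFunctor A' A) (ξ : DGFunctor A' C) (P : A.Ob → Prop) : Prop where
  quasiEquivalence : π.IsQuasiEquivalence
  essSurj : (Ho.map ξ).EssSurj
  contractible : ∀ X, PreimageOf π P X → Contractible C (ξ.obj X)
  isModQis : ∀ {M : RightModule A'}, IsSemiFree M →
    (∀ X, PreimageOf π P X → (evalMod X).IsAcyclic M) → IsModQis (indUnit ξ M)

variable {π : DGFunctor A' A} {ξ : DGFunctor A' C} {P : A.Ob → Prop}

lemma IsDGQuotient.contractible (h : IsDGQuotient π ξ P) {X : A'.Ob} (hX : PreimageOf π P X) :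
    Contractible C (ξ.obj X) := by
  obtain ⟨Z, hZ, ⟨i⟩⟩ := hX
  have := h.isLocalization
  obtain ⟨T₀, hT₀⟩ := (pretr_pretriangulated A').exists_zero
  have hcomp : ∀ {B : DGCategory.{u, u, u} k} (F : DGFunctor A' B) (N : A'.Ob),
      (pretrMap F).obj ((cell A').obj N) = (cell B).obj (F.obj N) := fun F N =>
    congrArg (fun G : DGFunctor A' _ => G.obj N) (cell_pretrMap F)
  have hz : (pretr A').d 0 1 (zero_add 1)
      (0 : (pretr A').Hom T₀ ((cell A').obj X) 0) = 0 := map_zero _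
  let c : ConeData (A := pretr A') (0 : (pretr A').Hom T₀ ((cell A').obj X) 0) ((cell A').obj X) :=
    { inl := 0
      inr := (pretr A').one _
      fst := 0
      snd := (pretr A').one _
      fst_inl := by rw [map_zero, hT₀]
      snd_inr := (pretr A').one_comp _ _
      fst_inr := by rw [map_zero, LinearMap.zero_apply]
      snd_inl := by rw [map_zero]
      total := by
        exact (congrArg (· + _) (by rw [map_zero])).trans
          ((zero_add _).trans ((pretr A').one_comp _ _))
      d_inr := (pretr A').d_one _ _ _
      d_inl := by rw [map_zero, map_zero] }
  have h₁ : ((verdierClass A P).inverseImage (Tr.map π)) (Ho.mk _ hz) :=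
    ⟨(Z0.map (pretrMap π)).map ⟨_, hz⟩, _, (cell A).obj Z, rfl, ⟨c.map (pretrMap π)⟩, fun _ => hZ,
      ⟨eqToIso (congrArg Ho.of (hcomp π X)) ≪≫ (Ho.map (cell A)).mapIso i⟩⟩
  have h₂ : IsIso ((Tr.map ξ).map (Ho.mk _ hz)) := Localization.inverts (Tr.map ξ) _ _ h₁
  have h₃ : Contractible (pretr A') T₀ := ⟨0, by rw [map_zero, hT₀]⟩
  have h₄ := (contractible_iff_of_iso (@asIso _ _ _ _ _ h₂)).1 (h₃.map (pretrMap ξ))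
  rw [hcomp ξ X] at h₄
  obtain ⟨s, hs⟩ := h₄
  obtain ⟨s, rfl⟩ := (cell_bijective _ _ _).2 s
  refine ⟨s, (cell_bijective _ _ _).1 ?_⟩
  rw [(cell C).map_d, (cell C).map_one]
  exact hs

theorem IsDGQuotient.isModuleQuotient (h : IsDGQuotient π ξ P) : IsModuleQuotient π ξ P where
  quasiEquivalence := h.quasiEquivalence
  essSurj := h.essSurj
  contractible X := h.contractible
  isModQis hM hX := by
    have := h.isLocalization
    refine indUnit_isModQis_of_envelope (isEnvelope_cell A') (isEnvelope_cell A) (isEnvelope_cell C)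
      (cell_pretrMap π) (cell_pretrMap ξ) h.quasiEquivalence
      ((verdierClass A P).inverseImage (Tr.map π)) ?_ hM hX
    rintro X Y f hf ⟨⟨g, hg⟩, D, Z, hgφ, ⟨c⟩, hZ, hi⟩
    exact ⟨g, hg, _, _, _, _, D, Z, cellFrame Z, hgφ.symm, ⟨c.ext⟩, hi, hZ⟩

theorem IsDGQuotient.isModuleQuotient_op (h : IsDGQuotient π ξ P) :
    IsModuleQuotient π.op ξ.op P where
  quasiEquivalence := h.quasiEquivalence.op
  essSurj := essSurj_op h.essSurj
  contractible X hX := h.contractible (preimageOf_op.1 hX)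
  isModQis hM hX := by
    have := h.isLocalization
    have := isLocalization_op (pretrMap ξ) ((verdierClass A P).inverseImage (Tr.map π))
    refine indUnit_isModQis_of_envelope (isEnvelope_cell A').op (isEnvelope_cell A).op
      (isEnvelope_cell C).op 
      (show (cell A').op.comp (pretrMap π).op = π.op.comp (cell A).op from
        congrArg DGFunctor.op (cell_pretrMap π))
      (show (cell A').op.comp (pretrMap ξ).op = ξ.op.comp (cell C).op from
        congrArg DGFunctor.op (cell_pretrMap ξ)) h.quasiEquivalence.op
      (((verdierClass A P).inverseImage (Tr.map π)).op.inverseImage (Ho.opFunctor (pretr A')))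
      ?_ hM hX
    rintro X Y f hf ⟨⟨g, hg⟩, D, Z, hgφ, ⟨c⟩, hZ, hi⟩
    refine ⟨g, hg, _, _, _, _, D, Z, (cellFrame Z).op, ?_, ⟨c.ext.op⟩, nonempty_iso_op_iff.2 hi,
      fun a => hZ _⟩
    exact ((Ho.mk_eq_iff (A := (pretr A).op) _ _).2
      ((Ho.mk_eq_iff (A := pretr A) hg _).1 hgφ)).symm

end quotients

section coreflection

variable {S K S' K' : Type*} [Category* S] [Category* K] [Category* S'] [Category* K']
  {I : S ⥤ K} {R : K ⥤ S} (c : I ⊣ R) {I' : S' ⥤ K'} [I'.Full] [I'.Faithful] {F : K ⥤ K'}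
  {G : K' ⥤ K} (adj : F ⊣ G) {L : S ⥤ S'} (e : I ⋙ F ≅ L ⋙ I')

/-- The restriction of an adjunction to coreflective subcategories, the left adjoint preserving
them. -/
def coreflectAdj : L ⊣ I' ⋙ G ⋙ R :=
  (c.comp adj).restrictFullyFaithful (Functor.FullyFaithful.id S) (Functor.FullyFaithful.ofFullyFaithful I')
    ((I ⋙ F).leftUnitor ≪≫ e) (Functor.rightUnitor _).symm

lemma isIso_coreflectAdj_unit_iff [I.Full] [I.Faithful] (X : S) :
    IsIso ((coreflectAdj c adj e).unit.app X) ↔ IsIso (R.map (adj.unit.app (I.obj X))) := by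
  have h : (coreflectAdj c adj e).unit.app X = (c.comp adj).unit.app X ≫ (G ⋙ R).map
      (((I ⋙ F).leftUnitor ≪≫ e).hom.app X) ≫ (Functor.rightUnitor _).inv.app _ :=
    (c.comp adj).map_restrictFullyFaithful_unit_app (Functor.FullyFaithful.id S)
      (Functor.FullyFaithful.ofFullyFaithful I') ((I ⋙ F).leftUnitor ≪≫ e)
      (Functor.rightUnitor _).symm X
  rw [h, isIso_comp_right_iff, Adjunction.comp_unit_app, isIso_comp_left_iff]

end coreflection

section coreflector

variable {k : Type u} [CommRing k] {A : DGCategory.{u, u, u} k}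

/-- The homotopy category of semi-free modules, in that of all modules. -/
abbrev semifreeInclusion (A : DGCategory.{u, u, u} k) : Ho (indCat A) ⥤ Ho (rightMod A) :=
  Ho.map (inclusion (rightMod A) IsSemiFree)

instance : (semifreeInclusion A).Full :=
  full_of_chainQis _ fun _ _ => chainQis_of_bijective _ fun _ => Function.bijective_id

instance : (semifreeInclusion A).Faithful :=
  faithful_of_chainQis _ fun _ _ => chainQis_of_bijective _ fun _ => Function.bijective_id

/-- A morphism of the homotopy category of modules is a quasi-isomorphism. -/
def IsHoModQis {M N : Ho (rightMod A)} (φ : M ⟶ N) : Prop := ∀ Y, HoQis (evalMod Y) φ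

lemma isHoModQis_mk_iff {M N : RightModule A} {f : (rightMod A).Hom M N 0}
    (hf : (rightMod A).d 0 1 (zero_add 1) f = 0) : IsHoModQis (Ho.mk f hf) ↔ IsModQis f :=
  forall_congr' fun _ => hoQis_mk_iff hf

lemma IsHoModQis.isIso {M N : Ho (rightMod A)} {φ : M ⟶ N} (hM : IsSemiFree M.as.ob)
    (hN : IsSemiFree N.as.ob) (h : IsHoModQis φ) : IsIso φ := by
  obtain ⟨f, hf, rfl⟩ := Ho.mk_surj (X := M.as.ob) (Y := N.as.ob) φ
  exact hM.isIso hN hf ((isHoModQis_mk_iff hf).1 h)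

lemma IsSemiFree.bijective_comp {L M N : Ho (rightMod A)} {φ : M ⟶ N} (hL : IsSemiFree L.as.ob)
    (h : IsHoModQis φ) : Function.Bijective (fun ψ : L ⟶ M => ψ ≫ φ) := by
  obtain ⟨f, hf, rfl⟩ := Ho.mk_surj (X := M.as.ob) (Y := N.as.ob) φ
  have hq := hL.isQis_hom hf ((isHoModQis_mk_iff hf).1 h)
  constructor
  · intro ψ ψ' e
    obtain ⟨g, hg, rfl⟩ := Ho.mk_surj (X := L.as.ob) (Y := M.as.ob) ψ
    obtain ⟨g', hg', rfl⟩ := Ho.mk_surj (X := L.as.ob) (Y := M.as.ob) ψ'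
    change Ho.mk g hg ≫ Ho.mk f hf = Ho.mk g' hg' ≫ Ho.mk f hf at e
    obtain ⟨s, hs⟩ := (Ho.mk_eq_iff _ _).1 ((Ho.mk_comp hg hf).symm.trans (e.trans (Ho.mk_comp hg' hf)))
    obtain ⟨x, -, hx, -⟩ := hq (by omega : -2 + 1 = -1) (neg_add_cancel 1) (zero_add 1) (g - g') s
      ((map_sub _ _ _).trans (by rw [hg, hg', sub_zero]))
      (by
        refine Eq.trans ?_ hs.symm
        exact map_sub _ _ _)
    exact (Ho.mk_eq_iff _ _).2 ⟨x, hx⟩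
  · intro ψ
    obtain ⟨g, hg, rfl⟩ := Ho.mk_surj (X := L.as.ob) (Y := N.as.ob) ψ
    obtain ⟨x, y, hx, hy⟩ := hq (neg_add_cancel 1) (zero_add 1) (rfl : (1 : ℤ) + 1 = 2) 0 g
      (map_zero _) ((map_zero _).trans hg.symm)
    refine ⟨Ho.mk x hx, (Ho.mk_comp hx hf).trans ((Ho.mk_eq_iff _ _).2 ⟨-y, ?_⟩)⟩
    exact (map_neg _ _).trans ((sub_add_cancel_left _ _).symm.trans (congrArg _ hy.symm))

/-- The semi-free resolution, as an object of the homotopy category. -/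
abbrev hoResolution (N : Ho (rightMod A)) : Ho (indCat A) :=
  Ho.of (A := indCat A) ⟨resolution N.as.ob, isSemiFree_resolution _⟩

/-- The map from the semi-free resolution, in the homotopy category. -/
def hoResolutionMap (N : Ho (rightMod A)) : (semifreeInclusion A).obj (hoResolution N) ⟶ N :=
  Ho.mk (resolutionMap N.as.ob) (resolutionMap_closed _)

lemma isHoModQis_hoResolutionMap (N : Ho (rightMod A)) : IsHoModQis (hoResolutionMap N) :=
  (isHoModQis_mk_iff _).2 (resolutionMap_isModQis _)

/-- Morphisms from a semi-free module lift to the resolution. -/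
def resolutionEquiv (M : Ho (indCat A)) (N : Ho (rightMod A)) :
    ((semifreeInclusion A).obj M ⟶ N) ≃ (M ⟶ hoResolution N) :=
  (Equiv.ofBijective (fun φ : M ⟶ hoResolution N => (semifreeInclusion A).map φ ≫ hoResolutionMap N)
    ((IsSemiFree.bijective_comp (L := (semifreeInclusion A).obj M) M.as.ob.2
      (isHoModQis_hoResolutionMap N)).comp
        ((Functor.FullyFaithful.ofFullyFaithful (semifreeInclusion A)).map_bijective _ _))).symm

lemma map_resolutionEquiv {M : Ho (indCat A)} {N : Ho (rightMod A)}
    (φ : (semifreeInclusion A).obj M ⟶ N) :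
    (semifreeInclusion A).map (resolutionEquiv M N φ) ≫ hoResolutionMap N = φ :=
  (resolutionEquiv M N).symm_apply_apply φ

lemma resolutionEquiv_naturality (M' M : Ho (indCat A)) (N : Ho (rightMod A)) (f : M' ⟶ M)
    (g : (semifreeInclusion A).obj M ⟶ N) :
    resolutionEquiv M' N ((semifreeInclusion A).map f ≫ g) = f ≫ resolutionEquiv M N g := by
  refine (resolutionEquiv M' N).symm.injective ?_
  rw [Equiv.symm_apply_apply]
  refine Eq.trans ?_ (congrArg (· ≫ hoResolutionMap N) ((semifreeInclusion A).map_comp _ _)).symm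
  rw [Category.assoc, map_resolutionEquiv]

/-- The semi-free resolution, as a functor. -/
def resolutionFunctor (A : DGCategory.{u, u, u} k) : Ho (rightMod A) ⥤ Ho (indCat A) :=
  Adjunction.rightAdjointOfEquiv resolutionEquiv resolutionEquiv_naturality

/-- The semi-free resolution is right adjoint to the inclusion of the semi-free modules. -/
def resolutionAdj (A : DGCategory.{u, u, u} k) : semifreeInclusion A ⊣ resolutionFunctor A :=
  Adjunction.adjunctionOfEquivRight resolutionEquiv resolutionEquiv_naturality

lemma map_resolutionFunctor {M N : Ho (rightMod A)} (φ : M ⟶ N) :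
    (semifreeInclusion A).map ((resolutionFunctor A).map φ) ≫ hoResolutionMap N =
      hoResolutionMap M ≫ φ := by
  refine (map_resolutionEquiv _).trans (congrArg (· ≫ φ) ?_)
  refine (congrArg (· ≫ hoResolutionMap M) ((semifreeInclusion A).map_id _)).trans
    (Category.id_comp _)

lemma isIso_resolutionFunctor_map_iff {M N : Ho (rightMod A)} (φ : M ⟶ N) :
    IsIso ((resolutionFunctor A).map φ) ↔ IsHoModQis φ := by
  have e := map_resolutionFunctor φ
  have h : IsHoModQis φ ↔ IsHoModQis ((semifreeInclusion A).map ((resolutionFunctor A).map φ)) := by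
    refine forall_congr' fun Y => ?_
    rw [← (isHoModQis_hoResolutionMap M Y).comp_iff_left, ← e]
    exact HoQis.comp_iff_right _ (isHoModQis_hoResolutionMap N Y)
  rw [h, ← isIso_iff_of_reflects_iso _ (semifreeInclusion A)]
  exact ⟨fun h Y => HoQis.of_isIso _, fun h => h.isIso (isSemiFree_resolution _) (isSemiFree_resolution _)⟩

lemma coneIn_isAcyclic_iff {M N : Ho (rightMod A)} (φ : M ⟶ N) :
    coneIn (rightMod A) IsAcyclic φ ↔ IsHoModQis φ := by
  constructor
  · rintro ⟨f, C, Z, rfl, ⟨c⟩, hZ, ⟨e⟩⟩ Y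
    exact ⟨f.1, f.2, rfl, c.ext.isQis_of_isAcyclic
      ((isAcyclic_iff_of_iso _ e).2 (isAcyclic_iff.1 hZ Y))⟩
  · intro h
    obtain ⟨f, hf, rfl⟩ := Ho.mk_surj (X := M.as.ob) (Y := N.as.ob) φ
    obtain ⟨C, ⟨E⟩, -⟩ := exists_moduleCone f hf
    exact ⟨⟨f, hf⟩, C, C, rfl, ⟨E.coneData⟩,
      isAcyclic_iff.2 fun Y => E.isAcyclic_of_isQis ((isHoModQis_mk_iff hf).1 h Y), ⟨Iso.refl _⟩⟩

instance : (resolutionFunctor A).IsLocalization (coneIn (rightMod A) IsAcyclic) := by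
  have h : coneIn (rightMod A) IsAcyclic =
      (MorphismProperty.isomorphisms _).inverseImage (resolutionFunctor A) := by
    ext M N φ
    exact (coneIn_isAcyclic_iff φ).trans (isIso_resolutionFunctor_map_iff φ).symm
  rw [h]
  exact (resolutionAdj A).isLocalization_rightAdjoint'

/-- The derived category, as the homotopy category of semi-free modules. -/
abbrev derivedEquivalence (A : DGCategory.{u, u, u} k) : D A ≌ Ho (indCat A) :=
  Localization.uniq (D.Q A) (resolutionFunctor A) (coneIn (rightMod A) IsAcyclic)

/-- The semi-free resolution computes the derived category. -/
def derivedEquivalenceIso (A : DGCategory.{u, u, u} k) :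
    D.Q A ⋙ (derivedEquivalence A).functor ≅ resolutionFunctor A :=
  Localization.compUniqFunctor _ _ _

/-- The functor from the homotopy category of semi-free modules to the derived category. -/
abbrev semifreeToD (A : DGCategory.{u, u, u} k) : Ho (indCat A) ⥤ D A :=
  semifreeInclusion A ⋙ D.Q A

instance : (semifreeToD A).IsEquivalence := by
  have i : semifreeToD A ⋙ (derivedEquivalence A).functor ≅ 𝟭 _ :=
    Functor.associator _ _ _ ≪≫ Functor.isoWhiskerLeft _ (derivedEquivalenceIso A) ≪≫
      (asIso (resolutionAdj A).unit).symm
  have := Functor.isEquivalence_of_iso i.symm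
  exact Functor.isEquivalence_of_comp_right _ (derivedEquivalence A).functor

lemma isIso_Q_map_iff {M N : Ho (rightMod A)} (φ : M ⟶ N) :
    IsIso ((D.Q A).map φ) ↔ IsHoModQis φ := by
  rw [← isIso_resolutionFunctor_map_iff, ← NatIso.isIso_map_iff (derivedEquivalenceIso A)]
  exact (isIso_iff_of_reflects_iso _ (derivedEquivalence A).functor).symm

end coreflector

section derivedInduction

variable {k : Type u} [CommRing k] {A B : DGCategory.{u, u, u} k} (F : DGFunctor A B)

/-- Restriction, on the homotopy categories of semi-free modules. -/
abbrev semifreeRes : Ho (indCat B) ⥤ Ho (indCat A) :=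
  semifreeInclusion B ⋙ Ho.map (res F) ⋙ resolutionFunctor A

/-- Induction is left adjoint to restriction, on the homotopy categories of semi-free modules. -/
def semifreeAdj : Ho.map (indMap F) ⊣ semifreeRes F :=
  coreflectAdj (resolutionAdj A) (indResAdj F).ho
    (Ho.mapComp (inclusion (rightMod A) IsSemiFree) (ind F) ≪≫
      (Ho.mapComp (indMap F) (inclusion (rightMod B) IsSemiFree)).symm)

lemma isIso_semifreeAdj_unit_iff (M : Ho (indCat A)) :
    IsIso ((semifreeAdj F).unit.app M) ↔ IsModQis (indUnit F M.as.ob.1) :=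
  (isIso_coreflectAdj_unit_iff _ _ _ M).trans
    ((isIso_resolutionFunctor_map_iff _).trans (isHoModQis_mk_iff (d_indUnit F _)))

lemma isIso_semifreeRes_map_iff {M N : Ho (indCat B)} (φ : M ⟶ N) :
    IsIso ((semifreeRes F).map φ) ↔
      ∀ X, HoQis (evalMod (F.obj X)) ((semifreeInclusion B).map φ) := by
  refine (isIso_resolutionFunctor_map_iff _).trans (forall_congr' fun X => ?_)
  obtain ⟨f, hf, rfl⟩ := Ho.mk_surj (X := M.as.ob) (Y := N.as.ob) φ
  exact (hoQis_mk_iff (E := rightMod A) (L := evalMod X) (f := (res F).map 0 f)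
    (by rw [← (res F).map_d]; exact (congrArg _ hf).trans (map_zero _))).trans
    (hoQis_mk_iff (E := rightMod B) (L := evalMod (F.obj X)) (f := f) hf).symm

lemma resD_fac : D.Q B ⋙ resD F = Ho.map (res F) ⋙ D.Q A := Localization.Construction.fac _ _

/-- Restriction on derived categories is computed by semi-free resolutions. -/
def semifreeResIso : semifreeToD B ⋙ resD F ≅ semifreeRes F ⋙ semifreeToD A := by
  have : ∀ M, IsIso ((Functor.whiskerRight (resolutionAdj A).counit (D.Q A)).app M) := fun M =>
    (isIso_Q_map_iff _).2 ((isIso_resolutionFunctor_map_iff _).1 inferInstance)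
  have : IsIso (Functor.whiskerRight (resolutionAdj A).counit (D.Q A)) := NatIso.isIso_of_isIso_app _
  exact Functor.isoWhiskerLeft (semifreeInclusion B) (eqToIso (resD_fac F)) ≪≫
    (Functor.isoWhiskerLeft (semifreeInclusion B ⋙ Ho.map (res F))
      (asIso (Functor.whiskerRight (resolutionAdj A).counit (D.Q A)))).symm

/-- Restriction on derived categories is equivalent to that of semi-free modules. -/
def resDIso : resD F ≅ (semifreeToD B).inv ⋙ semifreeRes F ⋙ semifreeToD A :=
  (Functor.leftUnitor _).symm ≪≫
    Functor.isoWhiskerRight (semifreeToD B).asEquivalence.counitIso.symm (resD F) ≪≫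
    Functor.isoWhiskerLeft (semifreeToD B).inv (semifreeResIso F)

lemma isIso_of_semifreeRes_map (hF : (Ho.map F).EssSurj) {M N : Ho (indCat B)} {φ : M ⟶ N}
    (h : IsIso ((semifreeRes F).map φ)) : IsIso φ := by
  have h' := (isIso_semifreeRes_map_iff F φ).1 h
  obtain ⟨f, hf, rfl⟩ := Ho.mk_surj (X := M.as.ob) (Y := N.as.ob) φ
  refine (isIso_iff_of_reflects_iso _ (semifreeInclusion B)).1 ?_
  refine M.as.ob.2.isIso N.as.ob.2 hf (isModQis_of_res F hF hf fun X => ?_)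
  exact (hoQis_mk_iff (E := rightMod B) (L := evalMod (F.obj X)) (f := f) hf).1 (h' X)

lemma chainQis_indMap (h : ∀ M, IsSemiFree M → IsModQis (indUnit F M)) (M N : (indCat A).Ob) :
    ChainQis (fun p q h => (indCat A).d (X := M) (Y := N) p q h) (fun p q h => (indCat B).d p q h)
      (indMap F).map :=
  (indResAdj F).chainQis (M.2.isQis_hom (d_indUnit F N.1) (h N.1 N.2))

/-- Induction along a quasi-equivalence is a quasi-equivalence of DG categories of semi-free
modules. -/
lemma DGFunctor.IsQuasiEquivalence.indMap {F : DGFunctor A B} (hF : F.IsQuasiEquivalence) :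
    (indMap F).IsQuasiEquivalence := by
  have hc := chainQis_indMap F fun M hM => hM.indUnit_isModQis F hF.chainQis
  refine ⟨fun X Y => (quasiIso_mkComplexMap_iff _ _).2 (hc X Y), ?_⟩
  have := full_of_chainQis _ hc
  have := faithful_of_chainQis _ hc
  refine ⟨fun N => ⟨(semifreeRes F).obj N, ⟨?_⟩⟩⟩
  have := isIso_of_semifreeRes_map F hF.essSurj (φ := (semifreeAdj F).counit.app N) inferInstance
  exact asIso ((semifreeAdj F).counit.app N)

end derivedInduction

section pretriangulated

variable {k : Type u} [CommRing k] (A : DGCategory.{u, u, u} k)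

lemma indCat_pretriangulated : Pretriangulated (indCat A) where
  exists_zero := ⟨⟨RightModule.zero, isSemiFree_zero⟩, family_ext fun _ _ _ _ _ => rfl⟩
  exists_shift {r r'} hr X := ⟨⟨X.1.shift r', X.2.shift r'⟩,
    ⟨(shiftData X.1 r r' hr).sub (P := IsSemiFree) X.2 (X.2.shift r')⟩⟩
  exists_ext {X Y} f hf := ⟨⟨_, X.2.ext Y.2 (moduleExt f hf)⟩,
    ⟨(moduleExt f hf).sub (P := IsSemiFree) X.2 Y.2 _⟩⟩

end pretriangulated

section vanishing

variable {k : Type w} [CommRing k] {A : DGCategory.{w, v, u} k}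

lemma contractible_of_subsingleton {X : A.Ob} (h : Subsingleton (Ho.of X ⟶ Ho.of X)) :
    Contractible A X := by
  obtain ⟨s, hs⟩ := (Ho.mk_eq_iff (A.d_one X 1 (zero_add 1)) (map_zero (A.d 0 1 (zero_add 1)))).1
    (h.elim _ _)
  exact ⟨s, hs.trans (sub_zero _)⟩

end vanishing

section modules

variable {k : Type u} [CommRing k] {A B : DGCategory.{u, u, u} k}

lemma Contractible.isAcyclic_evalMod {Y : A.Ob} (h : Contractible A Y) (N : RightModule A) :
    (evalMod Y).IsAcyclic N := by
  obtain ⟨s, hs⟩ := h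
  intro p q r hp hq m hm
  change N.d q r hq m = 0 at hm
  refine ⟨sgn q • N.act (by omega : q + -1 = p) m s, ?_⟩
  change N.d p q hp _ = m
  rw [map_zsmul, N.leibniz (q' := r) (p' := 0) _ hp hq (neg_add_cancel 1) (by omega) (add_zero q),
    hm, hs, map_zero, LinearMap.zero_apply, zero_add, sgn_smul_sgn_smul, N.act_one]

lemma IsSemiFree.subsingleton_hom {M N : Ho (rightMod A)} (hM : IsSemiFree M.as.ob)
    (hN : ∀ Y, (evalMod Y).IsAcyclic N.as.ob) : Subsingleton (M ⟶ N) := by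
  refine ⟨fun φ ψ => ?_⟩
  obtain ⟨f, hf, rfl⟩ := Ho.mk_surj (X := M.as.ob) (Y := N.as.ob) φ
  obtain ⟨g, hg, rfl⟩ := Ho.mk_surj (X := M.as.ob) (Y := N.as.ob) ψ
  exact (Ho.mk_eq_iff hf hg).2 (hM.isAcyclic_hom hN (neg_add_cancel 1) (zero_add 1) (f - g)
    ((map_sub _ _ _).trans (by rw [hf, hg, sub_zero])))

lemma isAcyclic_ind_iff {M : RightModule A} (hM : IsSemiFree M) {F : DGFunctor A B}
    (hF : F.IsQuasiEquivalence) (X : A.Ob) :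
    (evalMod (F.obj X)).IsAcyclic ((ind F).obj M) ↔ (evalMod X).IsAcyclic M :=
  have h := hM.indUnit_isModQis F hF.chainQis X
  ⟨fun h' => LeftModule.IsAcyclic.of_isQis (d_indUnit F M) h' h,
    fun h' => show (evalMod X).IsAcyclic ((res F).obj ((ind F).obj M)) from
      LeftModule.IsAcyclic.of_isQis' (d_indUnit F M) h' h⟩

lemma isAcyclic_preimageOf_iff {π : DGFunctor A B} (hπ : (Ho.map π).EssSurj) {P : B.Ob → Prop}
    {N : RightModule B} : (∀ X, PreimageOf π P X → (evalMod (π.obj X)).IsAcyclic N) ↔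
      ∀ Z, P Z → (evalMod Z).IsAcyclic N := by
  constructor
  · intro h Z hZ
    obtain ⟨X, ⟨e⟩⟩ := hπ.mem_essImage (Ho.of Z)
    exact isAcyclic_of_iso_obj N e (h X.as.ob ⟨Z, hZ, ⟨e⟩⟩)
  · rintro h X ⟨Z, hZ, ⟨e⟩⟩
    exact isAcyclic_of_iso_obj N e.symm (h Z hZ)

lemma isAcyclic_semifreeRes_iff (F : DGFunctor A B) (N : Ho (indCat B)) (X : A.Ob) :
    (evalMod X).IsAcyclic ((semifreeRes F).obj N).as.ob.1 ↔
      (evalMod (F.obj X)).IsAcyclic N.as.ob.1 :=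
  have h := resolutionMap_isModQis ((res F).obj N.as.ob.1) X
  ⟨fun h' => show (evalMod X).IsAcyclic ((res F).obj N.as.ob.1) from
      LeftModule.IsAcyclic.of_isQis' (resolutionMap_closed _) h' h,
    fun h' => LeftModule.IsAcyclic.of_isQis (resolutionMap_closed _) h' h⟩

variable {P : A.Ob → Prop}

lemma chainQis_indMap_inclusion (M N : (indCat (fullSub A P)).Ob) :
    ChainQis (fun p q h => (indCat (fullSub A P)).d (X := M) (Y := N) p q h)
      (fun p q h => (indCat A).d p q h) (indMap (inclusion A P)).map :=
  chainQis_indMap _ (fun _ hM => hM.indUnit_isModQis _ fun _ _ =>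
    chainQis_of_bijective _ fun _ => Function.bijective_id) M N

instance : (Ho.map (indMap (inclusion A P))).Full := full_of_chainQis _ chainQis_indMap_inclusion

instance : (Ho.map (indMap (inclusion A P))).Faithful :=
  faithful_of_chainQis _ chainQis_indMap_inclusion

end modules

section quotients

variable {k : Type u} [CommRing k] {A' A C : DGCategory.{u, u, u} k} {π : DGFunctor A' A}
  {ξ : DGFunctor A' C} {P : A.Ob → Prop}

namespace IsModuleQuotient

variable (h : IsModuleQuotient π ξ P)
include h

lemma full_indMap : (Ho.map (indMap π)).Full :=
  full_of_chainQis _ h.quasiEquivalence.indMap.chainQis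

lemma faithful_indMap : (Ho.map (indMap π)).Faithful :=
  faithful_of_chainQis _ h.quasiEquivalence.indMap.chainQis

lemma isAcyclic_semifreeRes (N : Ho (indCat C)) (X : A'.Ob) (hX : PreimageOf π P X) :
    (evalMod X).IsAcyclic ((semifreeRes ξ).obj N).as.ob.1 :=
  (isAcyclic_semifreeRes_iff ξ N X).2 ((h.contractible X hX).isAcyclic_evalMod _)

lemma isIso_counit (N : Ho (indCat C)) : IsIso ((semifreeAdj ξ).counit.app N) := by
  have h₁ : IsIso ((semifreeAdj ξ).unit.app ((semifreeRes ξ).obj N)) :=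
    (isIso_semifreeAdj_unit_iff ξ _).2
      (h.isModQis ((semifreeRes ξ).obj N).as.ob.2 (h.isAcyclic_semifreeRes N))
  refine isIso_of_semifreeRes_map ξ h.essSurj ?_
  have h₂ := (semifreeAdj ξ).right_triangle_components N
  have h₃ : IsIso ((semifreeAdj ξ).unit.app ((semifreeRes ξ).obj N) ≫
      (semifreeRes ξ).map ((semifreeAdj ξ).counit.app N)) := by
    rw [h₂]
    exact IsIso.id _
  exact IsIso.of_isIso_comp_left ((semifreeAdj ξ).unit.app ((semifreeRes ξ).obj N)) _

/-- Restriction along a DG quotient is fully faithful. -/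
def fullyFaithful_semifreeRes : (semifreeRes ξ).FullyFaithful :=
  have := h.isIso_counit
  have : IsIso (semifreeAdj ξ).counit := NatIso.isIso_of_isIso_app _
  (semifreeAdj ξ).fullyFaithfulROfIsIsoCounit

lemma contractible_of_indSub {M : Ho (indCat A')} {T : (indCat A).Ob} (hT : indSub P T)
    (e : (Ho.map (indMap π)).obj M ≅ Ho.of T) : Contractible (indCat C) ((indMap ξ).obj M.as.ob) := by
  refine contractible_of_subsingleton (A := indCat C) ?_
  refine ((semifreeAdj ξ).homEquiv M _).subsingleton_congr.2 ?_
  set K := (semifreeRes ξ).obj ((Ho.map (indMap ξ)).obj M)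
  have hK : ∀ X, PreimageOf π P X → (evalMod X).IsAcyclic K.as.ob.1 := h.isAcyclic_semifreeRes _
  have := h.faithful_indMap
  suffices Subsingleton ((Ho.map (indMap π)).obj M ⟶ (Ho.map (indMap π)).obj K) from
    (Functor.map_injective (Ho.map (indMap π)) (X := M) (Y := K)).subsingleton
  refine (Iso.homCongr e (Iso.refl _)).subsingleton_congr.2 ?_
  suffices Subsingleton ((semifreeInclusion A).obj (Ho.of T) ⟶
      (semifreeInclusion A).obj ((Ho.map (indMap π)).obj K)) from
    (Functor.map_injective (semifreeInclusion A)).subsingleton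
  obtain ⟨Q, hQ, ⟨i⟩⟩ := hT
  refine (Iso.homCongr ((Quotient.functor (homotopic (rightMod A))).mapIso i) (Iso.refl _)).subsingleton_congr.2 ?_
  refine ((indResAdj (inclusion A P)).ho.homEquiv (Ho.of Q) _).subsingleton_congr.2 ?_
  refine IsSemiFree.subsingleton_hom hQ fun Z => ?_
  exact (isAcyclic_preimageOf_iff h.quasiEquivalence.essSurj).1
    (fun X hX => (isAcyclic_ind_iff K.as.ob.2 h.quasiEquivalence X).2 (hK X hX)) Z.1 Z.2

lemma exists_indSub {M : Ho (indCat A')} (hM : Contractible (indCat C) ((indMap ξ).obj M.as.ob)) :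
    ∃ T : (indCat A).Ob, indSub P T ∧ Nonempty ((Ho.map (indMap π)).obj M ≅ Ho.of T) := by
  have := h.full_indMap
  have := h.quasiEquivalence.indMap.essSurj
  let j := inclusion A P
  let N := (Ho.map (indMap π)).obj M
  let t := (semifreeAdj j).counit.app N
  have hT : indSub P ((Ho.map (indMap j)).obj ((semifreeRes j).obj N)).as.ob :=
    ⟨_, ((semifreeRes j).obj N).as.ob.2, ⟨Iso.refl _⟩⟩
  refine ⟨_, hT, ?_⟩
  obtain ⟨L, ⟨i⟩⟩ := this.mem_essImage ((Ho.map (indMap j)).obj ((semifreeRes j).obj N))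
  obtain ⟨φ, hφ⟩ := (Ho.map (indMap π)).map_surjective (i.hom ≫ t)
  suffices hi : IsIso φ from
    ⟨(asIso ((Ho.map (indMap π)).map φ)).symm ≪≫ i⟩
  have hj : IsIso ((semifreeRes j).map ((Ho.map (indMap π)).map φ)) := by
    rw [hφ, Functor.map_comp]
    infer_instance
  rw [isIso_semifreeRes_map_iff] at hj
  obtain ⟨f, hf, rfl⟩ := Ho.mk_surj (X := L.as.ob) (Y := M.as.ob) φ
  obtain ⟨D, ⟨E⟩, hD⟩ := exists_moduleCone f hf
  have hD := hD L.as.ob.2 M.as.ob.2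
  have hc : Contractible (indCat C) ((indMap ξ).obj ⟨D, hD⟩) :=
    ((E.sub (P := IsSemiFree) L.as.ob.2 M.as.ob.2 hD).mapDG (indMap ξ)).contractible
      (h.contractible_of_indSub hT i) hM
  have hl : ∀ X, PreimageOf π P X → (evalMod X).IsAcyclic D := by
    intro X hX
    refine (isAcyclic_ind_iff hD h.quasiEquivalence X).1 ?_
    refine (isAcyclic_preimageOf_iff h.quasiEquivalence.essSurj).2 (fun Z hZ => ?_) X hX
    exact (E.mapDG (ind π)).isAcyclic_of_isQis
      ((hoQis_mk_iff (E := rightMod A) (f := (ind π).map 0 f) _).1 (hj ⟨Z, hZ⟩))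
  have ha : ∀ Y, (evalMod Y).IsAcyclic D := fun Y =>
    LeftModule.IsAcyclic.of_isQis (d_indUnit ξ D)
      ((hc.map (inclusion (rightMod C) IsSemiFree)).isAcyclic ((evalMod (ξ.obj Y)))) (h.isModQis hD hl Y)
  refine (isIso_iff_of_reflects_iso _ (semifreeInclusion A')).1 ?_
  exact L.as.ob.2.isIso M.as.ob.2 hf fun Y => E.isQis_of_isAcyclic (ha Y)

lemma contractible_iff (M : (indCat A').Ob) : Contractible (indCat C) ((indMap ξ).obj M) ↔
    ∃ T : (indCat A).Ob, indSub P T ∧ Nonempty (Ho.of ((indMap π).obj M) ≅ Ho.of T) :=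
  ⟨fun hM => h.exists_indSub (M := Ho.of M) hM,
    fun ⟨_, hT, ⟨e⟩⟩ => h.contractible_of_indSub (M := Ho.of M) hT e⟩

lemma isLocalization_indMap : (Ho.map (indMap ξ)).IsLocalization
    ((MorphismProperty.isomorphisms _).inverseImage (Ho.map (indMap ξ))) :=
  have := h.fullyFaithful_semifreeRes.full
  have := h.fullyFaithful_semifreeRes.faithful
  (semifreeAdj ξ).isLocalization_leftAdjoint'

theorem isDGQuotient_indMap : IsDGQuotient (indMap π) (indMap ξ) (indSub P) :=
  have := h.isLocalization_indMap
  isDGQuotient_of_pretriangulated (indCat_pretriangulated A') (indCat_pretriangulated C)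
    h.quasiEquivalence.indMap ((MorphismProperty.isomorphisms _).inverseImage (Ho.map (indMap ξ)))
    h.contractible_iff

end IsModuleQuotient

theorem IsDGQuotient.proMap (h : IsDGQuotient π ξ P) :
    IsDGQuotient (proMap π) (proMap ξ) (proSub P) := by
  have h' := h.isModuleQuotient_op
  have := h'.isLocalization_indMap
  have := isLocalization_op (indMap ξ.op)
    ((MorphismProperty.isomorphisms _).inverseImage (Ho.map (indMap ξ.op)))
  exact isDGQuotient_of_pretriangulated (π := (indMap π.op).op) (ξ := (indMap ξ.op).op)
    (indCat_pretriangulated A'.op).op (indCat_pretriangulated C.op).op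
    h'.quasiEquivalence.indMap.op (((MorphismProperty.isomorphisms _).inverseImage
      (Ho.map (indMap ξ.op))).op.inverseImage (Ho.opFunctor (indCat A'.op))) fun M => (h'.contractible_iff M).trans
      (exists_congr fun T => and_congr_right fun _ =>
        (nonempty_iso_op_iff (A := indCat A.op) (X := (indMap π.op).obj M) (Y := T)).symm)

end quotients

section zero

lemma isZero_obj_of_isEquivalence {C D : Type*} [Category* C] [Category* D] (F : C ⥤ D)
    [F.IsEquivalence] {X : C} (hX : Limits.IsZero X) : Limits.IsZero (F.obj X) where
  unique_to Y := (hX.unique_to (F.inv.obj Y)).map fun i =>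
    @Equiv.unique _ _ i (F.asEquivalence.toAdjunction.homEquiv X Y)
  unique_from Y := (hX.unique_from (F.inv.obj Y)).map fun i =>
    @Equiv.unique _ _ i (F.asEquivalence.symm.toAdjunction.homEquiv Y X).symm

lemma exists_arrow_iso {C D : Type*} [Category* C] [Category* D] (F : C ⥤ D)
    [F.Full] [F.EssSurj] {X Y : D} (φ : X ⟶ Y) :
    ∃ (X' Y' : C) (f : X' ⟶ Y'), Nonempty (Arrow.mk φ ≅ Arrow.mk (F.map f)) := by
  obtain ⟨f, hf⟩ := F.map_surjective ((F.objObjPreimageIso X).hom ≫ φ ≫ (F.objObjPreimageIso Y).inv)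
  refine ⟨_, _, f, ⟨Arrow.isoMk (F.objObjPreimageIso X).symm (F.objObjPreimageIso Y).symm ?_⟩⟩
  simp [hf]

lemma Contractible.isZero {k : Type w} [CommRing k] {A : DGCategory.{w, v, u} k} {X : A.Ob}
    (h : Contractible A X) : Limits.IsZero (Ho.of X) := by
  have h₀ : ∀ {Y Z : A.Ob}, A.d 0 1 (zero_add 1) (0 : A.Hom Y Z 0) = 0 := map_zero _
  have e : 𝟙 (Ho.of X) = Ho.mk 0 h₀ := by
    obtain ⟨s, hs⟩ := h
    exact (Ho.mk_eq_iff (A.d_one X 1 (zero_add 1)) h₀).2 ⟨s, by rw [hs, sub_zero]⟩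
  refine ⟨fun Y => ⟨⟨⟨Ho.mk (Y := Y.as.ob) 0 h₀⟩, fun φ => ?_⟩⟩,
    fun Y => ⟨⟨⟨Ho.mk (X := Y.as.ob) 0 h₀⟩, fun φ => ?_⟩⟩⟩
  · obtain ⟨f, hf, rfl⟩ := Ho.mk_surj (Y := Y.as.ob) φ
    refine (Category.id_comp _).symm.trans ((congrArg (· ≫ _) e).trans ((Ho.mk_comp h₀ hf).trans ?_))
    exact (Ho.mk_eq_iff _ h₀).2 ⟨0, by rw [map_zero, map_zero, sub_zero]⟩
  · obtain ⟨f, hf, rfl⟩ := Ho.mk_surj (X := Y.as.ob) φ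
    refine (Category.comp_id _).symm.trans ((congrArg (_ ≫ ·) e).trans ((Ho.mk_comp hf h₀).trans ?_))
    exact (Ho.mk_eq_iff _ h₀).2 ⟨0, by rw [map_zero, map_zero, LinearMap.zero_apply, sub_zero]⟩

end zero

section derived

variable {k : Type u} [CommRing k] {A B : DGCategory.{u, u, u} k}

instance : (D.Q A).EssSurj := Localization.essSurj (D.Q A) (coneIn (rightMod A) IsAcyclic)

/-- The resolution is isomorphic to the module in the derived category. -/
def semifreeToDIso (N : Ho (rightMod A)) : (semifreeToD A).obj (hoResolution N) ≅ (D.Q A).obj N :=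
  have := (isIso_Q_map_iff (hoResolutionMap N)).2 (isHoModQis_hoResolutionMap N)
  asIso ((D.Q A).map (hoResolutionMap N))

lemma isAcyclic_resolution_iff (N : Ho (rightMod A)) (Y : A.Ob) :
    (evalMod Y).IsAcyclic (resolution N.as.ob) ↔ (evalMod Y).IsAcyclic N.as.ob :=
  have h := resolutionMap_isModQis N.as.ob Y
  ⟨fun h' => LeftModule.IsAcyclic.of_isQis' (resolutionMap_closed _) h' h,
    fun h' => LeftModule.IsAcyclic.of_isQis (resolutionMap_closed _) h' h⟩

lemma isAcyclic_iff_of_Q_iso {M N : Ho (rightMod A)} (i : (D.Q A).obj M ≅ (D.Q A).obj N) (Y : A.Ob) :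
    (evalMod Y).IsAcyclic M.as.ob ↔ (evalMod Y).IsAcyclic N.as.ob := by
  let i' := (semifreeInclusion A).mapIso
    ((semifreeToD A).preimageIso (semifreeToDIso M ≪≫ i ≪≫ (semifreeToDIso N).symm))
  rw [← isAcyclic_resolution_iff M, ← isAcyclic_resolution_iff N]
  exact isAcyclic_iff_of_iso (evalMod Y) i'

lemma isZero_Q_iff (M : Ho (rightMod A)) :
    Limits.IsZero ((D.Q A).obj M) ↔ ∀ Y, (evalMod Y).IsAcyclic M.as.ob := by
  have key : ∀ M : Ho (rightMod A), (∀ Y, (evalMod Y).IsAcyclic M.as.ob) →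
      Limits.IsZero ((D.Q A).obj M) := by
    intro M hM
    refine Limits.IsZero.of_iso ?_ (semifreeToDIso M).symm
    refine isZero_obj_of_isEquivalence _ ?_
    have hM' : ∀ Y, (evalMod Y).IsAcyclic (resolution M.as.ob) := fun Y =>
      (isAcyclic_resolution_iff M Y).2 (hM Y)
    refine Contractible.isZero (A := indCat A) ?_
    exact contractible_of_isAcyclic (A := indCat A) ((isSemiFree_resolution M.as.ob).isAcyclic_hom hM')
  refine ⟨fun h Y => ?_, key M⟩
  have h₀ : ∀ Y, (evalMod Y).IsAcyclic (RightModule.zero : RightModule A) :=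
    fun Y p q r _ _ m _ => ⟨0, rfl⟩
  exact (isAcyclic_iff_of_Q_iso (h.iso (key (Ho.of RightModule.zero) h₀)) Y).2 (h₀ Y)

/-- Restriction on derived categories, for the image of a module. -/
def resDObjIso (F : DGFunctor A B) (N : Ho (rightMod B)) :
    (resD F).obj ((D.Q B).obj N) ≅ (D.Q A).obj ((Ho.map (res F)).obj N) :=
  (eqToIso (resD_fac F)).app N

lemma isIso_resD_map_iff (F : DGFunctor A B) {M N : RightModule B} {f : (rightMod B).Hom M N 0}
    (hf : (rightMod B).d 0 1 (zero_add 1) f = 0) :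
    IsIso ((resD F).map ((D.Q B).map (Ho.mk f hf))) ↔ ∀ X, (evalMod (F.obj X)).IsQis f := by
  have hf' : (rightMod A).d 0 1 (zero_add 1) ((res F).map 0 f) = 0 := by
    rw [← (res F).map_d]
    exact (congrArg _ hf).trans (map_zero _)
  exact (NatIso.isIso_map_iff (eqToIso (resD_fac F)) (Ho.mk f hf)).trans
    ((isIso_Q_map_iff _).trans (isHoModQis_mk_iff hf'))

lemma isZero_resD_inclusion_iff {P : A.Ob → Prop} (N : Ho (rightMod A)) :
    Limits.IsZero ((resD (inclusion A P)).obj ((D.Q A).obj N)) ↔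
      ∀ Z, P Z → (evalMod Z).IsAcyclic N.as.ob := by
  rw [(resDObjIso (inclusion A P) N).isZero_iff, isZero_Q_iff]
  exact ⟨fun h Z hZ => h ⟨Z, hZ⟩, fun h Z => h Z.1 Z.2⟩

/-- Restriction to a full DG subcategory is a localization of derived categories. -/
lemma isLocalization_resD_inclusion (P : A.Ob → Prop) : (resD (inclusion A P)).IsLocalization
    ((MorphismProperty.isomorphisms _).inverseImage (resD (inclusion A P))) :=
  ((((semifreeToD (fullSub A P)).asEquivalence.symm.toAdjunction.comp
    (semifreeAdj (inclusion A P))).comp (semifreeToD A).asEquivalence.toAdjunction).ofNatIsoRight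
      (resDIso (inclusion A P)).symm).isLocalization_rightAdjoint'

end derived

section quotients

variable {k : Type u} [CommRing k] {A' A C : DGCategory.{u, u, u} k} {π : DGFunctor A' A}
  {ξ : DGFunctor A' C} {P : A.Ob → Prop}

lemma DGFunctor.IsQuasiEquivalence.isEquivalence_resD (hπ : π.IsQuasiEquivalence) :
    (resD π).IsEquivalence := by
  have := full_of_chainQis _ hπ.indMap.chainQis
  have := faithful_of_chainQis _ hπ.indMap.chainQis
  have := hπ.indMap.essSurj
  have : (Ho.map (DG.indMap π)).IsEquivalence := { }
  have := (semifreeAdj π).isEquivalence_right_of_isEquivalence_left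
  exact Functor.isEquivalence_of_iso (resDIso π).symm

lemma essImage_comp_inv_iff {C₁ C₂ C₃ : Type*} [Category* C₁] [Category* C₂] [Category* C₃]
    (F : C₁ ⥤ C₂) (G : C₃ ⥤ C₂) [G.IsEquivalence] (X : C₃) :
    (F ⋙ G.inv).essImage X ↔ F.essImage (G.obj X) :=
  ⟨fun ⟨Y, ⟨i⟩⟩ => ⟨Y, ⟨(G.asEquivalence.counitIso.app _).symm ≪≫ G.mapIso i⟩⟩,
    fun ⟨Y, ⟨i⟩⟩ => ⟨Y, ⟨G.inv.mapIso i ≪≫ (G.asEquivalence.unitIso.app X).symm⟩⟩⟩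

namespace IsModuleQuotient

variable (h : IsModuleQuotient π ξ P)
include h

lemma full_resD : (resD ξ).Full :=
  have := h.fullyFaithful_semifreeRes.full
  Functor.Full.of_iso (resDIso ξ).symm

lemma faithful_resD : (resD ξ).Faithful :=
  have := h.fullyFaithful_semifreeRes.faithful
  Functor.Faithful.of_iso (resDIso ξ).symm

lemma essImage_resD_iff (N : Ho (rightMod A')) : (resD ξ).essImage ((D.Q A').obj N) ↔
    ∀ X, PreimageOf π P X → (evalMod X).IsAcyclic N.as.ob := by
  constructor
  · rintro ⟨K, ⟨i⟩⟩ X hX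
    let j := (D.Q C).objObjPreimageIso K
    let e := (resDObjIso ξ _).symm ≪≫ (resD ξ).mapIso j ≪≫ i
    exact (isAcyclic_iff_of_Q_iso e X).1 ((h.contractible X hX).isAcyclic_evalMod _)
  · intro hN
    have : IsIso ((semifreeAdj ξ).unit.app (hoResolution N)) :=
      (isIso_semifreeAdj_unit_iff ξ _).2 (h.isModQis (isSemiFree_resolution _) fun X hX =>
        (isAcyclic_resolution_iff N X).2 (hN X hX))
    exact ⟨_, ⟨(semifreeResIso ξ).app _ ≪≫ (semifreeToD A').mapIso
      (asIso ((semifreeAdj ξ).unit.app (hoResolution N))).symm ≪≫ semifreeToDIso N⟩⟩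

lemma essImage_iff_isZero [(resD π).IsEquivalence] (M : D A) :
    (resD ξ ⋙ (resD π).inv).essImage M ↔ Limits.IsZero ((resD (inclusion A P)).obj M) := by
  let j := (D.Q A).objObjPreimageIso M
  rw [essImage_comp_inv_iff, ← ((resD (inclusion A P)).mapIso j).isZero_iff,
    isZero_resD_inclusion_iff, ← isAcyclic_preimageOf_iff h.quasiEquivalence.essSurj]
  let e := (resDObjIso π _).symm ≪≫ (resD π).mapIso j
  exact ⟨fun h' => (h.essImage_resD_iff _).1 (h'.ofIso e.symm),
    fun h' => ((h.essImage_resD_iff ((Ho.map (res π)).obj _)).2 h').ofIso e⟩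

lemma coneIn_essImage [(resD π).IsEquivalence] :
    D.coneIn A (resD ξ ⋙ (resD π).inv).essImage =
      (MorphismProperty.isomorphisms _).inverseImage (resD (inclusion A P)) := by
  ext M N φ
  constructor
  · rintro ⟨M', N', f, K, ⟨i⟩, ⟨c⟩, hK⟩
    refine (MorphismProperty.arrow_mk_iso_iff _ i).2 ?_
    refine (isIso_resD_map_iff (inclusion A P) f.2).2 fun Z => ?_
    rw [h.essImage_iff_isZero, isZero_resD_inclusion_iff] at hK
    exact c.ext.isQis_of_isAcyclic (hK Z.1 Z.2)
  · intro hφ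
    obtain ⟨M', N', φ', ⟨i⟩⟩ := exists_arrow_iso (semifreeToD A) φ
    obtain ⟨f, hf, rfl⟩ := Ho.mk_surj (X := M'.as.ob) (Y := N'.as.ob) φ'
    obtain ⟨K, ⟨E⟩, -⟩ := exists_moduleCone f hf
    refine ⟨⟨M'.as.ob.1⟩, ⟨N'.as.ob.1⟩, ⟨f, hf⟩, K, ⟨i⟩, ⟨E.coneData⟩, ?_⟩
    rw [h.essImage_iff_isZero, isZero_resD_inclusion_iff]
    intro Z hZ
    refine E.isAcyclic_of_isQis ((isIso_resD_map_iff (inclusion A P) hf).1 ?_ ⟨Z, hZ⟩)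
    exact (MorphismProperty.arrow_mk_iso_iff _ i).1 hφ

end IsModuleQuotient

end quotients

end DG

end

theorem proposition4p6 {k : Type u} [CommRing k] {A' A C : DG.DGCategory.{u, u, u} k}
    (π : DG.DGFunctor A' A) (ξ : DG.DGFunctor A' C) (P : A.Ob → Prop)
    (h : DG.IsDGQuotient π ξ P) :
    DG.IsDGQuotient (DG.indMap π) (DG.indMap ξ) (DG.indSub P) ∧
    DG.IsDGQuotient (DG.proMap π) (DG.proMap ξ) (DG.proSub P) ∧
    ∃ _ : (DG.resD π).IsEquivalence,
      let R : DG.D C ⥤ DG.D A := DG.resD ξ ⋙ (DG.resD π).inv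
      let ρ : DG.D A ⥤ DG.D (DG.fullSub A P) := DG.resD (DG.inclusion A P)
      R.Full ∧ R.Faithful ∧
      (∀ M : DG.D A, R.essImage M ↔ Limits.IsZero (ρ.obj M)) ∧
      ρ.IsLocalization (DG.D.coneIn A R.essImage) := by
  have hm := h.isModuleQuotient
  have := hm.full_resD
  have := hm.faithful_resD
  have he := hm.quasiEquivalence.isEquivalence_resD
  refine ⟨hm.isDGQuotient_indMap, h.proMap, he, ?_⟩
  exact ⟨inferInstance, inferInstance, hm.essImage_iff_isZero,
    hm.coneIn_essImage ▸ DG.isLocalization_resD_inclusion P⟩
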